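/- **Setting.** Let $d\in\{2,3\}$, let $\Omega\subset\mathbb R^d$ be a bounded domain with $C^2$-boundary, $0<T_*\le T_0<\infty$, $\varepsilon\in(0,1)$. Let $W\in C^2(\mathbb R)$ be a double-well potential: $W(\pm1)=W'(\pm1)=0$, $W''(\pm1)>0$ and $W>0$ on $(-1,1)$. Put $c_0:=\int_{-1}^1\sqrt{2W(r)}\,dr$. The matrix $\nabla u$ is the Jacobian of $u$, $(\nabla u)_{ij}=\partial_ju_i$, so that $(a\cdot\nabla)u=(\nabla u)a$; $A:A'$ is the Frobenius product, $|A|^2=A:A$. **Weak solution.** Let $(\varphi_\varepsilon,v_\varepsilon)$ be a weak solution of the Navier–Stokes/Allen–Cahn system on $\Omega\times(0,T_0)$ with initial data $(\varphi_{\varepsilon,0},v_{\varepsilon,0})$, that is: $\varphi_{\varepsilon,0}\in H^1(\Omega;[-1,1])$, $v_{\varepsilon,0}\in H^1(\Omega;\mathbb R^d)$, $(\varphi_{\varepsilon,0}+1,v_{\varepsilon,0})\in H^1_0(\Omega)$, $\nabla\cdot v_{\varepsilon,0}=0$; $v_\varepsilon\in L^2(0,T_0;H^1)\cap L^\infty(0,T_0;L^2)$,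 $\varphi_\varepsilon\in H^1(0,T_0;L^2(\Omega;[-1,1]))\cap L^2(0,T_0;H^2(\Omega))$; for a.e. $t$, $(\varphi_\varepsilon+1,v_\varepsilon)(\cdot,t)\in H^1_0(\Omega)$ and $\nabla\cdot v_\varepsilon(\cdot,t)=0$; for a.e. $T\in(0,T_0)$ and all $\eta\in C^\infty_c([0,T_0);C^\infty_c(\Omega;\mathbb R^d))$ with $\nabla\cdot\eta=0$, $$\int_\Omega v_\varepsilon(T)\cdot\eta(T)\,dx-\int_\Omega v_{\varepsilon,0}\cdot\eta(0)\,dx=\int_0^T\!\!\int_\Omega v_\varepsilon\cdot\partial_t\eta+v_\varepsilon\otimes v_\varepsilon:\nabla\eta-\nabla v_\varepsilon:\nabla\eta+\varepsilon\nabla\varphi_\varepsilon\otimes\nabla\varphi_\varepsilon:\nabla\eta\,dx\,dt;$$ $\partial_t\varphi_\varepsilon+(v_\varepsilon\cdot\nabla)\varphi_\varepsilon=\Delta\varphi_\varepsilon-\varepsilon^{-2}W'(\varphi_\varepsilon)$ a.e. in $\Omega\times(0,T_0)$; $\varphi_\varepsilon(t)\to\varphi_{\varepsilon,0}$ in $L^2(\Omega)$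 as $t\downarrow0$; and, with $E[\varphi,v]:=\int_\Omega\frac12|v|^2+\frac\varepsilon2|\nabla\varphi|^2+\frac1\varepsilon W(\varphi)\,dx$, for a.e. $T\in(0,T_0)$, $$E[\varphi_\varepsilon(T),v_\varepsilon(T)]+\int_0^T\!\!\int_\Omega|\nabla v_\varepsilon|^2+\varepsilon|\partial_t\varphi_\varepsilon+(v_\varepsilon\cdot\nabla)\varphi_\varepsilon|^2\,dx\,dt\le E[\varphi_{\varepsilon,0},v_{\varepsilon,0}].$$ **Strong solution.** Let $(\chi,v)$, $\chi\in\{0,1\}$, be a strong solution of the sharp interface limit on $[0,T_*)$ with initial data $(\chi_0,v_0)$, that is: $v_0\in (H^1_0\cap C^1)(\Omega;\mathbb R^d)$, $\nabla\cdot v_0=0$; $\chi_0\in BV(\Omega;\{0,1\})$, $\Omega_+(0):=\{\chi_0=1\}$ is open with finitely many connected components, $\overline{\Omega_+(0)}\subset\Omega$, and $\partial\Omega_+(0)$ is of class $C^3$; $v\in H^1(0,T_*;L^2)\cap L^2(0,T_*;H^1)$, $v(t)\in H^1_0(\Omega)$ and $\nabla\cdot v(t)=0$ for a.e. $t$, $v(t)\to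 v_0$ in $L^2(\Omega)$ as $t\downarrow0$, and $v\in L^\infty(0,T;C^1(\Omega;\mathbb R^d))$ with $\nabla v$ bounded for all $T<T_*$; for a.e. $T\in(0,T_*)$ and all $\eta\in C^\infty_c([0,T_*);C_c^\infty(\Omega;\mathbb R^d))$ with $\nabla\cdot\eta=0$, $$\int_\Omega v(T)\cdot\eta(T)\,dx-\int_\Omega v_0\cdot\eta(0)\,dx=\int_0^T\!\!\int_\Omega v\cdot\partial_t\eta-\eta\cdot(v\cdot\nabla)v-\nabla v:\nabla\eta\,dx\,dt+c_0\int_0^T\!\!\int_\Omega\tfrac{\nabla\chi}{|\nabla\chi|}\otimes\tfrac{\nabla\chi}{|\nabla\chi|}:\nabla\eta\,d|\nabla\chi|\,dt;$$ the sets $\Omega_+(t):=\{\chi(\cdot,t)=1\}$ satisfy $\overline{\Omega_+(t)}\subset\Omega$ and $\Omega_+(t)=\Psi(\Omega_+(0),t)$ for a family of $C^3$-diffeomorphisms $\Psi(\cdot,t)$ of $\overline\Omega$ with $\Psi(\cdot,0)=\mathrm{Id}$ and $\Psi\in C^1([0,T];C^1(\overline\Omega))\cap C([0,T];C^3(\overline\Omega))$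 for all $T<T_*$; and $\mathcal I(t):=\partial\Omega_+(t)$ evolves by $V_{\mathcal I}=\mathbf n_{\mathcal I}\cdot v+H_{\mathcal I}$, where $\mathbf n_{\mathcal I}$ is the unit normal pointing into $\Omega_+$, and the normal speed $V_{\mathcal I}$ and the scalar mean curvature $H_{\mathcal I}$ are taken with respect to $\mathbf n_{\mathcal I}$ ($H_{\mathcal I}>0$ if $\Omega_+(t)$ is a ball). **Vector fields.** Let $(\xi,B)$ be vector fields on $\Omega\times[0,T_*)$ such that for every $T<T_*$: $\xi\in C^{0,1}([0,T];L^\infty(\Omega))\cap L^\infty([0,T];C^{1,1}_c(\Omega))$, $B\in L^\infty([0,T];C^{0,1}(\overline\Omega))$ with $B=0$ on $\partial\Omega$, and $\partial_t\xi,\nabla^2\xi,\nabla B\in L^\infty(\Omega\times(0,T))$. Suppose that $$\xi=\mathbf n_{\mathcal I}\quad\text{and}\quad\nabla\cdot\xi=-H_{\mathcal I}\qquad\text{on }\mathcal I(t)\ \text{(for a.e. }t\in(0,T_*)).$$ **Notation.** $\psi_\varepsilon:=\int_{-1}^{\varphi_\varepsilon}\sqrt{2W(r)}\,dr$, and $\psi_{\varepsilon,0}$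 likewise from $\varphi_{\varepsilon,0}$; $\mathbf n_\varepsilon:=\nabla\varphi_\varepsilon/|\nabla\varphi_\varepsilon|$ where $\nabla\varphi_\varepsilon\ne0$, and $\mathbf n_\varepsilon:=\mathrm s$ elsewhere, for a fixed arbitrary unit vector $\mathrm s$; $H_\varepsilon:=-\varepsilon\Delta\varphi_\varepsilon+\frac1\varepsilon W'(\varphi_\varepsilon)$; and $$E(t):=\int_\Omega\tfrac12|v_\varepsilon-v|^2+\tfrac\varepsilon2|\nabla\varphi_\varepsilon|^2+\tfrac1\varepsilon W(\varphi_\varepsilon)-\xi\cdot\nabla\psi_\varepsilon\,dx$$ at time $t$, where $E(0)$ is computed from the initial data $\varphi_{\varepsilon,0},\psi_{\varepsilon,0},v_{\varepsilon,0},v_0$ and $\xi(\cdot,0)$. **Claim.** $E(0)$ is finite, all space-time integrands below are integrable on $\Omega\times(0,T)$ for every $T\in(0,T_*)$, and for a.e. $T\in(0,T_*)$ the integral $E(T)$ is finite and $$\begin{aligned}E(T)\le{}&E(0)-\int_0^T\!\!\int_\Omega|\nabla v_\varepsilon-\nabla v|^2-\int_0^T\!\!\int_\Omega\tfrac1{2\varepsilon}\big|H_\varepsilon+\sqrt{2W(\varphi_\varepsilon)}\,\nabla\cdot\xi\big|^2-\int_0^T\!\!\int_\Omega\tfrac1{2\varepsilon}\big|H_\varepsilon-((B-v)\cdot\xi)\,\varepsilon|\nabla\varphi_\varepsilon|\big|^2\\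 &-\int_0^T\!\!\int_\Omega(v_\varepsilon-v)\cdot((v_\varepsilon-v)\cdot\nabla)v-\int_0^T\!\!\int_\Omega(c_0\chi-\psi_\varepsilon)((v_\varepsilon-v)\cdot\nabla)(\nabla\cdot\xi)\\ &+\int_0^T\!\!\int_\Omega\big|(B-v)\cdot\xi+\nabla\cdot\xi\big|^2\varepsilon|\nabla\varphi_\varepsilon|^2+\int_0^T\!\!\int_\Omega|\nabla\cdot\xi|^2\Big(\tfrac{\sqrt{2W(\varphi_\varepsilon)}}{\sqrt\varepsilon}-\sqrt\varepsilon|\nabla\varphi_\varepsilon|\Big)^2\\ &-\int_0^T\!\!\int_\Omega\tfrac1{\sqrt\varepsilon}\big(H_\varepsilon+\sqrt{2W(\varphi_\varepsilon)}\,\nabla\cdot\xi\big)\big((v-B)\cdot(\mathbf n_\varepsilon-\xi)\big)\sqrt\varepsilon|\nabla\varphi_\varepsilon|\\ &-\int_0^T\!\!\int_\Omega\big(\partial_t\xi+(B\cdot\nabla)\xi+(\nabla B)^{\mathsf T}\xi\big)\cdot(\mathbf n_\varepsilon-\xi)|\nabla\psi_\varepsilon|-\int_0^T\!\!\int_\Omega\xi\cdot\big(\partial_t\xi+(B\cdot\nabla)\xi\big)|\nabla\psi_\varepsilon|\\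 &-\int_0^T\!\!\int_\Omega\nabla B:(\xi-\mathbf n_\varepsilon)\otimes(\xi-\mathbf n_\varepsilon)|\nabla\psi_\varepsilon|+\int_0^T\!\!\int_\Omega(\nabla\cdot B)(1-\xi\cdot\mathbf n_\varepsilon)|\nabla\psi_\varepsilon|\\ &+\int_0^T\!\!\int_\Omega(\nabla\cdot B)\tfrac12\Big(\sqrt\varepsilon|\nabla\varphi_\varepsilon|-\tfrac1{\sqrt\varepsilon}\sqrt{2W(\varphi_\varepsilon)}\Big)^2-\int_0^T\!\!\int_\Omega(\mathbf n_\varepsilon\otimes\mathbf n_\varepsilon-\xi\otimes\xi):\nabla B\,\big(\varepsilon|\nabla\varphi_\varepsilon|^2-|\nabla\psi_\varepsilon|\big)\\ &-\int_0^T\!\!\int_\Omega\xi\otimes\xi:\nabla B\,\big(\varepsilon|\nabla\varphi_\varepsilon|^2-|\nabla\psi_\varepsilon|\big).\end{aligned}$$ -/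

import Mathlib

open Set Filter Topology MeasureTheory Function
open scoped NNReal ENNReal InnerProductSpace

noncomputable section

/-- `d`-dimensional Euclidean space. -/
abbrev Vec (d : ℕ) := EuclideanSpace ℝ (Fin d)

/-! ### Linear algebra and vector calculus -/

/-- The trace of an endomorphism of `ℝ^d`. -/
def tr {d : ℕ} (A : Vec d →L[ℝ] Vec d) : ℝ :=
  ∑ i, (A (EuclideanSpace.single i 1)) i

/-- The Frobenius inner product `A : A'`. -/
def frob {d : ℕ} (A A' : Vec d →L[ℝ] Vec d) : ℝ :=
  ∑ i, ⟪A (EuclideanSpace.single i 1), A' (EuclideanSpace.single i 1)⟫_ℝ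

/-- The (classical) divergence of a vector field. -/
def divg {d : ℕ} (u : Vec d → Vec d) (x : Vec d) : ℝ := tr (fderiv ℝ u x)

/-! ### Domains, normals and mean curvature -/

/-- Near `x`, the set `U` is `{ρ > 0}`, where `ρ` is of class `C^k`, `ρ x = 0`, `∇ρ x ≠ 0`. -/
structure IsLocalDefiningFunction {d : ℕ} (k : ℕ) (U : Set (Vec d)) (x : Vec d)
    (ρ : Vec d → ℝ) : Prop where
  contDiffAt : ContDiffAt ℝ k ρ x
  eq_zero : ρ x = 0
  gradient_ne_zero : gradient ρ x ≠ 0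
  mem_iff : ∀ᶠ y in 𝓝 x, (y ∈ U ↔ 0 < ρ y)

/-- `U` has a boundary of class `C^k` and lies locally on one side of it. -/
def HasCkBoundary {d : ℕ} (k : ℕ) (U : Set (Vec d)) : Prop :=
  ∀ x ∈ frontier U, ∃ ρ, IsLocalDefiningFunction k U x ρ

/-- A bounded domain with `C^2`-boundary (which is then orientable). -/
structure IsC2Domain {d : ℕ} (Ω : Set (Vec d)) : Prop where
  isOpen : IsOpen Ω
  isConnected : IsConnected Ω
  isBounded : Bornology.IsBounded Ω
  boundary : HasCkBoundary 2 Ω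

/-- `∇ρ / |∇ρ|`. If `ρ` is a local defining function of `U` at `x ∈ ∂U`, its value at `x` is the
unit normal of `∂U` at `x` pointing into `U`. -/
def unitNormal {d : ℕ} (ρ : Vec d → ℝ) (x : Vec d) : Vec d := ‖gradient ρ x‖⁻¹ • gradient ρ x

/-- The scalar mean curvature `-∇·(∇ρ / |∇ρ|)` of the level set of `ρ` through `x`, with respect to
the normal `∇ρ / |∇ρ|`. At a boundary point of `U` with `C^2` local defining function `ρ` it is the
mean curvature of `∂U` with respect to the inner normal (it does not depend on `ρ`, and it is
positive for balls). -/
def meanCurv {d : ℕ} (ρ : Vec d → ℝ) (x : Vec d) : ℝ := -divg (unitNormal ρ) x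

/-! ### Weak derivatives and function spaces -/

section Sobolev

variable {d : ℕ} {F : Type*} [NormedAddCommGroup F] [NormedSpace ℝ F]

/-- `η ∈ C_c^∞(Ω; F)`. -/
structure IsTest (Ω : Set (Vec d)) (η : Vec d → F) : Prop where
  smooth : ContDiff ℝ (⊤ : ℕ∞) η
  compact : HasCompactSupport η
  support : tsupport η ⊆ Ω

/-- `G` is the weak derivative of `u` in `Ω`. -/
structure HasWeakFDeriv (Ω : Set (Vec d)) (u : Vec d → F) (G : Vec d → Vec d →L[ℝ] F) : Prop where
  locInt : LocallyIntegrableOn u Ω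
  locInt_deriv : LocallyIntegrableOn G Ω
  byParts : ∀ η : Vec d → ℝ, IsTest Ω η → ∀ e : Vec d,
    ∫ x in Ω, fderiv ℝ η x e • u x = -∫ x in Ω, η x • G x e

/-- The vector field `g` is the weak gradient of the scalar function `u` in `Ω`. -/
def HasWeakGrad (Ω : Set (Vec d)) (u : Vec d → ℝ) (g : Vec d → Vec d) : Prop :=
  HasWeakFDeriv Ω u (fun x => innerSL ℝ (g x))

/-- `u ∈ H^1(Ω; F)`, with weak derivative `G`. -/
structure MemH1 (Ω : Set (Vec d)) (u : Vec d → F) (G : Vec d → Vec d →L[ℝ] F) : Prop where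
  memLp : MemLp u 2 (volume.restrict Ω)
  memLp_deriv : MemLp G 2 (volume.restrict Ω)
  weak : HasWeakFDeriv Ω u G

/-- `u ∈ H^1_0(Ω; F)`, the closure of `C_c^∞(Ω; F)` in `H^1(Ω; F)`, with weak derivative `G`. -/
structure MemH10 (Ω : Set (Vec d)) (u : Vec d → F) (G : Vec d → Vec d →L[ℝ] F) : Prop
    extends MemH1 Ω u G where
  approx : ∃ η : ℕ → Vec d → F, (∀ n, IsTest Ω (η n)) ∧
    Tendsto (fun n => eLpNorm (η n - u) 2 (volume.restrict Ω)) atTop (𝓝 0) ∧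
    Tendsto (fun n => eLpNorm (fderiv ℝ (η n) - G) 2 (volume.restrict Ω)) atTop (𝓝 0)

/-- `∇·u = 0` in `Ω` in the sense of distributions. -/
def WeaklyDivFree (Ω : Set (Vec d)) (u : Vec d → Vec d) : Prop :=
  ∀ η : Vec d → ℝ, IsTest Ω η → ∫ x in Ω, ⟪u x, gradient η x⟫_ℝ = 0

/-- Lebesgue measure on the space-time cylinder `(0,T) × Ω`. -/
def spaceTime (Ω : Set (Vec d)) (T : ℝ) : Measure (ℝ × Vec d) :=
  (volume.restrict (Ioo 0 T)).prod (volume.restrict Ω)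

/-- `u'` is the weak time derivative of `u` in `(0,T) × Ω`. -/
def HasWeakTimeDeriv (Ω : Set (Vec d)) (T : ℝ) (u u' : ℝ → Vec d → F) : Prop :=
  ∀ θ : ℝ × Vec d → ℝ, ContDiff ℝ (⊤ : ℕ∞) θ → HasCompactSupport θ → tsupport θ ⊆ Ioo 0 T ×ˢ Ω →
    ∫ p, fderiv ℝ θ p (1, 0) • u p.1 p.2 ∂(spaceTime Ω T)
      = -∫ p, θ p • u' p.1 p.2 ∂(spaceTime Ω T)

/-- `u → u₀` strongly in `L^2(Ω)` as `t ↓ 0` (outside a null set of times, since `u` is only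
determined up to such sets). -/
def TendstoL2AtZero (Ω : Set (Vec d)) (u : ℝ → Vec d → F) (u₀ : Vec d → F) : Prop :=
  Tendsto (fun t => eLpNorm (u t - u₀) 2 (volume.restrict Ω)) (𝓝[>] 0 ⊓ ae volume) (𝓝 0)

end Sobolev

/-- `η ∈ C_c^∞([0,T); C_c^∞(Ω; ℝ^d))` with `∇·η = 0` (extended to negative times). -/
structure IsSolenoidalTest {d : ℕ} (Ω : Set (Vec d)) (T : ℝ) (η : ℝ → Vec d → Vec d) : Prop where
  smooth : ContDiff ℝ (⊤ : ℕ∞) (uncurry η)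
  compact : HasCompactSupport (uncurry η)
  support : tsupport (uncurry η) ⊆ Iio T ×ˢ Ω
  divFree : ∀ t x, divg (η t) x = 0

/-- `∇χ = ν |∇χ|` in `Ω` for the function `χ` of bounded variation: `μ = |∇χ|` is the total
variation measure of the distributional gradient, and `ν = ∇χ/|∇χ|` its density. -/
structure IsPolarGradient {d : ℕ} (Ω : Set (Vec d)) (χ : Vec d → ℝ) (μ : Measure (Vec d))
    (ν : Vec d → Vec d) : Prop where
  integrable : IntegrableOn χ Ω
  finite : μ univ < ⊤
  compl : μ Ωᶜ = 0
  aesm : AEStronglyMeasurable ν μ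
  norm_eq_one : ∀ᵐ x ∂μ, ‖ν x‖ = 1
  byParts : ∀ η : Vec d → Vec d, IsTest Ω η →
    ∫ x in Ω, χ x * divg η x = -∫ x, ⟪ν x, η x⟫_ℝ ∂μ

/-! ### The double-well potential and the energies -/

/-- A double-well potential with wells `±1`. -/
structure IsDoubleWell (W : ℝ → ℝ) : Prop where
  contDiff : ContDiff ℝ 2 W
  zero : W (-1) = 0 ∧ W 1 = 0
  deriv_zero : deriv W (-1) = 0 ∧ deriv W 1 = 0
  deriv2_pos : 0 < deriv (deriv W) (-1) ∧ 0 < deriv (deriv W) 1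
  pos : ∀ r ∈ Ioo (-1 : ℝ) 1, 0 < W r

/-- `r ↦ ∫_{-1}^r √(2W(s)) ds`. -/
def psi (W : ℝ → ℝ) (r : ℝ) : ℝ := ∫ s in (-1 : ℝ)..r, √(2 * W s)

/-- The surface tension constant `c₀ = ∫_{-1}^1 √(2W(s)) ds`. -/
def surfaceTension (W : ℝ → ℝ) : ℝ := ∫ s in (-1 : ℝ)..1, √(2 * W s)

/-- The total energy `E[φ,u]` at a fixed time, where `Dφ = ∇φ`. -/
def totalEnergy {d : ℕ} (Ω : Set (Vec d)) (W : ℝ → ℝ) (ε : ℝ) (φ : Vec d → ℝ)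
    (Dφ u : Vec d → Vec d) : ℝ :=
  (∫ x in Ω, 1 / 2 * ‖u x‖ ^ 2) + ∫ x in Ω, (ε / 2 * ‖Dφ x‖ ^ 2 + 1 / ε * W (φ x))

/-- The density of the relative energy at a fixed time, where `Dφ = ∇φ` and `Dψ = ∇ψ`,
`ψ = psi W ∘ φ`. -/
def relEnergyDensity {d : ℕ} (W : ℝ → ℝ) (ε : ℝ) (φ : Vec d → ℝ)
    (Dφ Dψ u v ξ : Vec d → Vec d) (x : Vec d) : ℝ :=
  1 / 2 * ‖u x - v x‖ ^ 2 + (ε / 2 * ‖Dφ x‖ ^ 2 + 1 / ε * W (φ x) - ⟪ξ x, Dψ x⟫_ℝ)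

/-- The relative energy `E[φ,u|χ,v]` at a fixed time. -/
def relEnergy {d : ℕ} (Ω : Set (Vec d)) (W : ℝ → ℝ) (ε : ℝ) (φ : Vec d → ℝ)
    (Dφ Dψ u v ξ : Vec d → Vec d) : ℝ :=
  ∫ x in Ω, relEnergyDensity W ε φ Dφ Dψ u v ξ x

/-! ### Weak solutions of the Navier-Stokes/Allen-Cahn system -/

/-- `(φ, u)` is a weak solution of the Navier-Stokes/Allen-Cahn system on `(0,T₀) × Ω` with initial
data `(φ₀, u₀)`. The functions `φt = ∂ₜφ`, `Dφ = ∇φ`, `D2φ = ∇²φ`, `Du = ∇u`, `Dφ₀ = ∇φ₀` are the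
weak derivatives; space-time functions are written as `t ↦ x ↦ _`. -/
structure IsWeakSolution {d : ℕ} (Ω : Set (Vec d)) (W : ℝ → ℝ) (ε T₀ : ℝ)
    (φ₀ : Vec d → ℝ) (Dφ₀ u₀ : Vec d → Vec d)
    (φ φt : ℝ → Vec d → ℝ) (Dφ : ℝ → Vec d → Vec d) (D2φ : ℝ → Vec d → Vec d →L[ℝ] Vec d)
    (u : ℝ → Vec d → Vec d) (Du : ℝ → Vec d → Vec d →L[ℝ] Vec d) : Prop where
  -- initial data
  init_range : ∀ᵐ x ∂(volume.restrict Ω), φ₀ x ∈ Icc (-1 : ℝ) 1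
  init_phase : MemH1 Ω φ₀ (fun x => innerSL ℝ (Dφ₀ x))
  init_phase_bdry : MemH10 Ω (fun x => φ₀ x - (-1)) (fun x => innerSL ℝ (Dφ₀ x))
  init_velocity : ∃ Du₀ : Vec d → Vec d →L[ℝ] Vec d, MemH10 Ω u₀ Du₀
  init_divFree : WeaklyDivFree Ω u₀
  -- `u ∈ L²(0,T₀;H¹) ∩ L^∞(0,T₀;L²)`
  velocity_memLp : MemLp (uncurry u) 2 (spaceTime Ω T₀)
  velocity_grad_memLp : MemLp (uncurry Du) 2 (spaceTime Ω T₀)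
  velocity_bound : ∃ C : ℝ≥0, ∀ᵐ t ∂(volume.restrict (Ioo 0 T₀)),
    eLpNorm (u t) 2 (volume.restrict Ω) ≤ C
  -- `φ ∈ H¹(0,T₀;L²(Ω;[-1,1])) ∩ L²(0,T₀;H²)`
  phase_range : ∀ᵐ p ∂(spaceTime Ω T₀), φ p.1 p.2 ∈ Icc (-1 : ℝ) 1
  phase_memLp : MemLp (uncurry φ) 2 (spaceTime Ω T₀)
  phase_time_memLp : MemLp (uncurry φt) 2 (spaceTime Ω T₀)
  phase_time : HasWeakTimeDeriv Ω T₀ φ φt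
  phase_grad_memLp : MemLp (uncurry Dφ) 2 (spaceTime Ω T₀)
  phase_hess_memLp : MemLp (uncurry D2φ) 2 (spaceTime Ω T₀)
  phase_hess : ∀ᵐ t ∂(volume.restrict (Ioo 0 T₀)), HasWeakFDeriv Ω (Dφ t) (D2φ t)
  -- boundary conditions (and identification of the weak gradients)
  phase_bdry : ∀ᵐ t ∂(volume.restrict (Ioo 0 T₀)),
    MemH10 Ω (fun x => φ t x - (-1)) (fun x => innerSL ℝ (Dφ t x))
  velocity_bdry : ∀ᵐ t ∂(volume.restrict (Ioo 0 T₀)), MemH10 Ω (u t) (Du t)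
  -- the momentum equation
  momentum : ∀ᵐ T ∂(volume.restrict (Ioo 0 T₀)), ∀ η, IsSolenoidalTest Ω T₀ η →
    (∫ x in Ω, ⟪u T x, η T x⟫_ℝ) - (∫ x in Ω, ⟪u₀ x, η 0 x⟫_ℝ)
      = (∫ t in 0..T, ∫ x in Ω, ⟪u t x, deriv (fun s => η s x) t⟫_ℝ)
      + (∫ t in 0..T, ∫ x in Ω, ⟪u t x, fderiv ℝ (η t) x (u t x)⟫_ℝ)
      - (∫ t in 0..T, ∫ x in Ω, frob (Du t x) (fderiv ℝ (η t) x))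
      + (∫ t in 0..T, ∫ x in Ω, ε * ⟪Dφ t x, fderiv ℝ (η t) x (Dφ t x)⟫_ℝ)
  divFree : ∀ᵐ t ∂(volume.restrict (Ioo 0 T₀)), WeaklyDivFree Ω (u t)
  -- the Allen-Cahn equation
  allenCahn : ∀ᵐ p ∂(spaceTime Ω T₀),
    φt p.1 p.2 + ⟪u p.1 p.2, Dφ p.1 p.2⟫_ℝ
      = tr (D2φ p.1 p.2) - 1 / ε ^ 2 * deriv W (φ p.1 p.2)
  phase_init : TendstoL2AtZero Ω φ φ₀
  -- sharp energy dissipation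
  energy : ∀ᵐ T ∂(volume.restrict (Ioo 0 T₀)),
    totalEnergy Ω W ε (φ T) (Dφ T) (u T)
      + (∫ t in 0..T, ∫ x in Ω,
          (frob (Du t x) (Du t x) + ε * (φt t x + ⟪u t x, Dφ t x⟫_ℝ) ^ 2))
      ≤ totalEnergy Ω W ε φ₀ Dφ₀ u₀

/-! ### Strong solutions of the sharp interface limit system -/

/-- The region `{χ = 1}` in `Ω` at a fixed time. -/
def plusPhase {d : ℕ} (Ω : Set (Vec d)) (χ : Vec d → ℝ) : Set (Vec d) := {x ∈ Ω | χ x = 1}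

/-- A family of `C^3`-diffeomorphisms `Ψ t` of the closure of `Ω`, with `Ψ 0 = id`, time derivative
`Ψt`, and `Ψ ∈ C^1([0,T];C^1) ∩ C([0,T];C^3)` on the closure of `Ω` for all `T < Tstar` (the closure
being compact, this is joint continuity of the derivatives on `[0,Tstar) × closure Ω`). -/
structure IsDiffeoFlow {d : ℕ} (Ω : Set (Vec d)) (Tstar : ℝ) (Ψ Ψt : ℝ → Vec d → Vec d) :
    Prop where
  init : ∀ x ∈ closure Ω, Ψ 0 x = x
  contDiff : ∀ t ∈ Ico 0 Tstar, ContDiffOn ℝ 3 (Ψ t) (closure Ω)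
  mapsTo : ∀ t ∈ Ico 0 Tstar, MapsTo (Ψ t) (closure Ω) (closure Ω)
  inverse : ∀ t ∈ Ico 0 Tstar, ∃ Φ : Vec d → Vec d, ContDiffOn ℝ 3 Φ (closure Ω) ∧
    MapsTo Φ (closure Ω) (closure Ω) ∧ InvOn Φ (Ψ t) (closure Ω) (closure Ω)
  continuous : ∀ k : ℕ, k ≤ 3 →
    ContinuousOn (fun p : ℝ × Vec d => iteratedFDerivWithin ℝ k (Ψ p.1) (closure Ω) p.2)
      (Ico 0 Tstar ×ˢ closure Ω)
  time_contDiff : ∀ t ∈ Ico 0 Tstar, ContDiffOn ℝ 1 (Ψt t) (closure Ω)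
  time_deriv : ∀ t ∈ Ico 0 Tstar, ∀ x ∈ closure Ω,
    HasDerivWithinAt (fun s => Ψ s x) (Ψt t x) (Ico 0 Tstar) t
  time_deriv_fderiv : ∀ t ∈ Ico 0 Tstar, ∀ x ∈ closure Ω,
    HasDerivWithinAt (fun s => fderivWithin ℝ (Ψ s) (closure Ω) x)
      (fderivWithin ℝ (Ψt t) (closure Ω) x) (Ico 0 Tstar) t
  time_continuous : ContinuousOn (uncurry Ψt) (Ico 0 Tstar ×ˢ closure Ω)
  time_fderiv_continuous :
    ContinuousOn (fun p : ℝ × Vec d => fderivWithin ℝ (Ψt p.1) (closure Ω) p.2)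
      (Ico 0 Tstar ×ˢ closure Ω)

/-- `(χ, v)` is a strong solution on `[0,Tstar)` of the sharp interface limit system with surface
tension constant `c₀` and initial data `(χ₀, v₀)`. -/
structure IsStrongSolution {d : ℕ} (Ω : Set (Vec d)) (c₀ Tstar : ℝ)
    (χ₀ : Vec d → ℝ) (v₀ : Vec d → Vec d)
    (χ : ℝ → Vec d → ℝ) (v : ℝ → Vec d → Vec d) : Prop where
  -- initial data
  init_velocity : ContDiffOn ℝ 1 v₀ Ω ∧ MemH10 Ω v₀ (fderiv ℝ v₀)
  init_divFree : ∀ x ∈ Ω, divg v₀ x = 0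
  init_phase_range : ∀ x ∈ Ω, χ₀ x = 0 ∨ χ₀ x = 1
  init_phase_bv : ∃ μ ν, IsPolarGradient Ω χ₀ μ ν
  init_open : IsOpen (plusPhase Ω χ₀)
  init_components : Finite (ConnectedComponents (plusPhase Ω χ₀))
  init_closure : closure (plusPhase Ω χ₀) ⊆ Ω
  init_boundary : HasCkBoundary 3 (plusPhase Ω χ₀)
  -- regularity of the velocity, boundary and initial condition
  velocity_memLp : MemLp (uncurry v) 2 (spaceTime Ω Tstar)
  velocity_time : ∃ vt : ℝ → Vec d → Vec d,
    MemLp (uncurry vt) 2 (spaceTime Ω Tstar) ∧ HasWeakTimeDeriv Ω Tstar v vt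
  velocity_grad_memLp :
    MemLp (fun p : ℝ × Vec d => fderiv ℝ (v p.1) p.2) 2 (spaceTime Ω Tstar)
  velocity_bdry : ∀ᵐ t ∂(volume.restrict (Ioo 0 Tstar)), MemH10 Ω (v t) (fderiv ℝ (v t))
  velocity_init : TendstoL2AtZero Ω v v₀
  velocity_C1 : ∀ T ∈ Ico 0 Tstar, ∃ C : ℝ, ∀ᵐ t ∂(volume.restrict (Ioo 0 T)),
    ContDiffOn ℝ 1 (v t) Ω ∧ ∀ x ∈ Ω, ‖v t x‖ ≤ C ∧ ‖fderiv ℝ (v t) x‖ ≤ C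
  -- the momentum equation
  momentum : ∃ (μ : ℝ → Measure (Vec d)) (ν : ℝ → Vec d → Vec d),
    (∀ t ∈ Ioo 0 Tstar, IsPolarGradient Ω (χ t) (μ t) (ν t)) ∧
    ∀ᵐ T ∂(volume.restrict (Ioo 0 Tstar)), ∀ η, IsSolenoidalTest Ω Tstar η →
      (∫ x in Ω, ⟪v T x, η T x⟫_ℝ) - (∫ x in Ω, ⟪v₀ x, η 0 x⟫_ℝ)
        = (∫ t in 0..T, ∫ x in Ω, ⟪v t x, deriv (fun s => η s x) t⟫_ℝ)
        - (∫ t in 0..T, ∫ x in Ω, ⟪η t x, fderiv ℝ (v t) x (v t x)⟫_ℝ)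
        - (∫ t in 0..T, ∫ x in Ω, frob (fderiv ℝ (v t) x) (fderiv ℝ (η t) x))
        + c₀ * (∫ t in 0..T, ∫ x, ⟪ν t x, fderiv ℝ (η t) x (ν t x)⟫_ℝ ∂(μ t))
  divFree : ∀ᵐ t ∂(volume.restrict (Ioo 0 Tstar)), WeaklyDivFree Ω (v t)
  -- the phase indicator
  phase_measurable : AEStronglyMeasurable (uncurry χ) (spaceTime Ω Tstar)
  phase_range : ∀ t ∈ Ioo 0 Tstar, ∀ x ∈ Ω, χ t x = 0 ∨ χ t x = 1
  phase_closure : ∀ t ∈ Ioo 0 Tstar, closure (plusPhase Ω (χ t)) ⊆ Ω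
  -- the interface moves by `V = n·v + H`, where `V = n·∂ₜΨ` is its normal speed
  evolution : ∃ Ψ Ψt : ℝ → Vec d → Vec d, IsDiffeoFlow Ω Tstar Ψ Ψt ∧
    (∀ t ∈ Ioo 0 Tstar, plusPhase Ω (χ t) = Ψ t '' plusPhase Ω χ₀) ∧
    ∀ᵐ t ∂(volume.restrict (Ioo 0 Tstar)), ∀ y ∈ frontier (plusPhase Ω χ₀), ∀ ρ,
      IsLocalDefiningFunction 2 (plusPhase Ω (χ t)) (Ψ t y) ρ →
      ⟪unitNormal ρ (Ψ t y), Ψt t y⟫_ℝ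
        = ⟪unitNormal ρ (Ψ t y), v t (Ψ t y)⟫_ℝ + meanCurv ρ (Ψ t y)

/-! ### The pair of auxiliary vector fields -/

/-- Regularity of the pair `(ξ, B)`: for every `T < Tstar`,
`ξ ∈ C^{0,1}([0,T];L^∞(Ω)) ∩ L^∞([0,T];C^{1,1}_c(Ω))` and `B ∈ L^∞([0,T];C^{0,1}(closure Ω))` with
`B = 0` on `∂Ω`, and `∂ₜξ`, `∇²ξ`, `∇B` are bounded. Both fields are extended by zero to `ℝ^d`;
`ξt` is the weak time derivative of `ξ`. -/
structure IsRegularPair {d : ℕ} (Ω : Set (Vec d)) (Tstar : ℝ)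
    (ξ ξt B : ℝ → Vec d → Vec d) : Prop where
  xi_measurable : AEStronglyMeasurable (uncurry ξ) (spaceTime Ω Tstar)
  xi_time_measurable : AEStronglyMeasurable (uncurry ξt) (spaceTime Ω Tstar)
  xi_time : HasWeakTimeDeriv Ω Tstar ξ ξt
  B_measurable : AEStronglyMeasurable (uncurry B) (spaceTime Ω Tstar)
  bounds : ∀ T ∈ Ico 0 Tstar, ∃ C : ℝ≥0,
    (∀ s ∈ Icc 0 T, ∀ t ∈ Icc 0 T, ∀ᵐ x ∂(volume.restrict Ω), ‖ξ t x - ξ s x‖ ≤ C * |t - s|) ∧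
    (∀ᵐ p ∂(spaceTime Ω T), ‖ξt p.1 p.2‖ ≤ C) ∧
    (∀ᵐ t ∂(volume.restrict (Ioo 0 T)),
      ContDiff ℝ 1 (ξ t) ∧ HasCompactSupport (ξ t) ∧ tsupport (ξ t) ⊆ Ω ∧
      (∀ x, ‖ξ t x‖ ≤ C ∧ ‖fderiv ℝ (ξ t) x‖ ≤ C) ∧ LipschitzWith C (fderiv ℝ (ξ t))) ∧
    (∀ᵐ t ∂(volume.restrict (Ioo 0 T)),
      LipschitzWith C (B t) ∧ (∀ x, ‖B t x‖ ≤ C) ∧ ∀ x ∉ Ω, B t x = 0)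

/-- Consistency: `ξ = n` and `∇·ξ = -H` on the interface `∂{χ(t) = 1}`. -/
def IsConsistent {d : ℕ} (Ω : Set (Vec d)) (Tstar : ℝ) (χ : ℝ → Vec d → ℝ)
    (ξ : ℝ → Vec d → Vec d) : Prop :=
  ∀ᵐ t ∂(volume.restrict (Ioo 0 Tstar)), ∀ x ∈ frontier (plusPhase Ω (χ t)), ∀ ρ,
    IsLocalDefiningFunction 2 (plusPhase Ω (χ t)) x ρ →
    ξ t x = unitNormal ρ x ∧ divg (ξ t) x = -meanCurv ρ x

/-! ### Diffuse normal and curvature -/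

open Classical in
/-- The diffuse unit normal `∇φ/|∇φ|`, with the value `s` where `∇φ = 0`. -/
def diffuseNormal {d : ℕ} (s : Vec d) (Dφ : ℝ → Vec d → Vec d) (t : ℝ) (x : Vec d) : Vec d :=
  if Dφ t x = 0 then s else ‖Dφ t x‖⁻¹ • Dφ t x

/-- The diffuse curvature `-εΔφ + ε⁻¹ W'(φ)`. -/
def diffuseCurvature {d : ℕ} (W : ℝ → ℝ) (ε : ℝ) (φ : ℝ → Vec d → ℝ)
    (D2φ : ℝ → Vec d → Vec d →L[ℝ] Vec d) (t : ℝ) (x : Vec d) : ℝ :=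
  -ε * tr (D2φ t x) + 1 / ε * deriv W (φ t x)

/-- The densities of the space-time integrals on the right-hand side of the relative energy
inequality, with their signs. The first three are the dissipation terms. Here `H` and `n` are the
diffuse curvature and normal, `∇B` is the Jacobian matrix of `B`, and `Dψ = ∇ψ`,
`ψ = psi W ∘ φ`. -/
def relEnergyTerms {d : ℕ} (W : ℝ → ℝ) (ε : ℝ) (s : Vec d)
    (φ : ℝ → Vec d → ℝ) (Dφ Dψ : ℝ → Vec d → Vec d) (D2φ : ℝ → Vec d → Vec d →L[ℝ] Vec d)
    (u : ℝ → Vec d → Vec d) (Du : ℝ → Vec d → Vec d →L[ℝ] Vec d)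
    (χ : ℝ → Vec d → ℝ) (v ξ ξt B : ℝ → Vec d → Vec d) : List (ℝ → Vec d → ℝ) :=
  let H := diffuseCurvature W ε φ D2φ
  let n := diffuseNormal s Dφ
  let DB := fun t x => fderiv ℝ (B t) x
  let Dξ := fun t x => fderiv ℝ (ξ t) x
  [ fun t x => -frob (Du t x - fderiv ℝ (v t) x) (Du t x - fderiv ℝ (v t) x),
    fun t x => -(1 / (2 * ε) * (H t x + √(2 * W (φ t x)) * divg (ξ t) x) ^ 2),
    fun t x => -(1 / (2 * ε) * (H t x - ⟪B t x - v t x, ξ t x⟫_ℝ * (ε * ‖Dφ t x‖)) ^ 2),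
    fun t x => -⟪u t x - v t x, fderiv ℝ (v t) x (u t x - v t x)⟫_ℝ,
    fun t x => -((surfaceTension W * χ t x - psi W (φ t x))
      * fderiv ℝ (fun y => divg (ξ t) y) x (u t x - v t x)),
    fun t x => (⟪B t x - v t x, ξ t x⟫_ℝ + divg (ξ t) x) ^ 2 * (ε * ‖Dφ t x‖ ^ 2),
    fun t x => divg (ξ t) x ^ 2 * (√(2 * W (φ t x)) / √ε - √ε * ‖Dφ t x‖) ^ 2,
    fun t x => -(1 / √ε * (H t x + √(2 * W (φ t x)) * divg (ξ t) x)
      * ⟪v t x - B t x, n t x - ξ t x⟫_ℝ * (√ε * ‖Dφ t x‖)),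
    fun t x => -(⟪ξt t x + Dξ t x (B t x) + ContinuousLinearMap.adjoint (DB t x) (ξ t x),
      n t x - ξ t x⟫_ℝ * ‖Dψ t x‖),
    fun t x => -(⟪ξ t x, ξt t x + Dξ t x (B t x)⟫_ℝ * ‖Dψ t x‖),
    fun t x => -(⟪ξ t x - n t x, DB t x (ξ t x - n t x)⟫_ℝ * ‖Dψ t x‖),
    fun t x => divg (B t) x * (1 - ⟪ξ t x, n t x⟫_ℝ) * ‖Dψ t x‖,
    fun t x => divg (B t) x * (1 / 2 * (√ε * ‖Dφ t x‖ - 1 / √ε * √(2 * W (φ t x))) ^ 2),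
    fun t x => -((⟪n t x, DB t x (n t x)⟫_ℝ - ⟪ξ t x, DB t x (ξ t x)⟫_ℝ)
      * (ε * ‖Dφ t x‖ ^ 2 - ‖Dψ t x‖)),
    fun t x => -(⟪ξ t x, DB t x (ξ t x)⟫_ℝ * (ε * ‖Dφ t x‖ ^ 2 - ‖Dψ t x‖)) ]

end

open intervalIntegral (integral_of_le integral_interval_sub_left continuousOn_primitive_interval' integral_hasDerivAt_right integral_add_adjacent_intervals integral_same integral_congr)
open EuclideanSpace (single proj basisFun)
open Metric (infDist mem_ball ball ball_subset_ball eventually_nhds_iff_ball mem_cthickening_of_dist_le isCompact_of_isClosed_isBounded ball_mem_nhds closedBall ball_subset_closedBall mem_closedBall isOpen_ball)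
open ContinuousLinearMap (le_opNorm lsmul apply opNorm_comp_le opNorm_flip mul_apply' norm_id_le)
open Bornology (IsBounded)
open Real (norm_of_nonneg norm_eq_abs le_coe_toNNReal)
open MeasureTheory.Measure (restrict_univ quasiMeasurePreserving_fst quasiMeasurePreserving_snd restrict_apply_univ ae_ae_of_ae_prod restrict_mono measurePreserving_swap prod_mono)
open ENNReal (ofReal mul_lt_top tendsto_nhds_zero ofReal_ne_top rpow_ne_top_of_nonneg mul_ne_top coe_ne_top continuous_ofReal ofReal_zero)
open HasCompactSupport (of_support_subset_isCompact)
open Finset (sum_congr)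
open Filter.Eventually (of_forall)
open scoped RealInnerProductSpace

/-- The Lebesgue measure restricted to a set. -/
notation "vol" => MeasureTheory.Measure.restrict MeasureTheory.volume
notation "∇" => fderiv ℝ
notation "idL" => ContinuousLinearMap.id ℝ
notation "mulL" => ContinuousLinearMap.mul ℝ ℝ
notation "M[" d "]" => Vec d →L[ℝ] Vec d
notation "V[" d "]" => Vec d → Vec d
notation "R[" d "]" => Vec d → ℝ
notation "L[" d ", " F "]" => Vec d →L[ℝ] F
notation "Null" f:max => Filter.Tendsto f Filter.atTop (nhds 0)
notation "ML2" f:max Ω:max => MeasureTheory.MemLp f 2 (MeasureTheory.Measure.restrict MeasureTheory.volume Ω)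
notation "eL2" f:max Ω:max => MeasureTheory.eLpNorm f 2 (MeasureTheory.Measure.restrict MeasureTheory.volume Ω)
notation "vI" T:max => MeasureTheory.Measure.restrict MeasureTheory.volume (Set.Ioo 0 T)
notation "AESM" f:max μ:max => MeasureTheory.AEStronglyMeasurable f μ
notation "ST" => spaceTime
notation "Smooth" => ContDiff ℝ (⊤ : ℕ∞)

lemma Continuous.aesm {α β : Type*} [TopologicalSpace β] [MeasurableSpace β] [OpensMeasurableSpace β]
    [TopologicalSpace α] [TopologicalSpace.PseudoMetrizableSpace α] [SecondCountableTopologyEither β α]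
    {f : β → α} {ν : Measure β} (h : Continuous f) : AESM f ν := h.aestronglyMeasurable

lemma Measurable.aesm {α β : Type*} [MeasurableSpace β] [TopologicalSpace α]
    [TopologicalSpace.PseudoMetrizableSpace α] [SecondCountableTopology α] [MeasurableSpace α] [OpensMeasurableSpace α]
    {f : β → α} {ν : Measure β} (h : Measurable f) : AESM f ν := h.aestronglyMeasurable

lemma Continuous.comp_aesm {α β γ : Type*} [MeasurableSpace β] [TopologicalSpace α] [TopologicalSpace γ] {g : α → γ}
    {f : β → α} {ν : Measure β} (hg : Continuous g) (hf : AESM f ν) : AESM (fun x => g (f x)) ν :=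
  hg.comp_aestronglyMeasurable hf

variable {d : ℕ} {Ω : Set (Vec d)} {E F : Type*} [NormedAddCommGroup E] [NormedSpace ℝ E]
  [NormedAddCommGroup F] [NormedSpace ℝ F]

lemma ContDiff.toC1 {f : E → F} (h : Smooth f) : ContDiff ℝ 1 f := h.of_le (by exact_mod_cast le_top)

lemma fderiv_off {f : E → F} {x : E} (h : x ∉ tsupport f) : ∇ f x = 0 := by
  by_contra hne; exact h (support_fderiv_subset ℝ hne)

/-- A bounded open set in positive dimension. -/
structure Dom (Ω : Set (Vec d)) : Prop where
  d : d ≠ 0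
  o : IsOpen Ω
  b : Bornology.IsBounded Ω

lemma Dom.m (h : Dom Ω) : MeasurableSet Ω := h.o.measurableSet

lemma tendsto_zero_of_le {ι : Type*} {l : Filter ι} {f g : ι → ℝ≥0∞} (h : Tendsto g l (𝓝 0))
    (hfg : ∀ n, f n ≤ g n) : Tendsto f l (𝓝 0) :=
  tendsto_of_tendsto_of_tendsto_of_le_of_le tendsto_const_nhds h (fun _ => zero_le) hfg

lemma setIntegral_eq_of_zero {β : Type*} [MeasurableSpace β] {μ : Measure β} {s : Set β} {f : β → E}
    (h : ∀ x ∉ s, f x = 0) : ∫ x in s, f x ∂μ = ∫ x, f x ∂μ := setIntegral_eq_integral_of_forall_compl_eq_zero h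

lemma tendsto_inv_succ : Tendsto (fun n : ℕ => 1 / ((n : ℝ) + 1)) atTop (𝓝 0) :=
  tendsto_one_div_add_atTop_nhds_zero_nat

lemma mul_le_left {a b c : ℝ} (h : b ≤ c) (ha : 0 ≤ a) : a * b ≤ a * c :=
  mul_le_mul_of_nonneg_left h ha

lemma mul_le_right {a b c : ℝ} (h : b ≤ c) (ha : 0 ≤ a) : b * a ≤ c * a :=
  mul_le_mul_of_nonneg_right h ha

lemma eq_zero_off {α M : Type*} [TopologicalSpace α] [Zero M] {f : α → M} {x : α}
    (h : x ∉ tsupport f) : f x = 0 := image_eq_zero_of_notMem_tsupport h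

lemma Continuous.bdd_Icc {f : ℝ → ℝ} (h : Continuous f) : ∃ C, ∀ r ∈ Icc (-1 : ℝ) 1, ‖f r‖ ≤ C :=
  isCompact_Icc.exists_bound_of_continuousOn h.continuousOn

lemma ae_mem_Ioo {a b : ℝ} : ∀ᵐ t ∂vol (Ioo a b), t ∈ Ioo a b := ae_restrict_mem measurableSet_Ioo

/-! ### Translations and mollification -/

lemma tendsto_eLpNorm_translate {E F : Type*} [NormedAddCommGroup E] [NormedSpace ℝ E]
    [FiniteDimensional ℝ E] [MeasurableSpace E] [BorelSpace E] {μ : Measure E} [μ.IsAddHaarMeasure]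
    [NormedAddCommGroup F] {p : ℝ≥0∞} [hp1 : Fact (1 ≤ p)] (hp : p ≠ ∞) {f : E → F}
    (hf : MemLp f p μ) :
    Tendsto (fun y => eLpNorm (fun x => f (x + y) - f x) p μ) (𝓝 0) (𝓝 0) := by
  let g : E → C(E, E) := fun a => ⟨fun x => x + a, by fun_prop⟩
  have hg : Tendsto g (𝓝 0) (𝓝 (g 0)) := by
    have : Continuous g := ContinuousMap.continuous_of_continuous_uncurry _ (by
      simp only [Function.uncurry_def, g, ContinuousMap.coe_mk]; fun_prop)
    exact this.tendsto 0
  have hgm : ∀ a, MeasurePreserving (g a) μ μ := fun a => measurePreserving_add_right μ a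
  have h := (tendsto_const_nhds (x := hf.toLp f) (f := 𝓝 (0 : E))).compMeasurePreservingLp hg
    hgm (hgm 0) hp
  rw [Lp.tendsto_Lp_iff_tendsto_eLpNorm'] at h
  refine h.congr fun a => eLpNorm_congr_ae ?_
  filter_upwards [Lp.coeFn_compMeasurePreserving (hf.toLp f) (hgm a),
    Lp.coeFn_compMeasurePreserving (hf.toLp f) (hgm 0), hf.coeFn_toLp,
    (hgm a).quasiMeasurePreserving.ae_eq_comp hf.coeFn_toLp] with x h1 h2 h3 h4
  have h4' : (hf.toLp f) (x + a) = f (x + a) := h4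
  have h0 : g 0 x = x := by simp [g]
  simp only [Pi.sub_apply, h1, h2, Function.comp_apply, h0, h3]
  rw [← h4']; rfl

lemma sq_lintegral_mul_le {α : Type*} [MeasurableSpace α] {μ : Measure α} {r g : α → ℝ≥0∞}
    (hr : AEMeasurable r μ) (hg : AEMeasurable g μ) (h1 : ∫⁻ y, r y ∂μ = 1) :
    (∫⁻ y, r y * g y ∂μ) ^ 2 ≤ ∫⁻ y, r y * g y ^ 2 ∂μ := by
  have h := ENNReal.lintegral_mul_le_Lp_mul_Lq μ Real.HolderConjugate.two_two
    (f := fun y => r y ^ (1 / 2 : ℝ)) (g := fun y => r y ^ (1 / 2 : ℝ) * g y)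
    (hr.pow_const _) ((hr.pow_const _).mul hg)
  have e1 : ∀ x : ℝ≥0∞, x ^ (1 / 2 : ℝ) * x ^ (1 / 2 : ℝ) = x := fun x => by
    rw [← ENNReal.rpow_add_of_nonneg _ _ (by norm_num) (by norm_num)]; norm_num
  have e2 : ∀ x : ℝ≥0∞, (x ^ (1 / 2 : ℝ)) ^ (2 : ℝ) = x := fun x => by
    rw [← ENNReal.rpow_mul]; norm_num
  simp only [Pi.mul_apply, ← mul_assoc, e1, e2, h1, ENNReal.one_rpow, one_mul] at h
  have e3 : ∀ y, (r y ^ (1 / 2 : ℝ) * g y) ^ (2 : ℝ) = r y * g y ^ 2 := fun y => by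
    rw [ENNReal.mul_rpow_of_nonneg _ _ (by norm_num), e2]; norm_cast
  simp only [e3] at h
  calc (∫⁻ y, r y * g y ∂μ) ^ 2 ≤ ((∫⁻ y, r y * g y ^ 2 ∂μ) ^ (1 / 2 : ℝ)) ^ 2 := by gcongr
    _ = _ := by
      rw [← ENNReal.rpow_natCast, ← ENNReal.rpow_mul]; norm_num

section

noncomputable section

def mollBump (d n : ℕ) : ContDiffBump (0 : Vec d) where
  rIn := 1 / (2 * (n + 1))
  rOut := 1 / (n + 1)
  rIn_pos := by positivity
  rIn_lt_rOut := by
    apply one_div_lt_one_div_of_lt <;> nlinarith [(Nat.cast_nonneg n : (0 : ℝ) ≤ n)]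

notation "κ[" n "]" => ContDiffBump.normed (mollBump _ n) MeasureTheory.volume

def mollify (n : ℕ) (f : Vec d → F) : Vec d → F :=
  convolution (κ[n]) f (lsmul ℝ ℝ) volume

end

lemma mollify_apply (n : ℕ) (f : Vec d → F) (x : Vec d) :
    mollify n f x = ∫ y, κ[n] y • f (x - y) := rfl

lemma mollify_apply' (n : ℕ) (f : Vec d → F) (x : Vec d) :
    mollify n f x = ∫ y, κ[n] (x - y) • f y := by
  rw [mollify, convolution_lsmul_swap]

lemma tendsto_mollBump_rOut : Null (fun n => (mollBump d n).rOut) :=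
  tendsto_inv_succ

lemma mollify_contDiff (n : ℕ) {f : Vec d → F} (hf : LocallyIntegrable f) :
    Smooth (mollify n f) :=
  (mollBump d n).hasCompactSupport_normed.contDiff_convolution_left _
    (mollBump d n).contDiff_normed hf

lemma mollify_ae_tendsto [CompleteSpace F] {f : Vec d → F} (hf : LocallyIntegrable f) :
    ∀ᵐ x, Tendsto (fun n => mollify n f x) atTop (𝓝 (f x)) :=
  ContDiffBump.ae_convolution_tendsto_right_of_locallyIntegrable (K := 2) tendsto_mollBump_rOut
    (of_forall fun n => by simp only [mollBump]; field_simp; norm_num) hf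

lemma mollify_congr_ae {f g : Vec d → F} (h : f =ᵐ[volume] g) (n : ℕ) :
    mollify n f = mollify n g := by
  ext x
  rw [mollify_apply', mollify_apply']
  refine integral_congr_ae ?_
  filter_upwards [h] with y hy
  rw [hy]

lemma mollBump_integrable_smul (n : ℕ) {f : Vec d → F} (hf : LocallyIntegrable f) (x : Vec d) :
    Integrable (fun y => κ[n] (x - y) • f y) := by
  have h := ((mollBump d n).hasCompactSupport_normed (μ := volume)).convolutionExists_left
    (lsmul ℝ ℝ) (mollBump d n).continuous_normed hf x
  simpa using h.integrable_swap

lemma mollBump_integrable_smul' (n : ℕ) {f : Vec d → F} (hf : LocallyIntegrable f) (x : Vec d) :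
    Integrable (fun y => κ[n] y • f (x - y)) := by
  have h := ((mollBump d n).hasCompactSupport_normed (μ := volume)).convolutionExists_left
    (lsmul ℝ ℝ) (mollBump d n).continuous_normed hf x
  simpa using h.integrable

lemma norm_mollify_le {f : Vec d → F} {C : ℝ} (hC : ∀ᵐ x, ‖f x‖ ≤ C) (n : ℕ) (x : Vec d) :
    ‖mollify n f x‖ ≤ C := by
  rw [mollify_apply']
  have h1 : ∫ y, κ[n] (x - y) = 1 := by
    rw [integral_sub_left_eq_self (fun y => κ[n] y)]
    exact (mollBump d n).integral_normed
  have hi : Integrable (fun y => κ[n] (x - y)) :=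
    ((mollBump d n).integrable_normed (μ := volume)).comp_sub_left x
  calc ‖∫ y, κ[n] (x - y) • f y‖
      ≤ ∫ y, κ[n] (x - y) * C := by
        refine norm_integral_le_of_norm_le (hi.mul_const C) ?_
        filter_upwards [hC] with y hy
        rw [norm_smul, norm_of_nonneg ((mollBump d n).nonneg_normed _)]
        exact mul_le_left hy ((mollBump d n).nonneg_normed _)
    _ = C := by rw [integral_mul_const, h1, one_mul]

lemma mollify_sub [CompleteSpace F] (n : ℕ) {f : Vec d → F} (hf : LocallyIntegrable f) (x : Vec d) (c : F) :
    mollify n f x - c = ∫ y, κ[n] y • (f (x - y) - c) := by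
  simp only [smul_sub]
  rw [integral_sub (mollBump_integrable_smul' n hf x)
    (((mollBump d n).integrable_normed (μ := volume)).smul_const c), integral_smul_const,
    (mollBump d n).integral_normed, one_smul, mollify_apply]

lemma lipschitzWith_mollify {f : Vec d → F} {C : ℝ≥0} (hf : LipschitzWith C f)
    (n : ℕ) : LipschitzWith C (mollify n f) := by
  refine LipschitzWith.of_dist_le_mul fun x z => ?_
  have hl := hf.continuous.locallyIntegrable (μ := (volume : Measure (Vec d)))
  rw [dist_eq_norm, mollify_apply, mollify_apply, ← integral_sub (mollBump_integrable_smul' n hl x)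
    (mollBump_integrable_smul' n hl z)]
  calc _ ≤ ∫ y, κ[n] y * (C * dist x z) := by
        refine norm_integral_le_of_norm_le
          (((mollBump d n).integrable_normed (μ := volume)).mul_const _) ?_
        filter_upwards with y
        rw [← smul_sub, norm_smul, norm_of_nonneg ((mollBump d n).nonneg_normed _)]
        refine mul_le_left ?_ ((mollBump d n).nonneg_normed _)
        have := hf.dist_le_mul (x - y) (z - y)
        rwa [dist_sub_right, dist_eq_norm (f _)] at this
    _ = _ := by rw [integral_mul_const, (mollBump d n).integral_normed, one_mul]

lemma dist_mollify_le [CompleteSpace F] {f : Vec d → F} {C : ℝ≥0} (hf : LipschitzWith C f)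
    (n : ℕ) (x : Vec d) : dist (mollify n f x) (f x) ≤ C * (1 / (n + 1)) := by
  refine ContDiffBump.dist_normed_convolution_le hf.continuous.aesm fun y hy => ?_
  refine (hf.dist_le_mul y x).trans ?_
  gcongr
  exact (mem_ball.1 hy).le

lemma mollify_eq_zero {f : Vec d → F} {n : ℕ} {x : Vec d}
    (h : ∀ y, dist y x < 1 / (n + 1) → f y = 0) : mollify n f x = 0 := by
  rw [mollify_apply']
  refine integral_eq_zero_of_ae (of_forall fun y => ?_)
  by_cases hy : dist y x < 1 / (n + 1)
  · simp [h y hy]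
  · have : κ[n] (x - y) = 0 := by
      rw [← notMem_support, (mollBump d n).support_normed_eq, mem_ball, dist_zero_right]
      rwa [dist_comm, dist_eq_norm] at hy
    simp [this]

lemma memLp_mollify_sub_le [CompleteSpace F] (n : ℕ) {f : Vec d → F} (hf : MemLp f 2)
    {ε : ℝ≥0∞}
    (hε : ∀ y ∈ ball (0 : Vec d) (1 / (n + 1)), eLpNorm (fun x => f (x + y) - f x) 2 ≤ ε) :
    eLpNorm (mollify n f - f) 2 ≤ ε := by
  have hl : LocallyIntegrable f := hf.locallyIntegrable (by norm_num)
  set r : Vec d → ℝ≥0∞ := fun y => ofReal (κ[n] y)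
  have hrm : Measurable r :=
    ENNReal.measurable_ofReal.comp (mollBump d n).continuous_normed.measurable
  have hr1 : ∫⁻ y, r y = 1 := by
    rw [← ofReal_integral_eq_lintegral_ofReal (mollBump d n).integrable_normed
      (of_forall (mollBump d n).nonneg_normed), (mollBump d n).integral_normed,
      ENNReal.ofReal_one]
  have key : ∀ g : Vec d → F, (eLpNorm g 2) ^ 2 = ∫⁻ x, ‖g x‖ₑ ^ 2 := by
    intro g
    have := eLpNorm_nnreal_pow_eq_lintegral (p := 2) (f := g) (μ := (volume : Measure (Vec d))) (by norm_num)
    simpa using this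
  have hFm : AESM (fun p : Vec d × Vec d => f (p.1 - p.2) - f p.1)
      (volume.prod volume) := by
    refine AEStronglyMeasurable.sub ?_ hf.1.comp_fst
    exact hf.1.comp_quasiMeasurePreserving (quasiMeasurePreserving_sub _ _)
  have h1 : ∀ᵐ x, ‖(mollify n f - f) x‖ₑ ^ 2 ≤ ∫⁻ y, r y * ‖f (x - y) - f x‖ₑ ^ 2 := by
    filter_upwards [hFm.prodMk_left] with x hx
    refine le_trans ?_ (sq_lintegral_mul_le hrm.aemeasurable hx.enorm hr1)
    gcongr
    rw [Pi.sub_apply, mollify_sub n hl]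
    refine (enorm_integral_le_lintegral_enorm _).trans (le_of_eq (lintegral_congr fun y => ?_))
    rw [enorm_smul, Real.enorm_of_nonneg ((mollBump d n).nonneg_normed _)]
  have h2 : (eLpNorm (mollify n f - f) 2) ^ 2 ≤ ε ^ 2 := by
    rw [key]
    calc _ ≤ ∫⁻ x, ∫⁻ y, r y * ‖f (x - y) - f x‖ₑ ^ 2 := lintegral_mono_ae h1
      _ = ∫⁻ y, ∫⁻ x, r y * ‖f (x - y) - f x‖ₑ ^ 2 := by
        refine lintegral_lintegral_swap ?_
        exact (hrm.aemeasurable.comp_snd).mul (hFm.enorm.pow_const 2)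
      _ ≤ ∫⁻ y, r y * ε ^ 2 := by
        refine lintegral_mono fun y => ?_
        by_cases hy : y ∈ ball (0 : Vec d) (1 / (n + 1))
        · rw [lintegral_const_mul' _ _ ofReal_ne_top]
          gcongr
          have := hε (-y) (by simpa using hy)
          have h3 := key (fun x => f (x + -y) - f x)
          simp only [sub_eq_add_neg] at h3 this ⊢
          rw [← h3]
          gcongr
        · have : r y = 0 := by
            have h0 : κ[n] y = 0 := by
              rw [← notMem_support, (mollBump d n).support_normed_eq]
              exact hy
            simp [r, h0]
          simp [this]
      _ = ε ^ 2 := by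
        rw [lintegral_mul_const _ hrm, hr1, one_mul]
  exact (ENNReal.pow_le_pow_left_iff (n := 2) (by norm_num)).1 h2

lemma tendsto_eLpNorm_mollify_sub [CompleteSpace F] {f : Vec d → F} (hf : MemLp f 2) :
    Null (fun n => eLpNorm (mollify n f - f) 2) := by
  rw [tendsto_nhds_zero]
  intro ε hε
  have h := tendsto_nhds_zero.1 (tendsto_eLpNorm_translate (by norm_num) hf) ε hε
  obtain ⟨δ, hδ, hb⟩ := eventually_nhds_iff_ball.1 h
  filter_upwards [tendsto_inv_succ.eventually (gt_mem_nhds hδ)]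
    with n hn
  exact memLp_mollify_sub_le n hf fun y hy => hb y (ball_subset_ball hn.le hy)

lemma mollify_memLp [CompleteSpace F] {f : Vec d → F} (hf : MemLp f 2) (n : ℕ) :
    MemLp (mollify n f) 2 := by
  have hl : LocallyIntegrable f := hf.locallyIntegrable (by norm_num)
  have h : MemLp (mollify n f - f) 2 := by
    refine ⟨(mollify_contDiff n hl).continuous.aesm.sub hf.1, ?_⟩
    refine (memLp_mollify_sub_le n hf (ε := 2 * eLpNorm f 2) fun y _ => ?_).trans_lt ?_
    · refine (eLpNorm_sub_le (f := fun x => f (x + y)) (g := f) ?_ hf.1 (by norm_num)).trans ?_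
      · exact hf.1.comp_measurePreserving (measurePreserving_add_right volume y)
      · have : eLpNorm (fun x => f (x + y)) 2 = eLpNorm f 2 :=
          eLpNorm_comp_measurePreserving hf.1 (measurePreserving_add_right volume y)
        rw [this, two_mul]
    · exact mul_lt_top (by norm_num) hf.2
  simpa using h.add hf

/-- Mollification commutes with weak differentiation, at distance `1 / (n + 1)` from the boundary. -/
lemma hasFDerivAt_mollify [CompleteSpace F] {f : Vec d → F} {G : Vec d → L[d, F]}
    (hf : LocallyIntegrable f) (hG : LocallyIntegrable G) (h : HasWeakFDeriv Ω f G) {n : ℕ}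
    {x : Vec d} (hx : closedBall x (1 / (n + 1)) ⊆ Ω) :
    HasFDerivAt (mollify n f) (mollify n G x) x := by
  have h0 := ((mollBump d n).hasCompactSupport_normed (μ := volume)).hasFDerivAt_convolution_left
    (lsmul ℝ ℝ) (mollBump d n).contDiff_normed hf x
  suffices hs : mollify n G x = convolution (∇ (κ[n])) f
      (ContinuousLinearMap.precompL (Vec d) (lsmul ℝ ℝ)) volume x by
    rw [hs]; exact h0
  refine ContinuousLinearMap.ext fun e => ?_
  rw [mollify_apply', ContinuousLinearMap.integral_apply (mollBump_integrable_smul n hG x)]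
  set ρ : R[d] := κ[n] with hρ
  have hρs : Smooth ρ := (mollBump d n).contDiff_normed
  have hρc : HasCompactSupport ρ := (mollBump d n).hasCompactSupport_normed
  let η : R[d] := fun y => ρ (x - y)
  have hsup : tsupport η ⊆ closedBall x (1 / (n + 1)) := by
    refine closure_minimal (fun y hy => ?_) Metric.isClosed_closedBall
    have hy' : x - y ∈ support ρ := hy
    rw [(mollBump d n).support_normed_eq, mem_ball, dist_zero_right] at hy'
    rw [mem_closedBall, dist_comm, dist_eq_norm]
    exact hy'.le
  have hη : IsTest Ω η :=
    { smooth := hρs.comp (contDiff_const.sub contDiff_id)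
      compact := of_support_subset_isCompact (isCompact_closedBall x (1 / (n + 1)))
        ((subset_tsupport _).trans hsup)
      support := hsup.trans hx }
  have hb := h.byParts η hη e
  have hd : ∀ y, ∇ η y = -∇ ρ (x - y) := fun y => by
    have h1 : HasFDerivAt ρ (∇ ρ (x - y)) (x - y) :=
      (hρs.differentiable (by simp) _).hasFDerivAt
    have h2 : HasFDerivAt (fun y : Vec d => x - y) (-idL (Vec d)) y := by
      simpa using (hasFDerivAt_id y).const_sub x
    have := h1.comp y h2
    rw [show η = ρ ∘ (fun y => x - y) from rfl, this.fderiv]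
    ext; simp
  rw [setIntegral_eq_of_zero,
    setIntegral_eq_of_zero] at hb
  · simp only [smul_apply]
    change ∫ y, η y • G y e = _
    rw [← neg_eq_iff_eq_neg] at hb
    rw [← hb, convolution_eq_swap, ContinuousLinearMap.integral_apply, ← integral_neg]
    · simp [hd, ContinuousLinearMap.precompL_apply, ContinuousLinearMap.lsmul_apply]
    · have := (hρc.fderiv ℝ).convolutionExists_left
        ((lsmul ℝ ℝ : ℝ →L[ℝ] F →L[ℝ] F).precompL (Vec d))
        (hρs.continuous_fderiv (by simp)) hf x
      exact this.integrable_swap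
  · intro y hy
    have : η y = 0 := eq_zero_off fun h' => hy (hη.support h')
    simp [this]
  · intro y hy
    have : ∇ η y = 0 := by
      have : y ∉ tsupport (∇ η) := fun h' => hy (hη.support (tsupport_fderiv_subset ℝ h'))
      exact eq_zero_off this
    simp [this]

end

/-! ### Bilinear pairings of square-integrable functions -/

section

variable {α : Type*} [MeasurableSpace α] {μ : Measure α} {E F G : Type*} [NormedAddCommGroup E]
  [NormedSpace ℝ E] [NormedAddCommGroup F] [NormedSpace ℝ F] [NormedAddCommGroup G]
  [NormedSpace ℝ G]

lemma eLpNorm_bilin_le (B : E →L[ℝ] F →L[ℝ] G) {f : α → E} {g : α → F}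
    (hf : AESM f μ) (hg : AESM g μ) :
    eLpNorm (fun x => B (f x) (g x)) 1 μ ≤ ‖B‖₊ * eLpNorm f 2 μ * eLpNorm g 2 μ :=
  eLpNorm_le_eLpNorm_mul_eLpNorm_of_nnnorm hf hg (fun a b => B a b) ‖B‖₊
    (of_forall fun x => by
      have := B.le_opNorm₂ (f x) (g x)
      exact_mod_cast this)

lemma integrable_bilin (B : E →L[ℝ] F →L[ℝ] G) {f : α → E} {g : α → F}
    (hf : MemLp f 2 μ) (hg : MemLp g 2 μ) : Integrable (fun x => B (f x) (g x)) μ := by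
  rw [← memLp_one_iff_integrable]
  refine ⟨B.aestronglyMeasurable_comp₂ hf.1 hg.1, (eLpNorm_bilin_le B hf.1 hg.1).trans_lt ?_⟩
  exact mul_lt_top (mul_lt_top ENNReal.coe_lt_top hf.2) hg.2

lemma tendsto_integral_of_eLpNorm {f : ℕ → α → G} {f₀ : α → G} (h : ∀ n, Integrable (f n) μ)
    (h₀ : Integrable f₀ μ) (ht : Null (fun n => eLpNorm (f n - f₀) 1 μ)) :
    Tendsto (fun n => ∫ x, f n x ∂μ) atTop (𝓝 (∫ x, f₀ x ∂μ)) :=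
  tendsto_integral_of_L1' f₀ h₀.1 (of_forall h) ht

lemma tendsto_integral_bilin (B : E →L[ℝ] F →L[ℝ] G) {f : ℕ → α → E} {f₀ : α → E}
    {g : ℕ → α → F} {g₀ : α → F} (hf : ∀ n, MemLp (f n) 2 μ) (hf₀ : MemLp f₀ 2 μ)
    (hg : ∀ n, MemLp (g n) 2 μ) (hg₀ : MemLp g₀ 2 μ)
    (hft : Null (fun n => eLpNorm (f n - f₀) 2 μ))
    (hgt : Null (fun n => eLpNorm (g n - g₀) 2 μ)) :
    Tendsto (fun n => ∫ x, B (f n x) (g n x) ∂μ) atTop (𝓝 (∫ x, B (f₀ x) (g₀ x) ∂μ)) := by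
  refine tendsto_integral_of_eLpNorm (fun n => integrable_bilin B (hf n) (hg n))
    (integrable_bilin B hf₀ hg₀) ?_
  have hb : ∀ n, eLpNorm ((fun x => B (f n x) (g n x)) - fun x => B (f₀ x) (g₀ x)) 1 μ ≤
      ‖B‖₊ * eLpNorm (f n - f₀) 2 μ * (eLpNorm (g n - g₀) 2 μ + eLpNorm g₀ 2 μ) +
      ‖B‖₊ * eLpNorm f₀ 2 μ * eLpNorm (g n - g₀) 2 μ := fun n => by
    have e : ((fun x => B (f n x) (g n x)) - fun x => B (f₀ x) (g₀ x)) =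
        (fun x => B ((f n - f₀) x) (g n x)) + fun x => B (f₀ x) ((g n - g₀) x) := by
      ext x; simp
    rw [e]
    refine (eLpNorm_add_le ?_ ?_ le_rfl).trans ?_
    · exact B.aestronglyMeasurable_comp₂ ((hf n).1.sub hf₀.1) (hg n).1
    · exact B.aestronglyMeasurable_comp₂ hf₀.1 ((hg n).1.sub hg₀.1)
    refine add_le_add ((eLpNorm_bilin_le B ((hf n).1.sub hf₀.1) (hg n).1).trans ?_)
      (eLpNorm_bilin_le B hf₀.1 ((hg n).1.sub hg₀.1))
    gcongr
    have := eLpNorm_add_le ((hg n).1.sub hg₀.1) hg₀.1 (p := 2) (by norm_num)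
    simpa using this
  refine tendsto_zero_of_le ?_ hb
  have h1 : Tendsto (fun n => ‖B‖₊ * eLpNorm (f n - f₀) 2 μ *
      (eLpNorm (g n - g₀) 2 μ + eLpNorm g₀ 2 μ)) atTop (𝓝 (‖B‖₊ * 0 * (0 + eLpNorm g₀ 2 μ))) := by
    refine ENNReal.Tendsto.mul (ENNReal.Tendsto.const_mul hft (Or.inr coe_ne_top)) ?_
      (hgt.add_const _) ?_
    · right; simpa using hg₀.2.ne
    · right; simp
  have h2 : Tendsto (fun n => ‖B‖₊ * eLpNorm f₀ 2 μ * eLpNorm (g n - g₀) 2 μ) atTop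
      (𝓝 (‖B‖₊ * eLpNorm f₀ 2 μ * 0)) :=
    ENNReal.Tendsto.const_mul hgt (Or.inr (mul_ne_top coe_ne_top hf₀.2.ne))
  simpa using h1.add h2

lemma eLpNorm_two_bdd_mul_le {b : α → ℝ} {g : α → F} {C : ℝ} (hb : ∀ᵐ x ∂μ, ‖b x‖ ≤ C) :
    eLpNorm (fun x => b x • g x) 2 μ ≤ ofReal C * eLpNorm g 2 μ :=
  eLpNorm_le_mul_eLpNorm_of_ae_le_mul (by
    filter_upwards [hb] with x hx
    rw [norm_smul]; gcongr) 2

lemma MeasureTheory.MemLp.bdd_smul {b : α → ℝ} {g : α → F} {C : ℝ} (hg : MemLp g 2 μ)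
    (hm : AESM b μ) (hb : ∀ᵐ x ∂μ, ‖b x‖ ≤ C) :
    MemLp (fun x => b x • g x) 2 μ :=
  ⟨hm.smul hg.1, (eLpNorm_two_bdd_mul_le hb).trans_lt (mul_lt_top ENNReal.ofReal_lt_top hg.2)⟩

end

/-! ### Weak derivatives -/

section

lemma IsTest.mono {Ω' : Set (Vec d)} {η : Vec d → F} (h : IsTest Ω η) (hs : Ω ⊆ Ω') :
    IsTest Ω' η := ⟨h.smooth, h.compact, h.support.trans hs⟩

lemma IsTest.eq_zero {η : Vec d → F} (h : IsTest Ω η) {x : Vec d} (hx : x ∉ Ω) : η x = 0 :=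
  eq_zero_off fun h' => hx (h.support h')

lemma IsTest.fderiv_eq_zero {η : Vec d → F} (h : IsTest Ω η) {x : Vec d} (hx : x ∉ Ω) :
    ∇ η x = 0 :=
  eq_zero_off fun h' => hx (h.support (tsupport_fderiv_subset ℝ h'))

lemma IsTest.differentiable {η : Vec d → F} (h : IsTest Ω η) : Differentiable ℝ η :=
  h.smooth.differentiable (by simp)

lemma IsTest.cont {η : Vec d → F} (h : IsTest Ω η) : Continuous η := h.smooth.continuous

lemma IsTest.bdd {η : Vec d → F} (h : IsTest Ω η) : ∃ C, ∀ x, ‖η x‖ ≤ C :=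
  h.cont.bounded_above_of_compact_support h.compact

lemma IsTest.continuous_fderiv {η : Vec d → F} (h : IsTest Ω η) : Continuous (∇ η) :=
  h.smooth.continuous_fderiv (by simp)

lemma IsTest.bdd_fderiv {η : Vec d → F} (h : IsTest Ω η) : ∃ C, ∀ x, ‖∇ η x‖ ≤ C :=
  h.continuous_fderiv.bounded_above_of_compact_support (h.compact.fderiv ℝ)

lemma IsTest.exists_lipschitz {η : Vec d → F} (h : IsTest Ω η) : ∃ K, LipschitzWith K η := 
  ContDiff.lipschitzWith_of_hasCompactSupport h.compact (h.smooth.toC1) one_ne_zero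

lemma IsTest.memLp {η : Vec d → F} (h : IsTest Ω η) {μ : Measure (Vec d)} [IsFiniteMeasureOnCompacts μ] :
    MemLp η 2 μ := h.cont.memLp_of_hasCompactSupport h.compact

lemma IsTest.memLp_fderiv {η : Vec d → F} (h : IsTest Ω η) {μ : Measure (Vec d)} [IsFiniteMeasureOnCompacts μ] :
    MemLp (∇ η) 2 μ := h.continuous_fderiv.memLp_of_hasCompactSupport (h.compact.fderiv ℝ)

lemma IsTest.smul_const {η : R[d]} (h : IsTest Ω η) (e : F) :
    IsTest Ω (fun x => η x • e) :=
  ⟨h.smooth.smul contDiff_const, h.compact.smul_right,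
    (closure_mono (support_smul_subset_left η (fun _ => e))).trans h.support⟩

lemma HasWeakFDeriv.mono {Ω' : Set (Vec d)} {u : Vec d → F} {G : Vec d → L[d, F]}
    (h : HasWeakFDeriv Ω' u G) (hs : Ω ⊆ Ω') : HasWeakFDeriv Ω u G where
  locInt := h.locInt.mono_set hs
  locInt_deriv := h.locInt_deriv.mono_set hs
  byParts η hη e := by
    have := h.byParts η (hη.mono hs) e
    rw [setIntegral_eq_of_zero, setIntegral_eq_of_zero] at this ⊢
    · exact this
    · intro x hx; rw [hη.eq_zero hx, zero_smul]
    · intro x hx; rw [(hη.mono hs).eq_zero hx, zero_smul]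
    · intro x hx; rw [hη.fderiv_eq_zero hx]; simp
    · intro x hx; rw [(hη.mono hs).fderiv_eq_zero hx]; simp

lemma HasWeakFDeriv.ae_eq [FiniteDimensional ℝ F] (hΩ : IsOpen Ω) {u : Vec d → F}
    {G G' : Vec d → L[d, F]} (h : HasWeakFDeriv Ω u G) (h' : HasWeakFDeriv Ω u G') :
    ∀ᵐ x, x ∈ Ω → G x = G' x := by
  have key : ∀ i : Fin d, ∀ᵐ x, x ∈ Ω →
      (G x - G' x) (single i 1) = 0 := fun i => by
    have hl : LocallyIntegrableOn (fun x => (G x - G' x) (single i 1)) Ω := by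
      intro x hx
      obtain ⟨s, hs, hi⟩ := (h.locInt_deriv.sub h'.locInt_deriv) x hx
      exact ⟨s, hs, (apply ℝ F (single i (1 : ℝ))).integrable_comp hi⟩
    refine hΩ.ae_eq_zero_of_integral_contDiff_smul_eq_zero hl fun g hg hc hs => ?_
    have ht : IsTest Ω g := ⟨hg, hc, hs⟩
    have e1 := h.byParts g ht (single i 1)
    have e2 := h'.byParts g ht (single i 1)
    rw [e1, neg_inj] at e2
    have z : ∀ K : Vec d → F, (∀ x ∉ Ω, g x • K x = 0) := fun K x hx => by simp [ht.eq_zero hx]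
    have hi : ∀ K : Vec d → L[d, F], LocallyIntegrableOn K Ω →
        Integrable (fun x => g x • K x (single i 1)) := fun K hK => by
      have h1 : IntegrableOn K (tsupport g) := hK.integrableOn_compact_subset hs hc
      have h1' : IntegrableOn (fun x => K x (single i 1)) (tsupport g) :=
        (apply ℝ F (single i (1 : ℝ))).integrable_comp h1
      have h2 : IntegrableOn (fun x => g x • K x (single i 1)) (tsupport g) :=
        IntegrableOn.continuousOn_smul h1' hg.continuous.continuousOn hc
      rwa [integrableOn_iff_integrable_of_support_subset] at h2
      exact (support_smul_subset_left _ _).trans (subset_tsupport g)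
    rw [setIntegral_eq_of_zero (z _), setIntegral_eq_of_zero (z _)] at e2
    have : ∀ x, g x • (G x - G' x) (single i 1) =
      g x • G x (single i 1) - g x • G' x (single i 1) := fun x => by
      rw [← smul_sub]; rfl
    simp only [this]
    rw [integral_sub (hi G h.locInt_deriv) (hi G' h'.locInt_deriv), e2, sub_self]
  filter_upwards [ae_all_iff.2 key] with x hx hxΩ
  have : (G x - G' x : L[d, F]).toLinearMap = 0 := by
    refine (basisFun (Fin d) ℝ).toBasis.ext fun i => ?_
    simpa using hx i hxΩ
  have h0 : G x - G' x = 0 := by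
    ext v
    exact LinearMap.congr_fun this v
  exact sub_eq_zero.1 h0

lemma integral_fderiv_smul_eq_neg [CompleteSpace F] {θ : R[d]} {f : Vec d → F}
    (hθ : ContDiff ℝ 1 θ) (hc : HasCompactSupport θ) (hf : ContDiff ℝ 1 f) (e : Vec d) :
    ∫ x, ∇ θ x e • f x = -∫ x, θ x • ∇ f x e := by
  have c1 : Continuous fun x => ∇ θ x e :=
    (hθ.continuous_fderiv one_ne_zero).clm_apply continuous_const
  have c2 : Continuous fun x => ∇ f x e :=
    (hf.continuous_fderiv one_ne_zero).clm_apply continuous_const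
  have s1 : HasCompactSupport fun x => ∇ θ x e := hc.fderiv_apply ℝ e
  rw [integral_smul_fderiv_eq_neg_fderiv_smul_of_integrable, neg_neg]
  · exact (c1.smul hf.continuous).integrable_of_hasCompactSupport s1.smul_right
  · exact (hθ.continuous.smul c2).integrable_of_hasCompactSupport hc.smul_right
  · exact (hθ.continuous.smul hf.continuous).integrable_of_hasCompactSupport hc.smul_right
  · exact fun x _ => hθ.differentiable one_ne_zero x
  · exact fun x _ => hf.differentiable one_ne_zero x

lemma hasWeakFDeriv_of_contDiff [CompleteSpace F] {f : Vec d → F} (hf : ContDiff ℝ 1 f) :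
    HasWeakFDeriv univ f (∇ f) where
  locInt := hf.continuous.locallyIntegrable.locallyIntegrableOn _
  locInt_deriv := (hf.continuous_fderiv one_ne_zero).locallyIntegrable.locallyIntegrableOn _
  byParts η hη e := by
    rw [restrict_univ]
    exact integral_fderiv_smul_eq_neg (hη.smooth.toC1) hη.compact hf e

lemma LipschitzWith.hasWeakFDeriv [FiniteDimensional ℝ F] {f : Vec d → F} {K : ℝ≥0}
    (hf : LipschitzWith K f) : HasWeakFDeriv univ f (∇ f) := by
  have hm : AESM (∇ f) volume := by
    have := FiniteDimensional.complete ℝ F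
    borelize (L[d, F])
    exact (measurable_fderiv ℝ f).aesm
  have hl : LocallyIntegrable (∇ f) := by
    refine (locallyIntegrable_const (K : ℝ)).mono hm (of_forall fun x => ?_)
    simpa using norm_fderiv_le_of_lipschitz ℝ hf
  refine ⟨hf.continuous.locallyIntegrable.locallyIntegrableOn _, hl.locallyIntegrableOn _, ?_⟩
  intro η hη e
  have := FiniteDimensional.complete ℝ F
  rw [restrict_univ]
  obtain ⟨D, hD⟩ := hη.exists_lipschitz
  have i1 : Integrable fun x => ∇ η x e • f x :=
    ((hη.continuous_fderiv.clm_apply continuous_const).smul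
      hf.continuous).integrable_of_hasCompactSupport (hη.compact.fderiv_apply ℝ e).smul_right
  have i2 : Integrable fun x => η x • ∇ f x e := by
    have := hl.integrable_smul_left_of_hasCompactSupport hη.cont hη.compact
    exact (apply ℝ F e).integrable_comp this
  refine (SeparatingDual.eq_iff_forall_dual_eq (R := ℝ)).2 fun ℓ => ?_
  rw [map_neg, ← ℓ.integral_comp_comm i1, ← ℓ.integral_comp_comm i2]
  have hℓ : LipschitzWith (‖ℓ‖₊ * K) (fun x => ℓ (f x)) := ℓ.lipschitz.comp hf
  have h1 := hℓ.integral_lineDeriv_mul_eq (μ := volume) hD hη.compact e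
  have h2 : ∫ x, ℓ (η x • ∇ f x e) = ∫ x, lineDeriv ℝ (fun x => ℓ (f x)) x e * η x := by
    refine integral_congr_ae ?_
    filter_upwards [hf.ae_differentiableAt (μ := volume)] with x hx
    have : HasFDerivAt (fun x => ℓ (f x)) (ℓ.comp (∇ f x)) x :=
      ℓ.hasFDerivAt.comp x hx.hasFDerivAt
    rw [(this.hasLineDerivAt e).lineDeriv]
    simp [mul_comm]
  rw [h2, h1, ← integral_neg]
  congr 1; ext x
  rw [((hη.differentiable x).hasFDerivAt.hasLineDerivAt (-e)).lineDeriv]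
  simp

lemma tendsto_eLpNorm_clm_apply {α E : Type*} [MeasurableSpace α] {μ : Measure α}
    [NormedAddCommGroup E] [NormedSpace ℝ E] {A : ℕ → α → E →L[ℝ] F} {A₀ : α → E →L[ℝ] F} (e : E)
    (h : Null (fun n => eLpNorm (A n - A₀) 2 μ)) :
    Null (fun n => eLpNorm ((fun x => A n x e) - fun x => A₀ x e) 2 μ) := by
  have h' := ENNReal.Tendsto.const_mul (a := ofReal ‖e‖) h (Or.inr ofReal_ne_top)
  rw [mul_zero] at h'
  refine tendsto_zero_of_le h'
    fun n => eLpNorm_le_mul_eLpNorm_of_ae_le_mul (of_forall fun x => ?_) 2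
  rw [mul_comm]
  exact (A n x - A₀ x).le_opNorm e

lemma memLp_indicator_clm (hΩ : IsOpen Ω) {G : Vec d → L[d, F]}
    (h : ML2 G Ω) : MemLp (Ω.indicator G) 2 := by
  have h2 := (memLp_indicator_iff_restrict (p := 2) (μ := volume) (f := G) hΩ.measurableSet).2 h
  convert h2 using 1

lemma MemH10.extend [FiniteDimensional ℝ F] (hΩ : IsOpen Ω) {u : Vec d → F} {G : Vec d → L[d, F]}
    (h : MemH10 Ω u G) : MemH1 univ (Ω.indicator u) (Ω.indicator G) := by
  have := FiniteDimensional.complete ℝ F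
  have m1 : MemLp (Ω.indicator u) 2 := (memLp_indicator_iff_restrict hΩ.measurableSet).2 h.memLp
  have m2 : MemLp (Ω.indicator G) 2 := memLp_indicator_clm hΩ h.memLp_deriv
  refine ⟨by rwa [restrict_univ], by rwa [restrict_univ],
    (m1.locallyIntegrable (by norm_num)).locallyIntegrableOn _,
    (m2.locallyIntegrable (by norm_num)).locallyIntegrableOn _, fun η hη e => ?_⟩
  obtain ⟨v, hv, t1, t2⟩ := h.approx
  have r1 : ∀ f : Vec d → F, ∀ a : R[d], ∫ x in univ, a x • Ω.indicator f x = ∫ x in Ω, a x • f x := by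
    intro f a
    rw [restrict_univ, ← integral_indicator hΩ.measurableSet]
    congr 1; ext x; by_cases hx : x ∈ Ω <;> simp [hx]
  have r2 : ∫ x in univ, η x • Ω.indicator G x e = ∫ x in Ω, η x • G x e := by
    rw [← r1 (fun x => G x e) η]
    congr 1; ext x; by_cases hx : x ∈ Ω <;> simp [hx]
  rw [r1, r2]
  have e1 : ML2 (fun x => ∇ η x e) Ω := (apply ℝ ℝ e).comp_memLp' hη.memLp_fderiv
  have e2 : ML2 η Ω := hη.memLp
  have z : ∀ (a : R[d]), Null (fun _ : ℕ => eL2 (a - a) Ω) := fun a => by simp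
  have a1 := tendsto_integral_bilin (lsmul ℝ ℝ : ℝ →L[ℝ] F →L[ℝ] F)
    (fun _ : ℕ => e1) e1 (fun n => (hv n).memLp) h.memLp (z _) t1
  have ap : ∀ {A : Vec d → L[d, F]}, ML2 A Ω →
      ML2 (fun x => A x e) Ω := fun hA =>
    (apply ℝ F e).comp_memLp' hA
  have t3 := tendsto_eLpNorm_clm_apply e t2
  have a2 := tendsto_integral_bilin (lsmul ℝ ℝ : ℝ →L[ℝ] F →L[ℝ] F)
    (fun _ : ℕ => e2) e2
    (fun n => ap (hv n).memLp_fderiv) (ap h.memLp_deriv) (z _) t3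
  refine tendsto_nhds_unique a1 (a2.neg.congr fun n => ?_)
  have := (hasWeakFDeriv_of_contDiff ((hv n).smooth.toC1 : ContDiff ℝ 1 (v n))).byParts η hη e
  rw [restrict_univ] at this
  rw [setIntegral_eq_of_zero, setIntegral_eq_of_zero]
  · change -∫ x, η x • ∇ (v n) x e = ∫ x, ∇ η x e • v n x
    rw [this]
  · intro x hx; simp [(hv n).eq_zero hx]
  · intro x hx
    have := (hv n).fderiv_eq_zero hx
    change η x • ∇ (v n) x e = 0
    simp [this]

end

/-! ### Approximation of Lipschitz functions by test functions -/

section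

/-- Boundedly, with uniformly bounded Lipschitz constants, `w n → w₀` pointwise and
`∇(w n) → ∇w₀` almost everywhere in `Ω`. -/
structure BddConv (Ω : Set (Vec d)) (C : ℝ≥0) (w : ℕ → Vec d → F) (w₀ : Vec d → F) : Prop where
  lip : ∀ n, LipschitzWith C (w n)
  bdd : ∀ n x, ‖w n x‖ ≤ C
  tendsto : ∀ x, Tendsto (fun n => w n x) atTop (𝓝 (w₀ x))
  tendsto_fderiv : ∀ᵐ x ∂vol Ω,
    Tendsto (fun n => ∇ (w n) x) atTop (𝓝 (∇ w₀ x))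

lemma BddConv.norm_fderiv_le {C : ℝ≥0} {w : ℕ → Vec d → F} {w₀ : Vec d → F}
    (h : BddConv Ω C w w₀) (n : ℕ) (x : Vec d) : ‖∇ (w n) x‖ ≤ C :=
  norm_fderiv_le_of_lipschitz ℝ (h.lip n)

lemma isTest_mollify [CompleteSpace F] {f : Vec d → F} (hf : LocallyIntegrable f) {K : Set (Vec d)}
    (hK : IsCompact K) (hΩ : IsOpen Ω) (hKΩ : K ⊆ Ω) (h0 : ∀ x ∉ K, f x = 0) :
    ∀ᶠ n in atTop, IsTest Ω (mollify n f) := by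
  obtain ⟨δ, hδ, hδΩ⟩ := hK.exists_cthickening_subset_open hΩ hKΩ
  filter_upwards [tendsto_inv_succ.eventually (gt_mem_nhds hδ)]
    with n hn
  have hs : tsupport (mollify n f) ⊆ Metric.cthickening δ K := by
    refine closure_minimal (fun x hx => ?_) Metric.isClosed_cthickening
    by_contra hx'
    refine hx (mollify_eq_zero fun y hy => h0 y fun hyK => hx' ?_)
    refine mem_cthickening_of_dist_le x y δ K hyK ?_
    rw [dist_comm]; exact (hy.trans hn).le
  exact ⟨mollify_contDiff n hf,
    of_support_subset_isCompact hK.cthickening ((subset_tsupport _).trans hs),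
    hs.trans hδΩ⟩

lemma fderiv_mollify_of_memH1 [CompleteSpace F] {f : Vec d → F} {G : Vec d → L[d, F]}
    (hf : LocallyIntegrable f) (hG : LocallyIntegrable G) (h : HasWeakFDeriv univ f G) (n : ℕ) :
    ∇ (mollify n f) = mollify n G := by
  ext1 x
  exact (hasFDerivAt_mollify hf hG h (subset_univ _)).fderiv

lemma bddConv_mollify [FiniteDimensional ℝ F] {f : Vec d → F} {C : ℝ≥0} (hf : LipschitzWith C f)
    (hb : ∀ x, ‖f x‖ ≤ C) : BddConv Ω C (fun n => mollify n f) f := by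
  have := FiniteDimensional.complete ℝ F
  have hw := hf.hasWeakFDeriv
  have h1 := locallyIntegrableOn_univ.1 hw.locInt
  have h2 := locallyIntegrableOn_univ.1 hw.locInt_deriv
  refine ⟨fun n => lipschitzWith_mollify hf n, fun n x => norm_mollify_le (of_forall hb) n x,
    fun x => ?_, ae_restrict_of_ae ?_⟩
  · rw [tendsto_iff_dist_tendsto_zero]
    have : Tendsto (fun n : ℕ => (C : ℝ) * (1 / ((n : ℝ) + 1))) atTop (𝓝 (C * 0)) :=
      tendsto_inv_succ.const_mul _
    rw [mul_zero] at this
    exact squeeze_zero (fun _ => dist_nonneg) (fun n => dist_mollify_le hf n x) this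
  · filter_upwards [mollify_ae_tendsto h2] with x hx
    refine hx.congr fun n => ?_
    rw [fderiv_mollify_of_memH1 h1 h2 hw]

lemma norm_le_of_lipschitz_of_zero {w : Vec d → F} {K : ℝ≥0} (hK : LipschitzWith K w)
    (h0 : ∀ x ∉ Ω, w x = 0) (hne : Ωᶜ.Nonempty) (x : Vec d) :
    ‖w x‖ ≤ K * infDist x Ωᶜ := by
  refine le_of_forall_pos_le_add fun ε hε => ?_
  obtain ⟨y, hy, hxy⟩ := (Metric.infDist_lt_iff (r := infDist x Ωᶜ + ε / (K + 1)) hne).1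
    (lt_add_of_pos_right _ (by positivity))
  have h1 := hK.dist_le_mul x y
  rw [h0 y hy, dist_zero_right] at h1
  have h2 : (K : ℝ) * (ε / (K + 1)) ≤ ε := by
    rw [mul_div_assoc', div_le_iff₀ (by positivity)]; nlinarith [K.coe_nonneg]
  calc ‖w x‖ ≤ K * dist x y := h1
    _ ≤ K * (infDist x Ωᶜ + ε / (K + 1)) := by gcongr
    _ ≤ _ := by rw [mul_add]; gcongr

lemma compl_nonempty_of_bounded (hd : d ≠ 0) (hb : IsBounded Ω) :
    Ωᶜ.Nonempty := by
  rw [nonempty_compl]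
  rintro rfl
  have : Nonempty (Fin d) := Fin.pos_iff_nonempty.1 (Nat.pos_of_ne_zero hd)
  have : Nontrivial (Vec d) := inferInstance
  exact NormedSpace.unbounded_univ ℝ (Vec d) hb

/-- Distance cutoff: `0` within distance `δ` of the complement of `Ω`, and `1` beyond `2δ`. -/
noncomputable def distCutoff (Ω : Set (Vec d)) (δ : ℝ) (x : Vec d) : ℝ :=
  max 0 (min 1 (infDist x Ωᶜ / δ - 1))

lemma distCutoff_nonneg {δ : ℝ} (x : Vec d) : 0 ≤ distCutoff Ω δ x := le_max_left _ _

lemma distCutoff_le_one {δ : ℝ} (x : Vec d) : distCutoff Ω δ x ≤ 1 :=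
  max_le zero_le_one (min_le_left _ _)

lemma distCutoff_eq_one {δ : ℝ} (hδ : 0 < δ) {x : Vec d} (hx : 2 * δ ≤ infDist x Ωᶜ) :
    distCutoff Ω δ x = 1 := by
  have : 1 ≤ infDist x Ωᶜ / δ - 1 := by
    rw [le_sub_iff_add_le, le_div_iff₀ hδ]; linarith
  simp [distCutoff, this]

lemma distCutoff_eq_zero {δ : ℝ} (hδ : 0 < δ) {x : Vec d} (hx : infDist x Ωᶜ ≤ δ) :
    distCutoff Ω δ x = 0 := by
  have : infDist x Ωᶜ / δ - 1 ≤ 0 := by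
    rw [sub_nonpos, div_le_iff₀ hδ]; linarith
  rw [distCutoff, max_eq_left]
  exact (min_le_right _ _).trans this

lemma abs_distCutoff_sub_le {δ : ℝ} (hδ : 0 < δ) (x y : Vec d) :
    |distCutoff Ω δ x - distCutoff Ω δ y| ≤ dist x y / δ := by
  have h1 : |infDist x Ωᶜ - infDist y Ωᶜ| ≤ dist x y := by
    have := (Metric.lipschitz_infDist_pt Ωᶜ).dist_le_mul x y
    rwa [Real.dist_eq, NNReal.coe_one, one_mul] at this
  calc _ ≤ |(min 1 (infDist x Ωᶜ / δ - 1)) - (min 1 (infDist y Ωᶜ / δ - 1))| := by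
        have := abs_max_sub_max_le_abs (min 1 (infDist x Ωᶜ / δ - 1))
          (min 1 (infDist y Ωᶜ / δ - 1)) 0
        rwa [max_comm, max_comm _ (0 : ℝ)] at this
    _ ≤ |(infDist x Ωᶜ / δ - 1) - (infDist y Ωᶜ / δ - 1)| := by
        have := abs_min_sub_min_le_max 1 (infDist x Ωᶜ / δ - 1) 1 (infDist y Ωᶜ / δ - 1)
        simpa using this
    _ = |infDist x Ωᶜ - infDist y Ωᶜ| / δ := by
        rw [← abs_of_pos hδ, ← abs_div, abs_of_pos hδ]; congr 1; ring
    _ ≤ _ := by gcongr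

lemma lipschitz_distCutoff_smul {w : Vec d → F} {K : ℝ≥0} (hK : LipschitzWith K w)
    (h0 : ∀ x ∉ Ω, w x = 0) (hne : Ωᶜ.Nonempty) {δ : ℝ} (hδ : 0 < δ) :
    LipschitzWith (3 * K) (fun x => distCutoff Ω δ x • w x) := by
  have main : ∀ x y : Vec d, infDist y Ωᶜ ≤ 2 * δ →
      ‖distCutoff Ω δ x • w x - distCutoff Ω δ y • w y‖ ≤ 3 * K * dist x y := fun x y hy => by
    have e : distCutoff Ω δ x • w x - distCutoff Ω δ y • w y =
        distCutoff Ω δ x • (w x - w y) + (distCutoff Ω δ x - distCutoff Ω δ y) • w y := by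
      rw [smul_sub, sub_smul]; abel
    rw [e]
    refine (norm_add_le _ _).trans ?_
    rw [norm_smul, norm_smul, norm_of_nonneg (distCutoff_nonneg x), norm_eq_abs]
    have h1 : distCutoff Ω δ x * ‖w x - w y‖ ≤ K * dist x y := by
      have := hK.dist_le_mul x y
      rw [dist_eq_norm (w x)] at this
      nlinarith [distCutoff_le_one (Ω := Ω) (δ := δ) x, distCutoff_nonneg (Ω := Ω) (δ := δ) x,
        norm_nonneg (w x - w y)]
    have h2 : |distCutoff Ω δ x - distCutoff Ω δ y| * ‖w y‖ ≤ dist x y / δ * (K * (2 * δ)) := by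
      have := norm_le_of_lipschitz_of_zero hK h0 hne y
      gcongr
      · exact abs_distCutoff_sub_le hδ x y
      · exact this.trans (by gcongr)
    have h3 : dist x y / δ * (K * (2 * δ)) = 2 * (K * dist x y) := by field_simp
    linarith
  refine LipschitzWith.of_dist_le_mul fun x y => ?_
  rw [dist_eq_norm]
  push_cast
  by_cases hy : infDist y Ωᶜ ≤ 2 * δ
  · exact main x y hy
  by_cases hx : infDist x Ωᶜ ≤ 2 * δ
  · rw [norm_sub_rev, dist_comm]; exact main y x hx
  rw [distCutoff_eq_one hδ (not_le.1 hx).le, distCutoff_eq_one hδ (not_le.1 hy).le, one_smul, one_smul]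
  have := hK.dist_le_mul x y
  rw [dist_eq_norm (w x)] at this
  nlinarith [K.coe_nonneg, dist_nonneg (x := x) (y := y), mul_nonneg K.coe_nonneg (dist_nonneg (x := x) (y := y))]

/-- A property of functions which holds for test functions in `Ω` and which is stable under bounded
convergence holds for all Lipschitz functions vanishing outside `Ω`. -/
lemma lipschitz_induction [FiniteDimensional ℝ F] (dm : Dom Ω) {p : (Vec d → F) → Prop} (test : ∀ η, IsTest Ω η → p η)
    (lim : ∀ C w w₀, (∀ n, p (w n)) → BddConv Ω C w w₀ → p w₀) {w : Vec d → F} {K : ℝ≥0}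
    (hK : LipschitzWith K w) (h0 : ∀ x ∉ Ω, w x = 0) : p w := by
  have := FiniteDimensional.complete ℝ F
  have hne := compl_nonempty_of_bounded dm.d dm.b
  obtain ⟨M, hM⟩ : ∃ M : ℝ≥0, ∀ x, ‖w x‖ ≤ M := by
    obtain ⟨y, hy⟩ := hne
    obtain ⟨R, hR⟩ := (dm.b.union (Bornology.isBounded_singleton (x := y))).subset_closedBall y
    have hR0 : 0 ≤ R := by
      have := hR (Or.inr rfl); rwa [mem_closedBall, dist_self] at this
    refine ⟨K * R.toNNReal, fun x => ?_⟩
    by_cases hx : x ∈ Ω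
    · have := hK.dist_le_mul x y
      rw [h0 y hy, dist_zero_right] at this
      push_cast
      rw [Real.coe_toNNReal _ hR0]
      exact this.trans (by gcongr; exact hR (Or.inl hx))
    · rw [h0 x hx, norm_zero]; positivity
  let wδ : ℕ → Vec d → F := fun n x => distCutoff Ω (1 / (n + 1)) x • w x
  have hδ : ∀ n : ℕ, (0 : ℝ) < 1 / (n + 1) := fun n => by positivity
  have hlip : ∀ n, LipschitzWith (3 * K + M) (wδ n) := fun n =>
    (lipschitz_distCutoff_smul hK h0 hne (hδ n)).weaken le_self_add
  have hbd : ∀ n x, ‖wδ n x‖ ≤ (3 * K + M : ℝ≥0) := fun n x => by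
    simp only [wδ]
    rw [norm_smul, norm_of_nonneg (distCutoff_nonneg x)]
    have : distCutoff Ω (1 / (n + 1)) x * ‖w x‖ ≤ 1 * M := by
      gcongr
      · exact distCutoff_le_one x
      · exact hM x
    push_cast
    nlinarith [K.coe_nonneg]
  have hev : ∀ x ∈ Ω, ∀ᶠ n : ℕ in atTop, wδ n =ᶠ[𝓝 x] w := fun x hx => by
    have hpos : 0 < infDist x Ωᶜ :=
      (dm.o.isClosed_compl.notMem_iff_infDist_pos hne).1 (by simpa using hx)
    filter_upwards [tendsto_inv_succ.eventually
      (gt_mem_nhds (show (0 : ℝ) < infDist x Ωᶜ / 2 by positivity))] with n hn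
    have : ∀ᶠ y in 𝓝 x, 2 * (1 / ((n : ℝ) + 1)) < infDist y Ωᶜ :=
      (Metric.continuous_infDist_pt Ωᶜ).continuousAt.eventually (lt_mem_nhds (by linarith))
    filter_upwards [this] with y hy
    simp only [wδ, distCutoff_eq_one (hδ n) hy.le, one_smul]
  refine lim (3 * K + M) wδ w (fun n => ?_) ⟨hlip, hbd, fun x => ?_, ?_⟩
  · have hmol := bddConv_mollify (Ω := Ω) (hlip n) (hbd n)
    have hcpt : IsCompact {x | 1 / ((n : ℝ) + 1) ≤ infDist x Ωᶜ} := by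
      refine isCompact_of_isClosed_isBounded
        (isClosed_le continuous_const (Metric.continuous_infDist_pt _)) (dm.b.subset fun x hx => ?_)
      by_contra hx'
      rw [mem_ofPred_eq, Metric.infDist_zero_of_mem hx'] at hx
      linarith [hδ n]
    have hsub : {x | 1 / ((n : ℝ) + 1) ≤ infDist x Ωᶜ} ⊆ Ω := fun x hx => by
      by_contra hx'
      rw [mem_ofPred_eq, Metric.infDist_zero_of_mem hx'] at hx
      linarith [hδ n]
    obtain ⟨N, hN⟩ := eventually_atTop.1 (isTest_mollify
      (hlip n).continuous.locallyIntegrable hcpt dm.o hsub fun x hx => by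
        simp only [wδ]; rw [distCutoff_eq_zero (hδ n) (not_le.1 hx).le, zero_smul])
    refine lim (3 * K + M) (fun m => mollify (m + N) (wδ n)) _
      (fun m => test _ (hN _ (Nat.le_add_left _ _))) ⟨fun m => hmol.lip _, fun m => hmol.bdd _,
      fun x => (hmol.tendsto x).comp (tendsto_add_atTop_nat N), ?_⟩
    filter_upwards [hmol.tendsto_fderiv] with x hx
    exact hx.comp (tendsto_add_atTop_nat N)
  · by_cases hx : x ∈ Ω
    · refine tendsto_const_nhds.congr' ?_
      filter_upwards [hev x hx] with n hn
      exact hn.eq_of_nhds.symm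
    · simp [wδ, h0 x hx]
  · filter_upwards [ae_restrict_mem dm.m] with x hx
    refine tendsto_const_nhds.congr' ?_
    filter_upwards [hev x hx] with n hn
    exact hn.fderiv_eq.symm

end

lemma MemH1.comp_real {Ψ h : ℝ → ℝ} (hΨ : ∀ r, HasDerivAt Ψ (h r) r) (hc : Continuous h)
    {C : ℝ≥0} (hC : ∀ r, ‖h r‖ ≤ C) (h0 : Ψ 0 = 0) {f : R[d]} {G : Vec d → L[d, ℝ]}
    (hf : MemH1 univ f G) : MemH1 univ (fun x => Ψ (f x)) (fun x => h (f x) • G x) := by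
  have f2 : MemLp f 2 := by simpa using hf.memLp
  have G2 : MemLp G 2 := by simpa using hf.memLp_deriv
  have hl : LocallyIntegrable f := f2.locallyIntegrable (by norm_num)
  have hlG : LocallyIntegrable G := G2.locallyIntegrable (by norm_num)
  have hΨl : LipschitzWith C Ψ := lipschitzWith_of_nnnorm_deriv_le
    (fun r => (hΨ r).differentiableAt) fun r => by rw [(hΨ r).deriv]; exact hC r
  have hΨm : ∀ {g : R[d]}, MemLp g 2 → MemLp (fun x => Ψ (g x)) 2 := fun hg =>
    hΨl.comp_memLp h0 hg
  have hhm : ∀ {g : R[d]} {K : Vec d → L[d, ℝ]}, AESM g volume →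
      MemLp K 2 → MemLp (fun x => h (g x) • K x) 2 := fun hg hK =>
    hK.bdd_smul (hc.comp_aesm hg) (of_forall fun x => hC _)
  refine ⟨by simpa using hΨm f2, by simpa using hhm f2.1 G2,
    ((hΨm f2).locallyIntegrable (by norm_num)).locallyIntegrableOn _,
    ((hhm f2.1 G2).locallyIntegrable (by norm_num)).locallyIntegrableOn _, fun η hη e => ?_⟩
  rw [restrict_univ]
  have e1 : MemLp (fun x => ∇ η x e) 2 := (apply ℝ ℝ e).comp_memLp' hη.memLp_fderiv
  have e2 : MemLp η 2 := hη.memLp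
  have z : ∀ (a : R[d]), Null (fun _ : ℕ => eLpNorm (a - a) 2) := fun a => by simp
  have ap : ∀ {A : Vec d → L[d, ℝ]}, MemLp A 2 → MemLp (fun x => A x e) 2 :=
    fun hA => (apply ℝ ℝ e).comp_memLp' hA
  have hfn : ∀ n, MemLp (mollify n f) 2 := mollify_memLp f2
  have t1 : Null (fun n => eLpNorm ((fun x => Ψ (mollify n f x)) - fun x => Ψ (f x)) 2) := by
    have h' := ENNReal.Tendsto.const_mul (a := ofReal C) (tendsto_eLpNorm_mollify_sub f2)
      (Or.inr ofReal_ne_top)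
    rw [mul_zero] at h'
    refine tendsto_zero_of_le h'
      fun n => eLpNorm_le_mul_eLpNorm_of_ae_le_mul (of_forall fun x => ?_) 2
    exact hΨl.norm_sub_le _ _
  have t2 := tendsto_eLpNorm_clm_apply e (tendsto_eLpNorm_mollify_sub G2)
  have a1 := tendsto_integral_bilin (mulL) (fun _ : ℕ => e1) e1
    (fun n => hΨm (hfn n)) (hΨm f2) (z _) t1
  have a2 : Null (fun n => ∫ x, (η x * h (mollify n f x)) * (mollify n G x e - G x e)) := by
    have hm : ∀ n, MemLp (fun x => η x * h (mollify n f x)) 2 := fun n => by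
      have := e2.bdd_smul (hc.comp_aesm (hfn n).1) (of_forall fun x => hC _)
      simpa [mul_comm] using this
    rw [tendsto_zero_iff_norm_tendsto_zero]
    have hb : Null (fun n => (C * (eLpNorm η 2).toReal) *
        (eLpNorm ((fun x => mollify n G x e) - fun x => G x e) 2).toReal) := by
      have := ((ENNReal.tendsto_toReal ENNReal.zero_ne_top).comp t2).const_mul
        ((C : ℝ) * (eLpNorm η 2).toReal)
      simpa using this
    refine squeeze_zero (fun _ => norm_nonneg _) (fun n => ?_) hb
    have h1 := eLpNorm_bilin_le (mulL) (hm n).1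
      ((ap (mollify_memLp G2 n)).sub (ap G2)).1
    have h2 : eLpNorm (fun x => η x * h (mollify n f x)) 2 ≤
        ofReal C * eLpNorm η 2 := by
      have := eLpNorm_two_bdd_mul_le (μ := volume) (b := fun x => h (mollify n f x)) (g := η)
        (of_forall fun x => hC _)
      simpa [mul_comm] using this
    have h3 : ‖∫ x, (η x * h (mollify n f x)) * (mollify n G x e - G x e)‖ₑ ≤
        ofReal C * eLpNorm η 2 *
        eLpNorm ((fun x => mollify n G x e) - fun x => G x e) 2 := by
      refine (enorm_integral_le_lintegral_enorm _).trans ?_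
      rw [← eLpNorm_one_eq_lintegral_enorm]
      refine h1.trans ?_
      refine mul_le_mul' ?_ le_rfl
      refine le_trans (mul_le_mul' ?_ h2) (one_mul _).le
      have : ‖mulL‖ ≤ 1 := ContinuousLinearMap.opNorm_mul_le ℝ ℝ
      exact_mod_cast this
    have h4 := ENNReal.toReal_mono (mul_ne_top (mul_ne_top ofReal_ne_top
      e2.2.ne) ((ap (mollify_memLp G2 n)).sub (ap G2)).2.ne) h3
    simpa [ENNReal.toReal_mul] using h4
  have a3 : Tendsto (fun n => ∫ x, h (mollify n f x) * (η x * G x e)) atTop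
      (𝓝 (∫ x, h (f x) * (η x * G x e))) := by
    refine tendsto_integral_of_dominated_convergence (fun x => C * ‖η x * G x e‖)
      (fun n => (hc.comp_aesm (hfn n).1).mul (e2.1.mul (ap G2).1))
      ((integrable_bilin (mulL) e2 (ap G2)).norm.const_mul _)
      (fun n => of_forall fun x => ?_) ?_
    · rw [norm_mul]; gcongr; exact hC _
    · filter_upwards [mollify_ae_tendsto hl] with x hx
      exact ((hc.tendsto _).comp hx).mul_const _
  have a4 := (a2.add a3).neg
  rw [zero_add] at a4
  have e3 : ∫ x, η x • (h (f x) • G x) e = ∫ x, h (f x) * (η x * G x e) := by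
    congr 1; ext x; simp; ring
  rw [e3]
  refine tendsto_nhds_unique a1 (a4.congr fun n => ?_)
  have hcd : ContDiff ℝ 1 (fun x => Ψ (mollify n f x)) := by
    have : ContDiff ℝ 1 Ψ := by
      rw [contDiff_one_iff_deriv]
      refine ⟨fun r => (hΨ r).differentiableAt, ?_⟩
      convert hc using 1; ext r; exact (hΨ r).deriv
    exact this.comp ((mollify_contDiff n hl).toC1)
  have hfd : ∀ x, ∇ (fun x => Ψ (mollify n f x)) x e = h (mollify n f x) * mollify n G x e := by
    intro x
    have h1 := hasFDerivAt_mollify hl hlG hf.weak (n := n) (x := x) (subset_univ _)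
    have := (hΨ (mollify n f x)).comp_hasFDerivAt x h1
    have h2 := this.fderiv
    rw [show (fun x => Ψ (mollify n f x)) = Ψ ∘ mollify n f from rfl, h2]; simp
  have := integral_fderiv_smul_eq_neg (hη.smooth.toC1) hη.compact hcd e
  simp only [hfd, smul_eq_mul] at this
  simp only [mul_apply']
  rw [this, ← integral_add]
  · congr 2; ext x; ring
  · have h5 : MemLp (fun x => η x * h (mollify n f x)) 2 := by
      have := e2.bdd_smul (hc.comp_aesm (hfn n).1) (of_forall fun x => hC _)
      simpa [mul_comm] using this
    exact integrable_bilin (mulL) h5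
      ((ap (mollify_memLp G2 n)).sub (ap G2))
  · exact (integrable_bilin (mulL) e2 (ap G2)).bdd_mul
      (hc.comp_aesm (hfn n).1) (of_forall fun x => hC _)

section

/-- The direction `e` points out of `Ω` at `q`, uniformly near `q`. -/
def IsOutward (Ω : Set (Vec d)) (q e : Vec d) : Prop :=
  ∃ r > 0, ∀ x ∈ ball q r, x ∉ Ω → ∀ e' ∈ ball e r, ∀ t ∈ Ioo 0 r,
    x + t • e' ∉ closure Ω

lemma IsLocalDefiningFunction.exists_isOutward {k : ℕ} (hk : k ≠ 0) {p : Vec d} {ρ : R[d]}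
    (h : IsLocalDefiningFunction k Ω p ρ) : ∃ e, IsOutward Ω p e := by
  have hk1 : (1 : WithTop ℕ∞) ≤ k := by exact_mod_cast Nat.one_le_iff_ne_zero.2 hk
  set L := ∇ ρ p with hL
  set e : Vec d := -gradient ρ p with he
  set a : ℝ := ‖gradient ρ p‖ ^ 2 with ha
  have ha0 : 0 < a := by have := norm_pos_iff.2 h.gradient_ne_zero; positivity
  have hLe : L e = -a := by
    have : L e = ⟪gradient ρ p, e⟫ := by simp [gradient, hL]
    rw [this, he, inner_neg_right, real_inner_self_eq_norm_sq]
  have hstr : HasStrictFDerivAt ρ L p := h.contDiffAt.hasStrictFDerivAt (by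
    rintro h0; exact hk (by exact_mod_cast h0))
  obtain ⟨c, hc, hc4⟩ : ∃ c : ℝ, 0 < c ∧ c * (‖e‖ + 1) ≤ a / 4 :=
    ⟨a / 4 / (‖e‖ + 1), by positivity, by field_simp; rfl⟩
  obtain ⟨r₀, hr₀, hr₀4⟩ : ∃ r : ℝ, 0 < r ∧ ‖L‖ * r ≤ a / 4 :=
    ⟨a / 4 / (‖L‖ + 1), by positivity, by
      rw [mul_div_assoc', div_le_iff₀ (by positivity)]; nlinarith [norm_nonneg L]⟩
  have h1 := hstr.isLittleO.def hc
  have h2 : ∀ᶠ x in 𝓝 p, (x ∈ Ω ↔ 0 < ρ x) ∧ ContinuousAt ρ x := by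
    filter_upwards [h.mem_iff, (h.contDiffAt.of_le hk1).eventually (by simp)] with x h1 h2
    exact ⟨h1, h2.continuousAt⟩
  obtain ⟨δ₁, hδ₁, hb1⟩ := eventually_nhds_iff_ball.1 h1
  obtain ⟨δ₂, hδ₂, hb2⟩ := eventually_nhds_iff_ball.1 h2
  set δ := min δ₁ δ₂
  have hδ : 0 < δ := lt_min hδ₁ hδ₂
  refine ⟨e, min (min r₀ 1) (min (δ / 2) (δ / 2 / (‖e‖ + 1))), by positivity, ?_⟩
  intro x hx hxΩ e' he' t ht
  simp only [mem_ball, lt_min_iff, mem_Ioo] at hx he' ht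
  obtain ⟨ht0, ⟨htr, ht1⟩, htδ, htδ'⟩ := ht
  have hee : ‖e'‖ ≤ ‖e‖ + 1 := by
    have := norm_le_norm_add_norm_sub e e'
    rw [dist_eq_norm] at he'
    rw [norm_sub_rev] at this
    linarith [he'.1.2]
  have hz : x + t • e' ∈ ball p δ := by
    rw [mem_ball]
    calc dist (x + t • e') p ≤ dist (x + t • e') x + dist x p := dist_triangle _ _ _
      _ < δ / 2 + δ / 2 := by
        refine add_lt_add_of_le_of_lt ?_ hx.2.1
        rw [dist_self_add_left, norm_smul, norm_of_nonneg ht0.le]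
        calc t * ‖e'‖ ≤ δ / 2 / (‖e‖ + 1) * (‖e‖ + 1) := by gcongr
          _ = δ / 2 := by field_simp
      _ = δ := by ring
  have hxb : x ∈ ball p δ := mem_ball.2 (by linarith [hx.2.1])
  have hρx : ρ x ≤ 0 := not_lt.1 fun h' =>
    hxΩ ((hb2 x (ball_subset_ball (min_le_right _ _) hxb)).1.2 h')
  have hest := hb1 (x + t • e', x) (by
    rw [mem_ball, Prod.dist_eq]
    exact max_lt (ball_subset_ball (min_le_left _ _) hz)
      (ball_subset_ball (min_le_left _ _) hxb))
  simp only [add_sub_cancel_left, map_smul, smul_eq_mul] at hest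
  have hLe' : L e' ≤ -a + a / 4 := by
    have : L e' = L e + L (e' - e) := by rw [← map_add]; simp
    rw [this, hLe]
    have h3 : |L (e' - e)| ≤ ‖L‖ * ‖e' - e‖ := L.le_opNorm _
    have h4 : ‖e' - e‖ ≤ r₀ := by rw [← dist_eq_norm]; exact he'.1.1.le
    nlinarith [le_abs_self (L (e' - e)), norm_nonneg L, mul_le_left h4 (norm_nonneg L)]
  have hρz : ρ (x + t • e') < 0 := by
    rw [norm_smul, norm_of_nonneg ht0.le, norm_eq_abs] at hest
    have h5 : c * (t * ‖e'‖) ≤ t * (a / 4) := by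
      calc c * (t * ‖e'‖) = t * (c * ‖e'‖) := by ring
        _ ≤ t * (c * (‖e‖ + 1)) := by gcongr
        _ ≤ _ := by gcongr
    have h6 := le_abs_self (ρ (x + t • e') - ρ x - t * L e')
    nlinarith
  have hzc := (hb2 _ (ball_subset_ball (min_le_right _ _) hz)).2
  rw [mem_closure_iff_frequently]
  intro hfr
  have hev : ∀ᶠ y in 𝓝 (x + t • e'), y ∉ Ω := by
    filter_upwards [hzc.eventually (gt_mem_nhds hρz), isOpen_ball.mem_nhds hz] with y hy1 hy2 hy3
    exact absurd ((hb2 y (ball_subset_ball (min_le_right _ _) hy2)).1.1 hy3) (not_lt.2 hy1.le)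
  exact hfr hev

lemma convex_isOutward (q : Vec d) : Convex ℝ {e | IsOutward Ω q e} := by
  rintro e₁ ⟨r₁, hr₁, h₁⟩ e₂ ⟨r₂, hr₂, h₂⟩ α β hα hβ hαβ
  rcases hα.eq_or_lt with rfl | hα
  · rw [zero_add] at hαβ; subst hαβ
    simp only [zero_smul, one_smul, zero_add]
    exact ⟨r₂, hr₂, h₂⟩
  rcases hβ.eq_or_lt with rfl | hβ
  · rw [add_zero] at hαβ; subst hαβ
    simp only [zero_smul, one_smul, add_zero]
    exact ⟨r₁, hr₁, h₁⟩
  set r := min (min r₁ r₂ / 2) (r₂ / 2 / (‖e₁‖ + r₁ + 1)) with hr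
  have hrpos : 0 < r := by positivity
  have hrr₁ : r < r₁ := by
    have := min_le_left (min r₁ r₂ / 2) (r₂ / 2 / (‖e₁‖ + r₁ + 1))
    have := min_le_left r₁ r₂; linarith
  have hrr₂ : r ≤ r₂ / 2 := by
    have := min_le_left (min r₁ r₂ / 2) (r₂ / 2 / (‖e₁‖ + r₁ + 1))
    have := min_le_right r₁ r₂; linarith
  have hrr₃ : r * (‖e₁‖ + r₁ + 1) ≤ r₂ / 2 := by
    rw [← le_div_iff₀ (by positivity)]; exact min_le_right _ _
  refine ⟨r, hrpos, fun x hx hxΩ e' he' t ht => ?_⟩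
  set f := e' - (α • e₁ + β • e₂) with hf
  have hfr : ‖f‖ < r := by rw [hf, ← dist_eq_norm]; exact he'
  have hα1 : α ≤ 1 := by linarith
  have hβ1 : β ≤ 1 := by linarith
  have e : x + t • e' = (x + (t * α) • (e₁ + f)) + (t * β) • (e₂ + f) := by
    have : e' = α • (e₁ + f) + β • (e₂ + f) := by
      have : e' = (α • e₁ + β • e₂) + (α + β) • f := by rw [hαβ, one_smul, hf]; abel
      rw [this, add_smul, smul_add, smul_add]; abel
    rw [this, smul_add, smul_smul, smul_smul, add_assoc]
  have hy : x + (t * α) • (e₁ + f) ∉ closure Ω := by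
    refine h₁ x (ball_subset_ball hrr₁.le hx) hxΩ _ ?_ _ ⟨by have := ht.1; positivity, ?_⟩
    · rw [mem_ball, dist_self_add_left]; linarith
    · have := ht.1; have := ht.2; nlinarith
  rw [e]
  refine h₂ _ ?_ (fun h => hy (subset_closure h)) _ ?_ _ ⟨by have := ht.1; positivity, ?_⟩
  · rw [mem_ball]
    calc dist (x + (t * α) • (e₁ + f)) q ≤ dist (x + (t * α) • (e₁ + f)) x + dist x q :=
          dist_triangle _ _ _
      _ < r₂ / 2 + r₂ / 2 := by
        refine add_lt_add_of_le_of_lt ?_ (lt_of_lt_of_le hx hrr₂)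
        rw [dist_self_add_left, norm_smul, norm_of_nonneg (by have := ht.1; positivity)]
        have h3 : ‖e₁ + f‖ ≤ ‖e₁‖ + r₁ + 1 := (norm_add_le _ _).trans (by linarith)
        have h4 : t * α ≤ r := by have := ht.1; have := ht.2; nlinarith
        calc _ ≤ r * (‖e₁‖ + r₁ + 1) := by gcongr
          _ ≤ _ := hrr₃
      _ = r₂ := by ring
  · rw [mem_ball, dist_self_add_left]; linarith
  · have := ht.1; have := ht.2; nlinarith

/-- A smooth compactly supported vector field which pushes the complement of `Ω` away from the
closure of `Ω`. -/
lemma IsC2Domain.exists_outward_field (hΩ : IsC2Domain Ω) :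
    ∃ X : V[d], Smooth X ∧ HasCompactSupport X ∧
      ∃ s₀ : ℝ, 0 < s₀ ∧ ∀ s ∈ Ioo 0 s₀, ∀ x ∉ Ω, x + s • X x ∉ closure Ω := by
  let t : Vec d → Set (Vec d) := fun q => {e | q ∈ frontier Ω → IsOutward Ω q e}
  have ht : ∀ q, Convex ℝ (t q) := fun q => by
    by_cases hq : q ∈ frontier Ω
    · simpa [t, hq] using convex_isOutward q
    · simpa [t, hq] using convex_univ
  have hloc : ∀ q, ∃ c, ∀ᶠ y in 𝓝 q, c ∈ t y := fun q => by
    by_cases hq : q ∈ frontier Ω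
    · obtain ⟨ρ, hρ⟩ := hΩ.boundary q hq
      obtain ⟨e, r, hr, he⟩ := hρ.exists_isOutward two_ne_zero
      refine ⟨e, ?_⟩
      filter_upwards [ball_mem_nhds q (half_pos hr)] with y hy _
      refine ⟨r / 2, half_pos hr, fun x hx hxΩ e' he' t ht => he x ?_ hxΩ e' ?_ t ?_⟩
      · rw [mem_ball] at hx hy ⊢
        linarith [dist_triangle x y q]
      · exact ball_subset_ball (by linarith) he'
      · exact ⟨ht.1, by linarith [ht.2]⟩
    · refine ⟨0, ?_⟩
      filter_upwards [isClosed_frontier.isOpen_compl.mem_nhds hq] with y hy hy'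
      exact absurd hy' hy
  obtain ⟨g, hg⟩ := exists_contMDiffMap_forall_mem_convex_of_local_const (n := (⊤ : ℕ∞))
    (modelWithCornersSelf ℝ (Vec d)) ht hloc
  have hgs : Smooth g := g.contMDiff.contDiff
  obtain ⟨R, hR, hRΩ⟩ := hΩ.isBounded.closure.subset_ball_lt 0 0
  let κ : ContDiffBump (0 : Vec d) := ⟨R + 1, R + 2, by positivity, by linarith⟩
  set X : V[d] := fun x => κ x • g x with hX
  have hXs : Smooth X := κ.contDiff.smul hgs
  have hXc : HasCompactSupport X := κ.hasCompactSupport.smul_right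
  refine ⟨X, hXs, hXc, ?_⟩
  by_contra! hcon
  obtain ⟨C, hC⟩ := hXs.continuous.bounded_above_of_compact_support hXc
  have hseq : ∀ n : ℕ, ∃ s ∈ Ioo (0 : ℝ) (1 / (n + 1)), ∃ x ∉ Ω, x + s • X x ∈ closure Ω :=
    fun n => hcon _ (by positivity)
  choose s hs x hx hxs using hseq
  have hs0 : Null s := squeeze_zero (fun n => (hs n).1.le) (fun n => (hs n).2.le)
    tendsto_inv_succ
  have hy : Null (fun n => s n • X (x n)) := by
    rw [tendsto_zero_iff_norm_tendsto_zero]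
    have h0 := hs0.mul_const C
    rw [zero_mul] at h0
    refine squeeze_zero (fun _ => norm_nonneg _) (fun n => ?_) h0
    rw [norm_smul, norm_of_nonneg (hs n).1.le]
    exact mul_le_left (hC _) (hs n).1.le
  have hcpt : IsCompact (closure Ω) := hΩ.isBounded.isCompact_closure
  obtain ⟨q, hq, ν, hν, hlim⟩ := hcpt.tendsto_subseq hxs
  have hxq : Tendsto (fun n => x (ν n)) atTop (𝓝 q) := by
    have := hlim.sub (hy.comp hν.tendsto_atTop)
    simpa using this
  have hqf : q ∈ frontier Ω := by
    refine ⟨hq, ?_⟩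
    rw [hΩ.isOpen.interior_eq]
    exact hΩ.isOpen.isClosed_compl.mem_of_tendsto hxq (of_forall fun n => hx _)
  have hqR : q ∈ ball (0 : Vec d) R := hRΩ hq
  have hXq : X q = g q := by
    simp only [hX]
    rw [κ.one_of_mem_closedBall, one_smul]
    exact ball_subset_closedBall.trans (Metric.closedBall_subset_closedBall (by simp [κ])) hqR
  obtain ⟨r, hr, hout⟩ := hg q hqf
  have e1 : ∀ᶠ n in atTop, x (ν n) ∈ ball q r := hxq.eventually (ball_mem_nhds q hr)
  have e2 : ∀ᶠ n in atTop, X (x (ν n)) ∈ ball (g q) r := by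
    have := (hXs.continuous.tendsto q).comp hxq
    rw [hXq] at this
    exact this.eventually (ball_mem_nhds _ hr)
  have e3 : ∀ᶠ n in atTop, s (ν n) < r := (hs0.comp hν.tendsto_atTop).eventually (gt_mem_nhds hr)
  obtain ⟨n, h1, h2, h3⟩ := (e1.and (e2.and e3)).exists
  exact hout _ h1 (hx _) _ h2 _ ⟨(hs _).1, h3⟩ (hxs _)

end

section

noncomputable def matrixOf (L : M[d]) : Matrix (Fin d) (Fin d) ℝ :=
  LinearMap.toMatrix (basisFun (Fin d) ℝ).toBasis
    (basisFun (Fin d) ℝ).toBasis L.toLinearMap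

noncomputable def adjg (L : M[d]) : M[d] :=
  LinearMap.toContinuousLinearMap (Matrix.toLin (basisFun (Fin d) ℝ).toBasis
    (basisFun (Fin d) ℝ).toBasis (matrixOf L).adjugate)

lemma matrixOf_apply (L : M[d]) (i j : Fin d) :
    matrixOf L i j = L (single j 1) i := by
  simp [matrixOf, LinearMap.toMatrix_apply]

lemma det_eq_matrixOf (L : M[d]) : L.det = (matrixOf L).det := by
  rw [matrixOf, LinearMap.det_toMatrix]

lemma apply_adjg (L : M[d]) (v : Vec d) : L (adjg L v) = L.det • v := by
  have h : Matrix.toLin (basisFun (Fin d) ℝ).toBasis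
      (basisFun (Fin d) ℝ).toBasis (matrixOf L * (matrixOf L).adjugate) v = L.det • v := by
    rw [Matrix.mul_adjugate, ← det_eq_matrixOf]; simp
  rw [Matrix.toLin_mul _ (basisFun (Fin d) ℝ).toBasis] at h
  simpa [matrixOf, adjg] using h

lemma adjg_one : adjg (idL (Vec d)) = idL (Vec d) := by
  ext v i
  have := apply_adjg (idL (Vec d)) v
  have h1 : (idL (Vec d)).det = 1 := by
    rw [ContinuousLinearMap.det]; simp
  rw [h1, one_smul] at this
  simpa using congrArg (fun w : Vec d => w i) this

lemma contDiff_det_of_entries {M : M[d] → Matrix (Fin d) (Fin d) ℝ}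
    (h : ∀ i j, Smooth fun L => M L i j) : Smooth fun L => (M L).det := by
  simp only [Matrix.det_apply]
  refine ContDiff.sum fun σ _ => ContDiff.const_smul _ (contDiff_prod fun i _ => h _ _)

lemma contDiff_matrixOf (i j : Fin d) : Smooth fun L => matrixOf (d := d) L i j := by
  simp only [matrixOf_apply]
  have h : Smooth fun L : M[d] => L (single j 1) :=
    (apply ℝ (Vec d) (single j (1 : ℝ))).contDiff
  exact (contDiff_euclidean.1 h) i

lemma contDiff_det : Smooth fun L : M[d] => L.det := by
  simp only [det_eq_matrixOf]
  exact contDiff_det_of_entries contDiff_matrixOf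

lemma contDiff_adjg : Smooth (adjg (d := d)) := by
  rw [contDiff_clm_apply_iff]
  intro v
  rw [contDiff_euclidean]
  intro i
  have : ∀ L : M[d], adjg L v i = ∑ j, (matrixOf L).adjugate i j * v j := fun L => by
    simp [adjg, Matrix.toLin_apply, Matrix.mulVec, dotProduct, Pi.single_apply]
  simp only [this]
  refine ContDiff.sum fun j _ => ContDiff.mul ?_ contDiff_const
  simp only [Matrix.adjugate_apply]
  refine contDiff_det_of_entries fun a b => ?_
  by_cases hab : a = j
  · subst hab; simp only [Matrix.updateRow_self]; exact contDiff_const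
  · simp only [Matrix.updateRow_ne hab]; exact contDiff_matrixOf a b

end

/-! ### Piola transforms along diffeomorphisms close to the identity -/

section

/-- Diffeomorphisms `G n` converging to the identity, mapping the complement of `Ω` away from
`closure Ω`, with multipliers `J n` such that `x ↦ J n x (u (G n x))` preserves solenoidal fields. -/
structure IsPiolaSeq (Ω : Set (Vec d)) (G : ℕ → V[d])
    (J : ℕ → Vec d → M[d]) (δ : ℕ → ℝ) : Prop where
  G_smooth : ∀ n, Smooth (G n)
  J_smooth : ∀ n, Smooth (J n)
  G_near : ∀ n x, ‖G n x - x‖ ≤ δ n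
  DG_near : ∀ n x, ‖∇ (G n) x - idL (Vec d)‖ ≤ δ n
  J_near : ∀ n x, ‖J n x - idL (Vec d)‖ ≤ δ n
  DJ_small : ∀ n x, ‖∇ (J n) x‖ ≤ δ n
  le_one : ∀ n, δ n ≤ 1
  tendsto : Null δ
  map_le : ∀ n, Measure.map (G n) volume ≤ (2 : ℝ≥0∞) • (volume : Measure (Vec d))
  outward : ∀ n, ∀ x ∉ Ω, G n x ∉ closure Ω
  transport : ∀ n (u : V[d]),
    (∀ η : R[d], IsTest univ η → ∫ x, ∇ η x (u x) = 0) →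
    ∀ ζ : R[d], IsTest univ ζ → ∫ x, ∇ ζ x (J n x (u (G n x))) = 0

lemma det_id_eq_one : (idL (Vec d)).det = 1 := by
  rw [ContinuousLinearMap.det]; simp

/-- A diffeomorphism `G` of `ℝ^d` which is a small perturbation of the identity. -/
lemma exists_homeomorph_of_near_id {G : V[d]} (hG : Smooth G)
    (hnear : ∀ x, ‖∇ G x - idL (Vec d)‖ ≤ 1 / 2)
    (hdet : ∀ x, 1 / 2 ≤ (∇ G x).det) :
    ∃ Φ : Vec d ≃ₜ Vec d, (∀ x, Φ x = G x) ∧ Smooth Φ.symm := by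
  have hdiff : Differentiable ℝ G := hG.differentiable (by simp)
  have hap : ApproximatesLinearOn G
      ((ContinuousLinearEquiv.refl ℝ (Vec d) : Vec d ≃L[ℝ] Vec d) : M[d]) univ (1 / 2) := by
    rw [ApproximatesLinearOn.approximatesLinearOn_iff_lipschitzOnWith, lipschitzOnWith_univ]
    have hd' : Differentiable ℝ (G - ⇑((ContinuousLinearEquiv.refl ℝ (Vec d) : Vec d ≃L[ℝ] Vec d) :
        M[d])) := hdiff.sub (ContinuousLinearMap.differentiable _)
    refine lipschitzWith_of_nnnorm_fderiv_le hd' fun x => ?_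
    have : ∇ (G - ⇑((ContinuousLinearEquiv.refl ℝ (Vec d) : Vec d ≃L[ℝ] Vec d) :
        M[d])) x = ∇ G x - idL (Vec d) := by
      rw [fderiv_sub (hdiff x) (ContinuousLinearMap.differentiableAt _), ContinuousLinearMap.fderiv]
      rfl
    rw [this, ← NNReal.coe_le_coe]
    simpa using hnear x
  have hc : Subsingleton (Vec d) ∨ (1 / 2 : ℝ≥0) <
      ‖((ContinuousLinearEquiv.refl ℝ (Vec d)).symm : M[d])‖₊⁻¹ := by
    rcases subsingleton_or_nontrivial (Vec d) with h | h
    · exact Or.inl h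
    · right
      have : ‖((ContinuousLinearEquiv.refl ℝ (Vec d)).symm : M[d])‖₊ = 1 := by
        exact NNReal.eq (ContinuousLinearMap.norm_id (𝕜 := ℝ) (E := Vec d))
      rw [this, inv_one]
      exact NNReal.half_lt_self one_ne_zero
  refine ⟨hap.toHomeomorph G hc, fun x => rfl, ?_⟩
  refine Homeomorph.contDiff_symm _ (f₀' := fun a =>
    (∇ G a).toContinuousLinearEquivOfDetNeZero (by have := hdet a; positivity)) (fun a => ?_) hG
  rw [ContinuousLinearMap.coe_toContinuousLinearEquivOfDetNeZero]
  exact (hdiff a).hasFDerivAt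

lemma integral_comp_det {G : V[d]} (hG : Differentiable ℝ G) (hb : Bijective G)
    (hdet : ∀ x, 1 / 2 ≤ (∇ G x).det) (g : R[d]) :
    ∫ x, (∇ G x).det * g (G x) = ∫ y, g y := by
  have h := integral_image_eq_integral_abs_det_fderiv_smul (volume : Measure (Vec d))
    MeasurableSet.univ (fun x _ => (hG x).hasFDerivAt.hasFDerivWithinAt) hb.1.injOn g
  rw [image_univ, hb.2.range_eq, restrict_univ] at h
  rw [h]
  congr 1; ext x
  rw [abs_of_nonneg (by linarith [hdet x]), smul_eq_mul]

lemma map_le_of_det {G : V[d]} (hG : Differentiable ℝ G) (hb : Bijective G)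
    (hdet : ∀ x, 1 / 2 ≤ (∇ G x).det) :
    Measure.map G volume ≤ (2 : ℝ≥0∞) • (volume : Measure (Vec d)) := by
  refine Measure.le_iff.2 fun s hs => ?_
  rw [Measure.map_apply hG.continuous.measurable hs, Measure.smul_apply, smul_eq_mul]
  have h := lintegral_image_eq_lintegral_abs_det_fderiv_mul (volume : Measure (Vec d))
    (MeasurableSet.univ) (fun x _ => (hG x).hasFDerivAt.hasFDerivWithinAt) hb.1.injOn
    (s.indicator (1 : Vec d → ℝ≥0∞))
  rw [image_univ, hb.2.range_eq, restrict_univ, lintegral_indicator_one hs] at h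
  rw [h, ← lintegral_indicator_one (hG.continuous.measurable hs), ← lintegral_const_mul' _ _ (by simp)]
  refine lintegral_mono fun x => ?_
  have h1 : (1 : ℝ≥0∞) ≤ 2 * ofReal |(∇ G x).det| := by
    have h2 : (1 : ℝ) ≤ 2 * |(∇ G x).det| := by
      have := le_abs_self (∇ G x).det; linarith [hdet x]
    have := ENNReal.ofReal_le_ofReal h2
    rwa [ENNReal.ofReal_one, ENNReal.ofReal_mul (by norm_num), ENNReal.ofReal_ofNat] at this
  rw [← mul_assoc]
  calc (G ⁻¹' s).indicator (1 : Vec d → ℝ≥0∞) x = 1 * s.indicator (1 : Vec d → ℝ≥0∞) (G x) := by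
        rw [one_mul]; rfl
    _ ≤ _ := by gcongr

lemma transport_of_diffeo {G : V[d]} (hG : Smooth G) (Φ : Vec d ≃ₜ Vec d)
    (hΦ : ∀ x, Φ x = G x) (hΦs : Smooth Φ.symm)
    (hdet : ∀ x, 1 / 2 ≤ (∇ G x).det) {u : V[d]}
    (hu : ∀ η : R[d], IsTest univ η → ∫ x, ∇ η x (u x) = 0) {ζ : R[d]}
    (hζ : IsTest univ ζ) : ∫ x, ∇ ζ x (adjg (∇ G x) (u (G x))) = 0 := by
  have hGd : Differentiable ℝ G := hG.differentiable (by simp)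
  have hb : Bijective G := by rw [show G = Φ from funext fun x => (hΦ x).symm]; exact Φ.bijective
  have ht : IsTest univ (ζ ∘ Φ.symm) :=
    ⟨hζ.smooth.comp hΦs, hζ.compact.comp_homeomorph Φ.symm, subset_univ _⟩
  have hI := integral_comp_det hGd hb hdet (fun y => ∇ (ζ ∘ Φ.symm) y (u y))
  rw [hu _ ht] at hI
  rw [← hI]
  congr 1; ext x
  have h1 : HasFDerivAt (ζ ∘ Φ.symm) (∇ (ζ ∘ Φ.symm) (G x)) (G x) :=
    (ht.differentiable _).hasFDerivAt
  have h2 := h1.comp x (hGd x).hasFDerivAt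
  have h3 : (ζ ∘ Φ.symm) ∘ G = ζ := by
    ext y; simp [← hΦ]
  rw [h3] at h2
  rw [h2.fderiv, ContinuousLinearMap.comp_apply, apply_adjg, map_smul, smul_eq_mul]

lemma IsC2Domain.exists_piolaSeq (hΩ : IsC2Domain Ω) : ∃ G J δ, IsPiolaSeq Ω G J δ := by
  obtain ⟨X, hX, hXc, s₀, hs₀, hout⟩ := hΩ.exists_outward_field
  have hDX : Smooth (∇ X) := hX.fderiv_right (by simp)
  obtain ⟨C₁, hC₁⟩ := hX.continuous.bounded_above_of_compact_support hXc
  obtain ⟨C₂, hC₂⟩ := hDX.continuous.bounded_above_of_compact_support (hXc.fderiv ℝ)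
  obtain ⟨C₃, hC₃⟩ := (hDX.continuous_fderiv (by simp)).bounded_above_of_compact_support
    ((hXc.fderiv ℝ).fderiv ℝ)
  set C := max C₁ (max C₂ C₃) with hC
  have hCC₁ : C₁ ≤ C := le_max_left _ _
  have hCC₂ : C₂ ≤ C := (le_max_left _ _).trans (le_max_right _ _)
  have hCC₃ : C₃ ≤ C := (le_max_right _ _).trans (le_max_right _ _)
  have hC0 : 0 ≤ C := (norm_nonneg _).trans ((hC₁ 0).trans hCC₁)
  have hadj : Smooth (adjg (d := d)) := contDiff_adjg
  set I := idL (Vec d) with hI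
  obtain ⟨M, hM⟩ := (isCompact_closedBall I 1).exists_bound_of_continuousOn
    (hadj.continuous_fderiv (by simp)).continuousOn
  have hM0 : 0 ≤ M := (norm_nonneg _).trans (hM I (Metric.mem_closedBall_self zero_le_one))
  obtain ⟨r, hr, hrdet⟩ : ∃ r > 0, ∀ L : M[d], ‖L - I‖ < r → 1 / 2 ≤ L.det := by
    have h1 : ContinuousAt (fun L : M[d] => L.det) I := contDiff_det.continuous.continuousAt
    have h2 := h1.eventually (lt_mem_nhds (show (1 / 2 : ℝ) < I.det by rw [det_id_eq_one]; norm_num))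
    obtain ⟨r, hr, h⟩ := eventually_nhds_iff_ball.1 h2
    exact ⟨r, hr, fun L hL => (h L (by rwa [mem_ball, dist_eq_norm])).le⟩
  set Q := (M + 1) * (C + 1) with hQ
  have hQ0 : 0 < Q := by positivity
  set s₁ := min (s₀ / 2) (min (1 / 2) (r / 2) / Q) with hs₁
  have hs₁0 : 0 < s₁ := by positivity
  have hs₁Q : s₁ * Q ≤ min (1 / 2) (r / 2) := by
    rw [← le_div_iff₀ hQ0]; exact min_le_right _ _
  let s : ℕ → ℝ := fun n => s₁ * (1 / (n + 1))
  have hs0 : ∀ n, 0 < s n := fun n => by positivity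
  have hss : ∀ n, s n ≤ s₁ := fun n => by
    have : (1 : ℝ) / (n + 1) ≤ 1 := by
      rw [div_le_one (by positivity)]; linarith [(Nat.cast_nonneg n : (0 : ℝ) ≤ n)]
    simp only [s]; nlinarith
  have hsQ : ∀ n, s n * Q ≤ min (1 / 2) (r / 2) := fun n =>
    (mul_le_right (hss n) hQ0.le).trans hs₁Q
  have hCQ : C ≤ Q := by rw [hQ]; nlinarith
  have hMCQ : M * C ≤ Q := by rw [hQ]; nlinarith
  let G : ℕ → V[d] := fun n x => x + s n • X x
  have hGs : ∀ n, Smooth (G n) := fun n => contDiff_id.add (hX.const_smul (s n))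
  have hDG : ∀ n x, ∇ (G n) x = I + s n • ∇ X x := fun n x =>
    ((hasFDerivAt_id x).add ((hX.differentiable (by simp) x).hasFDerivAt.const_smul (s n))).fderiv
  have hnear : ∀ n x, ‖∇ (G n) x - I‖ ≤ s n * C := fun n x => by
    rw [hDG, add_sub_cancel_left, norm_smul, norm_of_nonneg (hs0 n).le]
    exact mul_le_left ((hC₂ x).trans hCC₂) (hs0 n).le
  have hnear' : ∀ n x, ‖∇ (G n) x - I‖ ≤ s n * Q := fun n x =>
    (hnear n x).trans (mul_le_left hCQ (hs0 n).le)
  have hdet : ∀ n x, 1 / 2 ≤ (∇ (G n) x).det := fun n x =>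
    hrdet _ (((hnear' n x).trans ((hsQ n).trans (min_le_right _ _))).trans_lt (by linarith))
  have hhalf : ∀ n x, ‖∇ (G n) x - I‖ ≤ 1 / 2 := fun n x =>
    (hnear' n x).trans ((hsQ n).trans (min_le_left _ _))
  choose Φ hΦ hΦs using fun n => exists_homeomorph_of_near_id (hGs n) (hhalf n) (hdet n)
  have hbij : ∀ n, Bijective (G n) := fun n => by
    rw [show G n = Φ n from funext fun x => (hΦ n x).symm]; exact (Φ n).bijective
  have hmem : ∀ n x, ∇ (G n) x ∈ closedBall I 1 := fun n x => by
    rw [mem_closedBall, dist_eq_norm]; linarith [hhalf n x]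
  have hDGs : ∀ n, Smooth (∇ (G n)) := fun n => (hGs n).fderiv_right (by simp)
  refine ⟨G, fun n x => adjg (∇ (G n) x), fun n => s n * Q, hGs,
    fun n => hadj.comp (hDGs n), fun n x => ?_, hnear', fun n x => ?_, fun n x => ?_, fun n => ?_, ?_,
    fun n => map_le_of_det ((hGs n).differentiable (by simp)) (hbij n) (hdet n), fun n x hx => ?_,
    fun n u hu ζ hζ => transport_of_diffeo (hGs n) (Φ n) (hΦ n) (hΦs n) (hdet n) hu hζ⟩
  · simp only [G, add_sub_cancel_left]
    rw [norm_smul, norm_of_nonneg (hs0 n).le]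
    exact mul_le_left (((hC₁ x).trans hCC₁).trans hCQ) (hs0 n).le
  · have := (convex_closedBall I 1).norm_image_sub_le_of_norm_fderiv_le (𝕜 := ℝ) (f := adjg)
      (fun L _ => hadj.differentiable (by simp) L) hM (Metric.mem_closedBall_self zero_le_one) (hmem n x)
    rw [adjg_one] at this
    calc _ ≤ M * ‖∇ (G n) x - I‖ := this
      _ ≤ M * (s n * C) := by gcongr; exact hnear n x
      _ = s n * (M * C) := by ring
      _ ≤ _ := mul_le_left hMCQ (hs0 n).le
  · have h1 : HasFDerivAt adjg (∇ adjg (∇ (G n) x)) (∇ (G n) x) :=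
      (hadj.differentiable (by simp) _).hasFDerivAt
    have h2 : HasFDerivAt (∇ (G n)) (s n • ∇ (∇ X) x) x := by
      have h3 := ((hDX.differentiable (by simp) x).hasFDerivAt.const_smul (s n)).const_add I
      rwa [show ∇ (G n) = fun y => I + s n • ∇ X y from funext (hDG n)]
    have h4 := h1.comp x h2
    have h5 : ∇ (fun y => adjg (∇ (G n) y)) x = _ := h4.fderiv
    rw [h5]
    calc _ ≤ ‖∇ adjg (∇ (G n) x)‖ * ‖s n • ∇ (∇ X) x‖ :=
          opNorm_comp_le _ _
      _ ≤ M * (s n * C) := by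
        have h6 : ‖s n • ∇ (∇ X) x‖ ≤ s n * C := by
          refine (ContinuousLinearMap.opNorm_smul_le _ _).trans ?_
          rw [norm_of_nonneg (hs0 n).le]
          exact mul_le_left ((hC₃ x).trans hCC₃) (hs0 n).le
        exact mul_le_mul (hM _ (hmem n x)) h6 (ContinuousLinearMap.opNorm_nonneg _) hM0
      _ = s n * (M * C) := by ring
      _ ≤ _ := mul_le_left hMCQ (hs0 n).le
  · exact ((hsQ n).trans (min_le_left _ _)).trans (by norm_num)
  · have h := tendsto_inv_succ.const_mul s₁
    have h' := h.mul_const Q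
    simpa [s] using h'
  · refine hout (s n) ⟨hs0 n, (hss n).trans_lt ?_⟩ x hx
    have := min_le_left (s₀ / 2) (min (1 / 2) (r / 2) / Q)
    linarith

end

section

noncomputable def trCLM (d : ℕ) : M[d] →L[ℝ] ℝ :=
  ∑ i : Fin d, (proj i : L[d, ℝ]).comp
    (apply ℝ (Vec d) (single i (1 : ℝ)))

lemma trCLM_apply (A : M[d]) : trCLM d A = tr A := by
  simp [trCLM, tr]

lemma aesm_tr {β : Type*} [MeasurableSpace β] {ν : Measure β} {A : β → M[d]} (h : AESM A ν) :
    AESM (fun x => tr (A x)) ν := by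
  simp only [← trCLM_apply]; exact (trCLM d).continuous.comp_aesm h

lemma Continuous.tr' {β : Type*} [TopologicalSpace β] {A : β → M[d]} (h : Continuous A) :
    Continuous fun x => tr (A x) := by
  simp only [← trCLM_apply]; exact (trCLM d).continuous.comp h

lemma vec_eq_sum (x : Vec d) : x = ∑ i, x i • single i (1 : ℝ) := by
  conv_lhs => rw [← (basisFun (Fin d) ℝ).sum_repr x]
  simp

lemma clm_apply_eq_sum (L : L[d, F])
    (x : Vec d) : L x = ∑ i, x i • L (single i (1 : ℝ)) := by
  conv_lhs => rw [vec_eq_sum x]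
  simp [map_sum]

lemma inner_gradient_eq {f : R[d]} (a x : Vec d) : ⟪a, gradient f x⟫ = ∇ f x a := by
  rw [real_inner_comm, gradient, InnerProductSpace.toDual_symm_apply]

lemma integrableOn_smul_of_compact
    {g : R[d]} {K : Vec d → F} (hg : Continuous g) (hc : HasCompactSupport g)
    (hs : tsupport g ⊆ Ω) (hK : LocallyIntegrableOn K Ω) : IntegrableOn (fun x => g x • K x) Ω := by
  have h1 : IntegrableOn K (tsupport g) := hK.integrableOn_compact_subset hs hc
  have h2 : IntegrableOn (fun x => g x • K x) (tsupport g) :=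
    IntegrableOn.continuousOn_smul h1 hg.continuousOn hc
  have hsub : support (fun x => g x • K x) ⊆ tsupport g :=
    (support_smul_subset_left g K).trans (subset_tsupport g)
  exact ((integrableOn_iff_integrable_of_support_subset hsub).1 h2).integrableOn

lemma HasWeakFDeriv.integral_fderiv_apply {u : V[d]} {G : Vec d → M[d]}
    (h : HasWeakFDeriv Ω u G) {η : R[d]} (hη : IsTest Ω η) :
    ∫ x in Ω, ∇ η x (u x) = -∫ x in Ω, η x * tr (G x) := by
  have hs : ∀ e, tsupport (fun x => ∇ η x e) ⊆ Ω := fun e =>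
    (tsupport_fderiv_apply_subset ℝ e).trans hη.support
  have i1 : ∀ i : Fin d, IntegrableOn (fun x => ∇ η x (single i 1) • u x) Ω :=
    fun i => integrableOn_smul_of_compact (hη.continuous_fderiv.clm_apply continuous_const)
      (hη.compact.fderiv_apply ℝ _) (hs _) h.locInt
  have i2 : ∀ i : Fin d, IntegrableOn (fun x => η x • G x (single i 1)) Ω := fun i => by
    have := integrableOn_smul_of_compact hη.cont hη.compact hη.support h.locInt_deriv
    exact (apply ℝ (Vec d) (single i (1 : ℝ))).integrable_comp this
  have e1 : ∀ x, ∇ η x (u x) = ∑ i, (∇ η x (single i 1) • u x) i := by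
    intro x
    rw [clm_apply_eq_sum]
    refine sum_congr rfl fun i _ => ?_
    simp [mul_comm]
  have e2 : ∀ x, η x * tr (G x) = ∑ i, (η x • G x (single i 1)) i := by
    intro x
    simp [tr, Finset.mul_sum]
  have p : ∀ (i : Fin d) (f : V[d]), IntegrableOn f Ω → ∫ x in Ω, f x i = (∫ x in Ω, f x) i :=
    fun i f hf => (proj i : L[d, ℝ]).integral_comp_comm hf
  have q : ∀ (i : Fin d) (f : V[d]), IntegrableOn f Ω → IntegrableOn (fun x => f x i) Ω :=
    fun i f hf => (proj i : L[d, ℝ]).integrable_comp hf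
  simp only [e1, e2]
  rw [integral_finsetSum _ fun i _ => q i _ (i1 i), integral_finsetSum _ fun i _ => q i _ (i2 i),
    ← Finset.sum_neg_distrib]
  refine sum_congr rfl fun i _ => ?_
  rw [p i _ (i1 i), p i _ (i2 i), h.byParts η hη]
  simp

lemma HasWeakFDeriv.tr_eq_zero (hΩ : IsOpen Ω) {u : V[d]} {G : Vec d → M[d]}
    (h : HasWeakFDeriv Ω u G) (h0 : ∀ η : R[d], IsTest Ω η → ∫ x in Ω, ∇ η x (u x) = 0) :
    ∀ᵐ x, x ∈ Ω → tr (G x) = 0 := by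
  have hl : LocallyIntegrableOn (fun x => tr (G x)) Ω := by
    intro x hx
    obtain ⟨s, hs, hi⟩ := h.locInt_deriv x hx
    refine ⟨s, hs, ?_⟩
    have := (trCLM d).integrable_comp hi
    simp only [trCLM_apply] at this
    exact this
  refine hΩ.ae_eq_zero_of_integral_contDiff_smul_eq_zero hl fun g hg hc hs => ?_
  have ht : IsTest Ω g := ⟨hg, hc, hs⟩
  have h1 := h.integral_fderiv_apply ht
  rw [h0 g ht, eq_comm, neg_eq_zero, setIntegral_eq_of_zero] at h1
  · simpa using h1
  · intro x hx; rw [ht.eq_zero hx, zero_mul]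

lemma WeaklyDivFree.integral_eq {u : V[d]} (h : WeaklyDivFree Ω u) (η : R[d])
    (hη : IsTest Ω η) : ∫ x in Ω, ∇ η x (u x) = 0 := by
  simpa only [inner_gradient_eq] using h η hη

/-- The extension by zero of a solenoidal `H^1_0` field is solenoidal. -/
lemma MemH10.integral_fderiv_indicator_eq_zero (hΩ : IsOpen Ω) {u : V[d]}
    {G : Vec d → M[d]} (h : MemH10 Ω u G) (hdiv : WeaklyDivFree Ω u) {η : R[d]}
    (hη : IsTest univ η) : ∫ x, ∇ η x (Ω.indicator u x) = 0 := by
  have h1 := (h.extend hΩ).weak.integral_fderiv_apply hη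
  rw [restrict_univ] at h1
  rw [h1, neg_eq_zero]
  refine integral_eq_zero_of_ae ?_
  filter_upwards [h.weak.tr_eq_zero hΩ hdiv.integral_eq] with x hx
  by_cases hxΩ : x ∈ Ω
  · simp [hxΩ, hx hxΩ]
  · simp [hxΩ, tr]

lemma divg_mollify_eq_zero {u : V[d]} {G : Vec d → M[d]}
    (h : MemH1 univ u G) (h0 : ∀ η : R[d], IsTest univ η → ∫ x, ∇ η x (u x) = 0)
    (n : ℕ) (x : Vec d) : divg (mollify n u) x = 0 := by
  have f2 : MemLp u 2 := by simpa using h.memLp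
  have G2 : MemLp G 2 := by simpa using h.memLp_deriv
  have hl := f2.locallyIntegrable (by norm_num)
  have hlG := G2.locallyIntegrable (by norm_num)
  have h1 := h.weak.tr_eq_zero isOpen_univ (by simpa using h0)
  rw [divg, fderiv_mollify_of_memH1 hl hlG h.weak, ← trCLM_apply, mollify_apply',
    ← (trCLM d).integral_comp_comm (mollBump_integrable_smul n hlG x)]
  refine integral_eq_zero_of_ae ?_
  filter_upwards [h1] with y hy
  simp [trCLM_apply, hy (mem_univ _)]

end

section

lemma MemH1.of_tendsto {f : ℕ → Vec d → F} {G : ℕ → Vec d → L[d, F]} {f₀ : Vec d → F}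
    {G₀ : Vec d → L[d, F]} (h : ∀ n, MemH1 univ (f n) (G n)) (hf : MemLp f₀ 2)
    (hG : MemLp G₀ 2) (tf : Null (fun n => eLpNorm (f n - f₀) 2))
    (tG : Null (fun n => eLpNorm (G n - G₀) 2)) : MemH1 univ f₀ G₀ := by
  refine ⟨by simpa using hf, by simpa using hG,
    (hf.locallyIntegrable (by norm_num)).locallyIntegrableOn _,
    (hG.locallyIntegrable (by norm_num)).locallyIntegrableOn _, fun η hη e => ?_⟩
  rw [restrict_univ]
  have e1 : MemLp (fun x => ∇ η x e) 2 := (apply ℝ ℝ e).comp_memLp' hη.memLp_fderiv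
  have e2 : MemLp η 2 := hη.memLp
  have z : ∀ (a : R[d]), Null (fun _ : ℕ => eLpNorm (a - a) 2) := fun a => by simp
  have ap : ∀ {A : Vec d → L[d, F]}, MemLp A 2 → MemLp (fun x => A x e) 2 :=
    fun hA => (apply ℝ F e).comp_memLp' hA
  have m1 : ∀ n, MemLp (f n) 2 := fun n => by simpa using (h n).memLp
  have m2 : ∀ n, MemLp (G n) 2 := fun n => by simpa using (h n).memLp_deriv
  have a1 := tendsto_integral_bilin (lsmul ℝ ℝ : ℝ →L[ℝ] F →L[ℝ] F)
    (fun _ : ℕ => e1) e1 m1 hf (z _) tf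
  have a2 := tendsto_integral_bilin (lsmul ℝ ℝ : ℝ →L[ℝ] F →L[ℝ] F)
    (fun _ : ℕ => e2) e2 (fun n => ap (m2 n)) (ap hG) (z _) (tendsto_eLpNorm_clm_apply e tG)
  refine tendsto_nhds_unique a1 (a2.neg.congr fun n => ?_)
  have := (h n).weak.byParts η hη e
  rw [restrict_univ] at this
  exact this.symm

lemma eLpNorm_comp_le_of_map_le {F : Type*} [NormedAddCommGroup F] {G : V[d]} (hG : Measurable G)
    (hm : Measure.map G volume ≤ (2 : ℝ≥0∞) • (volume : Measure (Vec d))) {f : Vec d → F}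
    (hf : AESM f volume) :
    eLpNorm (f ∘ G) 2 ≤ 2 * eLpNorm f 2 := by
  have hac : Measure.map G volume ≪ (volume : Measure (Vec d)) :=
    (Measure.absolutelyContinuous_of_le hm).trans Measure.smul_absolutelyContinuous
  rw [← eLpNorm_map_measure (hf.mono_ac hac) hG.aemeasurable]
  refine (eLpNorm_mono_measure f hm).trans ?_
  rw [eLpNorm_smul_measure_of_ne_top (by norm_num)]
  rw [smul_eq_mul]
  gcongr
  calc (2 : ℝ≥0∞) ^ (1 / (2 : ℝ≥0∞)).toReal ≤ (2 : ℝ≥0∞) ^ (1 : ℝ) := by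
        refine ENNReal.rpow_le_rpow_of_exponent_le (by norm_num) ?_
        rw [ENNReal.toReal_div]; norm_num
    _ = 2 := ENNReal.rpow_one _

lemma memLp_comp_of_map_le {F : Type*} [NormedAddCommGroup F] {G : V[d]} (hG : Measurable G)
    (hm : Measure.map G volume ≤ (2 : ℝ≥0∞) • (volume : Measure (Vec d))) {f : Vec d → F}
    (hf : MemLp f 2) : MemLp (f ∘ G) 2 := by
  have hac : Measure.map G volume ≪ (volume : Measure (Vec d)) :=
    (Measure.absolutelyContinuous_of_le hm).trans Measure.smul_absolutelyContinuous
  exact ⟨(hf.1.mono_ac hac).comp_measurable hG, (eLpNorm_comp_le_of_map_le hG hm hf.1).trans_lt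
    (mul_lt_top (by norm_num) hf.2)⟩

/-- Composition with diffeomorphisms converging to the identity is strongly continuous in `L^2`. -/
lemma tendsto_eLpNorm_comp_sub {G : ℕ → V[d]} (hG : ∀ n, Continuous (G n))
    (hm : ∀ n, Measure.map (G n) volume ≤ (2 : ℝ≥0∞) • (volume : Measure (Vec d))) {δ : ℕ → ℝ}
    (hδ : Null δ) (hnear : ∀ n x, ‖G n x - x‖ ≤ δ n) {f : Vec d → F}
    (hf : MemLp f 2) :
    Null (fun n => eLpNorm (f ∘ G n - f) 2) := by
  have hcont : ∀ g : Vec d → F, Continuous g → HasCompactSupport g →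
      Null (fun n => eLpNorm (g ∘ G n - g) 2) := fun g hg hc => by
    set K := Metric.cthickening 1 (tsupport g) with hK
    have hKc : IsCompact K := IsCompact.cthickening hc
    have hu : UniformContinuous g := hc.uniformContinuous_of_continuous hg
    rw [tendsto_nhds_zero]
    intro ε hε
    obtain ⟨c, hc0, hcε⟩ : ∃ c : ℝ, 0 < c ∧ ofReal c * (volume K) ^ (1 / (2 : ℝ)) ≤ ε := by
      rcases eq_or_ne ε ⊤ with rfl | hεt
      · exact ⟨1, one_pos, le_top⟩
      have hV : (volume K) ^ (1 / (2 : ℝ)) ≠ ⊤ :=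
        rpow_ne_top_of_nonneg (by norm_num) hKc.measure_lt_top.ne
      set V := ((volume K) ^ (1 / (2 : ℝ))).toReal
      refine ⟨ε.toReal / (V + 1), div_pos (ENNReal.toReal_pos hε.ne' hεt) (by positivity), ?_⟩
      rw [← ENNReal.ofReal_toReal hV, ← ENNReal.ofReal_mul (by positivity)]
      conv_rhs => rw [← ENNReal.ofReal_toReal hεt]
      refine ENNReal.ofReal_le_ofReal ?_
      rw [div_mul_eq_mul_div, div_le_iff₀ (by positivity)]
      have : 0 ≤ ε.toReal := ENNReal.toReal_nonneg
      change ε.toReal * V ≤ _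
      nlinarith
    obtain ⟨r, hr, hru⟩ := Metric.uniformContinuous_iff.1 hu c hc0
    filter_upwards [hδ.eventually (gt_mem_nhds hr), hδ.eventually (gt_mem_nhds one_pos)] with n hn hn1
    have hz : ∀ x ∉ K, (g ∘ G n - g) x = 0 := fun x hx => by
      have h1 : x ∉ tsupport g := fun h => hx (Metric.self_subset_cthickening _ h)
      have h2 : G n x ∉ tsupport g := fun h => hx (by
        refine mem_cthickening_of_dist_le x _ 1 _ h ?_
        rw [dist_comm, dist_eq_norm]; exact (hnear n x).trans hn1.le)
      simp [eq_zero_off h1, eq_zero_off h2]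
    have hb : ∀ x, ‖(g ∘ G n - g) x‖ ≤ c := fun x => by
      have := hru (a := G n x) (b := x) (by rw [dist_eq_norm]; exact (hnear n x).trans_lt hn)
      rw [dist_eq_norm] at this; exact this.le
    have hsupp : K.indicator (g ∘ G n - g) = g ∘ G n - g := by
      ext x; by_cases hx : x ∈ K
      · simp [hx]
      · simp only [hx, not_false_eq_true, indicator_of_notMem]; exact (hz x hx).symm
    rw [← hsupp, eLpNorm_indicator_eq_eLpNorm_restrict hKc.isClosed.measurableSet]
    refine (eLpNorm_le_of_ae_bound (of_forall hb)).trans ?_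
    rw [mul_comm, restrict_apply_univ]
    have h2 : (ENNReal.toReal 2)⁻¹ = 1 / 2 := by norm_num
    rw [h2]
    exact hcε
  rw [tendsto_nhds_zero]
  intro ε hε
  obtain ⟨g, hgc, hgε, hg, hg2⟩ := hf.exists_hasCompactSupport_eLpNorm_sub_le (by norm_num)
    (ε := ε / 4) (ENNReal.div_pos hε.ne' (by norm_num)).ne'
  filter_upwards [tendsto_nhds_zero.1 (hcont g hg hgc) (ε / 4)
    (ENNReal.div_pos hε.ne' (by norm_num))] with n hn
  have h1 : eLpNorm ((f - g) ∘ G n) 2 ≤ 2 * (ε / 4) :=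
    (eLpNorm_comp_le_of_map_le (hG n).measurable (hm n) (hf.1.sub hg2.1)).trans (by gcongr)
  have e : f ∘ G n - f = (f - g) ∘ G n + ((g ∘ G n - g) + (g - f)) := by ext x; simp
  have mm : ∀ {h : Vec d → F}, MemLp h 2 → AESM (h ∘ G n) volume := fun hh =>
    (memLp_comp_of_map_le (hG n).measurable (hm n) hh).1
  rw [e]
  refine (eLpNorm_add_le (mm (hf.sub hg2)) (((mm hg2).sub hg2.1).add (hg2.1.sub hf.1)) (by norm_num)).trans ?_
  refine (add_le_add h1 (eLpNorm_add_le ((mm hg2).sub hg2.1) (hg2.1.sub hf.1) (by norm_num))).trans ?_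
  rw [eLpNorm_sub_comm g f]
  refine (add_le_add le_rfl (add_le_add hn hgε)).trans ?_
  rw [← two_mul, ← add_mul]
  norm_num
  rw [ENNReal.mul_div_cancel (by norm_num) (by norm_num)]

end

/-! ### Approximation of solenoidal fields -/

section

lemma tendsto_eLpNorm_of_le {α ι E : Type*} [MeasurableSpace α] {μ : Measure α}
    [NormedAddCommGroup E] {l : Filter ι} {f g : ι → α → E} {f₀ : α → E}
    (hf : ∀ n, AESM (f n) μ) (hg : ∀ n, AESM (g n) μ)
    (h₀ : AESM f₀ μ)
    (h1 : Tendsto (fun n => eLpNorm (f n - g n) 2 μ) l (𝓝 0))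
    (h2 : Tendsto (fun n => eLpNorm (g n - f₀) 2 μ) l (𝓝 0)) :
    Tendsto (fun n => eLpNorm (f n - f₀) 2 μ) l (𝓝 0) := by
  have h := h1.add h2
  rw [add_zero] at h
  refine tendsto_zero_of_le h fun n => ?_
  have : f n - f₀ = (f n - g n) + (g n - f₀) := by abel
  rw [this]
  exact eLpNorm_add_le ((hf n).sub (hg n)) ((hg n).sub h₀) (by norm_num)

def pullField (G : V[d]) (J : Vec d → M[d]) (u : V[d]) (x : Vec d) :
    Vec d := J x (u (G x))

noncomputable def pullDeriv (G : V[d]) (J : Vec d → M[d]) (u : V[d])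
    (Du : Vec d → M[d]) (x : Vec d) : M[d] :=
  (J x).comp ((Du (G x)).comp (∇ G x)) + (∇ J x).flip (u (G x))

lemma hasFDerivAt_pullField {G : V[d]} {J : Vec d → M[d]} {u : V[d]}
    {x : Vec d} {L : M[d]} (hG : DifferentiableAt ℝ G x) (hJ : DifferentiableAt ℝ J x)
    (hu : HasFDerivAt u L (G x)) :
    HasFDerivAt (pullField G J u)
      ((J x).comp (L.comp (∇ G x)) + (∇ J x).flip (u (G x))) x :=
  hJ.hasFDerivAt.clm_apply (hu.comp x hG.hasFDerivAt)

variable {G : ℕ → V[d]} {J : ℕ → Vec d → M[d]} {δ : ℕ → ℝ}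

lemma IsPiolaSeq.nonneg (h : IsPiolaSeq Ω G J δ) (n : ℕ) : 0 ≤ δ n :=
  (norm_nonneg _).trans (h.G_near n 0)

lemma IsPiolaSeq.norm_J_le (h : IsPiolaSeq Ω G J δ) (n : ℕ) (x : Vec d) : ‖J n x‖ ≤ 2 := by
  have h1 := norm_le_norm_sub_add (J n x) (idL (Vec d))
  have h2 := norm_id_le (𝕜 := ℝ) (E := Vec d)
  linarith [h.J_near n x, h.le_one n]

lemma IsPiolaSeq.norm_DG_le (h : IsPiolaSeq Ω G J δ) (n : ℕ) (x : Vec d) :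
    ‖∇ (G n) x‖ ≤ 2 := by
  have h1 := norm_le_norm_sub_add (∇ (G n) x) (idL (Vec d))
  have h2 := norm_id_le (𝕜 := ℝ) (E := Vec d)
  linarith [h.DG_near n x, h.le_one n]

lemma IsPiolaSeq.diff_G (h : IsPiolaSeq Ω G J δ) (n : ℕ) : Differentiable ℝ (G n) :=
  (h.G_smooth n).differentiable (by simp)

lemma IsPiolaSeq.diff_J (h : IsPiolaSeq Ω G J δ) (n : ℕ) : Differentiable ℝ (J n) :=
  (h.J_smooth n).differentiable (by simp)

lemma IsPiolaSeq.meas_G (h : IsPiolaSeq Ω G J δ) (n : ℕ) : Measurable (G n) :=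
  (h.diff_G n).continuous.measurable

lemma norm_pullDeriv_le (h : IsPiolaSeq Ω G J δ) (n : ℕ) (u : V[d])
    (Du : Vec d → M[d]) (x : Vec d) :
    ‖pullDeriv (G n) (J n) u Du x‖ ≤ 4 * ‖Du (G n x)‖ + δ n * ‖u (G n x)‖ := by
  refine (norm_add_le _ _).trans (add_le_add ?_ ?_)
  · calc _ ≤ ‖J n x‖ * (‖Du (G n x)‖ * ‖∇ (G n) x‖) :=
          (opNorm_comp_le _ _).trans
            (mul_le_left (opNorm_comp_le _ _) (norm_nonneg _))
      _ ≤ 2 * (‖Du (G n x)‖ * 2) := by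
        gcongr
        · exact h.norm_J_le n x
        · exact h.norm_DG_le n x
      _ = _ := by ring
  · refine (le_opNorm _ _).trans ?_
    rw [opNorm_flip]
    gcongr
    exact h.DJ_small n x

lemma continuous_clm_eval : Continuous fun p : (E →L[ℝ] F) × E => p.1 p.2 :=
  isBoundedBilinearMap_apply.continuous

lemma aesm_clm_eval {α E F : Type*} [MeasurableSpace α] {μ : Measure α} [NormedAddCommGroup E]
    [NormedSpace ℝ E] [NormedAddCommGroup F] [NormedSpace ℝ F] {L : α → E →L[ℝ] F} {g : α → E}
    (hL : AESM L μ) (hg : AESM g μ) :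
    AESM (fun x => L x (g x)) μ :=
  continuous_clm_eval.comp_aesm (hL.prodMk hg)

lemma clm_eq_sum_smulRight
    (L : L[d, F]) : L = ∑ i : Fin d, ((proj i : L[d, ℝ]).smulRight
      (L (single i (1 : ℝ)))) := by
  refine ContinuousLinearMap.ext fun x => ?_
  rw [clm_apply_eq_sum]
  simp

lemma aesm_clm_of_apply {α F : Type*} [MeasurableSpace α] {μ : Measure α}
    [NormedAddCommGroup F] [NormedSpace ℝ F] {L : α → L[d, F]}
    (h : ∀ e, AESM (fun x => L x e) μ) : AESM L μ := by
  rw [show L = fun x => ∑ i : Fin d, ((ContinuousLinearMap.smulRightL ℝ (Vec d) F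
    (proj i : L[d, ℝ])) (L x (single i (1 : ℝ)))) from
    funext fun x => clm_eq_sum_smulRight (L x)]
  refine Finset.aestronglyMeasurable_fun_sum _ fun i _ => ?_
  exact (ContinuousLinearMap.continuous _).comp_aesm (h _)

lemma aesm_pullField (h : IsPiolaSeq Ω G J δ) (n : ℕ) {u : V[d]}
    (hu : MemLp u 2) : AESM (pullField (G n) (J n) u) volume :=
  aesm_clm_eval (h.diff_J n).continuous.aesm
    (memLp_comp_of_map_le (h.meas_G n) (h.map_le n) hu).1

lemma aesm_pullDeriv (h : IsPiolaSeq Ω G J δ) (n : ℕ) {u : V[d]}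
    {Du : Vec d → M[d]} (hu : MemLp u 2) (hDu : MemLp Du 2) :
    AESM (pullDeriv (G n) (J n) u Du) volume := by
  have c1 : Continuous (∇ (G n)) := (h.G_smooth n).continuous_fderiv (by simp)
  have c2 : Continuous (∇ (J n)) := (h.J_smooth n).continuous_fderiv (by simp)
  have m1 := (memLp_comp_of_map_le (h.meas_G n) (h.map_le n) hDu).1
  have m2 := (memLp_comp_of_map_le (h.meas_G n) (h.map_le n) hu).1
  refine aesm_clm_of_apply fun e => ?_
  have a1 := aesm_clm_eval (h.diff_J n).continuous.aesm
    (aesm_clm_eval m1 (c1.clm_apply (continuous_const (y := e))).aesm)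
  have a2 := aesm_clm_eval (c2.clm_apply (continuous_const (y := e))).aesm m2
  exact a1.add a2

lemma eLpNorm_pullField_le (h : IsPiolaSeq Ω G J δ) (n : ℕ) {u : V[d]}
    (hu : MemLp u 2) : eLpNorm (pullField (G n) (J n) u) 2 ≤ 4 * eLpNorm u 2 := by
  have h1 : eLpNorm (pullField (G n) (J n) u) 2 ≤ ofReal 2 * eLpNorm (u ∘ G n) 2 :=
    eLpNorm_le_mul_eLpNorm_of_ae_le_mul (of_forall fun x => by
      refine (le_opNorm _ _).trans ?_
      exact mul_le_right (h.norm_J_le n x) (norm_nonneg _)) 2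
  have h2 := eLpNorm_comp_le_of_map_le (h.meas_G n) (h.map_le n) hu.1
  calc _ ≤ _ := h1
    _ ≤ ofReal 2 * (2 * eLpNorm u 2) := by gcongr
    _ = _ := by rw [← mul_assoc]; norm_num

lemma eLpNorm_pullDeriv_le (h : IsPiolaSeq Ω G J δ) (n : ℕ) {u : V[d]}
    {Du : Vec d → M[d]} (hu : MemLp u 2) (hDu : MemLp Du 2) :
    eLpNorm (pullDeriv (G n) (J n) u Du) 2
      ≤ 8 * eLpNorm Du 2 + 2 * eLpNorm u 2 := by
  have m1 := memLp_comp_of_map_le (h.meas_G n) (h.map_le n) hDu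
  have m2 := memLp_comp_of_map_le (h.meas_G n) (h.map_le n) hu
  have n1 := eLpNorm_comp_le_of_map_le (h.meas_G n) (h.map_le n) hDu.1
  have n2 := eLpNorm_comp_le_of_map_le (h.meas_G n) (h.map_le n) hu.1
  have h1 : eLpNorm (pullDeriv (G n) (J n) u Du) 2 ≤
      eLpNorm (fun x => 4 * ‖(Du ∘ G n) x‖ + 1 * ‖(u ∘ G n) x‖) 2 := by
    refine eLpNorm_mono fun x => ?_
    rw [norm_of_nonneg (by positivity)]
    refine (norm_pullDeriv_le h n u Du x).trans ?_
    simp only [comp_apply]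
    gcongr
    exact h.le_one n
  refine h1.trans ((eLpNorm_add_le (m1.1.norm.const_mul _) (m2.1.norm.const_mul _) (by norm_num)).trans ?_)
  have e1 : eLpNorm (fun x => 4 * ‖(Du ∘ G n) x‖) 2 ≤ 4 * eLpNorm (Du ∘ G n) 2 := by
    have := eLpNorm_const_smul_le (p := 2) (μ := volume) (c := (4 : ℝ)) (f := fun x => ‖(Du ∘ G n) x‖)
    rw [eLpNorm_norm] at this
    refine (le_of_eq rfl).trans (this.trans (le_of_eq ?_))
    congr 1
    rw [Real.enorm_eq_ofReal (by norm_num)]; norm_num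
  have e2 : eLpNorm (fun x => 1 * ‖(u ∘ G n) x‖) 2 = eLpNorm (u ∘ G n) 2 := by
    simp only [one_mul]; rw [eLpNorm_norm]
  rw [e2]
  refine add_le_add (e1.trans ?_) n2
  calc _ ≤ 4 * (2 * eLpNorm Du 2) := by gcongr
    _ = _ := by rw [← mul_assoc]; norm_num

lemma pullField_sub (n : ℕ) (u w : V[d]) :
    pullField (G n) (J n) u - pullField (G n) (J n) w = pullField (G n) (J n) (u - w) := by
  ext1 x; simp [pullField]

lemma pullDeriv_sub (n : ℕ) (u w : V[d]) (Du Dw : Vec d → M[d]) :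
    pullDeriv (G n) (J n) u Du - pullDeriv (G n) (J n) w Dw
      = pullDeriv (G n) (J n) (u - w) (Du - Dw) := by
  ext1 x
  simp only [pullDeriv, Pi.sub_apply, ContinuousLinearMap.sub_comp, ContinuousLinearMap.comp_sub,
    map_sub]
  abel

lemma MemH1.pullField (h : IsPiolaSeq Ω G J δ) (n : ℕ) {u : V[d]}
    {Du : Vec d → M[d]} (hu : MemH1 univ u Du) :
    MemH1 univ (pullField (G n) (J n) u) (pullDeriv (G n) (J n) u Du) := by
  have f2 : MemLp u 2 := by simpa using hu.memLp
  have G2 : MemLp Du 2 := by simpa using hu.memLp_deriv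
  have hl := f2.locallyIntegrable (by norm_num)
  have hlG := G2.locallyIntegrable (by norm_num)
  have mk : ∀ {w : V[d]} {Dw : Vec d → M[d]}, MemLp w 2 →
      MemLp Dw 2 → MemLp (_root_.pullField (G n) (J n) w) 2 ∧
      MemLp (pullDeriv (G n) (J n) w Dw) 2 := fun hw hDw =>
    ⟨⟨aesm_pullField h n hw, (eLpNorm_pullField_le h n hw).trans_lt (mul_lt_top (by norm_num) hw.2)⟩,
     ⟨aesm_pullDeriv h n hw hDw, (eLpNorm_pullDeriv_le h n hw hDw).trans_lt
      (ENNReal.add_lt_top.2 ⟨mul_lt_top (by norm_num) hDw.2, mul_lt_top (by norm_num) hw.2⟩)⟩⟩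
  have t1 := tendsto_eLpNorm_mollify_sub f2
  have t2 := tendsto_eLpNorm_mollify_sub G2
  refine MemH1.of_tendsto (f := fun k => _root_.pullField (G n) (J n) (mollify k u))
    (G := fun k => pullDeriv (G n) (J n) (mollify k u) (mollify k Du)) (fun k => ?_) (mk f2 G2).1
    (mk f2 G2).2 ?_ ?_
  · have hm := mk (mollify_memLp f2 k) (mollify_memLp G2 k)
    have hd : ∀ x, HasFDerivAt (_root_.pullField (G n) (J n) (mollify k u))
        (pullDeriv (G n) (J n) (mollify k u) (mollify k Du) x) x := fun x =>
      hasFDerivAt_pullField (h.diff_G n x) (h.diff_J n x)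
        (hasFDerivAt_mollify hl hlG hu.weak (subset_univ _))
    have hc : ContDiff ℝ 1 (_root_.pullField (G n) (J n) (mollify k u)) := by
      have h1 : Smooth (fun x => mollify k u (G n x)) :=
        (mollify_contDiff k hl).comp (h.G_smooth n)
      exact ((h.J_smooth n).clm_apply h1).toC1
    have hw := hasWeakFDeriv_of_contDiff hc
    rw [show ∇ (_root_.pullField (G n) (J n) (mollify k u)) =
      pullDeriv (G n) (J n) (mollify k u) (mollify k Du) from funext fun x => (hd x).fderiv] at hw
    exact ⟨by simpa using hm.1, by simpa using hm.2, hw⟩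
  · have h' := ENNReal.Tendsto.const_mul (a := 4) t1 (Or.inr (by norm_num))
    rw [mul_zero] at h'
    refine tendsto_zero_of_le h' fun k => ?_
    rw [pullField_sub]
    exact eLpNorm_pullField_le h n ((mollify_memLp f2 k).sub f2)
  · have h' := (ENNReal.Tendsto.const_mul (a := 8) t2 (Or.inr (by norm_num))).add
      (ENNReal.Tendsto.const_mul (a := 2) t1 (Or.inr (by norm_num)))
    rw [mul_zero, mul_zero, add_zero] at h'
    refine tendsto_zero_of_le h' fun k => ?_
    rw [pullDeriv_sub]
    exact eLpNorm_pullDeriv_le h n ((mollify_memLp f2 k).sub f2) ((mollify_memLp G2 k).sub G2)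

lemma tendsto_eLpNorm_of_norm_le {α : Type*} [MeasurableSpace α] {μ : Measure α} {E : Type*}
    [NormedAddCommGroup E] {f : ℕ → α → E} {g : ℕ → α → ℝ} (h : ∀ n x, ‖f n x‖ ≤ g n x)
    (hg : Null (fun n => eLpNorm (g n) 2 μ)) :
    Null (fun n => eLpNorm (f n) 2 μ) :=
  tendsto_zero_of_le hg fun n =>
    eLpNorm_mono fun x => (h n x).trans (le_abs_self _)

lemma tendsto_eLpNorm_const_mul_norm {α : Type*} [MeasurableSpace α] {μ : Measure α} {E : Type*}
    [NormedAddCommGroup E] {f : ℕ → α → E} {c : ℕ → ℝ} {M : ℝ≥0∞} (hM : M ≠ ⊤)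
    (h : ∀ n, eLpNorm (f n) 2 μ ≤ M) (hc : Null c) :
    Null (fun n => eLpNorm (fun x => c n * ‖f n x‖) 2 μ) := by
  have h' : Null (fun n => ‖c n‖ₑ * M) := by
    have := ENNReal.Tendsto.mul_const (b := M) ((continuous_enorm.tendsto _).comp hc) (Or.inr hM)
    simpa using this
  refine tendsto_zero_of_le h' fun n => ?_
  have := eLpNorm_const_smul_le (p := 2) (μ := μ) (c := c n) (f := fun x => ‖f n x‖)
  rw [eLpNorm_norm] at this
  exact this.trans (mul_le_mul' le_rfl (h n))

lemma tendsto_pullField (h : IsPiolaSeq Ω G J δ) {u : V[d]} (hu : MemLp u 2) :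
    Null (fun n => eLpNorm (pullField (G n) (J n) u - u) 2) := by
  have ht := tendsto_eLpNorm_comp_sub (fun n => (h.diff_G n).continuous) h.map_le h.tendsto h.G_near hu
  have hc := fun n => memLp_comp_of_map_le (h.meas_G n) (h.map_le n) hu
  refine tendsto_eLpNorm_of_le (g := fun n => u ∘ G n) (fun n => aesm_pullField h n hu)
    (fun n => (hc n).1) hu.1 ?_ ht
  refine tendsto_eLpNorm_of_norm_le (g := fun n x => δ n * ‖(u ∘ G n) x‖) (fun n x => ?_)
    (tendsto_eLpNorm_const_mul_norm (M := 2 * eLpNorm u 2 volume) (mul_ne_top (by norm_num) hu.2.ne)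
      (fun n => eLpNorm_comp_le_of_map_le (h.meas_G n) (h.map_le n) hu.1) h.tendsto)
  have : (pullField (G n) (J n) u - u ∘ G n) x
      = (J n x - idL (Vec d)) (u (G n x)) := by simp [pullField]
  rw [this]
  exact (le_opNorm _ _).trans (mul_le_right (h.J_near n x) (norm_nonneg _))

lemma tendsto_pullDeriv (h : IsPiolaSeq Ω G J δ) {u : V[d]}
    {Du : Vec d → M[d]} (hu : MemLp u 2) (hDu : MemLp Du 2) :
    Null (fun n => eLpNorm (pullDeriv (G n) (J n) u Du - Du) 2) := by
  have ht := tendsto_eLpNorm_comp_sub (fun n => (h.diff_G n).continuous) h.map_le h.tendsto h.G_near hDu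
  have hc := fun n => memLp_comp_of_map_le (h.meas_G n) (h.map_le n) hDu
  have hc' := fun n => memLp_comp_of_map_le (h.meas_G n) (h.map_le n) hu
  refine tendsto_eLpNorm_of_le (g := fun n => Du ∘ G n) (fun n => aesm_pullDeriv h n hu hDu)
    (fun n => (hc n).1) hDu.1 ?_ ht
  have hδ3 : Null (fun n => 3 * δ n) := by simpa using h.tendsto.const_mul 3
  have s1 := tendsto_eLpNorm_const_mul_norm (f := fun n => Du ∘ G n) (M := 2 * eLpNorm Du 2 volume)
    (mul_ne_top (by norm_num) hDu.2.ne)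
    (fun n => eLpNorm_comp_le_of_map_le (h.meas_G n) (h.map_le n) hDu.1) hδ3
  have s2 := tendsto_eLpNorm_const_mul_norm (f := fun n => u ∘ G n) (M := 2 * eLpNorm u 2 volume)
    (mul_ne_top (by norm_num) hu.2.ne)
    (fun n => eLpNorm_comp_le_of_map_le (h.meas_G n) (h.map_le n) hu.1) h.tendsto
  have s3 := s1.add s2
  rw [add_zero] at s3
  refine tendsto_eLpNorm_of_norm_le
    (g := fun n => (fun x => 3 * δ n * ‖(Du ∘ G n) x‖) + fun x => δ n * ‖(u ∘ G n) x‖) (fun n x => ?_)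
    (tendsto_zero_of_le s3 fun n =>
      eLpNorm_add_le ((hc n).1.norm.const_mul _) ((hc' n).1.norm.const_mul _) (by norm_num))
  set I := idL (Vec d)
  have e : (pullDeriv (G n) (J n) u Du - Du ∘ G n) x
      = (J n x - I).comp ((Du (G n x)).comp (∇ (G n) x))
        + (Du (G n x)).comp (∇ (G n) x - I) + (∇ (J n) x).flip (u (G n x)) := by
    simp only [pullDeriv, Pi.sub_apply, comp_apply, ContinuousLinearMap.sub_comp,
      ContinuousLinearMap.comp_sub, I, ContinuousLinearMap.id_comp, ContinuousLinearMap.comp_id]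
    abel
  rw [e]
  refine (norm_add₃_le).trans ?_
  have b1 : ‖(J n x - I).comp ((Du (G n x)).comp (∇ (G n) x))‖ ≤ δ n * (‖Du (G n x)‖ * 2) := by
    refine (opNorm_comp_le _ _).trans (mul_le_mul (h.J_near n x)
      ((opNorm_comp_le _ _).trans
      (mul_le_left (h.norm_DG_le n x) (norm_nonneg _))) (norm_nonneg _) (h.nonneg n))
  have b2 : ‖(Du (G n x)).comp (∇ (G n) x - I)‖ ≤ ‖Du (G n x)‖ * δ n :=
    (opNorm_comp_le _ _).trans
      (mul_le_left (h.DG_near n x) (norm_nonneg _))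
  have b3 : ‖(∇ (J n) x).flip (u (G n x))‖ ≤ δ n * ‖u (G n x)‖ := by
    refine (le_opNorm _ _).trans ?_
    rw [opNorm_flip]
    exact mul_le_right (h.DJ_small n x) (norm_nonneg _)
  simp only [Pi.add_apply, comp_apply]
  linarith

lemma pullField_eq_zero (h : IsPiolaSeq Ω G J δ) (hb : IsBounded Ω) (n : ℕ) :
    ∃ K : Set (Vec d), IsCompact K ∧ K ⊆ Ω ∧ ∀ w : V[d], (∀ x ∉ Ω, w x = 0) →
      ∀ x ∉ K, pullField (G n) (J n) w x = 0 := by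
  refine ⟨G n ⁻¹' closure Ω, ?_, fun x hx => ?_, fun w hw x hx => ?_⟩
  · refine isCompact_of_isClosed_isBounded
      (isClosed_closure.preimage (h.diff_G n).continuous) ?_
    obtain ⟨R, hR⟩ := hb.closure.subset_closedBall 0
    refine (Metric.isBounded_closedBall (x := (0 : Vec d)) (r := R + 1)).subset fun x hx => ?_
    have h1 := hR hx
    rw [mem_closedBall_zero_iff] at h1 ⊢
    have h2 := norm_le_norm_add_norm_sub' x (G n x)
    have h3 := h.G_near n x
    rw [norm_sub_rev] at h3
    linarith [h.le_one n]
  · by_contra hx'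
    exact h.outward n x hx' hx
  · rw [pullField, hw _ fun hG => hx (subset_closure hG), map_zero]

structure IsSolTest (Ω : Set (Vec d)) (w : V[d]) : Prop extends IsTest Ω w where
  divFree : ∀ x, divg w x = 0

lemma exists_isSolTest_near (h : IsPiolaSeq Ω G J δ) (hΩ : IsOpen Ω) (hb : IsBounded Ω)
    {u : V[d]} {Du : Vec d → M[d]} (hu : MemH1 univ u Du)
    (h0 : ∀ x ∉ Ω, u x = 0)
    (hdiv : ∀ η : R[d], IsTest univ η → ∫ x, ∇ η x (u x) = 0) (n : ℕ) :
    ∀ᶠ k in atTop, IsSolTest Ω (mollify k (pullField (G n) (J n) u)) := by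
  obtain ⟨K, hK, hKΩ, hz⟩ := pullField_eq_zero h hb n
  have hp := MemH1.pullField h n hu
  have f2 : MemLp (pullField (G n) (J n) u) 2 := by simpa using hp.memLp
  filter_upwards [isTest_mollify (f2.locallyIntegrable (by norm_num)) hK hΩ hKΩ (hz u h0)] with k hk
  exact ⟨hk, divg_mollify_eq_zero hp (h.transport n u hdiv) k⟩

/-- Solenoidal test fields are dense in the solenoidal fields of `H^1_0`. -/
lemma MemH10.exists_isSolTest_tendsto (hΩ : IsC2Domain Ω) {u : V[d]}
    {Du : Vec d → M[d]} (hu : MemH10 Ω u Du) (hdiv : WeaklyDivFree Ω u) :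
    ∃ w : ℕ → V[d], (∀ n, IsSolTest Ω (w n)) ∧
      Null (fun n => eL2 (w n - u) Ω) ∧
      Null (fun n => eL2 (∇ (w n) - Du) Ω) := by
  obtain ⟨G, J, δ, h⟩ := hΩ.exists_piolaSeq
  have he := hu.extend hΩ.isOpen
  have hed : ∀ η : R[d], IsTest univ η → ∫ x, ∇ η x (Ω.indicator u x) = 0 := fun η hη =>
    hu.integral_fderiv_indicator_eq_zero hΩ.isOpen hdiv hη
  set U := Ω.indicator u
  set DU := Ω.indicator Du
  have f2 : MemLp U 2 := by simpa using he.memLp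
  have G2 : MemLp DU 2 := by simpa using he.memLp_deriv
  have hU0 : ∀ x ∉ Ω, U x = 0 := fun x hx => indicator_of_notMem hx _
  have hp := fun n => MemH1.pullField h n he
  have p2 : ∀ n, MemLp (pullField (G n) (J n) U) 2 := fun n => by simpa using (hp n).memLp
  have q2 : ∀ n, MemLp (pullDeriv (G n) (J n) U DU) 2 := fun n => by simpa using (hp n).memLp_deriv
  have hε : ∀ n : ℕ, (0 : ℝ≥0∞) < ofReal (1 / (n + 1)) := fun n => by
    rw [ENNReal.ofReal_pos]; positivity
  have hex : ∀ n : ℕ, ∃ k, IsSolTest Ω (mollify k (pullField (G n) (J n) U)) ∧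
      eLpNorm (mollify k (pullField (G n) (J n) U) - pullField (G n) (J n) U) 2
        ≤ ofReal (1 / (n + 1)) ∧
      eLpNorm (mollify k (pullDeriv (G n) (J n) U DU) - pullDeriv (G n) (J n) U DU) 2
        ≤ ofReal (1 / (n + 1)) := fun n =>
    ((exists_isSolTest_near h hΩ.isOpen hΩ.isBounded he hU0 hed n).and
      ((tendsto_nhds_zero.1 (tendsto_eLpNorm_mollify_sub (p2 n)) _ (hε n)).and
      (tendsto_nhds_zero.1 (tendsto_eLpNorm_mollify_sub (q2 n)) _ (hε n)))).exists
  choose k hk1 hk2 hk3 using hex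
  have hz : Null (fun n : ℕ => ofReal (1 / ((n : ℝ) + 1))) := by
    have := (continuous_ofReal.tendsto 0).comp tendsto_inv_succ
    rw [ofReal_zero] at this
    exact this
  have r1 : Null (fun n => eLpNorm (mollify (k n) (pullField (G n) (J n) U) - U) 2) :=
    tendsto_eLpNorm_of_le (fun n => (mollify_memLp (p2 n) _).1) (fun n => (p2 n).1) f2.1
      (tendsto_zero_of_le hz hk2)
      (tendsto_pullField h f2)
  have r2 : Null (fun n => eLpNorm (mollify (k n) (pullDeriv (G n) (J n) U DU) - DU) 2) :=
    tendsto_eLpNorm_of_le (fun n => (mollify_memLp (q2 n) _).1) (fun n => (q2 n).1) G2.1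
      (tendsto_zero_of_le hz hk3)
      (tendsto_pullDeriv h f2 G2)
  refine ⟨fun n => mollify (k n) (pullField (G n) (J n) U), hk1, ?_, ?_⟩
  · refine tendsto_zero_of_le r1 fun n => ?_
    refine le_trans (le_of_eq (eLpNorm_congr_ae ?_)) (eLpNorm_mono_measure _ Measure.restrict_le_self)
    filter_upwards [ae_restrict_mem hΩ.isOpen.measurableSet] with x hx
    simp [U, hx]
  · refine tendsto_zero_of_le r2 fun n => ?_
    refine le_trans (le_of_eq (eLpNorm_congr_ae ?_)) (eLpNorm_mono_measure _ Measure.restrict_le_self)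
    filter_upwards [ae_restrict_mem hΩ.isOpen.measurableSet] with x hx
    rw [fderiv_mollify_of_memH1 ((p2 n).locallyIntegrable (by norm_num))
      ((q2 n).locallyIntegrable (by norm_num)) (hp n).weak]
    simp [DU, hx]

/-- A property of solenoidal fields that is stable under bounded convergence extends from
solenoidal test fields to Lipschitz solenoidal fields that vanish outside `Ω`. -/
lemma solenoidal_induction (hΩ : IsC2Domain Ω) {p : V[d] → Prop}
    (test : ∀ η, IsSolTest Ω η → p η)
    (lim : ∀ C w w₀, (∀ n, p (w n)) → BddConv Ω C w w₀ → p w₀) {w : V[d]} {K : ℝ≥0}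
    (hK : LipschitzWith K w) (hbd : ∀ x, ‖w x‖ ≤ K) (h0 : ∀ x ∉ Ω, w x = 0) (hC : ContDiffOn ℝ 1 w Ω)
    (hdiv : ∀ η : R[d], IsTest univ η → ∫ x, ∇ η x (w x) = 0) : p w := by
  obtain ⟨G, J, δ, h⟩ := hΩ.exists_piolaSeq
  have hcs : HasCompactSupport w := of_support_subset_isCompact
    (isCompact_of_isClosed_isBounded isClosed_closure hΩ.isBounded.closure)
    fun x hx => subset_closure (by_contra fun hx' => hx (h0 x hx'))
  have hw := hK.hasWeakFDeriv
  have f2 : MemLp w 2 := hK.continuous.memLp_of_hasCompactSupport hcs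
  have hH : MemH1 univ w (∇ w) := by
    refine ⟨by simpa using f2, ?_, hw⟩
    rw [restrict_univ]
    have hm : AESM (∇ w) volume :=
      (locallyIntegrableOn_univ.1 hw.locInt_deriv).aestronglyMeasurable
    have hb : MemLp ((tsupport w).indicator fun _ : Vec d => (K : ℝ)) 2 :=
      memLp_indicator_const 2 (isClosed_tsupport w).measurableSet (K : ℝ) (Or.inr hcs.measure_lt_top.ne)
    refine hb.mono hm (of_forall fun x => ?_)
    by_cases hx : x ∈ tsupport w
    · simpa [hx] using norm_fderiv_le_of_lipschitz ℝ hK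
    · have : ∇ w x = 0 := by
        by_contra hne
        exact hx (support_fderiv_subset ℝ hne)
      simp [this]
  have hlip : ∀ n, LipschitzWith (5 * K) (pullField (G n) (J n) w) := fun n => by
    have lG : LipschitzWith 2 (G n) := lipschitzWith_of_nnnorm_fderiv_le (h.diff_G n) fun x =>
      by exact_mod_cast h.norm_DG_le n x
    have lJ : LipschitzWith 1 (J n) := lipschitzWith_of_nnnorm_fderiv_le (h.diff_J n) fun x =>
      by exact_mod_cast (h.DJ_small n x).trans (h.le_one n)
    refine LipschitzWith.of_dist_le_mul fun x y => ?_
    have e : pullField (G n) (J n) w x - pullField (G n) (J n) w y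
        = J n x (w (G n x) - w (G n y)) + (J n x - J n y) (w (G n y)) := by
      simp [pullField]
    push_cast
    rw [dist_eq_norm, e]
    have b1 : ‖J n x (w (G n x) - w (G n y))‖ ≤ 2 * (K * (2 * dist x y)) := by
      refine (le_opNorm _ _).trans (mul_le_mul (h.norm_J_le n x) ?_
        (norm_nonneg _) (by norm_num))
      rw [← dist_eq_norm]
      refine (hK.dist_le_mul _ _).trans ?_
      gcongr
      exact lG.dist_le_mul x y
    have b2 : ‖(J n x - J n y) (w (G n y))‖ ≤ dist x y * K := by
      refine (le_opNorm _ _).trans (mul_le_mul ?_ (hbd _) (norm_nonneg _) dist_nonneg)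
      have := lJ.dist_le_mul x y
      rw [dist_eq_norm] at this; simpa using this
    linarith [norm_add_le (J n x (w (G n x) - w (G n y))) ((J n x - J n y) (w (G n y)))]
  have hbd' : ∀ n x, ‖pullField (G n) (J n) w x‖ ≤ (5 * K : ℝ≥0) := fun n x => by
    refine (le_opNorm _ _).trans ((mul_le_mul (h.norm_J_le n x) (hbd _)
      (norm_nonneg _) (by norm_num)).trans ?_)
    push_cast
    nlinarith [K.coe_nonneg]
  have hGt : ∀ x, Tendsto (fun n => G n x) atTop (𝓝 x) := fun x => by
    rw [tendsto_iff_norm_sub_tendsto_zero]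
    exact squeeze_zero (fun _ => norm_nonneg _) (fun n => h.G_near n x) h.tendsto
  have hJt : ∀ x, Tendsto (fun n => J n x) atTop (𝓝 (idL (Vec d))) := fun x => by
    rw [tendsto_iff_norm_sub_tendsto_zero]
    exact squeeze_zero (fun _ => norm_nonneg _) (fun n => h.J_near n x) h.tendsto
  have hDGt : ∀ x, Tendsto (fun n => ∇ (G n) x) atTop (𝓝 (idL (Vec d))) := fun x => by
    rw [tendsto_iff_norm_sub_tendsto_zero]
    exact squeeze_zero (fun _ => norm_nonneg _) (fun n => h.DG_near n x) h.tendsto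
  have hwt : ∀ x, Tendsto (fun n => w (G n x)) atTop (𝓝 (w x)) := fun x =>
    (hK.continuous.tendsto x).comp (hGt x)
  refine lim (5 * K) (fun n => pullField (G n) (J n) w) w (fun n => ?_) ⟨hlip, hbd', fun x => ?_, ?_⟩
  · have hmol := bddConv_mollify (Ω := Ω) (hlip n) (hbd' n)
    obtain ⟨N, hN⟩ := eventually_atTop.1
      (exists_isSolTest_near h hΩ.isOpen hΩ.isBounded hH h0 hdiv n)
    refine lim (5 * K) (fun m => mollify (m + N) (pullField (G n) (J n) w)) _
      (fun m => test _ (hN _ (Nat.le_add_left _ _))) ⟨fun m => hmol.lip _, fun m => hmol.bdd _,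
      fun x => (hmol.tendsto x).comp (tendsto_add_atTop_nat N), ?_⟩
    filter_upwards [hmol.tendsto_fderiv] with x hx
    exact hx.comp (tendsto_add_atTop_nat N)
  · exact (continuous_clm_eval.tendsto (idL (Vec d), w x)).comp
      ((hJt x).prodMk_nhds (hwt x))
  · filter_upwards [ae_restrict_mem hΩ.isOpen.measurableSet] with x hx
    have hdw : ∀ y ∈ Ω, DifferentiableAt ℝ w y := fun y hy =>
      (hC.differentiableOn one_ne_zero).differentiableAt (hΩ.isOpen.mem_nhds hy)
    have hcw : ContinuousAt (∇ w) x :=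
      (hC.continuousOn_fderiv_of_isOpen hΩ.isOpen (le_refl _)).continuousAt (hΩ.isOpen.mem_nhds hx)
    have hev : ∀ᶠ n in atTop, G n x ∈ Ω := (hGt x).eventually (hΩ.isOpen.mem_nhds hx)
    have hcc : Continuous fun p : M[d] × M[d] => p.1.comp p.2 := by fun_prop
    have t0 : Tendsto (fun n => (∇ w (G n x)).comp (∇ (G n) x)) atTop
        (𝓝 ((∇ w x).comp (idL (Vec d)))) :=
      (hcc.tendsto (∇ w x, idL (Vec d))).comp
        ((hcw.tendsto.comp (hGt x)).prodMk_nhds (hDGt x))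
    have t1 : Tendsto (fun n => (J n x).comp ((∇ w (G n x)).comp (∇ (G n) x))) atTop
        (𝓝 ((idL (Vec d)).comp
          ((∇ w x).comp (idL (Vec d))))) :=
      (hcc.tendsto (idL (Vec d),
        (∇ w x).comp (idL (Vec d)))).comp ((hJt x).prodMk_nhds t0)
    have t2 : Null (fun n => (∇ (J n) x).flip (w (G n x))) := by
      rw [tendsto_zero_iff_norm_tendsto_zero]
      refine squeeze_zero (fun _ => norm_nonneg _) (fun n => ?_)
        (by simpa using h.tendsto.mul_const (K : ℝ))
      refine (le_opNorm _ _).trans ?_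
      rw [opNorm_flip]
      exact mul_le_mul (h.DJ_small n x) (hbd _) (norm_nonneg _) (h.nonneg n)
    have t3 := t1.add t2
    rw [add_zero, ContinuousLinearMap.id_comp, ContinuousLinearMap.comp_id] at t3
    refine t3.congr' ?_
    filter_upwards [hev] with n hn
    exact (hasFDerivAt_pullField (h.diff_G n x) (h.diff_J n x) (hdw _ hn).hasFDerivAt).fderiv.symm

end

/-! ### Weak time derivatives -/

section

variable {T : ℝ}

lemma intervalIntegrable_of_Ioo {E : Type*} [NormedAddCommGroup E] (hT : 0 ≤ T) {f : ℝ → E}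
    (hf : IntegrableOn f (Ioo 0 T)) : IntervalIntegrable f volume 0 T :=
  (intervalIntegrable_iff_integrableOn_Ioo_of_le hT).2 hf

lemma intervalIntegrable_of_Ioo_of_mem {E : Type*} [NormedAddCommGroup E] {f : ℝ → E}
    (hf : IntegrableOn f (Ioo 0 T)) {a b : ℝ} (ha : a ∈ Icc 0 T) (hb : b ∈ Icc 0 T) :
    IntervalIntegrable f volume a b := by
  refine (intervalIntegrable_of_Ioo (ha.1.trans ha.2) hf).mono_set ?_
  rw [uIcc_of_le (ha.1.trans ha.2)]
  exact uIcc_subset_Icc ha hb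

lemma ae_deriv_primitive {f : ℝ → ℝ} (hT : 0 ≤ T) (hf : IntegrableOn f (Ioo 0 T)) :
    ∀ᵐ t ∂vI T, HasDerivAt (fun x => ∫ s in 0..x, f s) (f t) t := by
  rw [ae_restrict_iff' measurableSet_Ioo]
  filter_upwards [(intervalIntegrable_of_Ioo hT hf).ae_hasDerivAt_integral] with t ht htI
  rw [uIcc_of_le hT] at ht
  exact ht (Ioo_subset_Icc_self htI) 0 (left_mem_Icc.2 hT)

lemma LipschitzWith.comp_absolutelyContinuousOnInterval {Ψ : ℝ → ℝ} {K : ℝ≥0} (hΨ : LipschitzWith K Ψ)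
    {f : ℝ → ℝ} {a b : ℝ} (hf : AbsolutelyContinuousOnInterval f a b) :
    AbsolutelyContinuousOnInterval (fun x => Ψ (f x)) a b := by
  rw [absolutelyContinuousOnInterval_iff] at hf ⊢
  intro ε hε
  obtain ⟨δ, hδ, h⟩ := hf (ε / (K + 1)) (by positivity)
  refine ⟨δ, hδ, fun E hE hs => ?_⟩
  have h1 := h E hE hs
  rw [lt_div_iff₀ (by positivity)] at h1
  have h2 : ∑ i ∈ Finset.range E.1, dist (Ψ (f (E.2 i).1)) (Ψ (f (E.2 i).2)) ≤
      K * ∑ i ∈ Finset.range E.1, dist (f (E.2 i).1) (f (E.2 i).2) := by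
    rw [Finset.mul_sum]
    exact Finset.sum_le_sum fun i _ => hΨ.dist_le_mul _ _
  have h3 : 0 ≤ ∑ i ∈ Finset.range E.1, dist (f (E.2 i).1) (f (E.2 i).2) :=
    Finset.sum_nonneg fun _ _ => dist_nonneg
  nlinarith

lemma integral_comp_primitive {Ψ h : ℝ → ℝ} (hΨ : ∀ r, HasDerivAt Ψ (h r) r) {K : ℝ≥0}
    (hK : LipschitzWith K Ψ) {f : ℝ → ℝ} (hT : 0 ≤ T) (hf : IntegrableOn f (Ioo 0 T)) (c : ℝ) {t : ℝ}
    (ht : t ∈ Icc 0 T) :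
    Ψ (c + ∫ s in 0..t, f s)
      = Ψ c + ∫ s in 0..t, h (c + ∫ r in 0..s, f r) * f s := by
  have hac : AbsolutelyContinuousOnInterval (fun x => c + ∫ s in 0..x, f s) 0 T := by
    have h1 := (intervalIntegrable_of_Ioo hT hf).absolutelyContinuousOnInterval_intervalIntegral
      (c := 0) left_mem_uIcc
    have h2 : AbsolutelyContinuousOnInterval (fun _ : ℝ => c) 0 T :=
      ((LipschitzWith.const c).lipschitzOnWith (s := uIcc 0 T)).absolutelyContinuousOnInterval
    exact h2.add h1
  have hac2 := (hK.comp_absolutelyContinuousOnInterval hac).mono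
    (c := 0) (d := t) (by rw [uIcc_of_le hT, uIcc_of_le ht.1]; exact Icc_subset_Icc_right ht.2)
  have h3 := hac2.integral_deriv_eq_sub
  rw [integral_same, add_zero] at h3
  rw [← sub_eq_iff_eq_add', ← h3]
  refine intervalIntegral.integral_congr_ae ?_
  have h4 := ae_deriv_primitive hT hf
  rw [ae_restrict_iff' measurableSet_Ioo] at h4
  have h5 : ∀ᵐ x : ℝ, x ≠ T := by simp [ae_iff, measure_singleton]
  filter_upwards [h4, h5] with x hx hxT hxI
  rw [uIoc_of_le ht.1] at hxI
  have h6 := hx ⟨hxI.1, lt_of_le_of_ne (hxI.2.trans ht.2) hxT⟩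
  exact ((hΨ _).comp x (h6.const_add c)).deriv

/-- A function whose weak derivative is integrable is a.e. equal to a primitive. -/
lemma exists_primitive_of_weak_deriv (hT : 0 < T) {U U' : ℝ → ℝ} (hU : IntegrableOn U (Ioo 0 T))
    (hU' : IntegrableOn U' (Ioo 0 T))
    (h : ∀ α : ℝ → ℝ, Smooth α → HasCompactSupport α → tsupport α ⊆ Ioo 0 T →
      ∫ t in Ioo 0 T, deriv α t * U t = -∫ t in Ioo 0 T, α t * U' t) :
    ∃ c : ℝ, ∀ᵐ t ∂vI T, U t = c + ∫ s in 0..t, U' s := by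
  set V : ℝ → ℝ := fun t => ∫ s in 0..t, U' s with hV
  have hVac : AbsolutelyContinuousOnInterval V 0 T :=
    (intervalIntegrable_of_Ioo hT.le hU').absolutelyContinuousOnInterval_intervalIntegral left_mem_uIcc
  have hVc : ContinuousOn V (Icc 0 T) := by
    have := hVac.continuousOn; rwa [uIcc_of_le hT.le] at this
  have hVi : IntegrableOn V (Ioo 0 T) :=
    (hVc.integrableOn_compact isCompact_Icc).mono_set Ioo_subset_Icc_self
  have conv : ∀ f : ℝ → ℝ, ∫ t in 0..T, f t = ∫ t in Ioo 0 T, f t := fun f => by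
    rw [integral_of_le hT.le, integral_Ioc_eq_integral_Ioo]
  have hbm : ∀ {f g : ℝ → ℝ}, Continuous f → HasCompactSupport f → IntegrableOn g (Ioo 0 T) →
      IntegrableOn (fun t => f t * g t) (Ioo 0 T) := fun {f g} hf hc hg => by
    obtain ⟨C, hC⟩ := hf.bounded_above_of_compact_support hc
    exact hg.bdd_mul hf.aesm (of_forall hC)
  have hG : ∀ α : ℝ → ℝ, Smooth α → HasCompactSupport α → tsupport α ⊆ Ioo 0 T →
      ∫ t in Ioo 0 T, deriv α t * (U t - V t) = 0 := fun α hα hc hs => by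
    have hdc : Continuous (deriv α) := hα.continuous_deriv (by simp)
    have hds : HasCompactSupport (deriv α) := hc.deriv
    obtain ⟨C, hC⟩ := hα.lipschitzWith_of_hasCompactSupport hc (by simp)
    have hαac : AbsolutelyContinuousOnInterval α 0 T :=
      (hC.lipschitzOnWith (s := uIcc 0 T)).absolutelyContinuousOnInterval
    have hz : ∀ t, t ∉ Ioo 0 T → α t = 0 := fun t ht =>
      eq_zero_off fun h => ht (hs h)
    have h1 := hVac.integral_mul_deriv_eq_deriv_mul hαac
    rw [hz 0 (by simp), hz T (by simp), mul_zero, mul_zero, sub_zero, zero_sub, conv, conv] at h1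
    have h2 : ∫ t in Ioo 0 T, deriv V t * α t = ∫ t in Ioo 0 T, α t * U' t := by
      refine integral_congr_ae ?_
      filter_upwards [ae_deriv_primitive hT.le hU'] with t ht
      rw [ht.deriv, mul_comm]
    have h3 := h α hα hc hs
    simp only [mul_sub]
    rw [integral_sub (hbm hdc hds hU) (hbm hdc hds hVi), h3]
    have h4 : ∫ t in Ioo 0 T, deriv α t * V t = ∫ t in Ioo 0 T, V t * deriv α t := by
      simp only [mul_comm]
    rw [h4, h1, h2]; ring
  have hGi : IntegrableOn (fun t => U t - V t) (Ioo 0 T) := hU.sub hVi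
  -- a normalized bump
  let b : ContDiffBump (T / 2) := ⟨T / 8, T / 4, by positivity, by linarith⟩
  set β₀ : ℝ → ℝ := b.normed volume with hβ₀
  have hβs : tsupport β₀ ⊆ Ioo 0 T := by
    rw [hβ₀, b.tsupport_normed_eq, Real.closedBall_eq_Icc]
    intro x hx
    simp only [b, mem_Icc] at hx
    constructor <;> linarith [hx.1, hx.2]
  have hβ1 : ∫ t, β₀ t = 1 := b.integral_normed
  have hβd : Smooth β₀ := b.contDiff_normed
  have hβc : HasCompactSupport β₀ := b.hasCompactSupport_normed
  have hγ : ∀ γ : ℝ → ℝ, Smooth γ → HasCompactSupport γ → tsupport γ ⊆ Ioo 0 T →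
      ∫ t, γ t = 0 → ∫ t in Ioo 0 T, γ t * (U t - V t) = 0 := fun γ hγ hc hs h0 => by
    obtain ⟨δ, hδ, hδs⟩ := hc.exists_cthickening_subset_open isOpen_Ioo hs
    have hsub : tsupport γ ⊆ Icc δ (T - δ) := fun x hx => by
      have hm : ∀ y, dist y x ≤ δ → y ∈ Ioo 0 T := fun y hy =>
        hδs (mem_cthickening_of_dist_le y x δ _ hx hy)
      have m1 := hm (x - δ) (by rw [Real.dist_eq]; simp [abs_of_pos hδ])
      have m2 := hm (x + δ) (by rw [Real.dist_eq]; simp [abs_of_pos hδ])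
      constructor <;> linarith [m1.1, m2.2]
    set α : ℝ → ℝ := fun t => ∫ s in 0..t, γ s with hα
    have hd : ∀ t, HasDerivAt α (γ t) t := fun t =>
      integral_hasDerivAt_right (hγ.continuous.intervalIntegrable _ _)
        (hγ.continuous.stronglyMeasurableAtFilter _ _) hγ.continuous.continuousAt
    have hde : deriv α = γ := funext fun t => (hd t).deriv
    have hαs : Smooth α := by
      rw [contDiff_infty_iff_deriv]
      exact ⟨fun t => (hd t).differentiableAt, by rw [hde]; exact hγ⟩
    have hz : ∀ t, t ∉ Icc δ (T - δ) → γ t = 0 := fun t ht =>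
      eq_zero_off fun h => ht (hsub h)
    have hα0 : ∀ t, t ∉ Icc δ (T - δ) → α t = 0 := fun t ht => by
      rcases lt_or_ge t δ with htδ | htδ
      · refine (integral_congr fun s hs => ?_).trans intervalIntegral.integral_zero
        refine hz s fun hs' => ?_
        have : s ≤ max 0 t := by
          rw [uIcc, mem_Icc] at hs; exact hs.2
        have h2 : max 0 t < δ := max_lt hδ htδ
        linarith [hs'.1]
      · have ht2 : T - δ < t := by
          by_contra hcon; exact ht ⟨htδ, not_lt.1 hcon⟩
        rw [← h0, hα]
        simp only
        rw [integral_of_le (hδ.le.trans htδ)]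
        rw [setIntegral_eq_of_zero]
        intro x hx
        refine hz x fun hx' => hx ⟨hδ.trans_le hx'.1, hx'.2.trans ht2.le⟩
    have hts : tsupport α ⊆ Icc δ (T - δ) :=
      closure_minimal (fun x hx => by_contra fun hx' => hx (hα0 x hx')) isClosed_Icc
    have := hG α hαs (of_support_subset_isCompact isCompact_Icc
      ((subset_tsupport _).trans hts)) (hts.trans fun x hx => ⟨hδ.trans_le hx.1, hx.2.trans_lt (by linarith)⟩)
    rwa [hde] at this
  set c : ℝ := ∫ t in Ioo 0 T, β₀ t * (U t - V t) with hcdef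
  refine ⟨c, ?_⟩
  have hcI : IntegrableOn (fun _ : ℝ => c) (Ioo 0 T) :=
    integrableOn_const (by simp)
  have key := isOpen_Ioo.ae_eq_zero_of_integral_contDiff_smul_eq_zero (μ := volume)
    (f := fun t => (U t - V t) - c) (hGi.sub hcI).locallyIntegrableOn
    (fun β hβ hc hs => ?_)
  · rw [ae_restrict_iff' measurableSet_Ioo]
    filter_upwards [key] with t ht htI
    have := ht htI
    linarith
  have hset : ∀ f : ℝ → ℝ, ∫ x, β x • f x = ∫ x in Ioo 0 T, β x * f x := fun f => by
    rw [setIntegral_eq_of_zero]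
    · simp
    · intro x hx
      rw [eq_zero_off fun h => hx (hs h), zero_mul]
  rw [hset]
  have hβI : ∫ x in Ioo 0 T, β x * c = (∫ x, β x) * c := by
    rw [integral_mul_const]
    congr 1
    have := hset fun _ => 1
    simpa using this.symm
  have h1 := hγ (fun t => β t - (∫ s, β s) * β₀ t) (hβ.sub (contDiff_const.mul hβd))
    (hc.sub hβc.mul_left) ?_ ?_
  · simp only [sub_mul, mul_assoc] at h1
    rw [integral_sub (hbm hβ.continuous hc hGi) ((hbm hβd.continuous hβc hGi).const_mul _),
      integral_const_mul] at h1
    simp only [mul_sub]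
    have h2 : ∫ x in Ioo 0 T, (β x * (U x) - β x * V x - β x * c) =
        (∫ x in Ioo 0 T, β x * (U x - V x)) - ∫ x in Ioo 0 T, β x * c := by
      rw [← integral_sub (hbm hβ.continuous hc hGi) (hbm hβ.continuous hc hcI)]
      simp only [mul_sub]
    rw [h2, hβI]
    linarith
  · refine (tsupport_sub _ _).trans (union_subset hs ?_)
    exact (tsupport_mul_subset_right).trans hβs
  · rw [integral_sub (hβ.continuous.integrable_of_hasCompactSupport hc)
      ((hβd.continuous.integrable_of_hasCompactSupport hβc).const_mul _), integral_const_mul, hβ1]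
    ring

end

/-! ### Functions on space-time with an integrable weak time derivative -/

section

variable {T : ℝ}

lemma hasFDerivAt_prod_test {α : ℝ → ℝ} {κ : R[d]} {p : ℝ × Vec d}
    (hα : DifferentiableAt ℝ α p.1) (hκ : DifferentiableAt ℝ κ p.2) :
    ∇ (fun q : ℝ × Vec d => α q.1 * κ q.2) p (1, 0) = deriv α p.1 * κ p.2 := by
  have h1 : HasFDerivAt (fun q : ℝ × Vec d => α q.1)
      ((∇ α p.1).comp (ContinuousLinearMap.fst ℝ ℝ (Vec d))) p :=
    hα.hasFDerivAt.comp p hasFDerivAt_fst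
  have h2 : HasFDerivAt (fun q : ℝ × Vec d => κ q.2)
      ((∇ κ p.2).comp (ContinuousLinearMap.snd ℝ ℝ (Vec d))) p :=
    hκ.hasFDerivAt.comp p hasFDerivAt_snd
  have h3 : HasFDerivAt (fun q : ℝ × Vec d => α q.1 * κ q.2) _ p := h1.mul h2
  rw [h3.fderiv]
  simp [mul_comm]

lemma tsupport_prod_subset {α : ℝ → ℝ} {κ : R[d]} :
    tsupport (fun q : ℝ × Vec d => α q.1 * κ q.2) ⊆ tsupport α ×ˢ tsupport κ := by
  refine closure_minimal (fun q hq => ?_) ((isClosed_tsupport _).prod (isClosed_tsupport _))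
  rw [mem_support] at hq
  exact ⟨subset_tsupport _ (left_ne_zero_of_mul hq), subset_tsupport _ (right_ne_zero_of_mul hq)⟩

lemma HasWeakTimeDeriv.integral_test {u u' : ℝ → R[d]} (h : HasWeakTimeDeriv Ω T u u')
    (hu : Integrable (uncurry u) (ST Ω T)) (hu' : Integrable (uncurry u') (ST Ω T))
    {κ : R[d]} (hκ : IsTest Ω κ) {α : ℝ → ℝ} (hα : Smooth α)
    (hc : HasCompactSupport α) (hs : tsupport α ⊆ Ioo 0 T) :
    ∫ t in Ioo 0 T, deriv α t * ∫ x in Ω, κ x * u t x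
      = -∫ t in Ioo 0 T, α t * ∫ x in Ω, κ x * u' t x := by
  have h1 := h (fun q => α q.1 * κ q.2)
    ((hα.comp contDiff_fst).mul (hκ.smooth.comp contDiff_snd))
    (of_support_subset_isCompact (hc.isCompact.prod hκ.compact.isCompact)
      ((subset_tsupport _).trans tsupport_prod_subset))
    (tsupport_prod_subset.trans (prod_mono hs hκ.support))
  obtain ⟨C, hC⟩ := hα.continuous.bounded_above_of_compact_support hc
  obtain ⟨C', hC'⟩ := (hα.continuous_deriv (by simp)).bounded_above_of_compact_support hc.deriv
  obtain ⟨K, hK⟩ := hκ.bdd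
  have hi : ∀ {β : ℝ → ℝ} {C : ℝ} {w : ℝ → R[d]}, Continuous β → (∀ t, ‖β t‖ ≤ C) →
      Integrable (uncurry w) (ST Ω T) →
      Integrable (fun p : ℝ × Vec d => β p.1 * (κ p.2 * w p.1 p.2)) (ST Ω T) :=
    fun {β C w} hβ hb hw => (hw.bdd_mul (f := fun p : ℝ × Vec d => κ p.2)
      (hκ.cont.comp continuous_snd).aesm
      (of_forall fun p => hK p.2)).bdd_mul (hβ.comp continuous_fst).aesm
      (of_forall fun p => hb p.1)
  have e1 : ∀ p : ℝ × Vec d, ∇ (fun q : ℝ × Vec d => α q.1 * κ q.2) p (1, 0) • u p.1 p.2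
      = deriv α p.1 * (κ p.2 * u p.1 p.2) := fun p => by
    rw [hasFDerivAt_prod_test (hα.differentiable (by simp) _) (hκ.differentiable _), smul_eq_mul, mul_assoc]
  have e2 : ∀ p : ℝ × Vec d, (α p.1 * κ p.2) • u' p.1 p.2 = α p.1 * (κ p.2 * u' p.1 p.2) := fun p => by
    rw [smul_eq_mul, mul_assoc]
  simp only [e1, e2] at h1
  rw [spaceTime, integral_prod _ (hi (hα.continuous_deriv (by simp)) hC' hu),
    integral_prod _ (hi hα.continuous hC hu')] at h1
  simpa only [integral_const_mul] using h1

lemma ae_prod_eq_zero {X Y E : Type*} [MeasurableSpace X] [MeasurableSpace Y] {μ : Measure X}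
    {ν : Measure Y} [SFinite μ] [SFinite ν] [NormedAddCommGroup E] {f : X × Y → E}
    (hf : AESM f (μ.prod ν)) (h : ∀ᵐ x ∂μ, ∀ᵐ y ∂ν, f (x, y) = 0) :
    ∀ᵐ p ∂(μ.prod ν), f p = 0 := by
  borelize E
  have hm : MeasurableSet {p | hf.mk f p = 0} :=
    hf.stronglyMeasurable_mk.measurable (measurableSet_singleton 0)
  have h1 : ∀ᵐ p ∂(μ.prod ν), hf.mk f p = 0 := by
    refine (Measure.ae_prod_iff_ae_ae hm).2 ?_
    filter_upwards [h, ae_ae_of_ae_prod hf.ae_eq_mk] with x hx hx2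
    filter_upwards [hx, hx2] with y hy hy2
    rw [← hy2, hy]
  filter_upwards [h1, hf.ae_eq_mk] with p hp hp2
  rw [hp2, hp]

lemma spaceTime_ae_swap {p : ℝ → Vec d → Prop} (h : ∀ᵐ q ∂ST Ω T, p q.1 q.2) :
    ∀ᵐ x ∂vol Ω, ∀ᵐ t ∂vI T, p t x := by
  have h6 : ∀ᵐ q ∂((vol Ω).prod (vI T)), p q.swap.1 q.swap.2 :=
    (measurePreserving_swap (μ := vol Ω)
        (ν := vI T)).quasiMeasurePreserving.ae h
  exact ae_ae_of_ae_prod h6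

lemma Integrable.ae_time {u : ℝ → Vec d → E}
    (hu : Integrable (uncurry u) (ST Ω T)) :
    ∀ᵐ x ∂vol Ω, IntegrableOn (fun t => u t x) (Ioo 0 T) :=
  Integrable.prod_left_ae hu

lemma ae_mem_ST : ∀ᵐ p ∂ST Ω T, p.1 ∈ Ioo 0 T := quasiMeasurePreserving_fst.ae ae_mem_Ioo

lemma Integrable.ae_time_ST {u : ℝ → Vec d → E} (hu : Integrable (uncurry u) (ST Ω T)) :
    ∀ᵐ p ∂ST Ω T, IntegrableOn (fun t => u t p.2) (Ioo 0 T) := quasiMeasurePreserving_snd.ae (Integrable.ae_time hu)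

lemma aesm_primitive {u' : ℝ → Vec d → E}
    (hu' : AESM (uncurry u') (ST Ω T)) :
    AESM (fun p : ℝ × Vec d => ∫ s in 0..p.1, u' s p.2) (ST Ω T) := by
  set w := hu'.mk _ with hw
  have hwm : StronglyMeasurable w := hu'.stronglyMeasurable_mk
  have h1 : StronglyMeasurable fun p : ℝ × Vec d =>
      ∫ s in Ioo 0 T, (if s ≤ p.1 then w (s, p.2) else 0) := by
    have h2 : StronglyMeasurable fun q : (ℝ × Vec d) × ℝ => if q.2 ≤ q.1.1 then w (q.2, q.1.2) else 0 := by
      refine StronglyMeasurable.ite (measurableSet_le measurable_snd measurable_fst.fst) ?_ stronglyMeasurable_const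
      exact hwm.comp_measurable (measurable_snd.prodMk measurable_fst.snd)
    exact h2.integral_prod_right' (ν := vI T)
  refine ⟨_, h1, ?_⟩
  have h3 : ∀ᵐ p ∂ST Ω T, p.1 ∈ Ioo 0 T := ae_mem_ST
  have h4 : ∀ᵐ x ∂vol Ω, ∀ᵐ s ∂vI T, u' s x = w (s, x) := spaceTime_ae_swap hu'.ae_eq_mk
  have h7 : ∀ᵐ p ∂ST Ω T, ∀ᵐ s ∂vI T, u' s p.2 = w (s, p.2) :=
    (quasiMeasurePreserving_snd (μ := vI T)
      (ν := vol Ω)).ae h4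
  filter_upwards [h3, h7] with p hp hp2
  rw [integral_of_le hp.1.le]
  have e : ∫ s in Ioo 0 T, (if s ≤ p.1 then w (s, p.2) else 0)
      = ∫ s in Ioo 0 T, (Iic p.1).indicator (fun s => w (s, p.2)) s := by
    congr 1
  rw [e, integral_indicator measurableSet_Iic, Measure.restrict_restrict measurableSet_Iic]
  have e2 : Iic p.1 ∩ Ioo 0 T = Ioc 0 p.1 := by
    ext s; simp only [mem_inter_iff, mem_Iic, mem_Ioo, mem_Ioc]
    constructor
    · rintro ⟨a, b, _⟩; exact ⟨b, a⟩
    · rintro ⟨a, b⟩; exact ⟨b, a, b.trans_lt hp.2⟩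
  rw [e2]
  refine integral_congr_ae ?_
  exact ae_restrict_of_ae_restrict_of_subset
    (show Ioc 0 p.1 ⊆ Ioo 0 T from fun s hs => ⟨hs.1, hs.2.trans_lt hp.2⟩) hp2

lemma spaceTime_ae_ae {p : ℝ → Vec d → Prop} (h : ∀ᵐ q ∂ST Ω T, p q.1 q.2) :
    ∀ᵐ t ∂vI T, ∀ᵐ x ∂vol Ω, p t x :=
  ae_ae_of_ae_prod h

lemma norm_primitive_le {f : ℝ → E}
    (hf : IntegrableOn f (Ioo 0 T)) {t : ℝ} (ht : t ∈ Ioo 0 T) :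
    ‖∫ s in 0..t, f s‖ ≤ ∫ s in Ioo 0 T, ‖f s‖ := by
  refine (intervalIntegral.norm_integral_le_integral_norm ht.1.le).trans ?_
  rw [integral_of_le ht.1.le]
  exact setIntegral_mono_set hf.norm (of_forall fun _ => norm_nonneg _)
    (of_forall fun s hs => (⟨hs.1, hs.2.trans_lt ht.2⟩ : s ∈ Ioo 0 T))

lemma integrable_primitive {u' : ℝ → Vec d → E}
    (hu' : Integrable (uncurry u') (ST Ω T)) :
    Integrable (fun p : ℝ × Vec d => ∫ s in 0..p.1, u' s p.2) (ST Ω T) := by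
  have h1 : Integrable (fun x => ∫ s in Ioo 0 T, ‖u' s x‖) (vol Ω) :=
    hu'.norm.integral_prod_right
  have h2 : Integrable (fun p : ℝ × Vec d => ∫ s in Ioo 0 T, ‖u' s p.2‖) (ST Ω T) := by
    have : Integrable (fun _ : ℝ => (1 : ℝ)) (vI T) :=
      integrable_const 1
    have := this.mul_prod h1
    simpa [spaceTime] using this
  refine h2.mono' (aesm_primitive hu'.1) ?_
  have h3 : ∀ᵐ p ∂ST Ω T, p.1 ∈ Ioo 0 T := ae_mem_ST
  have h4 : ∀ᵐ p ∂ST Ω T, IntegrableOn (fun t => u' t p.2) (Ioo 0 T) := Integrable.ae_time_ST hu'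
  filter_upwards [h3, h4] with p hp hp4
  exact norm_primitive_le hp4 hp

lemma integral_primitive_swap {u' : ℝ → R[d]}
    (hu' : Integrable (uncurry u') (ST Ω T)) {t : ℝ} (ht : t ∈ Ioo 0 T) :
    ∫ x in Ω, ∫ s in 0..t, u' s x = ∫ s in 0..t, ∫ x in Ω, u' s x := by
  simp only [integral_of_le ht.1.le]
  rw [integral_integral_swap]
  have h1 : Integrable (uncurry u') ((vol (Ioc 0 t)).prod (vol Ω)) := by
    refine hu'.mono_measure (prod_mono (restrict_mono
      (show Ioc 0 t ⊆ Ioo 0 T from fun s hs => ⟨hs.1, hs.2.trans_lt ht.2⟩) le_rfl) le_rfl)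
  exact h1.swap

/-- A function with an integrable weak time derivative is a.e. the primitive of the latter. -/
lemma HasWeakTimeDeriv.exists_primitive_real (hΩ : IsOpen Ω) (hT : 0 < T) {u u' : ℝ → R[d]}
    (h : HasWeakTimeDeriv Ω T u u') (hu : Integrable (uncurry u) (ST Ω T))
    (hu' : Integrable (uncurry u') (ST Ω T)) :
    ∃ c : R[d], IntegrableOn c Ω ∧
      ∀ᵐ p ∂ST Ω T, u p.1 p.2 = c p.2 + ∫ s in 0..p.1, u' s p.2 := by
  set g : ℝ → R[d] := fun t x => u t x - ∫ s in 0..t, u' s x with hg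
  have hgi : Integrable (uncurry g) (ST Ω T) := hu.sub (integrable_primitive hu')
  set c : R[d] := fun x => T⁻¹ * ∫ t in Ioo 0 T, g t x with hc
  have hci : IntegrableOn c Ω := (Integrable.integral_prod_right hgi).const_mul _
  refine ⟨c, hci, ?_⟩
  have hk : ∀ κ : R[d], IsTest Ω κ → ∃ C, ∀ᵐ t ∂vI T,
      ∫ x in Ω, κ x * g t x = C := fun κ hκ => by
    obtain ⟨K, hK⟩ := hκ.bdd
    have hm : ∀ {w : ℝ → R[d]}, Integrable (uncurry w) (ST Ω T) →
        Integrable (uncurry fun t x => κ x * w t x) (ST Ω T) := fun {w} hw =>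
      hw.bdd_mul (f := fun p : ℝ × Vec d => κ p.2)
        (hκ.cont.comp continuous_snd).aesm
        (of_forall fun p => hK p.2)
    obtain ⟨C, hC⟩ := exists_primitive_of_weak_deriv hT (hm hu).integral_prod_left (hm hu').integral_prod_left
      fun α hα hcα hs => h.integral_test hu hu' hκ hα hcα hs
    refine ⟨C, ?_⟩
    filter_upwards [hC, ae_mem_Ioo, (hm hu).prod_right_ae,
      (hm (w := fun t x => ∫ s in 0..t, u' s x) (integrable_primitive hu')).prod_right_ae] with t h1 ht h2 h3
    have e : ∀ x, κ x * g t x = κ x * u t x - κ x * ∫ s in 0..t, u' s x := fun x => by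
      simp only [hg]; ring
    simp only [e]
    have h23 : ∫ x in Ω, (κ x * u t x - κ x * ∫ s in 0..t, u' s x) = _ := integral_sub h2 h3
    rw [h23]
    have h4 := integral_primitive_swap (hm hu') ht
    simp only [intervalIntegral.integral_const_mul] at h4
    simp only [uncurry] at h1 ⊢
    rw [h4, h1]; ring
  have hcut : ∀ q ∈ Icc 0 T, ∀ᵐ x ∂vol Ω, ∫ t in 0..q, g t x = q * c x := by
    intro q hq
    have hgq : Integrable (uncurry g) ((vol (Ioc 0 q)).prod (vol Ω)) := by
      have h1 : Integrable (uncurry g) ((vol (Ioc 0 T)).prod (vol Ω)) := by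
        rw [restrict_Ioo_eq_restrict_Ioc.symm]; exact hgi
      exact h1.mono_measure (prod_mono (restrict_mono (Ioc_subset_Ioc_right hq.2) le_rfl) le_rfl)
    have hli : IntegrableOn (fun x => (∫ t in 0..q, g t x) - q * c x) Ω := by
      simp only [integral_of_le hq.1]
      exact (Integrable.integral_prod_right hgq).sub (hci.const_mul _)
    have hz := hΩ.ae_eq_zero_of_integral_contDiff_smul_eq_zero hli.locallyIntegrableOn fun κ hκ1 hκ2 hκ3 => ?_
    · rw [ae_restrict_iff' hΩ.measurableSet]
      filter_upwards [hz] with x hx hxΩ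
      exact sub_eq_zero.1 (hx hxΩ)
    have hκ : IsTest Ω κ := ⟨hκ1, hκ2, hκ3⟩
    obtain ⟨C, hC⟩ := hk κ hκ
    obtain ⟨K, hK⟩ := hκ.bdd
    have hmul : ∀ {f : R[d]}, IntegrableOn f Ω → IntegrableOn (fun x => κ x * f x) Ω := fun hf =>
      hf.bdd_mul hκ.cont.aesm (of_forall hK)
    have hsw : ∀ r ∈ Icc 0 T, Integrable (uncurry g) ((vol (Ioc 0 r)).prod (vol Ω)) →
        ∫ x in Ω, κ x * ∫ t in Ioc 0 r, g t x = r * C := fun r hr hgr => by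
      have h2 : Integrable (uncurry fun t x => κ x * g t x) ((vol (Ioc 0 r)).prod (vol Ω)) :=
        hgr.bdd_mul (f := fun p : ℝ × Vec d => κ p.2)
          (hκ.cont.comp continuous_snd).aesm
          (of_forall fun p => hK p.2)
      calc ∫ x in Ω, κ x * ∫ t in Ioc 0 r, g t x = ∫ x in Ω, ∫ t in Ioc 0 r, κ x * g t x := by
            simp only [integral_const_mul]
        _ = ∫ t in Ioc 0 r, ∫ x in Ω, κ x * g t x := integral_integral_swap h2.swap
        _ = ∫ t in Ioc 0 r, C := by
          refine integral_congr_ae ?_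
          rw [← restrict_Ioo_eq_restrict_Ioc]
          exact ae_restrict_of_ae_restrict_of_subset (Ioo_subset_Ioo_right hr.2) hC
        _ = r * C := by
          simp [hr.1]
    rw [setIntegral_eq_of_zero (s := Ω) (f := fun x => κ x • ((∫ t in 0..q, g t x) - q * c x))
      (fun x hx => by rw [hκ.eq_zero hx, zero_smul]) |>.symm]
    simp only [smul_eq_mul, mul_sub, integral_of_le hq.1]
    have hsub : ∫ x in Ω, (κ x * (∫ t in Ioc 0 q, g t x) - κ x * (q * c x)) = _ :=
      integral_sub (hmul (Integrable.integral_prod_right hgq)) (hmul (hci.const_mul q))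
    rw [hsub, hsw q hq hgq]
    have hgT : Integrable (uncurry g) ((vol (Ioc 0 T)).prod (vol Ω)) := by
      rw [restrict_Ioo_eq_restrict_Ioc.symm]; exact hgi
    have h5 := hsw T (right_mem_Icc.2 hT.le) hgT
    have h6 : ∀ x, κ x * (q * c x) = q * T⁻¹ * (κ x * ∫ t in Ioc 0 T, g t x) := fun x => by
      simp only [hc, integral_Ioc_eq_integral_Ioo]; ring
    simp only [h6]
    rw [integral_const_mul, h5]
    field_simp
    ring
  have hrat : ∀ᵐ x ∂vol Ω, ∀ q : ℚ, (q : ℝ) ∈ Icc 0 T → ∫ t in 0..q, g t x = q * c x := by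
    rw [ae_all_iff]
    intro q
    by_cases hq : (q : ℝ) ∈ Icc 0 T
    · filter_upwards [hcut q hq] with x hx _ using hx
    · exact of_forall fun x hx => absurd hx hq
  have hfin : ∀ᵐ x ∂vol Ω, ∀ᵐ t ∂vI T, g t x = c x := by
    filter_upwards [hrat, Integrable.ae_time hgi] with x hx hxi
    have hcont : ContinuousOn (fun t => (∫ s in 0..t, g s x) - t * c x) (Icc 0 T) := by
      have h1 := continuousOn_primitive_interval' (μ := volume)
        (intervalIntegrable_of_Ioo hT.le hxi) left_mem_uIcc
      rw [uIcc_of_le hT.le] at h1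
      exact h1.sub (continuousOn_id.mul continuousOn_const)
    have hall : ∀ t ∈ Ioo 0 T, ∫ s in 0..t, g s x = t * c x := by
      intro t ht
      by_contra hne
      have hne' : (∫ s in 0..t, g s x) - t * c x ≠ 0 := sub_ne_zero.2 hne
      have hca := (hcont.mono Ioo_subset_Icc_self).continuousAt (isOpen_Ioo.mem_nhds ht)
      have hev := (hca.eventually_ne hne').and (isOpen_Ioo.mem_nhds ht)
      obtain ⟨r, hr⟩ := Rat.denseRange_cast.exists_mem_open isOpen_interior ⟨t, mem_interior_iff_mem_nhds.2 hev⟩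
      have := interior_subset hr
      exact this.1 (sub_eq_zero.2 (hx r (Ioo_subset_Icc_self this.2)))
    filter_upwards [ae_mem_Ioo, ae_deriv_primitive hT.le hxi] with t ht hd
    have hd2 : HasDerivAt (fun t => t * c x) (c x) t := by simpa using (hasDerivAt_id t).mul_const (c x)
    refine hd.unique (hd2.congr_of_eventuallyEq ?_)
    filter_upwards [isOpen_Ioo.mem_nhds ht] with s hs using hall s hs
  have hmeas : AESM (fun p : ℝ × Vec d => g p.1 p.2 - c p.2) (ST Ω T) :=
    hgi.1.sub (hci.1.comp_quasiMeasurePreserving quasiMeasurePreserving_snd)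
  have hae : ∀ᵐ p ∂ST Ω T, g p.1 p.2 - c p.2 = 0 := by
    have hm' : AESM (fun q : Vec d × ℝ => g q.2 q.1 - c q.1)
        ((vol Ω).prod (vI T)) := hmeas.prod_swap
    have h0 := ae_prod_eq_zero hm' (by
      filter_upwards [hfin] with x hx
      filter_upwards [hx] with t ht using sub_eq_zero.2 ht)
    exact (measurePreserving_swap (μ := vI T)
        (ν := vol Ω)).quasiMeasurePreserving.ae h0
  filter_upwards [hae] with p hp
  have := sub_eq_zero.1 hp
  simp only [hg] at this
  linarith

end

/-! ### Time derivatives of products -/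

section

lemma eLpNorm_bilin_le_of_holder {α G : Type*} [MeasurableSpace α] {μ : Measure α}
    [NormedAddCommGroup G] [NormedSpace ℝ G] (L : E →L[ℝ] F →L[ℝ] G) {p q : ℝ≥0∞} [p.HolderTriple q 1]
    {f : α → E} {g : α → F}
    (hf : AESM f μ) (hg : AESM g μ) :
    eLpNorm (fun x => L (f x) (g x)) 1 μ ≤ ‖L‖₊ * eLpNorm f p μ * eLpNorm g q μ :=
  eLpNorm_le_eLpNorm_mul_eLpNorm_of_nnnorm hf hg (fun a b => L a b) ‖L‖₊
    (of_forall fun x => by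
      rw [← NNReal.coe_le_coe]; push_cast; exact L.le_opNorm₂ _ _)

lemma integrable_bilin_of_holder {α G : Type*} [MeasurableSpace α] {μ : Measure α}
    [NormedAddCommGroup G] [NormedSpace ℝ G] (L : E →L[ℝ] F →L[ℝ] G) {p q : ℝ≥0∞} [p.HolderTriple q 1]
    {f : α → E} {g : α → F} (hf : MemLp f p μ) (hg : MemLp g q μ) :
    Integrable (fun x => L (f x) (g x)) μ := by
  rw [← memLp_one_iff_integrable]
  refine ⟨L.aestronglyMeasurable_comp₂ hf.1 hg.1, (eLpNorm_bilin_le_of_holder L (p := p) (q := q) hf.1 hg.1).trans_lt ?_⟩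
  exact mul_lt_top (mul_lt_top ENNReal.coe_lt_top hf.2) hg.2

def timeShift {G : Type*} (y : ℝ) (f : ℝ × Vec d → G) (z : ℝ × Vec d) : G := f (z + (y, 0))

lemma measurePreserving_timeShift (y : ℝ) :
    MeasurePreserving (fun z : ℝ × Vec d => z + (y, 0)) volume volume := by
  have : Measure.IsAddRightInvariant (volume : Measure (ℝ × Vec d)) :=
    inferInstanceAs (Measure.IsAddRightInvariant ((volume : Measure ℝ).prod (volume : Measure (Vec d))))
  exact measurePreserving_add_right volume _

lemma MeasureTheory.MemLp.timeShift {G : Type*} [NormedAddCommGroup G] {p : ℝ≥0∞} {f : ℝ × Vec d → G} (hf : MemLp f p volume) (y : ℝ) :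
    MemLp (_root_.timeShift y f) p volume := hf.comp_measurePreserving (measurePreserving_timeShift y)

lemma eLpNorm_timeShift {G : Type*} [NormedAddCommGroup G] {p : ℝ≥0∞} {f : ℝ × Vec d → G} (hf : AESM f volume) (y : ℝ) :
    eLpNorm (timeShift y f) p volume = eLpNorm f p volume :=
  eLpNorm_comp_measurePreserving hf (measurePreserving_timeShift y)

lemma tendsto_timeShift {G : Type*} [NormedAddCommGroup G] {p : ℝ≥0∞} [Fact (1 ≤ p)] (hp : p ≠ ⊤)
    {f : ℝ × Vec d → G}
    (hf : MemLp f p volume) :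
    Tendsto (fun y => eLpNorm (timeShift y f - f) p volume) (𝓝 0) (𝓝 0) := by
  have h1 : Measure.IsAddHaarMeasure (volume : Measure (ℝ × Vec d)) :=
    inferInstanceAs (Measure.IsAddHaarMeasure ((volume : Measure ℝ).prod (volume : Measure (Vec d))))
  have h := tendsto_eLpNorm_translate (μ := (volume : Measure (ℝ × Vec d))) hp hf
  have h2 : Tendsto (fun y : ℝ => (y, (0 : Vec d))) (𝓝 0) (𝓝 0) := by
    have : Continuous fun y : ℝ => (y, (0 : Vec d)) := by fun_prop
    exact this.tendsto 0
  exact h.comp h2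

lemma lintegral_bilin_shift_sub_le (L : E →L[ℝ] F →L[ℝ] ℝ) {p q : ℝ≥0∞} [p.HolderTriple q 1]
    {a : ℝ × Vec d → E} {b : ℝ × Vec d → F} (ha : MemLp a p volume) (hb : MemLp b q volume) (y z : ℝ) :
    ∫⁻ t, ‖(∫ x, L (a (t + y, x)) (b (t + z, x))) - ∫ x, L (a (t, x)) (b (t, x))‖ₑ
      ≤ ‖L‖₊ * eLpNorm (timeShift y a - a) p volume * eLpNorm b q volume
        + ‖L‖₊ * eLpNorm a p volume * eLpNorm (timeShift z b - b) q volume := by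
  have i1 : Integrable (fun w => L (timeShift y a w) (timeShift z b w)) volume :=
    integrable_bilin_of_holder L (p := p) (q := q) (ha.timeShift y) (hb.timeShift z)
  have i2 : Integrable (fun w => L (a w) (b w)) volume := integrable_bilin_of_holder L (p := p) (q := q) ha hb
  have hs : ∀ (t r : ℝ) (x : Vec d), ((t, x) + (r, 0) : ℝ × Vec d) = (t + r, x) := fun t r x => by simp
  calc _ ≤ ∫⁻ t, ∫⁻ x, ‖L (timeShift y a (t, x)) (timeShift z b (t, x)) - L (a (t, x)) (b (t, x))‖ₑ := by
        refine lintegral_mono_ae ?_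
        filter_upwards [i1.prod_right_ae, i2.prod_right_ae] with t h1 h2
        simp only [timeShift, hs] at h1 ⊢
        rw [← integral_sub h1 h2]
        exact enorm_integral_le_lintegral_enorm _
    _ = ∫⁻ w : ℝ × Vec d, ‖L (timeShift y a w) (timeShift z b w) - L (a w) (b w)‖ₑ :=
        (lintegral_prod _ (i1.sub i2).1.enorm).symm
    _ = eLpNorm ((fun w => L ((timeShift y a - a) w) (timeShift z b w))
          + fun w => L (a w) ((timeShift z b - b) w)) 1 volume := by
        rw [eLpNorm_one_eq_lintegral_enorm]
        congr 1; ext w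
        congr 1
        simp only [Pi.add_apply, Pi.sub_apply, map_sub, _root_.sub_apply]
        abel
    _ ≤ _ := by
        refine (eLpNorm_add_le (L.aestronglyMeasurable_comp₂ ((ha.timeShift y).sub ha).1 (hb.timeShift z).1)
          (L.aestronglyMeasurable_comp₂ ha.1 ((hb.timeShift z).sub hb).1) le_rfl).trans (add_le_add ?_ ?_)
        · refine (eLpNorm_bilin_le_of_holder L (p := p) (q := q) ((ha.timeShift y).sub ha).1
            (hb.timeShift z).1).trans ?_
          rw [eLpNorm_timeShift hb.1]
        · exact eLpNorm_bilin_le_of_holder L (p := p) (q := q) ha.1 ((hb.timeShift z).sub hb).1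

/-- Reconstruction of the increments of a function from approximations of its difference quotients. -/
lemma sub_eq_integral_of_average {f k₀ : ℝ → ℝ} {T₁ T₂ : ℝ} (h12 : T₁ ≤ T₂)
    (hf : LocallyIntegrable f volume)
    (hd₁ : ∀ c, HasDerivAt (fun x => ∫ t in c..x, f t) (f T₁) T₁)
    (hd₂ : ∀ c, HasDerivAt (fun x => ∫ t in c..x, f t) (f T₂) T₂)
    (hk₀ : IntegrableOn k₀ (Ioc T₁ T₂)) {k : ℝ → ℝ → ℝ → ℝ} {ω : ℝ → ℝ≥0∞}
    (hkm : ∀ h, StronglyMeasurable (uncurry (k h)))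
    (hω : Tendsto ω (𝓝[>] 0) (𝓝 0))
    (hk : ∀ h > 0, ∀ y ∈ Ioc 0 h, ∫⁻ t in Ioc T₁ T₂, ‖k h t y - k₀ t‖ₑ ≤ ω h)
    (hinc : ∀ᶠ h in 𝓝[>] 0, ∀ᵐ t ∂vol (Ioc T₁ T₂),
      IntegrableOn (k h t) (Ioc 0 h) → f (t + h) - f t = ∫ y in Ioc 0 h, k h t y) :
    f T₂ - f T₁ = ∫ t in Ioc T₁ T₂, k₀ t := by
  have hI : ∀ x y : ℝ, IntervalIntegrable f volume x y := fun x y =>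
    intervalIntegrable_iff.mpr ((hf.integrableOn_isCompact isCompact_uIcc).mono_set uIoc_subset_uIcc)
  have hsh : ∀ h, IntervalIntegrable (fun t => f (t + h)) volume T₁ T₂ := fun h => by
    simpa using (hI (T₁ + h) (T₂ + h)).comp_add_right h
  have lim1 : Tendsto (fun h => h⁻¹ * ∫ t in Ioc T₁ T₂, (f (t + h) - f t)) (𝓝[>] 0) (𝓝 (f T₂ - f T₁)) := by
    have s1 := (hasDerivAt_iff_tendsto_slope_zero.1 (hd₁ 0)).mono_left
      (nhdsWithin_mono (0 : ℝ) fun x (hx : (0 : ℝ) < x) => hx.ne')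
    have s2 := (hasDerivAt_iff_tendsto_slope_zero.1 (hd₂ 0)).mono_left
      (nhdsWithin_mono (0 : ℝ) fun x (hx : (0 : ℝ) < x) => hx.ne')
    refine (s2.sub s1).congr fun h => ?_
    rw [← integral_of_le h12]
    rw [intervalIntegral.integral_sub (hsh h) (hI _ _), intervalIntegral.integral_comp_add_right]
    rw [integral_interval_sub_left (hI _ _) (hI _ _),
      integral_interval_sub_left (hI _ _) (hI _ _), ← smul_sub, smul_eq_mul]
    congr 1
    rw [← integral_add_adjacent_intervals (hI T₂ (T₁ + h)) (hI _ (T₂ + h)),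
      ← integral_add_adjacent_intervals (hI T₁ T₂) (hI T₂ (T₁ + h))]
    ring
  refine tendsto_nhds_unique lim1 ?_
  rw [tendsto_iff_norm_sub_tendsto_zero]
  have hω' : Tendsto (fun h => (ω h).toReal) (𝓝[>] 0) (𝓝 0) := by
    have := (ENNReal.tendsto_toReal ENNReal.zero_ne_top).comp hω
    rwa [ENNReal.toReal_zero] at this
  refine squeeze_zero' (of_forall fun _ => norm_nonneg _) ?_ hω'
  filter_upwards [self_mem_nhdsWithin, hinc, hω.eventually (gt_mem_nhds ENNReal.zero_lt_top)]
    with h hh hinc' hωt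
  have hh0 : (0 : ℝ) < h := hh
  have hsub : AESM (fun p : ℝ × ℝ => k h p.1 p.2 - k₀ p.1)
      ((vol (Ioc T₁ T₂)).prod (vol (Ioc 0 h))) :=
    (hkm h).aestronglyMeasurable.sub
      (hk₀.1.comp_quasiMeasurePreserving quasiMeasurePreserving_fst)
  have hbd : ∫⁻ t in Ioc T₁ T₂, ∫⁻ y in Ioc 0 h, ‖k h t y - k₀ t‖ₑ ≤ ofReal h * ω h := by
    rw [lintegral_lintegral_swap hsub.enorm]
    calc _ ≤ ∫⁻ _ in Ioc 0 h, ω h := by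
          refine lintegral_mono_ae ?_
          filter_upwards [ae_restrict_mem measurableSet_Ioc] with y hy using hk h hh0 y hy
      _ = _ := by rw [lintegral_const, restrict_apply_univ, Real.volume_Ioc, sub_zero, mul_comm]
  have hfin : ofReal h * ω h < ⊤ := mul_lt_top ENNReal.ofReal_lt_top hωt
  have hint : Integrable (fun p : ℝ × ℝ => k h p.1 p.2 - k₀ p.1)
      ((vol (Ioc T₁ T₂)).prod (vol (Ioc 0 h))) := by
    refine ⟨hsub, ?_⟩
    rw [HasFiniteIntegral, lintegral_prod _ hsub.enorm]
    exact hbd.trans_lt hfin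
  have e1 : ∀ᵐ t ∂vol (Ioc T₁ T₂),
      h⁻¹ * (f (t + h) - f t) - k₀ t = h⁻¹ * ∫ y in Ioc 0 h, (k h t y - k₀ t) := by
    filter_upwards [hinc', hint.prod_right_ae] with t ht hti
    have hc : IntegrableOn (fun _ : ℝ => k₀ t) (Ioc 0 h) := integrableOn_const (by simp)
    have hki : IntegrableOn (k h t) (Ioc 0 h) := by
      have := hti.add hc
      refine this.congr (of_forall fun y => ?_)
      simp
    rw [ht hki, integral_sub hki hc, setIntegral_const]
    simp only [Real.volume_real_Ioc_of_le hh0.le, sub_zero, smul_eq_mul, mul_sub]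
    field_simp
  have hfi : IntegrableOn (fun t => f (t + h) - f t) (Ioc T₁ T₂) := ((hsh h).sub (hI _ _)).1
  have e2 : h⁻¹ * (∫ t in Ioc T₁ T₂, (f (t + h) - f t)) - ∫ t in Ioc T₁ T₂, k₀ t
      = h⁻¹ * ∫ t in Ioc T₁ T₂, ∫ y in Ioc 0 h, (k h t y - k₀ t) := by
    rw [← integral_const_mul, ← integral_const_mul, ← integral_sub (hfi.const_mul _) hk₀]
    exact integral_congr_ae e1
  rw [e2, norm_mul, norm_inv, norm_of_nonneg hh0.le]
  have e3 : ‖∫ t in Ioc T₁ T₂, ∫ y in Ioc 0 h, (k h t y - k₀ t)‖ₑ ≤ ofReal h * ω h := by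
    refine (enorm_integral_le_lintegral_enorm _).trans (le_trans (lintegral_mono fun t => ?_) hbd)
    exact enorm_integral_le_lintegral_enorm _
  have e4 := ENNReal.toReal_mono hfin.ne e3
  rw [ENNReal.toReal_mul, ENNReal.toReal_ofReal hh0.le, toReal_enorm] at e4
  rw [inv_mul_le_iff₀ hh0]
  exact e4

lemma ae_lebesgue_point {f : ℝ → ℝ} (hf : LocallyIntegrable f volume) :
    ∀ᵐ x, ∀ c, HasDerivAt (fun x => ∫ t in c..x, f t) (f x) x :=
  LocallyIntegrable.ae_hasDerivAt_integral hf

variable {E' F' : Type*} [NormedAddCommGroup E'] [NormedSpace ℝ E'] [NormedAddCommGroup F']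
  [NormedSpace ℝ F']

lemma stronglyMeasurable_shift_pairing (M : E →L[ℝ] F →L[ℝ] ℝ) {g : ℝ × Vec d → E}
    {g' : ℝ × Vec d → F} (hg : StronglyMeasurable g) (hg' : StronglyMeasurable g') (h : ℝ) :
    StronglyMeasurable (uncurry fun t y => ∫ x, M (g (t + y, x)) (g' (t + h, x))) := by
  have hm : StronglyMeasurable fun z : (ℝ × ℝ) × Vec d => M (g (z.1.1 + z.1.2, z.2)) (g' (z.1.1 + h, z.2)) := by
    have m1 : StronglyMeasurable fun z : (ℝ × ℝ) × Vec d => g (z.1.1 + z.1.2, z.2) :=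
      hg.comp_measurable (by fun_prop)
    have m2 : StronglyMeasurable fun z : (ℝ × ℝ) × Vec d => g' (z.1.1 + h, z.2) :=
      hg'.comp_measurable (by fun_prop)
    exact M.continuous₂.comp_stronglyMeasurable (m1.prodMk m2)
  exact hm.integral_prod_right' (ν := volume)

lemma steklov_aux (L : E →L[ℝ] F →L[ℝ] ℝ) (L' : E' →L[ℝ] F' →L[ℝ] ℝ) {p q : ℝ≥0∞} [p.HolderTriple q 1]
    [Fact (1 ≤ p)] (hp : p ≠ ⊤) {a : ℝ × Vec d → E} {b : ℝ × Vec d → F} {c : ℝ × Vec d → E'}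
    {e : ℝ × Vec d → F'} (ha : MemLp a p volume) (hb : MemLp b q volume) (hc : MemLp c 2)
    (he : MemLp e 2) (ham : StronglyMeasurable a) (hbm : StronglyMeasurable b)
    (hcm : StronglyMeasurable c) (hem : StronglyMeasurable e) {T : ℝ} {f : ℝ → ℝ}
    (hf : LocallyIntegrable f volume) {P : ℝ → Prop} (hP : ∀ᵐ t ∂vI T, P t)
    (hinc : ∀ t s, P t → P s → 0 < t → t < s → s < T → f s - f t =
      ∫ r in t..s, ((∫ x, L (a (r, x)) (b (t, x))) + ∫ x, L' (c (r, x)) (e (s, x)))) :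
    ∀ᵐ T₁, ∀ᵐ T₂, 0 < T₁ → T₁ < T₂ → T₂ < T → f T₂ - f T₁ =
      ∫ t in T₁..T₂, ((∫ x, L (a (t, x)) (b (t, x))) + ∫ x, L' (c (t, x)) (e (t, x))) := by
  filter_upwards [ae_lebesgue_point hf] with T₁ hd₁
  filter_upwards [ae_lebesgue_point hf] with T₂ hd₂ h0 h12 h2T
  rw [integral_of_le h12.le]
  have i1 : Integrable (fun w => L (a w) (b w)) volume := integrable_bilin_of_holder L (p := p) (q := q) ha hb
  have i2 : Integrable (fun w => L' (c w) (e w)) volume := integrable_bilin L' hc he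
  have j1 : Integrable (fun t => ∫ x, L (a (t, x)) (b (t, x))) volume := Integrable.integral_prod_left i1
  have j2 : Integrable (fun t => ∫ x, L' (c (t, x)) (e (t, x))) volume := Integrable.integral_prod_left i2
  let k : ℝ → ℝ → ℝ → ℝ := fun h t y =>
    (∫ x, L (a (t + y, x)) (b (t, x))) + ∫ x, L' (c (t + y, x)) (e (t + h, x))
  let N : ℝ → ℝ → ℝ≥0∞ := fun y h =>
    ‖L‖₊ * eLpNorm (timeShift y a - a) p volume * eLpNorm b q volume
      + (‖L'‖₊ * eLpNorm (timeShift y c - c) 2 volume * eLpNorm e 2 volume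
      + ‖L'‖₊ * eLpNorm c 2 volume * eLpNorm (timeShift h e - e) 2 volume)
  refine sub_eq_integral_of_average h12.le hf hd₁ hd₂ (j1.integrableOn.add j2.integrableOn) (k := k)
    (ω := fun h => ⨆ y ∈ Ioc 0 h, N y h)
    (fun h => ?_) ?_ (fun h hh y hy => ?_) ?_
  · have m1 := stronglyMeasurable_shift_pairing L ham hbm 0
    simp only [add_zero] at m1
    exact m1.add (stronglyMeasurable_shift_pairing L' hcm hem h)
  · have t1 := tendsto_timeShift hp ha
    have t2 := tendsto_timeShift (p := 2) (by norm_num) hc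
    have t3 := tendsto_timeShift (p := 2) (by norm_num) he
    have s1 := ENNReal.Tendsto.mul_const (ENNReal.Tendsto.const_mul (a := (‖L‖₊ : ℝ≥0∞)) t1
      (Or.inr coe_ne_top)) (b := eLpNorm b q volume) (Or.inr hb.2.ne)
    have s2 := ENNReal.Tendsto.mul_const (ENNReal.Tendsto.const_mul (a := (‖L'‖₊ : ℝ≥0∞)) t2
      (Or.inr coe_ne_top)) (b := eLpNorm e 2 volume) (Or.inr he.2.ne)
    have s3 := ENNReal.Tendsto.const_mul (a := (‖L'‖₊ : ℝ≥0∞) * eLpNorm c 2 volume) t3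
      (Or.inr (mul_ne_top coe_ne_top hc.2.ne))
    rw [mul_zero] at s3
    simp only [mul_zero, zero_mul] at s1 s2
    rw [tendsto_nhds_zero]
    intro ε hε
    have hε3 : 0 < ε / 3 := ENNReal.div_pos hε.ne' (by norm_num)
    have hev := ((tendsto_nhds_zero.1 s1 _ hε3).and ((tendsto_nhds_zero.1 s2 _ hε3).and
      (tendsto_nhds_zero.1 s3 _ hε3)))
    obtain ⟨δ, hδ, hball⟩ := eventually_nhds_iff_ball.1 hev
    filter_upwards [Ioo_mem_nhdsGT hδ] with h hh
    refine iSup₂_le fun y hy => ?_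
    have by' := hball y (by rw [mem_ball, dist_zero_right, norm_of_nonneg hy.1.le]; exact hy.2.trans_lt hh.2)
    have bh := hball h (by rw [mem_ball, dist_zero_right, norm_of_nonneg hh.1.le]; exact hh.2)
    refine (add_le_add by'.1 (add_le_add by'.2.1 bh.2.2)).trans (le_of_eq ?_)
    rw [← add_assoc]; exact ENNReal.add_thirds ε
  · refine le_trans ?_ (le_iSup₂ (f := fun y (_ : y ∈ Ioc 0 h) => N y h) y hy)
    have b1 := lintegral_bilin_shift_sub_le L ha hb y 0
    have b2 := lintegral_bilin_shift_sub_le (p := 2) (q := 2) L' hc he y h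
    have z0 : timeShift 0 b - b = 0 := by
      ext1 w
      have : w + ((0 : ℝ), (0 : Vec d)) = w := by ext1 <;> simp
      simp [timeShift, this]
    rw [z0, eLpNorm_zero, mul_zero, add_zero] at b1
    simp only [add_zero] at b1
    refine le_trans ?_ (add_le_add b1 b2)
    have hm1 : StronglyMeasurable fun t => (∫ x, L (a (t + y, x)) (b (t, x))) - ∫ x, L (a (t, x)) (b (t, x)) := by
      have m1 := stronglyMeasurable_shift_pairing L ham hbm 0
      simp only [add_zero] at m1
      have m2 := m1.comp_measurable (g := fun t : ℝ => (t, y)) (by fun_prop)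
      have m3 := m1.comp_measurable (g := fun t : ℝ => (t, (0 : ℝ))) (by fun_prop)
      have := m2.sub m3
      simpa [comp_def, uncurry, Pi.sub_def] using this
    rw [← lintegral_add_left hm1.measurable.enorm]
    refine (setLIntegral_le_lintegral _ _).trans (lintegral_mono fun t => ?_)
    have e1 : k h t y - ((fun t => ∫ x, L (a (t, x)) (b (t, x))) + fun t => ∫ x, L' (c (t, x)) (e (t, x))) t
        = ((∫ x, L (a (t + y, x)) (b (t, x))) - ∫ x, L (a (t, x)) (b (t, x)))
          + ((∫ x, L' (c (t + y, x)) (e (t + h, x))) - ∫ x, L' (c (t, x)) (e (t, x))) := by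
      simp only [k, Pi.add_apply]; ring
    exact (congrArg enorm e1).le.trans (enorm_add_le _ _)
  · filter_upwards [Ioo_mem_nhdsGT (show (0 : ℝ) < T - T₂ by linarith)] with h hh
    have hP' : ∀ᵐ t : ℝ, t ∈ Ioo 0 T → P t := (ae_restrict_iff' measurableSet_Ioo).1 hP
    have hP2 : ∀ᵐ t : ℝ, t + h ∈ Ioo 0 T → P (t + h) :=
      (measurePreserving_add_right volume h).quasiMeasurePreserving.ae hP'
    rw [ae_restrict_iff' measurableSet_Ioc]
    filter_upwards [hP', hP2] with t h1 h2 ht _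
    have ht0 : 0 < t := h0.trans ht.1
    have htT : t + h < T := by linarith [ht.2, hh.2]
    have h3 := hinc t (t + h) (h1 ⟨ht0, by linarith [hh.1]⟩) (h2 ⟨by linarith [hh.1], htT⟩) ht0
      (by linarith [hh.1]) htT
    rw [h3, ← integral_of_le hh.1.le]
    have h4 := intervalIntegral.integral_comp_add_left (a := 0) (b := h)
      (fun r => (∫ x, L (a (r, x)) (b (t, x))) + ∫ x, L' (c (r, x)) (e (t + h, x))) t
    rw [add_zero] at h4
    exact h4.symm

end

section

lemma neBot_nhdsGT_inf_ae : (𝓝[>] (0 : ℝ) ⊓ ae volume).NeBot := by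
  rw [inf_neBot_iff]
  intro s hs s' hs'
  obtain ⟨δ, hδ, hsub⟩ := mem_nhdsGT_iff_exists_Ioo_subset.1 hs
  by_contra hne
  rw [not_nonempty_iff_eq_empty] at hne
  have h1 : volume (Ioo 0 δ) = 0 := by
    refine measure_mono_null (fun x hx => ?_) (mem_ae_iff.1 hs')
    intro hx'
    exact (hne ▸ (⟨hsub hx, hx'⟩ : x ∈ s ∩ s') : x ∈ (∅ : Set ℝ))
  rw [Real.volume_Ioo, sub_zero, ENNReal.ofReal_eq_zero] at h1
  exact absurd hδ (not_lt.2 h1)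

lemma eventually_of_ae_Ioo {T : ℝ} (hT : 0 < T) {p : ℝ → Prop}
    (h : ∀ᵐ t ∂vI T, p t) : ∀ᶠ t in 𝓝[>] (0 : ℝ) ⊓ ae volume, p t := by
  rw [ae_restrict_iff' measurableSet_Ioo] at h
  have h1 : ∀ᶠ t in 𝓝[>] (0 : ℝ) ⊓ ae volume, t ∈ Ioo 0 T :=
    (Ioo_mem_nhdsGT hT : Ioo 0 T ∈ 𝓝[>] (0 : ℝ)) |> fun h => mem_inf_of_left h
  have h2 : ∀ᶠ t in 𝓝[>] (0 : ℝ) ⊓ ae volume, t ∈ Ioo 0 T → p t := mem_inf_of_right h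
  filter_upwards [h1, h2] with t a b using b a

lemma exists_seq_tendsto_zero {T : ℝ} (hT : 0 < T) {p : ℝ → Prop}
    (h : ∀ᶠ t in 𝓝[>] (0 : ℝ) ⊓ ae volume, p t) {f : ℝ → ℝ} {f₀ : ℝ}
    (hf : Tendsto f (𝓝[>] 0 ⊓ ae volume) (𝓝 f₀)) :
    ∃ t : ℕ → ℝ, (∀ n, p (t n)) ∧ (∀ n, t n ∈ Ioo 0 T) ∧ Null t ∧
      Tendsto (fun n => f (t n)) atTop (𝓝 f₀) := by
  have hne := neBot_nhdsGT_inf_ae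
  have hδ : ∀ n : ℕ, (0 : ℝ) < 1 / (n + 1) := fun n => by positivity
  have hex : ∀ n : ℕ, ∃ t, p t ∧ t ∈ Ioo 0 T ∧ t ∈ Ioo (0 : ℝ) (1 / (n + 1)) ∧ dist (f t) f₀ < 1 / (n + 1) :=
    fun n => by
      have h1 : ∀ᶠ t in 𝓝[>] (0 : ℝ) ⊓ ae volume, t ∈ Ioo 0 T := mem_inf_of_left (Ioo_mem_nhdsGT hT)
      have h2 : ∀ᶠ t in 𝓝[>] (0 : ℝ) ⊓ ae volume, t ∈ Ioo (0 : ℝ) (1 / (n + 1)) :=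
        mem_inf_of_left (Ioo_mem_nhdsGT (hδ n))
      have h3 := (Metric.tendsto_nhds.1 hf) _ (hδ n)
      exact (h.and (h1.and (h2.and h3))).exists
  choose t h1 h2 h3 h4 using hex
  refine ⟨t, h1, h2, ?_, ?_⟩
  · exact squeeze_zero (fun n => (h3 n).1.le) (fun n => (h3 n).2.le) tendsto_inv_succ
  · rw [tendsto_iff_dist_tendsto_zero]
    exact squeeze_zero (fun n => dist_nonneg) (fun n => (h4 n).le) tendsto_inv_succ

end

section

variable {T : ℝ} {E F E' F' : Type*} [NormedAddCommGroup E] [NormedSpace ℝ E]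
  [NormedAddCommGroup F] [NormedSpace ℝ F] [NormedAddCommGroup E'] [NormedSpace ℝ E']
  [NormedAddCommGroup F'] [NormedSpace ℝ F']

lemma spaceTime_eq_restrict : ST Ω T = (volume : Measure (ℝ × Vec d)).restrict (Ioo 0 T ×ˢ Ω) := by
  rw [spaceTime, Measure.prod_restrict]; rfl

/-- A strongly measurable representative on the whole space, vanishing outside the cylinder. -/
lemma exists_stronglyMeasurable_extension {G : Type*} [NormedAddCommGroup G] (hΩ : MeasurableSet Ω)
    {a : ℝ → Vec d → G} {p : ℝ≥0∞} (ha : MemLp (uncurry a) p (ST Ω T)) :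
    ∃ A : ℝ × Vec d → G, StronglyMeasurable A ∧ MemLp A p volume ∧ (∀ z, z.2 ∉ Ω → A z = 0) ∧
      ∀ᵐ t ∂vI T, ∀ᵐ x ∂vol Ω, a t x = A (t, x) := by
  have hS : MeasurableSet (Ioo 0 T ×ˢ Ω) := measurableSet_Ioo.prod hΩ
  refine ⟨(Ioo 0 T ×ˢ Ω).indicator (ha.1.mk _), ha.1.stronglyMeasurable_mk.indicator hS, ?_,
    fun z hz => indicator_of_notMem (fun h => hz h.2) _, ?_⟩
  · rw [memLp_indicator_iff_restrict hS, ← spaceTime_eq_restrict]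
    exact ha.ae_eq ha.1.ae_eq_mk
  · have h1 : ∀ᵐ q ∂ST Ω T, a q.1 q.2 = (Ioo 0 T ×ˢ Ω).indicator (ha.1.mk _) q := by
      have h2 : ∀ᵐ q ∂ST Ω T, q ∈ Ioo 0 T ×ˢ Ω := by
        rw [spaceTime_eq_restrict]; exact ae_restrict_mem hS
      filter_upwards [ha.1.ae_eq_mk, h2] with q hq hq2
      rw [indicator_of_mem hq2, ← hq]; rfl
    exact ae_ae_of_ae_prod h1

lemma integral_pairing_eq (L : E →L[ℝ] F →L[ℝ] ℝ) {A : Vec d → E} {B : Vec d → F} {a : Vec d → E} {b : Vec d → F}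
    (hA : ∀ x ∉ Ω, A x = 0) (ha : ∀ᵐ x ∂vol Ω, a x = A x)
    (hb : ∀ᵐ x ∂vol Ω, b x = B x) :
    ∫ x, L (A x) (B x) = ∫ x in Ω, L (a x) (b x) := by
  rw [← setIntegral_eq_of_zero (s := Ω) (fun x hx => by rw [hA x hx]; simp)]
  refine integral_congr_ae ?_
  filter_upwards [ha, hb] with x h1 h2
  rw [h1, h2]

/-- The fundamental theorem for `f`, if the increments of `f` are integrals of products of functions
evaluated at different times. -/
lemma sub_eq_integral_pairing (hΩ : MeasurableSet Ω) (hT : 0 < T) (L : E →L[ℝ] F →L[ℝ] ℝ)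
    (L' : E' →L[ℝ] F' →L[ℝ] ℝ)
    {p q : ℝ≥0∞} [p.HolderTriple q 1] [Fact (1 ≤ p)] (hp : p ≠ ⊤) {a : ℝ → Vec d → E} {b : ℝ → Vec d → F}
    {c : ℝ → Vec d → E'} {e : ℝ → Vec d → F'} (ha : MemLp (uncurry a) p (ST Ω T))
    (hb : MemLp (uncurry b) q (ST Ω T)) (hc : MemLp (uncurry c) 2 (ST Ω T))
    (he : MemLp (uncurry e) 2 (ST Ω T)) {f : ℝ → ℝ} (hf : IntegrableOn f (Ioo 0 T)) {P : ℝ → Prop}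
    (hP : ∀ᵐ t ∂vI T, P t)
    (hinc : ∀ t s, P t → P s → 0 < t → t < s → s < T → f s - f t =
      ∫ r in t..s, ((∫ x in Ω, L (a r x) (b t x)) + ∫ x in Ω, L' (c r x) (e s x)))
    {f₀ : ℝ} (hf₀ : Tendsto f (𝓝[>] 0 ⊓ ae volume) (𝓝 f₀)) :
    ∀ᵐ s ∂vI T, f s = f₀ +
      ∫ t in 0..s, ((∫ x in Ω, L (a t x) (b t x)) + ∫ x in Ω, L' (c t x) (e t x)) := by
  have h1 :
      ∀ᵐ T₁, ∀ᵐ T₂, 0 < T₁ → T₁ < T₂ → T₂ < T → f T₂ - f T₁ =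
        ∫ t in T₁..T₂, ((∫ x in Ω, L (a t x) (b t x)) + ∫ x in Ω, L' (c t x) (e t x)) := by
    obtain ⟨A, Am, A2, A0, Ae⟩ := exists_stronglyMeasurable_extension hΩ ha
    obtain ⟨B, Bm, B2, B0, Be⟩ := exists_stronglyMeasurable_extension hΩ hb
    obtain ⟨C, Cm, C2, C0, Ce⟩ := exists_stronglyMeasurable_extension hΩ hc
    obtain ⟨D, Dm, D2, D0, De⟩ := exists_stronglyMeasurable_extension hΩ he
    have hgood : ∀ r t s, (∀ᵐ x ∂vol Ω, a r x = A (r, x)) →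
        (∀ᵐ x ∂vol Ω, b t x = B (t, x)) → (∀ᵐ x ∂vol Ω, c r x = C (r, x)) →
        (∀ᵐ x ∂vol Ω, e s x = D (s, x)) →
        (∫ x, L (A (r, x)) (B (t, x))) + ∫ x, L' (C (r, x)) (D (s, x))
          = (∫ x in Ω, L (a r x) (b t x)) + ∫ x in Ω, L' (c r x) (e s x) := fun r t s h1 h2 h3 h4 => by
      rw [integral_pairing_eq L (fun x hx => A0 (r, x) hx) h1 h2, integral_pairing_eq L' (fun x hx => C0 (r, x) hx) h3 h4]
    have hcongr : ∀ {T₁ T₂ : ℝ} {g h : ℝ → ℝ}, 0 < T₁ → T₁ < T₂ → T₂ < T →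
        (∀ᵐ r ∂vI T, g r = h r) → ∫ r in T₁..T₂, g r = ∫ r in T₁..T₂, h r := by
      intro T₁ T₂ g h h0 h12 h2 hgh
      rw [ae_restrict_iff' measurableSet_Ioo] at hgh
      refine intervalIntegral.integral_congr_ae ?_
      filter_upwards [hgh] with r hr hrI
      rw [uIoc_of_le h12.le] at hrI
      exact hr ⟨h0.trans hrI.1, hrI.2.trans_lt h2⟩
    have hfi : LocallyIntegrable ((Ioo 0 T).indicator f) volume :=
      ((integrable_indicator_iff measurableSet_Ioo).2 hf).locallyIntegrable
    have main := steklov_aux L L' hp A2 B2 C2 D2 Am Bm Cm Dm (T := T) hfi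
      (P := fun t => P t ∧ (∀ᵐ x ∂vol Ω, b t x = B (t, x)) ∧
        ∀ᵐ x ∂vol Ω, e t x = D (t, x)) (hP.and (Be.and De)) (fun t s ht hs h0 hts hsT => ?_)
    · filter_upwards [main] with T₁ h1
      filter_upwards [h1] with T₂ h2 h0 h12 h2T
      have h3 := h2 h0 h12 h2T
      have m2 : T₂ ∈ Ioo 0 T := ⟨h0.trans h12, h2T⟩
      have m1 : T₁ ∈ Ioo 0 T := ⟨h0, h12.trans h2T⟩
      rw [indicator_of_mem m2, indicator_of_mem m1] at h3
      rw [h3]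
      refine hcongr h0 h12 h2T ?_
      filter_upwards [Ae, Be, Ce, De] with r r1 r2 r3 r4 using hgood r r r r1 r2 r3 r4
    · have m2 : s ∈ Ioo 0 T := ⟨h0.trans hts, hsT⟩
      have m1 : t ∈ Ioo 0 T := ⟨h0, hts.trans hsT⟩
      rw [indicator_of_mem m2, indicator_of_mem m1, hinc t s ht.1 hs.1 h0 hts hsT]
      refine hcongr h0 hts hsT ?_
      filter_upwards [Ae, Ce] with r r1 r3 using (hgood r t s r1 ht.2.1 r3 hs.2.2).symm
  obtain ⟨t, h2, h3, h4, h5⟩ := exists_seq_tendsto_zero hT (mem_inf_of_right h1) hf₀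
  have i1 : Integrable (fun w : ℝ × Vec d => L (a w.1 w.2) (b w.1 w.2)) (ST Ω T) :=
    integrable_bilin_of_holder L (p := p) (q := q) ha hb
  have i2 : Integrable (fun w : ℝ × Vec d => L' (c w.1 w.2) (e w.1 w.2)) (ST Ω T) := integrable_bilin L' hc he
  have j : IntegrableOn (fun t => (∫ x in Ω, L (a t x) (b t x)) + ∫ x in Ω, L' (c t x) (e t x)) (Ioo 0 T) :=
    (Integrable.integral_prod_left i1).add (Integrable.integral_prod_left i2)
  rw [ae_restrict_iff' measurableSet_Ioo]
  filter_upwards [ae_all_iff.2 h2] with s hs hsI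
  have hcont : Tendsto (fun n => ∫ t in (t n)..s, ((∫ x in Ω, L (a t x) (b t x)) + ∫ x in Ω, L' (c t x) (e t x)))
      atTop (𝓝 (∫ t in 0..s, ((∫ x in Ω, L (a t x) (b t x)) + ∫ x in Ω, L' (c t x) (e t x)))) := by
    have hc1 := intervalIntegral.continuousOn_primitive_interval_left (μ := volume) (a := 0) (b := s)
      (f := fun t => (∫ x in Ω, L (a t x) (b t x)) + ∫ x in Ω, L' (c t x) (e t x)) (by
        rw [uIcc_of_le hsI.1.le, integrableOn_Icc_iff_integrableOn_Ioo]
        exact j.mono_set (Ioo_subset_Ioo_right hsI.2.le))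
    have hc2 := hc1 0 left_mem_uIcc
    rw [uIcc_of_le hsI.1.le] at hc2
    refine hc2.tendsto.comp (tendsto_nhdsWithin_iff.2 ⟨h4, ?_⟩)
    filter_upwards [h4.eventually (gt_mem_nhds hsI.1)] with n hn
    exact ⟨(h3 n).1.le, hn.le⟩
  have h6 : Tendsto (fun n => f s - f (t n)) atTop (𝓝 (f s - f₀)) := tendsto_const_nhds.sub h5
  rw [← sub_eq_iff_eq_add']
  refine tendsto_nhds_unique h6 (hcont.congr' ?_)
  filter_upwards [h4.eventually (gt_mem_nhds hsI.1)] with n hn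
  exact (hs n (h3 n).1 hn hsI.2).symm

end

section

variable {T : ℝ}

lemma spaceTime_mono {T' : ℝ} (h : T' ≤ T) : ST Ω T' ≤ ST Ω T :=
  prod_mono (restrict_mono (Ioo_subset_Ioo_right h) le_rfl) le_rfl

lemma ae_Ioo_mono {T' : ℝ} (h : T' ≤ T) {p : ℝ → Prop} (hp : ∀ᵐ t ∂vI T, p t) :
    ∀ᵐ t ∂vI T', p t :=
  ae_restrict_of_ae_restrict_of_subset (Ioo_subset_Ioo_right h) hp

lemma ae_spaceTime_mono {T' : ℝ} (h : T' ≤ T) {p : ℝ × Vec d → Prop} (hp : ∀ᵐ t ∂ST Ω T, p t) :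
    ∀ᵐ t ∂(ST Ω T'), p t := ae_mono (spaceTime_mono h) hp

lemma HasWeakTimeDeriv.mono {u u' : ℝ → Vec d → F} (h : HasWeakTimeDeriv Ω T u u')
    {T' : ℝ} (hT : T' ≤ T) : HasWeakTimeDeriv Ω T' u u' := by
  intro θ h1 h2 h3
  have h4 := h θ h1 h2 (h3.trans (prod_mono (Ioo_subset_Ioo_right hT) le_rfl))
  have hz : ∀ p, p ∉ Ioo 0 T' ×ˢ Ω → θ p = 0 := fun p hp =>
    eq_zero_off fun h => hp (h3 h)
  have hz' : ∀ p, p ∉ Ioo 0 T' ×ˢ Ω → ∇ θ p = 0 := fun p hp => by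
    by_contra hne
    exact hp (h3 (support_fderiv_subset ℝ hne))
  have hcut : ∀ g : ℝ × Vec d → F, (∀ p, p ∉ Ioo 0 T' ×ˢ Ω → g p = 0) →
      ∫ p, g p ∂ST Ω T = ∫ p, g p ∂(ST Ω T') := fun g hg => by
    rw [spaceTime_eq_restrict, spaceTime_eq_restrict, setIntegral_eq_of_zero,
      setIntegral_eq_of_zero hg]
    intro p hp
    exact hg p fun h => hp (prod_mono (Ioo_subset_Ioo_right hT) le_rfl h)
  rw [hcut _ fun p hp => by rw [hz' p hp]; simp, hcut _ fun p hp => by rw [hz p hp]; simp] at h4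
  exact h4

lemma HasWeakTimeDeriv.exists_primitive_vec {m : ℕ} (hΩ : IsOpen Ω) (hT : 0 < T) {u u' : ℝ → Vec d → Vec m}
    (h : HasWeakTimeDeriv Ω T u u') (hu : Integrable (uncurry u) (ST Ω T))
    (hu' : Integrable (uncurry u') (ST Ω T)) :
    ∃ c : Vec d → Vec m, IntegrableOn c Ω ∧
      ∀ᵐ p ∂ST Ω T, u p.1 p.2 = c p.2 + ∫ s in 0..p.1, u' s p.2 := by
  have hcomp : ∀ i : Fin m, HasWeakTimeDeriv Ω T (fun t x => u t x i) (fun t x => u' t x i) := by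
    intro i θ h1 h2 h3
    obtain ⟨C, hC⟩ := h1.continuous.bounded_above_of_compact_support h2
    have hdc : Continuous fun p => ∇ θ p (1, 0) := (h1.continuous_fderiv (by simp)).clm_apply continuous_const
    obtain ⟨C', hC'⟩ := hdc.bounded_above_of_compact_support (h2.fderiv_apply ℝ _)
    have i1 : Integrable (fun p : ℝ × Vec d => ∇ θ p (1, 0) • u p.1 p.2) (ST Ω T) :=
      hu.bdd_smul _ hdc.aesm (of_forall hC')
    have i2 : Integrable (fun p : ℝ × Vec d => θ p • u' p.1 p.2) (ST Ω T) :=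
      hu'.bdd_smul _ h1.continuous.aesm (of_forall hC)
    have h4 := congrArg (fun v : Vec m => v i) (h θ h1 h2 h3)
    have e1 := (proj i : Vec m →L[ℝ] ℝ).integral_comp_comm i1
    have e2 := (proj i : Vec m →L[ℝ] ℝ).integral_comp_comm i2
    simp only [PiLp.proj_apply, PiLp.smul_apply, PiLp.neg_apply] at e1 e2 h4
    rw [e1, e2, h4]
  have hi : ∀ {w : ℝ → Vec d → Vec m} (i : Fin m), Integrable (uncurry w) (ST Ω T) →
      Integrable (uncurry fun t x => w t x i) (ST Ω T) := fun i hw =>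
    (proj i : Vec m →L[ℝ] ℝ).integrable_comp hw
  choose c hc hce using fun i => (hcomp i).exists_primitive_real hΩ hT (hi i hu) (hi i hu')
  refine ⟨fun x => WithLp.toLp 2 fun i => c i x, ?_, ?_⟩
  · have : (fun x => (WithLp.toLp 2 fun i => c i x : Vec m)) =
        fun x => ∑ i, c i x • (single i (1 : ℝ) : Vec m) := by
      ext1 x
      rw [vec_eq_sum (WithLp.toLp 2 fun i => c i x : Vec m)]
    rw [this]
    exact integrable_finsetSum _ fun i _ => (hc i).smul_const _
  · have h3 : ∀ᵐ p ∂ST Ω T, p.1 ∈ Ioo 0 T := ae_mem_ST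
    have h4 : ∀ᵐ p ∂ST Ω T, IntegrableOn (fun t => u' t p.2) (Ioo 0 T) := Integrable.ae_time_ST hu'
    filter_upwards [ae_all_iff.2 hce, h3, h4] with p hp hp1 hp2
    ext i
    rw [hp i]
    have hii : IntervalIntegrable (fun s => u' s p.2) volume 0 p.1 :=
      intervalIntegrable_of_Ioo_of_mem hp2 (left_mem_Icc.2 (hp1.1.trans hp1.2).le) (Ioo_subset_Icc_self hp1)
    have := (proj i : Vec m →L[ℝ] ℝ).intervalIntegral_comp_comm hii
    simp only [PiLp.proj_apply] at this
    rw [PiLp.add_apply, this]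

lemma ae_eq_of_tendstoL2AtZero [CompleteSpace F] [IsFiniteMeasure (vol Ω)] (hT : 0 < T)
    {u u' : ℝ → Vec d → F} {c u₀ : Vec d → F}
    (hu : AESM (uncurry u) (ST Ω T))
    (hu' : Integrable (uncurry u') (ST Ω T)) (hc : AESM c (vol Ω))
    (hu₀ : AESM u₀ (vol Ω))
    (h : ∀ᵐ p ∂ST Ω T, u p.1 p.2 = c p.2 + ∫ s in 0..p.1, u' s p.2)
    (hini : TendstoL2AtZero Ω u u₀) : c =ᵐ[vol Ω] u₀ := by
  have hne := neBot_nhdsGT_inf_ae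
  have hut : ∀ᵐ t ∂vI T, AESM (u t) (vol Ω) := hu.prodMk_left
  have hVt : ∀ᵐ t ∂vI T,
      AESM (fun x => ∫ s in 0..t, u' s x) (vol Ω) :=
    (aesm_primitive hu'.1).prodMk_left
  have h1 := spaceTime_ae_ae (p := fun t x => u t x = c x + ∫ s in 0..t, u' s x) h
  have hVlim : Tendsto (fun t : ℝ => ∫⁻ s in Ioc 0 t, ∫⁻ x in Ω, ‖u' s x‖ₑ ∂volume ∂vI T)
      (𝓝[>] 0 ⊓ ae volume) (𝓝 0) := by
    refine tendsto_setLIntegral_zero ?_ ?_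
    · have := hu'.2
      rw [HasFiniteIntegral, spaceTime, lintegral_prod _ hu'.1.enorm] at this
      exact this.ne
    · have h2 : Tendsto (fun t : ℝ => ofReal t) (𝓝[>] 0 ⊓ ae volume) (𝓝 0) := by
        have := (continuous_ofReal.tendsto 0).mono_left
          (inf_le_left.trans nhdsWithin_le_nhds : 𝓝[>] (0 : ℝ) ⊓ ae volume ≤ 𝓝 0)
        rwa [ofReal_zero] at this
      refine tendsto_zero_of_le h2 fun t => ?_
      refine (Measure.restrict_apply_le _ _).trans ?_
      simp
  have hlim2 : Tendsto (fun t => eL2 (u t - u₀) Ω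
      * (vol Ω univ) ^ (1 / (1 : ℝ≥0∞).toReal - 1 / (2 : ℝ≥0∞).toReal)) (𝓝[>] 0 ⊓ ae volume) (𝓝 0) := by
    have := ENNReal.Tendsto.mul_const (b := (vol Ω univ) ^ (1 / (1 : ℝ≥0∞).toReal - 1 / (2 : ℝ≥0∞).toReal))
      hini (Or.inr (rpow_ne_top_of_nonneg (by norm_num) (measure_ne_top _ _)))
    simpa using this
  have hsum := hVlim.add hlim2
  rw [add_zero] at hsum
  have hle : ∀ᶠ t in 𝓝[>] (0 : ℝ) ⊓ ae volume, eLpNorm (c - u₀) 1 (vol Ω) ≤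
      (∫⁻ s in Ioc 0 t, ∫⁻ x in Ω, ‖u' s x‖ₑ ∂volume ∂vI T)
      + eL2 (u t - u₀) Ω
      * (vol Ω univ) ^ (1 / (1 : ℝ≥0∞).toReal - 1 / (2 : ℝ≥0∞).toReal) := by
    refine eventually_of_ae_Ioo hT ?_
    filter_upwards [hut, hVt, h1, ae_mem_Ioo] with t m1 m2 e1 ht
    have e2 : c - u₀ =ᵐ[vol Ω] (fun x => -∫ s in 0..t, u' s x) + (u t - u₀) := by
      filter_upwards [e1] with x hx
      simp only [Pi.sub_apply, Pi.add_apply, hx]; abel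
    rw [eLpNorm_congr_ae e2]
    refine (eLpNorm_add_le m2.neg (m1.sub hu₀) le_rfl).trans (add_le_add ?_ ?_)
    · rw [eLpNorm_one_eq_lintegral_enorm]
      simp only [integral_of_le ht.1.le]
      have e3 : (vI T).restrict (Ioc 0 t) = vol (Ioc 0 t) := by
        rw [Measure.restrict_restrict measurableSet_Ioc, inter_eq_left.2
          (show Ioc 0 t ⊆ Ioo 0 T from fun s hs => ⟨hs.1, hs.2.trans_lt ht.2⟩)]
      rw [e3, ← lintegral_lintegral_swap]
      · exact lintegral_mono fun x => by
          rw [Pi.neg_apply, enorm_neg]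
          exact enorm_integral_le_lintegral_enorm _
      · have h3 : AESM (uncurry u') ((vol (Ioc 0 t)).prod (vol Ω)) :=
          hu'.1.mono_measure (prod_mono (restrict_mono
            (show Ioc 0 t ⊆ Ioo 0 T from fun s hs => ⟨hs.1, hs.2.trans_lt ht.2⟩) le_rfl) le_rfl)
        exact h3.prod_swap.enorm
    · exact eLpNorm_le_eLpNorm_mul_rpow_measure_univ (by norm_num) (m1.sub hu₀)
  have h0 : eLpNorm (c - u₀) 1 (vol Ω) ≤ 0 := ge_of_tendsto hsum hle
  have h00 := (eLpNorm_eq_zero_iff (hc.sub hu₀) one_ne_zero).1 (le_antisymm h0 zero_le)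
  filter_upwards [h00] with x hx
  exact sub_eq_zero.1 hx

end

/-! ### Integral identities for Lipschitz fields -/

section

/-- A first order integral identity extends from test functions to Lipschitz functions vanishing
outside `Ω`. -/
lemma lipschitz_integral_eq_zero
    [FiniteDimensional ℝ F] (dm : Dom Ω)
    {Λ : Vec d → F → (L[d, F]) → ℝ} {g : R[d]}
    (hcont : ∀ x, Continuous fun z : F × (L[d, F]) => Λ x z.1 z.2)
    (hmeas : ∀ w : Vec d → F, Continuous w → AESM (∇ w) (vol Ω) →
      AESM (fun x => Λ x (w x) (∇ w x)) (vol Ω))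
    (hg : IntegrableOn g Ω)
    (hbd : ∀ᵐ x ∂vol Ω, 0 ≤ g x ∧ ∀ m M, ‖Λ x m M‖ ≤ g x * (‖m‖ + ‖M‖))
    (test : ∀ η, IsTest Ω η → ∫ x in Ω, Λ x (η x) (∇ η x) = 0) {w : Vec d → F} {K : ℝ≥0}
    (hK : LipschitzWith K w) (h0 : ∀ x ∉ Ω, w x = 0) : ∫ x in Ω, Λ x (w x) (∇ w x) = 0 := by
  have := FiniteDimensional.complete ℝ F
  refine lipschitz_induction (p := fun w => ∫ x in Ω, Λ x (w x) (∇ w x) = 0) dm test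
    (fun C w w₀ hw h => ?_) hK h0
  have hlim := tendsto_integral_of_dominated_convergence (μ := vol Ω)
    (F := fun n x => Λ x (w n x) (∇ (w n) x)) (f := fun x => Λ x (w₀ x) (∇ w₀ x))
    (fun x => g x * (C + C)) (fun n => ?_) (hg.mul_const _) (fun n => ?_) ?_
  · simp only [hw] at hlim
    exact (tendsto_nhds_unique hlim tendsto_const_nhds)
  · borelize (L[d, F])
    exact hmeas _ (h.lip n).continuous (measurable_fderiv ℝ _).aesm
  · filter_upwards [hbd] with x hx
    refine (hx.2 _ _).trans ?_
    exact mul_le_left (add_le_add (h.bdd n x) (h.norm_fderiv_le n x)) hx.1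
  · filter_upwards [h.tendsto_fderiv] with x hx
    exact ((hcont x).tendsto (w₀ x, ∇ w₀ x)).comp ((h.tendsto x).prodMk_nhds hx)

/-- Weakly solenoidal fields are orthogonal to gradients of Lipschitz functions vanishing outside `Ω`. -/
lemma WeaklyDivFree.integral_fderiv_eq_zero (dm : Dom Ω)
    {u : V[d]} (hu : WeaklyDivFree Ω u) (hi : IntegrableOn u Ω) {f : R[d]} {K : ℝ≥0}
    (hK : LipschitzWith K f) (h0 : ∀ x ∉ Ω, f x = 0) : ∫ x in Ω, ∇ f x (u x) = 0 := by
  refine lipschitz_integral_eq_zero (Λ := fun x _ M => M (u x)) (g := fun x => ‖u x‖) dm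
    (fun x => by fun_prop) (fun w _ hw => aesm_clm_eval hw hi.1) hi.norm
    (of_forall fun x => ⟨norm_nonneg _, fun m M => ?_⟩) hu.integral_eq hK h0
  refine (M.le_opNorm _).trans ?_
  rw [mul_comm]
  exact mul_le_left (le_add_of_nonneg_left (norm_nonneg _)) (norm_nonneg _)

lemma tr_smulRight (L : L[d, ℝ]) (v : Vec d) : tr (L.smulRight v) = L v := by
  rw [clm_apply_eq_sum]
  simp [tr, mul_comm]

lemma abs_tr_le (A : M[d]) : |tr A| ≤ ‖trCLM d‖ * ‖A‖ := by
  rw [← trCLM_apply]; exact (trCLM d).le_opNorm A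

lemma HasWeakFDeriv.integral_apply_test {f : R[d]} {G : Vec d → L[d, ℝ]}
    (h : HasWeakFDeriv Ω f G) {η : V[d]} (hη : IsTest Ω η) :
    ∫ x in Ω, G x (η x) = -∫ x in Ω, f x * divg η x := by
  have hc : ∀ i : Fin d, IsTest Ω fun x => η x i := fun i =>
    ⟨(proj i : L[d, ℝ]).contDiff.comp hη.smooth,
      hη.compact.comp_left (g := fun v : Vec d => v i) rfl,
      (tsupport_comp_subset (g := fun v : Vec d => v i) rfl _).trans hη.support⟩
  have hd : ∀ (i : Fin d) x e, ∇ (fun x => η x i) x e = (∇ η x e) i := fun i x e => by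
    have := ((proj i : L[d, ℝ]).hasFDerivAt.comp x (hη.differentiable x).hasFDerivAt).fderiv
    exact congrArg (fun L => L e) this
  have i1 : ∀ i : Fin d, IntegrableOn (fun x => ∇ (fun x => η x i) x (single i 1) • f x) Ω :=
    fun i => integrableOn_smul_of_compact ((hc i).continuous_fderiv.clm_apply continuous_const)
      ((hc i).compact.fderiv_apply ℝ _) ((tsupport_fderiv_apply_subset ℝ _).trans (hc i).support) h.locInt
  have i2 : ∀ i : Fin d, IntegrableOn (fun x => η x i • G x (single i 1)) Ω := fun i =>
    (apply ℝ ℝ (single i (1 : ℝ))).integrable_comp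
      (integrableOn_smul_of_compact (hc i).cont (hc i).compact (hc i).support h.locInt_deriv)
  have e1 : ∀ x, G x (η x) = ∑ i, η x i • G x (single i 1) := fun x => clm_apply_eq_sum _ _
  have e2 : ∀ x, f x * divg η x = ∑ i, ∇ (fun x => η x i) x (single i 1) • f x := fun x => by
    simp only [divg, tr, Finset.mul_sum, hd, smul_eq_mul]
    exact sum_congr rfl fun i _ => mul_comm _ _
  simp only [e1, e2]
  rw [integral_finsetSum _ fun i _ => i1 i, integral_finsetSum _ fun i _ => i2 i, ← Finset.sum_neg_distrib]
  refine sum_congr rfl fun i _ => ?_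
  rw [h.byParts _ (hc i), neg_neg]

end

section

lemma integral_stress_of_smooth {P η : V[d]} (hP : Smooth P)
    (hη : IsTest univ η) (hs : ∀ x a b, ⟪∇ P x a, b⟫ = ⟪∇ P x b, a⟫) :
    ∫ x, (tr (∇ P x) * ⟪P x, η x⟫ - 1 / 2 * ⟪P x, P x⟫ * divg η x
      + ⟪P x, ∇ η x (P x)⟫) = 0 := by
  have hP1 : ContDiff ℝ 1 P := hP.toC1
  have dP : Differentiable ℝ P := hP1.differentiable one_ne_zero
  have cP : Continuous (∇ P) := hP1.continuous_fderiv one_ne_zero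
  have cη := hη.continuous_fderiv
  have c0 := hη.cont
  have cP0 := hP1.continuous
  have hθ : IsTest univ fun x => ⟪P x, η x⟫ := ⟨hP.inner ℝ hη.smooth,
    hη.compact.mono fun x hx hx' => hx (by simp only [hx', inner_zero_right]), subset_univ _⟩
  have h1 := (hasWeakFDeriv_of_contDiff hP1).integral_fderiv_apply hθ
  have hq : ContDiff ℝ 1 fun x => 1 / 2 * ⟪P x, P x⟫ := contDiff_const.mul (hP1.inner ℝ hP1)
  have h2 := (hasWeakFDeriv_of_contDiff hq).integral_apply_test hη
  have e1 : ∀ x, ∇ (fun x => ⟪P x, η x⟫) x (P x)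
      = ⟪P x, ∇ η x (P x)⟫ + ⟪∇ P x (P x), η x⟫ := fun x => by
    rw [fderiv_inner_apply ℝ (dP x) (hη.differentiable x)]
  have e2 : ∀ x, ∇ (fun x => 1 / 2 * ⟪P x, P x⟫) x (η x) = ⟪∇ P x (P x), η x⟫ := fun x => by
    rw [fderiv_const_mul ((dP x).inner ℝ (dP x))]
    simp only [smul_apply, fderiv_inner_apply ℝ (dP x) (dP x), smul_eq_mul]
    rw [real_inner_comm, hs x (η x) (P x)]; ring
  rw [restrict_univ] at h1 h2
  simp only [e1] at h1
  simp only [e2] at h2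
  have cs : ∀ {f : R[d]}, Continuous f → (∀ x ∉ tsupport η, f x = 0) → Integrable f := fun hf h0 =>
    hf.integrable_of_hasCompactSupport (HasCompactSupport.intro hη.compact h0)
  have i1 : Integrable fun x => tr (∇ P x) * ⟪P x, η x⟫ :=
    cs (cP.tr'.mul (cP0.inner c0)) fun x hx => by simp [eq_zero_off hx]
  have i2 : Integrable fun x => 1 / 2 * ⟪P x, P x⟫ * divg η x :=
    cs ((continuous_const.mul (cP0.inner cP0)).mul cη.tr') fun x hx => by simp [divg, tr, fderiv_off hx]
  have i3 : Integrable fun x => ⟪P x, ∇ η x (P x)⟫ :=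
    cs (cP0.inner (cη.clm_apply cP0)) fun x hx => by simp [fderiv_off hx]
  have i4 : Integrable fun x => ⟪∇ P x (P x), η x⟫ :=
    cs ((cP.clm_apply cP0).inner c0) fun x hx => by simp [eq_zero_off hx]
  rw [integral_add i3 i4] at h1
  have e3 : ∫ x, ⟪P x, η x⟫ * tr (∇ P x) = ∫ x, tr (∇ P x) * ⟪P x, η x⟫ := by
    congr 1; ext x; ring
  rw [e3] at h1
  have i12 : Integrable fun x => tr (∇ P x) * ⟪P x, η x⟫ - 1 / 2 * ⟪P x, P x⟫ * divg η x := i1.sub i2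
  rw [integral_add i12 i3, integral_sub i1 i2]
  linarith

lemma HasWeakFDeriv.eventually_fderiv_mollify (hΩ : IsOpen Ω) {P : V[d]} {A : Vec d → M[d]}
    (h : HasWeakFDeriv Ω P A) (hP : MemLp (Ω.indicator P) 2) (hA : MemLp (Ω.indicator A) 2)
    {K : Set (Vec d)} (hK : IsCompact K) (hKΩ : K ⊆ Ω) :
    ∀ᶠ n in atTop, ∀ x ∈ K, ∇ (mollify n (Ω.indicator P)) x = mollify n (Ω.indicator A) x := by
  obtain ⟨δ, hδ, hδΩ⟩ := hK.exists_cthickening_subset_open hΩ hKΩ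
  have hl := hP.locallyIntegrable (by norm_num : (1 : ℝ≥0∞) ≤ 2)
  have hlA := hA.locallyIntegrable (by norm_num : (1 : ℝ≥0∞) ≤ 2)
  have hw : HasWeakFDeriv Ω (Ω.indicator P) (Ω.indicator A) := by
    refine ⟨hl.locallyIntegrableOn _, hlA.locallyIntegrableOn _, fun η hη e => ?_⟩
    have := h.byParts η hη e
    rw [setIntegral_congr_fun hΩ.measurableSet (g := fun x => ∇ η x e • P x) fun x hx => by simp [hx], this,
      setIntegral_congr_fun hΩ.measurableSet (f := fun x => η x • Ω.indicator A x e) (g := fun x => η x • A x e)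
        fun x hx => by simp [hx]]
  filter_upwards [tendsto_inv_succ.eventually (gt_mem_nhds hδ)] with n hn x hx
  refine (hasFDerivAt_mollify hl hlA hw fun y hy => hδΩ ?_).fderiv
  exact mem_cthickening_of_dist_le y x δ K hx ((mem_closedBall.1 hy).trans hn.le)

structure PhaseSlice (Ω : Set (Vec d)) (φ : R[d]) (D : V[d]) (D2 : Vec d → M[d]) : Prop where
  bdry : MemH10 Ω (fun x => φ x - (-1)) (fun x => innerSL ℝ (D x))
  grad : ML2 D Ω
  hess : ML2 D2 Ω
  weak : HasWeakFDeriv Ω D D2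
  range : ∀ᵐ x ∂vol Ω, φ x ∈ Icc (-1 : ℝ) 1

variable {φ : R[d]} {D : V[d]} {D2 : Vec d → M[d]}

lemma mollify_innerSL (n : ℕ) {f : V[d]} (hf : LocallyIntegrable f) (x : Vec d) :
    mollify n (fun x => innerSL ℝ (f x)) x = innerSL ℝ (mollify n f x) := by
  rw [mollify_apply', mollify_apply']
  have := (innerSL ℝ : Vec d →L[ℝ] L[d, ℝ]).integral_comp_comm (mollBump_integrable_smul n hf x)
  rw [← this]
  simp only [map_smul]

lemma indicator_innerSL (f : V[d]) :
    Ω.indicator (fun x => innerSL ℝ (f x)) = fun x => innerSL ℝ (Ω.indicator f x) := by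
  ext1 x; by_cases hx : x ∈ Ω <;> simp [hx]

lemma symm_fderiv_mollify {f : R[d]} {g : V[d]}
    (h : MemH1 univ f fun x => innerSL ℝ (g x)) (hg : MemLp g 2) (n : ℕ) (x a b : Vec d) :
    ⟪∇ (mollify n g) x a, b⟫ = ⟪∇ (mollify n g) x b, a⟫ := by
  have hl := hg.locallyIntegrable (by norm_num : (1 : ℝ≥0∞) ≤ 2)
  have f2 : MemLp f 2 := by simpa using h.memLp
  have G2 : MemLp (fun x => innerSL ℝ (g x)) 2 := by simpa using h.memLp_deriv
  have hfl := f2.locallyIntegrable (by norm_num)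
  have h1 := fderiv_mollify_of_memH1 hfl (G2.locallyIntegrable (by norm_num)) h.weak n
  have hd : ∀ y, HasFDerivAt (mollify n f) (innerSL ℝ (mollify n g y)) y := fun y => by
    rw [← mollify_innerSL n hl, ← h1]
    exact ((mollify_contDiff n hfl).differentiable (by simp) y).hasFDerivAt
  have hd2 : HasFDerivAt (fun y => innerSL ℝ (mollify n g y))
      ((innerSL ℝ : Vec d →L[ℝ] L[d, ℝ]).comp (∇ (mollify n g) x)) x :=
    (innerSL ℝ : Vec d →L[ℝ] L[d, ℝ]).hasFDerivAt.comp x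
      ((mollify_contDiff n hl).differentiable (by simp) x).hasFDerivAt
  exact second_derivative_symmetric hd hd2 a b

lemma PhaseSlice.integral_stress_test (h : PhaseSlice Ω φ D D2) (hΩ : IsOpen Ω) {η : V[d]} (hη : IsTest Ω η) :
    ∫ x in Ω, (tr (D2 x) * ⟪D x, η x⟫ - 1 / 2 * ⟪D x, D x⟫ * divg η x
      + ⟪D x, ∇ η x (D x)⟫) = 0 := by
  have m1 : MemLp (Ω.indicator D) 2 := (memLp_indicator_iff_restrict hΩ.measurableSet).2 h.grad
  have m2 : MemLp (Ω.indicator D2) 2 := memLp_indicator_clm hΩ h.hess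
  have hl := m1.locallyIntegrable (by norm_num : (1 : ℝ≥0∞) ≤ 2)
  have he := h.bdry.extend hΩ
  rw [indicator_innerSL] at he
  have hz : ∀ᶠ n in atTop, ∫ x in Ω, ⟪mollify n (Ω.indicator D) x, tr (mollify n (Ω.indicator D2) x) • η x
      - (1 / 2 * divg η x) • mollify n (Ω.indicator D) x + ∇ η x (mollify n (Ω.indicator D) x)⟫ = 0 := by
    filter_upwards [h.weak.eventually_fderiv_mollify hΩ m1 m2 hη.compact hη.support] with n hn
    rw [← integral_stress_of_smooth (mollify_contDiff n hl) (hη.mono (subset_univ _)) (symm_fderiv_mollify he m1 n),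
      setIntegral_eq_of_zero]
    · congr 1; ext x
      rw [inner_add_right, inner_sub_right, real_inner_smul_right, real_inner_smul_right]
      by_cases hx : x ∈ tsupport η
      · rw [hn x hx]; ring
      · rw [eq_zero_off hx]; simp; ring
    · intro x hx
      rw [hη.eq_zero hx, divg, hη.fderiv_eq_zero hx]
      simp [tr]
  obtain ⟨C, hC⟩ := hη.bdd
  obtain ⟨C', hC'⟩ := hη.bdd_fderiv
  set M : Vec d →L[ℝ] L[d, ℝ] := innerSL ℝ
  have hMl : ∀ {P : V[d]} {A : Vec d → M[d]}, ML2 P Ω →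
      ML2 A Ω → ML2 (fun x => tr (A x) • η x - (1 / 2 * divg η x) • P x + ∇ η x (P x)) Ω := fun {P A} hP hA => by
    have a1 : ML2 (fun x => tr (A x) • η x) Ω := by
      have := (trCLM d).comp_memLp' hA
      refine MemLp.of_le_mul (c := C) this (AEStronglyMeasurable.smul (by simpa [comp_def, trCLM_apply] using this.1)
        hη.cont.aesm) (of_forall fun x => ?_)
      rw [norm_smul, mul_comm, comp_apply, trCLM_apply]
      exact mul_le_right (hC x) (norm_nonneg _)
    have a2 : ML2 (fun x => (1 / 2 * divg η x) • P x) Ω := by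
      refine hP.bdd_smul (C := 1 / 2 * (‖trCLM d‖ * C')) ?_ (of_forall fun x => ?_)
      · have : Continuous fun x => 1 / 2 * divg η x := by
          simp only [divg, ← trCLM_apply]
          exact continuous_const.mul ((trCLM d).continuous.comp hη.continuous_fderiv)
        exact this.aesm
      · rw [norm_mul, norm_of_nonneg (by norm_num : (0 : ℝ) ≤ 1 / 2)]
        have := abs_tr_le (∇ η x)
        have := mul_le_left (hC' x) (norm_nonneg (trCLM d))
        rw [norm_eq_abs, divg]; linarith
    have a3 : ML2 (fun x => ∇ η x (P x)) Ω :=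
      MemLp.of_le_mul (c := C') hP (aesm_clm_eval hη.continuous_fderiv.aesm hP.1)
        (of_forall fun x => ((∇ η x).le_opNorm _).trans
          (mul_le_right (hC' x) (norm_nonneg _)))
    exact (a1.sub a2).add a3
  have t1 : Null (fun n => eL2 (mollify n (Ω.indicator D) - D) Ω) := by
    refine tendsto_zero_of_le (tendsto_eLpNorm_mollify_sub m1) fun n => ?_
    refine le_trans (le_of_eq (eLpNorm_congr_ae ?_)) (eLpNorm_restrict_le (mollify n (Ω.indicator D) - Ω.indicator D) 2 volume Ω)
    filter_upwards [ae_restrict_mem hΩ.measurableSet] with x hx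
    simp [hx]
  have t2 : Null (fun n => eL2 (mollify n (Ω.indicator D2) - D2) Ω) := by
    refine tendsto_zero_of_le (tendsto_eLpNorm_mollify_sub m2) fun n => ?_
    refine le_trans (le_of_eq (eLpNorm_congr_ae ?_)) (eLpNorm_restrict_le (mollify n (Ω.indicator D2) - Ω.indicator D2) 2 volume Ω)
    filter_upwards [ae_restrict_mem hΩ.measurableSet] with x hx
    simp [hx]
  have q1 : ∀ n, ML2 (mollify n (Ω.indicator D)) Ω := fun n => (mollify_memLp m1 n).restrict _
  have q2 : ∀ n, ML2 (mollify n (Ω.indicator D2)) Ω := fun n => (mollify_memLp m2 n).restrict _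
  have t3 : Null (fun n => eL2 ((fun x => tr (mollify n (Ω.indicator D2) x) • η x
      - (1 / 2 * divg η x) • mollify n (Ω.indicator D) x + ∇ η x (mollify n (Ω.indicator D) x))
      - fun x => tr (D2 x) • η x - (1 / 2 * divg η x) • D x + ∇ η x (D x)) Ω) := by
    have s1 := ENNReal.Tendsto.const_mul (a := ofReal (‖trCLM d‖ * C)) t2 (Or.inr ofReal_ne_top)
    have s2 := ENNReal.Tendsto.const_mul (a := ofReal (1 / 2 * (‖trCLM d‖ * C') + C')) t1 (Or.inr ofReal_ne_top)
    have s3 := s1.add s2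
    rw [mul_zero, mul_zero, add_zero] at s3
    refine tendsto_zero_of_le s3 fun n => ?_
    have e : ((fun x => tr (mollify n (Ω.indicator D2) x) • η x
      - (1 / 2 * divg η x) • mollify n (Ω.indicator D) x + ∇ η x (mollify n (Ω.indicator D) x))
      - fun x => tr (D2 x) • η x - (1 / 2 * divg η x) • D x + ∇ η x (D x)) =
      (fun x => trCLM d ((mollify n (Ω.indicator D2) - D2) x) • η x) +
      fun x => ∇ η x ((mollify n (Ω.indicator D) - D) x) - (1 / 2 * divg η x) • (mollify n (Ω.indicator D) - D) x := by
      ext1 x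
      simp only [Pi.sub_apply, Pi.add_apply, map_sub, trCLM_apply, sub_smul, smul_sub]
      abel
    rw [e]
    have w2 := (q2 n).sub h.hess
    have w1 := (q1 n).sub h.grad
    have cd : Continuous fun x => 1 / 2 * divg η x := by
      simp only [divg, ← trCLM_apply]
      exact continuous_const.mul ((trCLM d).continuous.comp hη.continuous_fderiv)
    refine (eLpNorm_add_le (((trCLM d).continuous.comp_aesm w2.1).smul
      hη.cont.aesm) ((aesm_clm_eval hη.continuous_fderiv.aesm w1.1).sub
        (cd.aesm.smul w1.1)) (by norm_num)).trans (add_le_add ?_ ?_)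
    · refine eLpNorm_le_mul_eLpNorm_of_ae_le_mul (of_forall fun x => ?_) 2
      change ‖trCLM d ((mollify n (Ω.indicator D2) - D2) x) • η x‖ ≤ _
      rw [norm_smul]
      have h1 := (trCLM d).le_opNorm ((mollify n (Ω.indicator D2) - D2) x)
      calc _ ≤ (‖trCLM d‖ * ‖(mollify n (Ω.indicator D2) - D2) x‖) * C :=
            mul_le_mul h1 (hC x) (norm_nonneg _) (by positivity)
        _ = _ := by ring
    · refine eLpNorm_le_mul_eLpNorm_of_ae_le_mul (of_forall fun x => ?_) 2
      refine (norm_sub_le _ _).trans ?_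
      change ‖∇ η x ((mollify n (Ω.indicator D) - D) x)‖
        + ‖(1 / 2 * divg η x) • (mollify n (Ω.indicator D) - D) x‖ ≤ _
      rw [norm_smul, norm_mul, norm_of_nonneg (by norm_num : (0 : ℝ) ≤ 1 / 2), norm_eq_abs, divg]
      have h1 := (∇ η x).le_opNorm ((mollify n (Ω.indicator D) - D) x)
      have h2 := abs_tr_le (∇ η x)
      have h3 := mul_le_left (hC' x) (norm_nonneg (trCLM d))
      have h4 := mul_le_right (hC' x) (norm_nonneg ((mollify n (Ω.indicator D) - D) x))
      have h5 := mul_le_right (h2.trans h3) (norm_nonneg ((mollify n (Ω.indicator D) - D) x))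
      linarith
  have hlim := tendsto_integral_bilin M q1 h.grad (fun n => hMl (q1 n) (q2 n)) (hMl h.grad h.hess) t1 t3
  have hfin := tendsto_nhds_unique hlim (tendsto_const_nhds.congr' (hz.mono fun n hn => hn.symm))
  rw [← hfin]
  congr 1; ext x
  change _ = ⟪D x, _⟫
  simp only [inner_add_right, inner_sub_right, real_inner_smul_right]
  ring

end

/-! ### Chain rule and integral identities on a time slice -/

section

variable {φ : R[d]} {D : V[d]} {D2 : Vec d → M[d]}

lemma HasWeakFDeriv.congr_ae (hΩ : IsOpen Ω)
    {u u' : Vec d → F} {G G' : Vec d → L[d, F]}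
    (h : HasWeakFDeriv Ω u G) (hu : u =ᵐ[vol Ω] u') (hG : G =ᵐ[vol Ω] G') :
    HasWeakFDeriv Ω u' G' := by
  have key : ∀ {H : Type _} [NormedAddCommGroup H] {f f' : Vec d → H}, LocallyIntegrableOn f Ω →
      f =ᵐ[vol Ω] f' → LocallyIntegrableOn f' Ω := fun {H} _ {f f'} hf he => by
    have h1 := (locallyIntegrableOn_iff (μ := volume) (f := f) hΩ.isLocallyClosed).1 hf
    rw [locallyIntegrableOn_iff hΩ.isLocallyClosed]
    exact fun k hk hkc => (h1 k hk hkc).congr_fun_ae (ae_restrict_of_ae_restrict_of_subset hk he)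
  refine ⟨key h.locInt hu, key h.locInt_deriv hG, fun η hη e => ?_⟩
  rw [← integral_congr_ae (hu.mono fun x hx => by simp only [hx] : (fun x => ∇ η x e • u x)
    =ᵐ[vol Ω] fun x => ∇ η x e • u' x), h.byParts η hη e,
    integral_congr_ae (hG.mono fun x hx => by simp only [hx] : (fun x => η x • G x e)
    =ᵐ[vol Ω] fun x => η x • G' x e)]

lemma MemH1.congr_ae (hΩ : IsOpen Ω)
    {u u' : Vec d → F} {G G' : Vec d → L[d, F]}
    (h : MemH1 Ω u G) (hu : u =ᵐ[vol Ω] u') (hG : G =ᵐ[vol Ω] G') : MemH1 Ω u' G' :=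
  ⟨h.memLp.ae_eq hu, h.memLp_deriv.ae_eq hG, h.weak.congr_ae hΩ hu hG⟩

lemma MemH10.comp_primitive (hΩ : IsOpen Ω) (h : MemH10 Ω (fun x => φ x - (-1)) (fun x => innerSL ℝ (D x)))
    (hr : ∀ᵐ x ∂vol Ω, φ x ∈ Icc (-1 : ℝ) 1) {f : ℝ → ℝ} (hf : Continuous f) :
    MemH1 univ (Ω.indicator fun x => ∫ s in (-1 : ℝ)..φ x, f s)
      (Ω.indicator fun x => f (φ x) • innerSL ℝ (D x)) := by
  have h11 : (-1 : ℝ) ≤ 1 := by norm_num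
  set k : ℝ → ℝ := fun r => f (projIcc (-1 : ℝ) 1 h11 (r - 1)) with hk
  have kc : Continuous k := hf.comp (continuous_subtype_val.comp (continuous_projIcc.comp (continuous_id.sub continuous_const)))
  obtain ⟨C, hC⟩ := hf.bdd_Icc
  have hkC : ∀ r, ‖k r‖ ≤ C.toNNReal := fun r => (hC _ (projIcc (-1 : ℝ) 1 h11 (r - 1)).2).trans (le_coe_toNNReal C)
  have h1 := (h.extend hΩ).comp_real (Ψ := fun r => ∫ s in 0..r, k s) (h := k)
    (fun r => integral_hasDerivAt_right (kc.intervalIntegrable _ _)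
      (kc.stronglyMeasurableAtFilter _ _) kc.continuousAt) kc hkC integral_same
  rw [ae_restrict_iff' hΩ.measurableSet] at hr
  have hkp : ∀ {r : ℝ}, r ∈ Icc (-1 : ℝ) 1 → k (r - (-1)) = f r := fun {r} hr => by
    rw [hk]; simp only [sub_neg_eq_add, add_sub_cancel_right, projIcc_of_mem h11 hr]
  have hr' : ∀ᵐ x ∂(vol (univ : Set (Vec d))), x ∈ Ω → φ x ∈ Icc (-1 : ℝ) 1 := by
    rwa [restrict_univ]
  refine h1.congr_ae isOpen_univ ?_ ?_
  · filter_upwards [hr'] with x hx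
    by_cases hxΩ : x ∈ Ω
    · simp only [indicator_of_mem hxΩ]
      have := intervalIntegral.integral_comp_sub_right (a := (0 : ℝ)) (b := φ x - (-1))
        (fun r => f (projIcc (-1 : ℝ) 1 h11 r)) 1
      simp only [hk]
      rw [this]
      norm_num
      refine integral_congr fun s hs => ?_
      rw [uIcc_of_le (hx hxΩ).1] at hs
      simp only [projIcc_of_mem h11 (⟨hs.1, hs.2.trans (hx hxΩ).2⟩ : s ∈ Icc (-1 : ℝ) 1)]
    · simp [hxΩ]
  · filter_upwards [hr'] with x hx
    by_cases hxΩ : x ∈ Ω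
    · simp only [indicator_of_mem hxΩ, hkp (hx hxΩ)]
    · simp [hxΩ]

lemma IsDoubleWell.integral_deriv {W : ℝ → ℝ} (hW : IsDoubleWell W) (r : ℝ) : ∫ s in (-1 : ℝ)..r, deriv W s = W r := by
  rw [intervalIntegral.integral_deriv_eq_sub fun x _ => hW.contDiff.differentiable (by norm_num) x, hW.zero.1, sub_zero]
  exact (hW.contDiff.continuous_deriv (by norm_num)).intervalIntegrable _ _

lemma IsDoubleWell.continuous_sqrt {W : ℝ → ℝ} (hW : IsDoubleWell W) : Continuous fun r => √(2 * W r) :=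
  (continuous_const.mul hW.contDiff.continuous).sqrt

lemma IsDoubleWell.nonneg {W : ℝ → ℝ} (hW : IsDoubleWell W) {r : ℝ} (hr : r ∈ Icc (-1 : ℝ) 1) : 0 ≤ W r := by
  rcases eq_or_lt_of_le hr.1 with h | h
  · rw [← h, hW.zero.1]
  rcases eq_or_lt_of_le hr.2 with h' | h'
  · rw [h', hW.zero.2]
  exact (hW.pos r ⟨h, h'⟩).le

lemma MemH10.grad_psi_eq (hΩ : IsOpen Ω) (h : MemH10 Ω (fun x => φ x - (-1)) (fun x => innerSL ℝ (D x)))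
    (hr : ∀ᵐ x ∂vol Ω, φ x ∈ Icc (-1 : ℝ) 1) {W : ℝ → ℝ} (hW : IsDoubleWell W) {Dψ : V[d]}
    (hψ : HasWeakGrad Ω (fun x => psi W (φ x)) Dψ) :
    ∀ᵐ x ∂vol Ω, Dψ x = √(2 * W (φ x)) • D x := by
  have h1 := (h.comp_primitive hΩ hr hW.continuous_sqrt).weak.mono (subset_univ Ω)
  have h2 : HasWeakFDeriv Ω (fun x => psi W (φ x)) (fun x => √(2 * W (φ x)) • innerSL ℝ (D x)) :=
    h1.congr_ae hΩ ((ae_restrict_mem hΩ.measurableSet).mono fun x hx => by simp [hx, psi])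
      ((ae_restrict_mem hΩ.measurableSet).mono fun x hx => by simp only [indicator_of_mem hx])
  rw [ae_restrict_iff' hΩ.measurableSet]
  filter_upwards [hψ.ae_eq hΩ h2] with x hx hxΩ
  have := hx hxΩ
  refine ext_inner_right ℝ fun y => ?_
  have h3 := congrArg (fun L : L[d, ℝ] => L y) this
  rw [real_inner_smul_left]
  exact h3

/-- The Euler-Lagrange (stress tensor) identity. -/
lemma PhaseSlice.integral_curvature (h : PhaseSlice Ω φ D D2) (dm : Dom Ω)
    {W : ℝ → ℝ} (hW : IsDoubleWell W) {ε : ℝ} {w : V[d]} {K : ℝ≥0} (hK : LipschitzWith K w)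
    (h0 : ∀ x ∉ Ω, w x = 0) :
    ∫ x in Ω, ((-ε * tr (D2 x) + 1 / ε * deriv W (φ x)) * ⟪D x, w x⟫ - ε * ⟪D x, ∇ w x (D x)⟫
      + tr (∇ w x) * (ε / 2 * ‖D x‖ ^ 2 + 1 / ε * W (φ x))) = 0 := by
  have hfin : IsFiniteMeasure (vol Ω) := ⟨by rw [restrict_apply_univ]; exact dm.b.measure_lt_top⟩
  have mφ : AESM φ (vol Ω) := by
    have := h.bdry.memLp.1.add_const (-1); simpa using this
  have cW' := hW.contDiff.continuous_deriv (by norm_num)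
  have cW := hW.contDiff.continuous
  obtain ⟨C, hC⟩ := cW'.bdd_Icc
  obtain ⟨C', hC'⟩ := cW.bdd_Icc
  have mW' : ML2 (fun x => deriv W (φ x)) Ω :=
    MemLp.of_bound (cW'.comp_aesm mφ) C (h.range.mono fun x hx => hC _ hx)
  have mW : Integrable (fun x => W (φ x)) (vol Ω) :=
    Integrable.of_bound (cW.comp_aesm mφ) C' (h.range.mono fun x hx => hC' _ hx)
  have mtr : ML2 (fun x => tr (D2 x)) Ω := by
    have := (trCLM d).comp_memLp' h.hess
    simpa only [comp_def, trCLM_apply] using this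
  have mH : ML2 (fun x => -ε * tr (D2 x) + 1 / ε * deriv W (φ x)) Ω :=
    (mtr.const_mul _).add (mW'.const_mul _)
  have mD2 : Integrable (fun x => ‖D x‖ ^ 2) (vol Ω) := h.grad.norm.integrable_sq
  have me : Integrable (fun x => ε / 2 * ‖D x‖ ^ 2 + 1 / ε * W (φ x)) (vol Ω) :=
    (mD2.const_mul _).add (mW.const_mul _)
  have mHD : Integrable (fun x => ‖-ε * tr (D2 x) + 1 / ε * deriv W (φ x)‖ * ‖D x‖) (vol Ω) :=
    mH.norm.integrable_mul h.grad.norm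
  refine lipschitz_integral_eq_zero (w := w) (K := K) dm (Λ := fun x m M =>
      (-ε * tr (D2 x) + 1 / ε * deriv W (φ x)) * ⟪D x, m⟫ - ε * ⟪D x, M (D x)⟫
      + tr M * (ε / 2 * ‖D x‖ ^ 2 + 1 / ε * W (φ x)))
    (g := fun x => ‖-ε * tr (D2 x) + 1 / ε * deriv W (φ x)‖ * ‖D x‖ + (|ε| * ‖D x‖ ^ 2
      + ‖trCLM d‖ * ‖ε / 2 * ‖D x‖ ^ 2 + 1 / ε * W (φ x)‖))
    (fun x => ?_) (fun w hw hDw => ?_) ?_ (of_forall fun x => ⟨by positivity, fun m M => ?_⟩) (fun η hη => ?_) hK h0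
  · simp only [← trCLM_apply]; fun_prop
  · have a1 : AESM (fun x => ⟪D x, w x⟫) (vol Ω) := h.grad.1.inner hw.aesm
    have a2 : AESM (fun x => ⟪D x, ∇ w x (D x)⟫) (vol Ω) :=
      h.grad.1.inner (aesm_clm_eval hDw h.grad.1)
    have a3 : AESM (fun x => tr (∇ w x)) (vol Ω) := aesm_tr hDw
    exact ((mH.1.mul a1).sub (a2.const_mul _)).add (a3.mul me.1)
  · exact mHD.add ((mD2.const_mul _).add (me.norm.const_mul _))
  · have b1 := norm_inner_le_norm (𝕜 := ℝ) (D x) m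
    have b2 : ‖⟪D x, M (D x)⟫‖ ≤ ‖M‖ * ‖D x‖ ^ 2 := by
      refine (norm_inner_le_norm (𝕜 := ℝ) _ _).trans ?_
      have := mul_le_left (M.le_opNorm (D x)) (norm_nonneg (D x))
      nlinarith
    have b3 := abs_tr_le M
    refine (norm_add_le _ _).trans ((add_le_add (norm_sub_le _ _) le_rfl).trans ?_)
    rw [norm_mul, norm_mul, norm_mul (tr M), norm_eq_abs ε, norm_eq_abs (tr M)]
    have c1 := mul_le_left b1 (norm_nonneg (-ε * tr (D2 x) + 1 / ε * deriv W (φ x)))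
    have c2 := mul_le_left b2 (abs_nonneg ε)
    have c3 := mul_le_right b3 (norm_nonneg (ε / 2 * ‖D x‖ ^ 2 + 1 / ε * W (φ x)))
    set a := ‖-ε * tr (D2 x) + 1 / ε * deriv W (φ x)‖
    set b := ‖ε / 2 * ‖D x‖ ^ 2 + 1 / ε * W (φ x)‖
    have p1 : 0 ≤ a * ‖D x‖ * ‖M‖ := by positivity
    have p2 : 0 ≤ |ε| * ‖D x‖ ^ 2 * ‖m‖ := by positivity
    have p3 : 0 ≤ ‖trCLM d‖ * b * ‖m‖ := by positivity
    nlinarith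
  · have s1 := h.integral_stress_test dm.o hη
    have hw : HasWeakFDeriv Ω (fun x => W (φ x)) (fun x => deriv W (φ x) • innerSL ℝ (D x)) :=
      ((h.bdry.comp_primitive dm.o h.range cW').weak.mono (subset_univ Ω)).congr_ae dm.o
        ((ae_restrict_mem dm.m).mono fun x hx => by simp [hx, hW.integral_deriv])
        ((ae_restrict_mem dm.m).mono fun x hx => by simp only [indicator_of_mem hx])
    have s2 := hw.integral_apply_test hη
    obtain ⟨K', hK'⟩ := hη.bdd
    obtain ⟨K'', hK''⟩ := hη.bdd_fderiv
    have cη : Continuous η := hη.cont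
    have cd : Continuous fun x => divg η x := by
      simp only [divg, ← trCLM_apply]; exact (trCLM d).continuous.comp hη.continuous_fderiv
    have hdb : ∀ x, ‖divg η x‖ ≤ ‖trCLM d‖ * K'' := fun x =>
      (abs_tr_le _).trans (mul_le_left (hK'' x) (norm_nonneg (trCLM d)))
    have mη : ML2 (fun x => ⟪D x, η x⟫) Ω :=
      h.grad.of_le_mul (c := K') (h.grad.1.inner cη.aesm) (of_forall fun x => by
        refine (norm_inner_le_norm (𝕜 := ℝ) _ _).trans ?_
        rw [mul_comm]; exact mul_le_right (hK' x) (norm_nonneg _))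
    have i1 : Integrable (fun x => tr (D2 x) * ⟪D x, η x⟫) (vol Ω) := mtr.integrable_mul mη
    have i2 : Integrable (fun x => 1 / 2 * ⟪D x, D x⟫ * divg η x) (vol Ω) := by
      simp only [real_inner_self_eq_norm_sq]
      exact (mD2.const_mul _).mul_bdd (c := ‖trCLM d‖ * K'') cd.aesm (of_forall hdb)
    have i3 : Integrable (fun x => ⟪D x, ∇ η x (D x)⟫) (vol Ω) := by
      have : ML2 (fun x => ∇ η x (D x)) Ω :=
        h.grad.of_le_mul (c := K'') (aesm_clm_eval hη.continuous_fderiv.aesm h.grad.1)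
          (of_forall fun x => ((∇ η x).le_opNorm _).trans
          (mul_le_right (hK'' x) (norm_nonneg _)))
      exact integrable_bilin (innerSL ℝ) h.grad this
    have i4 : Integrable (fun x => deriv W (φ x) * ⟪D x, η x⟫) (vol Ω) := mW'.integrable_mul mη
    have i5 : Integrable (fun x => W (φ x) * divg η x) (vol Ω) :=
      mW.mul_bdd (c := ‖trCLM d‖ * K'') cd.aesm (of_forall hdb)
    have i6 : Integrable (fun x => deriv W (φ x) * ⟪D x, η x⟫ + W (φ x) * divg η x) (vol Ω) := i4.add i5
    have i7 : Integrable (fun x => tr (D2 x) * ⟪D x, η x⟫ - 1 / 2 * ⟪D x, D x⟫ * divg η x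
      + ⟪D x, ∇ η x (D x)⟫) (vol Ω) := (i1.sub i2).add i3
    have s3 : ∫ x in Ω, (deriv W (φ x) * ⟪D x, η x⟫ + W (φ x) * divg η x) = 0 := by
      rw [integral_add i4 i5]
      have : ∫ x in Ω, deriv W (φ x) * ⟪D x, η x⟫ = -∫ x in Ω, W (φ x) * divg η x := s2
      linarith
    have : ∀ x, (-ε * tr (D2 x) + 1 / ε * deriv W (φ x)) * ⟪D x, η x⟫ - ε * ⟪D x, ∇ η x (D x)⟫
      + tr (∇ η x) * (ε / 2 * ‖D x‖ ^ 2 + 1 / ε * W (φ x))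
      = (-ε) * (tr (D2 x) * ⟪D x, η x⟫ - 1 / 2 * ⟪D x, D x⟫ * divg η x + ⟪D x, ∇ η x (D x)⟫)
        + 1 / ε * (deriv W (φ x) * ⟪D x, η x⟫ + W (φ x) * divg η x) := fun x => by
      rw [real_inner_self_eq_norm_sq, divg]; ring
    simp only [this]
    rw [integral_add (i7.const_mul _) (i6.const_mul _), integral_const_mul, integral_const_mul, s1, s3]
    simp

lemma tendsto_fderiv_mollify {f : R[d]} {G : Vec d → L[d, ℝ]} (h : MemH1 univ f G) :
    (∀ n, Smooth (mollify n f)) ∧ (∀ n, ML2 (mollify n f) Ω) ∧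
    (∀ n, ML2 (∇ (mollify n f)) Ω) ∧ ML2 f Ω ∧
    ML2 G Ω ∧
    Null (fun n => eL2 (mollify n f - f) Ω) ∧
    Null (fun n => eL2 (∇ (mollify n f) - G) Ω) := by
  have f2 : MemLp f 2 := by simpa using h.memLp
  have G2 : MemLp G 2 := by simpa using h.memLp_deriv
  have hl := f2.locallyIntegrable (by norm_num : (1 : ℝ≥0∞) ≤ 2)
  have e := fderiv_mollify_of_memH1 hl (G2.locallyIntegrable (by norm_num)) h.weak
  refine ⟨fun n => mollify_contDiff n hl, fun n => (mollify_memLp f2 n).restrict _,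
    fun n => (e n).symm ▸ (mollify_memLp G2 n).restrict _, f2.restrict _, G2.restrict _, ?_, ?_⟩
  · exact tendsto_zero_of_le (tendsto_eLpNorm_mollify_sub f2) fun n => eLpNorm_restrict_le _ _ _ _
  · refine tendsto_zero_of_le (tendsto_eLpNorm_mollify_sub G2) fun n => ?_
    rw [e]
    exact eLpNorm_restrict_le _ _ _ _

/-- Integration by parts along a weakly solenoidal field. -/
lemma MemH1.integral_mul_apply (dm : Dom Ω)
    {f : R[d]} {G : Vec d → L[d, ℝ]} (h : MemH1 univ f G) {u : V[d]} (hu : WeaklyDivFree Ω u)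
    (u2 : ML2 u Ω) {g : R[d]} {K : ℝ≥0} (hK : LipschitzWith K g)
    (h0 : ∀ x ∉ Ω, g x = 0) : ∫ x in Ω, (g x * G x (u x) + f x * ∇ g x (u x)) = 0 := by
  obtain ⟨fs, f2, D2, f02, G2, tf, tG⟩ := tendsto_fderiv_mollify (Ω := Ω) h
  have n1 : Integrable (fun x => ‖G x‖ * ‖u x‖ + ‖f x‖ * ‖u x‖) (vol Ω) :=
    (G2.norm.integrable_mul u2.norm).add (f02.norm.integrable_mul u2.norm)
  have mGu := aesm_clm_eval G2.1 u2.1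
  refine lipschitz_integral_eq_zero (Λ := fun x m M => m * G x (u x) + f x * M (u x)) dm
    (fun x => by fun_prop) (fun w hw hDw => ?_) n1 (of_forall fun x => ⟨by positivity, fun m M => ?_⟩)
    (fun η hη => ?_) hK h0
  · exact (hw.aesm.mul mGu).add (f02.1.mul (aesm_clm_eval hDw u2.1))
  · refine (norm_add_le _ _).trans ?_
    rw [norm_mul, norm_mul]
    have c1 := mul_le_left ((G x).le_opNorm (u x)) (norm_nonneg m)
    have c2 := mul_le_left (M.le_opNorm (u x)) (norm_nonneg (f x))
    have p1 : 0 ≤ ‖G x‖ * ‖u x‖ * ‖M‖ := by positivity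
    have p2 : 0 ≤ ‖f x‖ * ‖u x‖ * ‖m‖ := by positivity
    nlinarith
  · obtain ⟨C, hC⟩ := hη.bdd
    obtain ⟨C', hC'⟩ := hη.bdd_fderiv
    have v1 : ML2 (fun x => η x • u x) Ω :=
      u2.bdd_smul hη.cont.aesm (of_forall hC)
    have v2 : ML2 (fun x => ∇ η x (u x)) Ω :=
      u2.of_le_mul (c := C') (aesm_clm_eval hη.continuous_fderiv.aesm u2.1)
        (of_forall fun x => ((∇ η x).le_opNorm _).trans
        (mul_le_right (hC' x) (norm_nonneg _)))
    have z : ∀ {E : Type} [NormedAddCommGroup E] (a : Vec d → E), Null (fun _ : ℕ => eL2 (a - a) Ω) := fun a => by simp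
    have l1 := tendsto_integral_bilin (idL (L[d, ℝ])) D2 G2 (fun _ : ℕ => v1) v1 tG (z _)
    have l2 := tendsto_integral_bilin (mulL) f2 f02 (fun _ : ℕ => v2) v2 tf (z _)
    have l3 := l1.add l2
    have e1 : ∀ x, (idL (L[d, ℝ])) (G x) (η x • u x) = η x * G x (u x) := fun x => by simp
    have i1 : Integrable (fun x => η x * G x (u x)) (vol Ω) :=
      (integrable_bilin (idL (L[d, ℝ])) G2 v1).congr (of_forall e1)
    have i2 : Integrable (fun x => f x * ∇ η x (u x)) (vol Ω) :=
      integrable_bilin (mulL) f02 v2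
    rw [integral_add i1 i2]
    simp only [e1] at l3
    refine tendsto_nhds_unique l3 (tendsto_const_nhds.congr fun n => ?_)
    rw [← integral_add (integrable_bilin (idL (L[d, ℝ])) (D2 n) v1)
      (integrable_bilin (mulL) (f2 n) v2)]
    have ht : IsTest Ω fun x => η x * mollify n f x := ⟨hη.smooth.mul (fs n), hη.compact.mul_right,
      (closure_mono (support_mul_subset_left _ _)).trans hη.support⟩
    rw [← hu.integral_eq _ ht]
    congr 1; ext x
    rw [fderiv_fun_mul (hη.differentiable x) ((fs n).differentiable (by simp) x)]
    simp

lemma integral_curl_of_smooth {f : R[d]} (hf : Smooth f) {ξ B : V[d]}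
    (hξ : ContDiff ℝ 1 ξ) (hB : IsTest Ω B) :
    ∫ x in Ω, ∇ f x (divg ξ x • B x + ∇ B x (ξ x) - divg B x • ξ x - ∇ ξ x (B x)) = 0 := by
  have hDf : Smooth (∇ f) := hf.fderiv_right le_rfl
  have dDf : Differentiable ℝ (∇ f) := hDf.differentiable (by simp)
  have dξ := hξ.differentiable one_ne_zero
  have cDf := hDf.continuous
  have cD2 : Continuous (∇ (∇ f)) := hDf.continuous_fderiv (by simp)
  have cξ := hξ.continuous
  have cDξ := hξ.continuous_fderiv one_ne_zero
  have cB := hB.cont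
  have cDB := hB.continuous_fderiv
  have hθ : IsTest univ fun x => ∇ f x (B x) := ⟨hDf.clm_apply hB.smooth,
    hB.compact.mono fun x hx hx' => hx (by simp only [hx', map_zero]), subset_univ _⟩
  have h1 := (hasWeakFDeriv_of_contDiff hξ).integral_fderiv_apply hθ
  have h2 := (hasWeakFDeriv_of_contDiff ((hDf.toC1).clm_apply hξ)).integral_apply_test
    (hB.mono (subset_univ _))
  have e1 : ∀ x, ∇ (fun x => ∇ f x (B x)) x (ξ x) =
      ∇ (∇ f) x (ξ x) (B x) + ∇ f x (∇ B x (ξ x)) := fun x => by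
    rw [((dDf x).hasFDerivAt.clm_apply (hB.differentiable x).hasFDerivAt).fderiv]; simp; ring
  have e2 : ∀ x, ∇ (fun x => ∇ f x (ξ x)) x (B x) =
      ∇ (∇ f) x (ξ x) (B x) + ∇ f x (∇ ξ x (B x)) := fun x => by
    rw [((dDf x).hasFDerivAt.clm_apply (dξ x).hasFDerivAt).fderiv,
      second_derivative_symmetric (fun y => (hf.differentiable (by simp) y).hasFDerivAt) (dDf x).hasFDerivAt (ξ x) (B x)]
    simp; ring
  rw [restrict_univ] at h1 h2
  simp only [e1] at h1
  simp only [e2] at h2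
  have cs : ∀ {g : R[d]}, Continuous g → (∀ x ∉ tsupport B, g x = 0) → Integrable g := fun hg h0 =>
    hg.integrable_of_hasCompactSupport (HasCompactSupport.intro hB.compact h0)
  have i1 : Integrable fun x => ∇ (∇ f) x (ξ x) (B x) :=
    cs ((cD2.clm_apply cξ).clm_apply cB) fun x hx => by simp [eq_zero_off hx]
  have i2 : Integrable fun x => ∇ f x (∇ B x (ξ x)) :=
    cs (cDf.clm_apply (cDB.clm_apply cξ)) fun x hx => by simp [fderiv_off hx]
  have i3 : Integrable fun x => ∇ f x (∇ ξ x (B x)) :=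
    cs (cDf.clm_apply (cDξ.clm_apply cB)) fun x hx => by simp [eq_zero_off hx]
  have i4 : Integrable fun x => ∇ f x (B x) * tr (∇ ξ x) :=
    cs ((cDf.clm_apply cB).mul cDξ.tr') fun x hx => by simp [eq_zero_off hx]
  have i5 : Integrable fun x => ∇ f x (ξ x) * divg B x :=
    cs ((cDf.clm_apply cξ).mul cDB.tr') fun x hx => by simp [divg, tr, fderiv_off hx]
  rw [integral_add i1 i2] at h1
  rw [integral_add i1 i3] at h2
  rw [setIntegral_eq_of_zero fun x hx => by rw [divg, divg, hB.fderiv_eq_zero hx, hB.eq_zero hx]; simp [tr]]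
  have e3 : ∀ x, ∇ f x (divg ξ x • B x + ∇ B x (ξ x) - divg B x • ξ x - ∇ ξ x (B x))
      = ∇ f x (B x) * tr (∇ ξ x) + ∇ f x (∇ B x (ξ x))
        - ∇ f x (ξ x) * divg B x - ∇ f x (∇ ξ x (B x)) := fun x => by
    simp only [map_sub, map_add, map_smul, smul_eq_mul, divg]; ring
  have i6 : Integrable fun x => ∇ f x (B x) * tr (∇ ξ x) + ∇ f x (∇ B x (ξ x)) := i4.add i2
  have i7 : Integrable fun x => ∇ f x (B x) * tr (∇ ξ x) + ∇ f x (∇ B x (ξ x))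
        - ∇ f x (ξ x) * divg B x := i6.sub i5
  simp only [e3]
  rw [integral_sub i7 i3, integral_sub i6 i5, integral_add i4 i2]
  linarith

/-- The divergence of the antisymmetric field `ξ ⊗ B - B ⊗ ξ` is orthogonal to gradients. -/
lemma MemH1.integral_curl (dm : Dom Ω)
    {f : R[d]} {G : Vec d → L[d, ℝ]} (h : MemH1 univ f G) {ξ B : V[d]} {C K : ℝ≥0}
    (hξ : ContDiff ℝ 1 ξ) (hξC : ∀ x, ‖ξ x‖ ≤ C ∧ ‖∇ ξ x‖ ≤ C) (hK : LipschitzWith K B)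
    (h0 : ∀ x ∉ Ω, B x = 0) :
    ∫ x in Ω, G x (divg ξ x • B x + ∇ B x (ξ x) - divg B x • ξ x - ∇ ξ x (B x)) = 0 := by
  have hfin : IsFiniteMeasure (vol Ω) := ⟨by rw [restrict_apply_univ]; exact dm.b.measure_lt_top⟩
  obtain ⟨fs, f2, D2, f02, G2, tf, tG⟩ := tendsto_fderiv_mollify (Ω := Ω) h
  have mξ : AESM ξ (vol Ω) := hξ.continuous.aesm
  have mDξ : AESM (∇ ξ) (vol Ω) :=
    (hξ.continuous_fderiv one_ne_zero).aesm
  set c : ℝ := ‖trCLM d‖ with hc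
  have hc0 : 0 ≤ c := norm_nonneg (trCLM d)
  have hZm : ∀ w : V[d], Continuous w → AESM (∇ w) (vol Ω) →
      AESM (fun x => divg ξ x • w x + ∇ w x (ξ x) - tr (∇ w x) • ξ x - ∇ ξ x (w x))
        (vol Ω) := fun w hw hDw =>
    ((((aesm_tr mDξ).smul hw.aesm).add (aesm_clm_eval hDw mξ)).sub ((aesm_tr hDw).smul mξ)).sub
      (aesm_clm_eval mDξ hw.aesm)
  have hZb : ∀ x (m : Vec d) (M : M[d]), ‖divg ξ x • m + M (ξ x) - tr M • ξ x - ∇ ξ x m‖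
      ≤ (c + 1) * C * (‖m‖ + ‖M‖) := fun x m M => by
    have b1 : ‖divg ξ x • m‖ ≤ c * C * ‖m‖ := by
      rw [norm_smul]
      exact mul_le_right ((abs_tr_le _).trans (mul_le_left (hξC x).2 hc0)) (norm_nonneg _)
    have b2 : ‖M (ξ x)‖ ≤ ‖M‖ * C := (M.le_opNorm _).trans (mul_le_left (hξC x).1 (norm_nonneg _))
    have b3 : ‖tr M • ξ x‖ ≤ c * ‖M‖ * C := by
      rw [norm_smul]
      exact mul_le_mul (abs_tr_le M) (hξC x).1 (norm_nonneg _) (by positivity)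
    have b4 : ‖∇ ξ x m‖ ≤ C * ‖m‖ := (le_opNorm _ _).trans
      (mul_le_right (hξC x).2 (norm_nonneg _))
    calc _ ≤ ‖divg ξ x • m‖ + ‖M (ξ x)‖ + ‖tr M • ξ x‖ + ‖∇ ξ x m‖ :=
          (norm_sub_le _ _).trans (add_le_add ((norm_sub_le _ _).trans (add_le_add (norm_add_le _ _) le_rfl)) le_rfl)
      _ ≤ _ := by nlinarith
  refine lipschitz_integral_eq_zero (w := B) (K := K)
    (Λ := fun x m M => G x (divg ξ x • m + M (ξ x) - tr M • ξ x - ∇ ξ x m))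
    (g := fun x => ‖G x‖ * ((c + 1) * C)) dm
    (fun x => ?_) (fun w hw hDw => aesm_clm_eval G2.1 (hZm w hw hDw)) ((G2.norm.integrable (by norm_num)).mul_const _)
    (of_forall fun x => ⟨by positivity, fun m M => ?_⟩) (fun η hη => ?_) hK h0
  · simp only [← trCLM_apply]; fun_prop
  · refine ((G x).le_opNorm _).trans ?_
    rw [mul_assoc]
    exact mul_le_left (hZb x m M) (norm_nonneg _)
  · obtain ⟨C₁, h1⟩ := hη.bdd
    obtain ⟨C₂, h2⟩ := hη.bdd_fderiv
    have Z2 : ML2 (fun x => divg ξ x • η x + ∇ η x (ξ x) - divg η x • ξ x - ∇ ξ x (η x)) Ω :=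
      MemLp.of_bound (hZm η hη.cont hη.continuous_fderiv.aesm) ((c + 1) * C * (C₁ + C₂))
        (of_forall fun x => (hZb x _ _).trans (mul_le_left (add_le_add (h1 x) (h2 x)) (by positivity)))
    have l1 := tendsto_integral_bilin (idL (L[d, ℝ])) D2 G2 (fun _ : ℕ => Z2) Z2 tG (by simp)
    exact tendsto_nhds_unique l1 (tendsto_const_nhds.congr fun n => (integral_curl_of_smooth (fs n) hξ hη).symm)

/-- The extension by zero of an `H^1_0` field with bounded classical derivative is Lipschitz. -/
lemma MemH10.lipschitzWith_indicator (hΩ : IsC2Domain Ω) {v : V[d]} (h : MemH10 Ω v (∇ v))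
    (hv : ContDiffOn ℝ 1 v Ω) {C : ℝ≥0} (hC : ∀ x ∈ Ω, ‖∇ v x‖ ≤ C) : LipschitzWith C (Ω.indicator v) := by
  have he := h.extend hΩ.isOpen
  set w := Ω.indicator v
  have f2 : MemLp w 2 := by simpa using he.memLp
  have G2 : MemLp (Ω.indicator (∇ v)) 2 := by simpa using he.memLp_deriv
  have hl := f2.locallyIntegrable (by norm_num : (1 : ℝ≥0∞) ≤ 2)
  have hlip : ∀ n, LipschitzWith C (mollify n w) := fun n => by
    refine lipschitzWith_of_nnnorm_fderiv_le ((mollify_contDiff n hl).differentiable (by simp)) fun x => ?_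
    rw [fderiv_mollify_of_memH1 hl (G2.locallyIntegrable (by norm_num)) he.weak]
    refine norm_mollify_le (of_forall fun y => ?_) n x
    by_cases hy : y ∈ Ω
    · simpa [hy] using hC y hy
    · simp [hy]
  have hae := mollify_ae_tendsto hl
  have hS : ∀ U : Set (Vec d), IsOpen U → U.Nonempty → ∃ y ∈ U, Tendsto (fun n => mollify n w y) atTop (𝓝 (w y)) := by
    intro U hU hne
    obtain ⟨y, h1, h2⟩ := (Measure.dense_of_ae hae).inter_open_nonempty U hU hne
    exact ⟨y, h1, h2⟩
  have key : ∀ x, ∀ δ > 0, ∃ y, Tendsto (fun n => mollify n w y) atTop (𝓝 (w y)) ∧ dist y x < δ ∧ dist (w y) (w x) < δ := by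
    intro x δ hδ
    by_cases hx : x ∈ Ω
    · have hcw : ContinuousAt w x := by
        refine (hv.continuousOn.continuousAt (hΩ.isOpen.mem_nhds hx)).congr ?_
        filter_upwards [hΩ.isOpen.mem_nhds hx] with y hy
        simp [w, hy]
      obtain ⟨r, hr, hball⟩ := Metric.continuousAt_iff.1 hcw δ hδ
      obtain ⟨y, hy, hyt⟩ := hS (ball x (min r δ)) isOpen_ball ⟨x, Metric.mem_ball_self (lt_min hr hδ)⟩
      have hy' := lt_min_iff.1 (mem_ball.1 hy)
      exact ⟨y, hyt, hy'.2, hball hy'.1⟩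
    · obtain ⟨X, -, -, s₀, hs₀, hX⟩ := hΩ.exists_outward_field
      have ht : Tendsto (fun s : ℝ => x + s • X x) (𝓝[>] 0) (𝓝 x) := by
        have : Continuous fun s : ℝ => x + s • X x := by fun_prop
        have := this.tendsto 0
        simp only [zero_smul, add_zero] at this
        exact this.mono_left nhdsWithin_le_nhds
      obtain ⟨s, hs1, hs2⟩ := ((ht.eventually (ball_mem_nhds x hδ)).and (Ioo_mem_nhdsGT hs₀)).exists
      obtain ⟨y, hy, hyt⟩ := hS (ball x δ ∩ (closure Ω)ᶜ) (isOpen_ball.inter isClosed_closure.isOpen_compl)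
        ⟨_, hs1, hX s hs2 x hx⟩
      refine ⟨y, hyt, hy.1, ?_⟩
      have : y ∉ Ω := fun h => hy.2 (subset_closure h)
      simpa [w, this, hx] using hδ
  refine LipschitzWith.of_dist_le_mul fun x z => ?_
  have hδ : ∀ n : ℕ, (0 : ℝ) < 1 / (n + 1) := fun n => by positivity
  choose a a1 a2 a3 using fun n => key x _ (hδ n)
  choose b b1 b2 b3 using fun n => key z _ (hδ n)
  have lim : ∀ {E : Type} [PseudoMetricSpace E] {f : ℕ → E} {y : E}, (∀ n : ℕ, dist (f n) y < 1 / (n + 1)) → Tendsto f atTop (𝓝 y) :=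
    fun hf => tendsto_iff_dist_tendsto_zero.2 (squeeze_zero (fun n => dist_nonneg) (fun n => (hf n).le)
      tendsto_inv_succ)
  exact le_of_tendsto_of_tendsto' ((lim a3).dist (lim b3)) (((lim a2).dist (lim b2)).const_mul _) fun n =>
    le_of_tendsto' ((a1 n).dist (b1 n)) fun k => (hlip k).dist_le_mul _ _

lemma WeaklyDivFree.integral_inner_fderiv (dm : Dom Ω)
    {u : V[d]} (hu : WeaklyDivFree Ω u) (hi : IntegrableOn u Ω) {w : V[d]} {K : ℝ≥0}
    (hK : LipschitzWith K w) (hbd : ∀ x, ‖w x‖ ≤ K) (h0 : ∀ x ∉ Ω, w x = 0) :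
    ∫ x in Ω, ⟪w x, ∇ w x (u x)⟫ = 0 := by
  have hl : LipschitzWith (K * K) fun x => 1 / 2 * ⟪w x, w x⟫ := by
    refine LipschitzWith.of_dist_le_mul fun x y => ?_
    have e : 1 / 2 * ⟪w x, w x⟫ - 1 / 2 * ⟪w y, w y⟫ = 1 / 2 * (⟪w x, w x - w y⟫ + ⟪w x - w y, w y⟫) := by
      rw [inner_sub_right, inner_sub_left]; ring
    rw [Real.dist_eq, e, abs_mul, abs_of_nonneg (by norm_num : (0 : ℝ) ≤ 1 / 2)]
    have h1 := hK.dist_le_mul x y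
    rw [dist_eq_norm (w x)] at h1
    have a1 := (abs_real_inner_le_norm (w x) (w x - w y)).trans (mul_le_mul (hbd x) h1 (norm_nonneg _) K.coe_nonneg)
    have a2 := (abs_real_inner_le_norm (w x - w y) (w y)).trans (mul_le_mul h1 (hbd y) (norm_nonneg _) (by positivity))
    have := abs_add_le ⟪w x, w x - w y⟫ ⟪w x - w y, w y⟫
    push_cast
    nlinarith
  rw [← hu.integral_fderiv_eq_zero dm hi hl fun x hx => by simp [h0 x hx]]
  refine integral_congr_ae (ae_restrict_of_ae ?_)
  filter_upwards [hK.ae_differentiableAt (μ := volume)] with x hx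
  rw [fderiv_const_mul (hx.inner ℝ hx)]
  simp only [smul_apply, fderiv_inner_apply ℝ hx hx, smul_eq_mul]
  rw [real_inner_comm (w x)]; ring

end

/-! ### The distributional gradient of an indicator function -/

section

variable {Ω U : Set (Vec d)} {χ : R[d]} {μ : Measure (Vec d)} {ν : V[d]}

lemma contDiff_of_tsupport {n : WithTop ℕ∞} {f : E → F} (h : ∀ x ∈ tsupport f, ContDiffAt ℝ n f x) : ContDiff ℝ n f :=
  contDiff_iff_contDiffAt.2 fun x => by
    by_cases hx : x ∈ tsupport f
    · exact h x hx
    · exact contDiffAt_const.congr_of_eventuallyEq (notMem_tsupport_iff_eventuallyEq.1 hx)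

lemma integral_tr_fderiv_eq_zero (dm : Dom Ω) {F : V[d]}
    {K : ℝ≥0} (hK : LipschitzWith K F) (h0 : ∀ x ∉ Ω, F x = 0) : ∫ x in Ω, tr (∇ F x) = 0 := by
  refine lipschitz_integral_eq_zero (Λ := fun _ _ M => tr M) (g := fun _ => ‖trCLM d‖) dm
    (fun x => by simp only [← trCLM_apply]; fun_prop) (fun w _ hw => ?_)
    (integrableOn_const (by exact dm.b.measure_lt_top.ne))
    (of_forall fun x => ⟨norm_nonneg (trCLM d), fun m M => ?_⟩) (fun η hη => ?_) hK h0
  · exact aesm_tr hw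
  · exact (abs_tr_le M).trans (mul_le_left (le_add_of_nonneg_left (norm_nonneg _)) (norm_nonneg (trCLM d)))
  · have := ((hasWeakFDeriv_of_contDiff (contDiff_const (c := (1 : ℝ)))).mono (subset_univ Ω)).integral_apply_test hη
    simpa [divg] using this.symm

lemma IsPolarGradient.byParts_lipschitz (h : IsPolarGradient Ω χ μ ν) (dm : Dom Ω) {F : V[d]} {K : ℝ≥0} (hK : LipschitzWith K F) (h0 : ∀ x ∉ Ω, F x = 0) :
    ∫ x in Ω, χ x * tr (∇ F x) = -∫ x, ⟪ν x, F x⟫ ∂μ := by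
  have : IsFiniteMeasure μ := ⟨h.finite⟩
  refine lipschitz_induction (p := fun F => ∫ x in Ω, χ x * tr (∇ F x) = -∫ x, ⟪ν x, F x⟫ ∂μ)
    dm h.byParts (fun C w w₀ hw hc => ?_) hK h0
  have l1 := tendsto_integral_of_dominated_convergence (μ := vol Ω)
    (F := fun n x => χ x * tr (∇ (w n) x)) (f := fun x => χ x * tr (∇ w₀ x))
    (fun x => ‖χ x‖ * (‖trCLM d‖ * C)) (fun n => ?_) (h.integrable.norm.mul_const _) (fun n => ?_) ?_
  have l2 := tendsto_integral_of_dominated_convergence (μ := μ)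
    (F := fun n x => ⟪ν x, w n x⟫) (f := fun x => ⟪ν x, w₀ x⟫)
    (fun x => (C : ℝ)) (fun n => h.aesm.inner (hc.lip n).continuous.aesm) (integrable_const _)
    (fun n => ?_) (of_forall fun x => tendsto_const_nhds.inner (hc.tendsto x))
  · simp only [hw] at l1
    exact tendsto_nhds_unique l1 l2.neg
  · filter_upwards [h.norm_eq_one] with x hx
    refine (norm_inner_le_norm (𝕜 := ℝ) _ _).trans ?_
    rw [hx, one_mul]; exact hc.bdd n x
  · borelize M[d]
    refine h.integrable.1.mul ?_
    exact aesm_tr (measurable_fderiv ℝ _).aesm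
  · refine of_forall fun x => ?_
    rw [norm_mul]
    exact mul_le_left ((abs_tr_le _).trans
      (mul_le_left (hc.norm_fderiv_le n x) (norm_nonneg (trCLM d)))) (norm_nonneg _)
  · filter_upwards [hc.tendsto_fderiv] with x hx
    simp only [← trCLM_apply]
    exact (((trCLM d).continuous.tendsto _).comp hx).const_mul _

/-- The total variation measure is concentrated on the topological boundary. -/
lemma IsPolarGradient.ae_mem_frontier (h : IsPolarGradient Ω χ μ ν) (dm : Dom Ω) (hχ : ∀ x ∈ Ω, χ x = U.indicator 1 x) : ∀ᵐ x ∂μ, x ∈ frontier U := by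
  have : IsFiniteMeasure μ := ⟨h.finite⟩
  have hνi : Integrable ν μ := Integrable.of_bound h.aesm 1 (h.norm_eq_one.mono fun x hx => hx.le)
  have hO : IsOpen (Ω \ frontier U) := dm.o.sdiff isClosed_frontier
  have h1 : ∀ᵐ x ∂μ, x ∈ Ω \ frontier U → ν x = 0 := by
    refine hO.ae_eq_zero_of_integral_contDiff_smul_eq_zero (hνi.locallyIntegrable.locallyIntegrableOn _) fun g hg hc hs => ?_
    have hgt : IsTest Ω g := ⟨hg, hc, hs.trans sdiff_subset⟩
    have hloc : ∀ x ∈ tsupport g, (x ∈ U ∧ U.indicator g =ᶠ[𝓝 x] g) ∨ (x ∉ U ∧ U.indicator g =ᶠ[𝓝 x] 0) := fun x hx => by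
      have hx2 := (hs hx).2
      by_cases hxi : x ∈ interior U
      · exact Or.inl ⟨interior_subset hxi, by
          filter_upwards [isOpen_interior.mem_nhds hxi] with y hy using indicator_of_mem (interior_subset hy) _⟩
      · have : x ∉ closure U := fun hcl => hx2 ⟨hcl, hxi⟩
        refine Or.inr ⟨fun h => this (subset_closure h), ?_⟩
        filter_upwards [isClosed_closure.isOpen_compl.mem_nhds this] with y hy
        exact indicator_of_notMem (fun h => hy (subset_closure h)) _
    have hts : tsupport (U.indicator g) ⊆ tsupport g := closure_mono fun x hx hx' => hx (by simp [hx'])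
    have hsm : Smooth (U.indicator g) := contDiff_of_tsupport fun x hx => by
      rcases hloc x (hts hx) with ⟨-, e⟩ | ⟨-, e⟩
      · exact hg.contDiffAt.congr_of_eventuallyEq e
      · exact contDiffAt_const.congr_of_eventuallyEq e
    have hit : IsTest Ω (U.indicator g) := ⟨hsm, hc.mono fun x hx hx' => hx (by simp [hx']),
      hts.trans hgt.support⟩
    refine ext_inner_right ℝ fun e => ?_
    have hi : Integrable (fun x => g x • ν x) μ := by
      obtain ⟨C, hC⟩ := hg.continuous.bounded_above_of_compact_support hc
      exact hνi.bdd_smul C hg.continuous.aesm (of_forall hC)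
    have h2 := h.byParts _ (hgt.smul_const e)
    obtain ⟨K, hK⟩ := (hit.smul_const e).exists_lipschitz
    have h3 := integral_tr_fderiv_eq_zero dm hK fun x hx => (hit.smul_const e).eq_zero hx
    have h4 : ∫ x in Ω, χ x * divg (fun x => g x • e) x = 0 := by
      rw [← h3]
      refine setIntegral_congr_fun dm.m fun x hx => ?_
      simp only [hχ x hx, divg]
      by_cases hxs : x ∈ tsupport g
      · rcases hloc x hxs with ⟨hxU, e1⟩ | ⟨hxU, e1⟩
        · rw [(e1.smul (EventuallyEq.refl _ fun _ => e) : (fun x => U.indicator g x • e) =ᶠ[𝓝 x] fun x => g x • e).fderiv_eq]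
          simp [hxU]
        · rw [(e1.smul (EventuallyEq.refl _ fun _ => e) : (fun x => U.indicator g x • e) =ᶠ[𝓝 x]
            fun x => (0 : R[d]) x • e).fderiv_eq]
          simp [hxU, tr]
      · have z1 : g =ᶠ[𝓝 x] 0 := notMem_tsupport_iff_eventuallyEq.1 hxs
        have z2 : U.indicator g =ᶠ[𝓝 x] 0 := notMem_tsupport_iff_eventuallyEq.1 fun h => hxs (hts h)
        rw [(z1.smul (EventuallyEq.refl _ fun _ => e) : (fun x => g x • e) =ᶠ[𝓝 x]
            fun x => (0 : R[d]) x • e).fderiv_eq, (z2.smul (EventuallyEq.refl _ fun _ => e) :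
            (fun x => U.indicator g x • e) =ᶠ[𝓝 x] fun x => (0 : R[d]) x • e).fderiv_eq]
        simp [tr]
    rw [h4, eq_comm, neg_eq_zero] at h2
    rw [inner_zero_left, real_inner_comm, ← integral_inner hi, ← h2]
    congr 1; ext x
    rw [real_inner_smul_right, real_inner_smul_right, real_inner_comm]
  have h2 : ∀ᵐ x ∂μ, x ∈ Ω := by
    rw [ae_iff]; exact h.compl
  filter_upwards [h1, h2, h.norm_eq_one] with x a b c
  by_contra hx
  rw [a ⟨b, hx⟩, norm_zero] at c
  exact zero_ne_one c

lemma divg_smul_eq {g : R[d]} {F : V[d]} {g' : L[d, ℝ]} {F' : M[d]} {x : Vec d}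
    (hg : HasFDerivAt g g' x) (hF : HasFDerivAt F F' x) :
    tr (∇ (fun x => g x • F x) x) = g x * tr F' + g' (F x) := by
  have h : HasFDerivAt (fun x => g x • F x) (g x • F' + g'.smulRight (F x)) x := hg.smul hF
  rw [h.fderiv, ← trCLM_apply (_ + _), map_add, map_smul, trCLM_apply, trCLM_apply, tr_smulRight, smul_eq_mul]

lemma integral_mul_tr_fderiv (dm : Dom Ω) {g : R[d]}
    (hg : ContDiff ℝ 1 g) {F : V[d]} (hF : ContDiff ℝ 1 F) (hc : HasCompactSupport F) (h0 : ∀ x ∉ Ω, F x = 0) :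
    ∫ x in Ω, g x * tr (∇ F x) = -∫ x in Ω, ∇ g x (F x) := by
  have hG : ContDiff ℝ 1 fun x => g x • F x := hg.smul hF
  have hGc : HasCompactSupport fun x => g x • F x := hc.mono fun x hx hx' => hx (by simp only [hx', smul_zero])
  obtain ⟨K, hK⟩ := hG.lipschitzWith_of_hasCompactSupport hGc one_ne_zero
  have h1 := integral_tr_fderiv_eq_zero dm hK fun x hx => by rw [h0 x hx, smul_zero]
  have e : ∀ x, tr (∇ (fun x => g x • F x) x) = g x * tr (∇ F x) + ∇ g x (F x) := fun x =>
    divg_smul_eq (hg.differentiable one_ne_zero x).hasFDerivAt (hF.differentiable one_ne_zero x).hasFDerivAt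
  simp only [e] at h1
  rw [integral_add] at h1
  · linarith
  · exact ((hg.continuous.mul (hF.continuous_fderiv one_ne_zero).tr').integrable_of_hasCompactSupport
      (HasCompactSupport.intro hc fun x hx => by simp [fderiv_off hx, tr])).integrableOn
  · exact (((hg.continuous_fderiv one_ne_zero).clm_apply hF.continuous).integrable_of_hasCompactSupport
      (HasCompactSupport.intro hc fun x hx => by
        rw [eq_zero_off hx, map_zero])).integrableOn

lemma IsPolarGradient.integral_inner_nonneg (h : IsPolarGradient Ω χ μ ν) (dm : Dom Ω) (hχ : ∀ x ∈ Ω, χ x = U.indicator 1 x) {ρ : R[d]} (hρ : ContDiff ℝ 1 ρ)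
    {F : V[d]} (hF : ContDiff ℝ 1 F) (hc : HasCompactSupport F) (hs : tsupport F ⊆ Ω)
    (hU : ∀ x ∈ tsupport F, (x ∈ U ↔ 0 < ρ x)) (hn : ∀ x ∈ tsupport F, 0 ≤ ∇ ρ x (F x)) :
    0 ≤ ∫ x, ⟪ν x, F x⟫ ∂μ := by
  have h0 : ∀ x ∉ Ω, F x = 0 := fun x hx => eq_zero_off fun h => hx (hs h)
  obtain ⟨K, hK⟩ := hF.lipschitzWith_of_hasCompactSupport hc (by simp)
  have hp := h.byParts_lipschitz dm hK h0
  have hS : ContDiff ℝ 1 Real.smoothTransition := by exact_mod_cast Real.smoothTransition.contDiff (n := 1)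
  have cDF := hF.continuous_fderiv one_ne_zero
  have hdivi : Integrable fun x => tr (∇ F x) := cDF.tr'.integrable_of_hasCompactSupport
    (HasCompactSupport.intro hc fun x hx => by simp [fderiv_off hx, tr])
  have hneg : ∀ k : ℕ, ∫ x in Ω, Real.smoothTransition (k * ρ x) * tr (∇ F x) ≤ 0 := fun k => by
    have hg : ContDiff ℝ 1 fun x => Real.smoothTransition (k * ρ x) := hS.comp (contDiff_const.mul hρ)
    rw [integral_mul_tr_fderiv dm hg hF hc h0, neg_nonpos]
    refine integral_nonneg fun x => ?_
    have e1 : HasFDerivAt (fun x => Real.smoothTransition (k * ρ x))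
        (deriv Real.smoothTransition (k * ρ x) • ((k : ℝ) • ∇ ρ x)) x :=
      (hS.differentiable one_ne_zero _).hasDerivAt.comp_hasFDerivAt x
        ((hρ.differentiable one_ne_zero x).hasFDerivAt.const_mul (k : ℝ))
    rw [e1.fderiv]
    by_cases hx : x ∈ tsupport F
    · exact mul_nonneg Real.smoothTransition.monotone.deriv_nonneg (mul_nonneg (Nat.cast_nonneg k) (hn x hx))
    · rw [eq_zero_off hx, map_zero]; exact le_rfl
  have l1 := tendsto_integral_of_dominated_convergence (μ := vol Ω)
    (F := fun (k : ℕ) x => Real.smoothTransition (k * ρ x) * tr (∇ F x)) (f := fun x => χ x * tr (∇ F x))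
    (fun x => ‖tr (∇ F x)‖) (fun k => ?_) hdivi.norm.integrableOn (fun k => of_forall fun x => ?_) ?_
  · rw [hp] at l1
    have := le_of_tendsto' l1 hneg
    linarith
  · exact ((hS.continuous.comp (continuous_const.mul hρ.continuous)).mul cDF.tr').aesm
  · rw [norm_mul, norm_of_nonneg (Real.smoothTransition.nonneg _)]
    exact mul_le_of_le_one_left (norm_nonneg _) (Real.smoothTransition.le_one _)
  · filter_upwards [ae_restrict_mem dm.m] with x hxΩ
    by_cases hx : x ∈ tsupport F
    · refine Tendsto.mul_const _ ?_
      rw [hχ x hxΩ]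
      by_cases hxU : x ∈ U
      · have hpos := (hU x hx).1 hxU
        rw [indicator_of_mem hxU, Pi.one_apply]
        refine tendsto_const_nhds.congr' ?_
        have := (tendsto_natCast_atTop_atTop (R := ℝ)).atTop_mul_const hpos
        filter_upwards [this.eventually_ge_atTop 1] with k hk
        exact (Real.smoothTransition.one_of_one_le hk).symm
      · have hnp : ρ x ≤ 0 := not_lt.1 fun h => hxU ((hU x hx).2 h)
        rw [indicator_of_notMem hxU]
        refine tendsto_const_nhds.congr fun k => ?_
        exact (Real.smoothTransition.zero_of_nonpos (mul_nonpos_of_nonneg_of_nonpos (Nat.cast_nonneg k) hnp)).symm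
    · simp only [fderiv_off hx]
      simp [tr]

end

/-! ### Geometry of the interface -/

section

variable {Ω U : Set (Vec d)} {χ : R[d]} {μ : Measure (Vec d)} {ν : V[d]}

lemma contDiffAt_gradient {ρ : R[d]} {x : Vec d} (h : ContDiffAt ℝ 2 ρ x) : ContDiffAt ℝ 1 (gradient ρ) x :=
  ((InnerProductSpace.toDual ℝ (Vec d)).symm.toContinuousLinearEquiv.toContinuousLinearMap.contDiff.contDiffAt).comp x
    (h.fderiv_right (by norm_num))

lemma contDiffAt_unitNormal {ρ : R[d]} {x : Vec d} (h : ContDiffAt ℝ 2 ρ x) (h0 : gradient ρ x ≠ 0) :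
    ContDiffAt ℝ 1 (unitNormal ρ) x :=
  (((contDiffAt_gradient h).norm ℝ h0).inv (norm_ne_zero_iff.2 h0)).smul (contDiffAt_gradient h)

lemma norm_unitNormal {ρ : R[d]} {x : Vec d} (h0 : gradient ρ x ≠ 0) : ‖unitNormal ρ x‖ = 1 := by
  rw [unitNormal, norm_smul, norm_inv, norm_norm, inv_mul_cancel₀ (norm_ne_zero_iff.2 h0)]

lemma fderiv_eq_inner_unitNormal {ρ : R[d]} {x : Vec d} (h0 : gradient ρ x ≠ 0) (a : Vec d) :
    ∇ ρ x a = ‖gradient ρ x‖ * ⟪unitNormal ρ x, a⟫ := by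
  rw [unitNormal, real_inner_smul_left, real_inner_comm, inner_gradient_eq, mul_inv_cancel_left₀ (norm_ne_zero_iff.2 h0)]

lemma IsLocalDefiningFunction.eventually {p : Vec d} {ρ : R[d]} (h : IsLocalDefiningFunction 2 U p ρ) :
    ∀ᶠ x in 𝓝 p, ContDiffAt ℝ 2 ρ x ∧ gradient ρ x ≠ 0 ∧ (x ∈ U ↔ 0 < ρ x) ∧
      (x ∈ frontier U ∨ ρ x = 0 → IsLocalDefiningFunction 2 U x ρ ∧ x ∈ frontier U) := by
  have h1 : ∀ᶠ x in 𝓝 p, ContDiffAt ℝ 2 ρ x := h.contDiffAt.eventually (by simp)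
  have h2 : ∀ᶠ x in 𝓝 p, gradient ρ x ≠ 0 :=
    (contDiffAt_gradient h.contDiffAt).continuousAt.eventually_ne h.gradient_ne_zero
  have h3 := h.mem_iff.eventually_nhds
  filter_upwards [h1, h2, h3] with x a b c
  refine ⟨a, b, c.self_of_nhds, fun hx => ?_⟩
  have hρ : ContinuousAt ρ x := a.continuousAt
  have hzero : ρ x = 0 := by
    rcases hx with hx | hx
    · refine le_antisymm (not_lt.1 fun hpos => ?_) (not_lt.1 fun hneg => ?_)
      · exact hx.2 (mem_interior_iff_mem_nhds.2 (by
          filter_upwards [c, hρ.eventually (lt_mem_nhds hpos)] with y h1 h2 using h1.2 h2))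
      · have : (closure U)ᶜ ∈ 𝓝 x := by
          rw [← interior_compl, interior_mem_nhds]
          filter_upwards [c, hρ.eventually (gt_mem_nhds hneg)] with y h1 h2 using fun h => absurd (h1.1 h) (not_lt.2 h2.le)
        exact (mem_of_mem_nhds this) hx.1
    · exact hx
  have hxU : x ∉ U := fun h => (lt_irrefl (0 : ℝ)) (by simpa [hzero] using c.self_of_nhds.1 h)
  refine ⟨⟨a, hzero, b, c⟩, ?_, fun h => hxU (interior_subset h)⟩
  have hd : HasDerivAt (fun t : ℝ => ρ (x + t • gradient ρ x)) (‖gradient ρ x‖ ^ 2) 0 := by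
    have h4 : HasFDerivAt ρ (∇ ρ x) (x + (0 : ℝ) • gradient ρ x) := by
      simpa using (a.differentiableAt (by norm_num)).hasFDerivAt
    have h5 : HasDerivAt (fun t : ℝ => x + t • gradient ρ x) (gradient ρ x) 0 := by
      simpa using ((hasDerivAt_id (0 : ℝ)).smul_const (gradient ρ x)).const_add x
    have h6 := h4.comp_hasDerivAt (0 : ℝ) h5
    rwa [← inner_gradient_eq, real_inner_self_eq_norm_sq] at h6
  have hpos : ∀ᶠ t in 𝓝[>] (0 : ℝ), 0 < ρ (x + t • gradient ρ x) := by
    have h7 := hd.tendsto_slope.mono_left (nhdsWithin_mono (0 : ℝ) (fun t ht => ne_of_gt ht : Ioi (0 : ℝ) ⊆ {0}ᶜ))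
    have h8 : (0 : ℝ) < ‖gradient ρ x‖ ^ 2 := by have := norm_pos_iff.2 b; positivity
    filter_upwards [h7.eventually (lt_mem_nhds h8), self_mem_nhdsWithin] with t ht ht0
    rw [slope_def_field] at ht
    simp only [zero_smul, add_zero, hzero, sub_zero] at ht
    exact (div_pos_iff_of_pos_right ht0).1 ht
  have htend : Tendsto (fun t : ℝ => x + t • gradient ρ x) (𝓝[>] 0) (𝓝 x) := by
    have : Continuous fun t : ℝ => x + t • gradient ρ x := by fun_prop
    have := this.tendsto 0
    simp only [zero_smul, add_zero] at this
    exact this.mono_left nhdsWithin_le_nhds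
  refine mem_closure_of_tendsto htend ?_
  filter_upwards [hpos, htend.eventually c] with t h1 h2 using h2.2 h1

lemma exists_fderiv_eq_smul {ρ f : R[d]} {p : Vec d} (hρ : ContDiffAt ℝ 1 ρ p) (h0 : ∇ ρ p ≠ 0)
    (hρp : ρ p = 0) (hf : ContDiffAt ℝ 1 f p) (h : ∀ᶠ x in 𝓝 p, ρ x = 0 → f x = 0) :
    ∃ c : ℝ, ∇ f p = c • ∇ ρ p := by
  have hext : IsLocalExtrOn f {x | ρ x = ρ p} p := by
    refine Or.inl ?_
    have h1 : ∀ᶠ x in 𝓝[{x | ρ x = ρ p}] p, ρ x = ρ p := eventually_mem_nhdsWithin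
    filter_upwards [h1, nhdsWithin_le_nhds h] with x hx hx2
    rw [hx2 (hx.trans hρp), h.self_of_nhds hρp]
  obtain ⟨a, b, hab, he⟩ := hext.exists_multipliers_of_hasStrictFDerivAt_1d
    (hρ.hasStrictFDerivAt one_ne_zero) (hf.hasStrictFDerivAt one_ne_zero)
  have hb : b ≠ 0 := by
    rintro rfl
    rw [zero_smul, add_zero] at he
    rcases smul_eq_zero.1 he with ha | ha
    · exact hab (by rw [ha]; rfl)
    · exact h0 ha
  refine ⟨-(b⁻¹ * a), ?_⟩
  have : b • ∇ f p = -(a • ∇ ρ p) := eq_neg_of_add_eq_zero_right he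
  rw [neg_smul, mul_smul, ← smul_neg, ← this, inv_smul_smul₀ hb]

/-- If `ξ` extends the unit normal and `∇·ξ` extends minus the mean curvature, then `(∇ξ)ᵀ ξ = 0` on
the interface. -/
lemma inner_fderiv_eq_zero_of_consistent {ξ : V[d]} (hξ : ContDiff ℝ 1 ξ)
    (hcons : ∀ x ∈ frontier U, ∀ ρ, IsLocalDefiningFunction 2 U x ρ → ξ x = unitNormal ρ x ∧ divg ξ x = -meanCurv ρ x)
    {p : Vec d} (hp : p ∈ frontier U) {ρ : R[d]} (hρ : IsLocalDefiningFunction 2 U p ρ) (a : Vec d) :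
    ⟪∇ ξ p a, ξ p⟫ = 0 := by
  obtain ⟨hN, hdiv⟩ := hcons p hp ρ hρ
  have hev := hρ.eventually
  have cN := contDiffAt_unitNormal hρ.contDiffAt hρ.gradient_ne_zero
  have dN : DifferentiableAt ℝ (unitNormal ρ) p := cN.differentiableAt one_ne_zero
  have dξ := hξ.differentiable one_ne_zero p
  have h0 : ∇ ρ p ≠ 0 := fun h => hρ.gradient_ne_zero (by rw [gradient, h, map_zero])
  have hNN : ⟪∇ (unitNormal ρ) p a, unitNormal ρ p⟫ = 0 := by
    have h1 : (fun x => ⟪unitNormal ρ x, unitNormal ρ x⟫) =ᶠ[𝓝 p] fun _ => (1 : ℝ) := by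
      filter_upwards [hev] with x hx
      rw [real_inner_self_eq_norm_sq, norm_unitNormal hx.2.1, one_pow]
    have h2 := fderiv_inner_apply ℝ dN dN a
    rw [h1.fderiv_eq, real_inner_comm] at h2
    simp at h2
    linarith
  choose c hc using fun i : Fin d => exists_fderiv_eq_smul (f := fun x => (ξ x - unitNormal ρ x) i)
    (hρ.contDiffAt.of_le (by norm_num)) h0 hρ.eq_zero
    (((proj i : L[d, ℝ]).contDiff.contDiffAt).comp p (hξ.contDiffAt.sub cN)) (by
      filter_upwards [hev] with x hx hx0
      obtain ⟨h1, h2⟩ := hx.2.2.2 (Or.inr hx0)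
      rw [(hcons x h2 ρ h1).1, sub_self]; rfl)
  have hD : ∀ (i : Fin d) b, (∇ ξ p b) i - (∇ (unitNormal ρ) p b) i
      = c i * (‖gradient ρ p‖ * ⟪unitNormal ρ p, b⟫) := fun i b => by
    have h1 := congrArg (fun L : L[d, ℝ] => L b) (hc i)
    have h2 : HasFDerivAt (fun x => (ξ x - unitNormal ρ x) i)
      ((proj i : L[d, ℝ]).comp (∇ ξ p - ∇ (unitNormal ρ) p)) p :=
      (proj i : L[d, ℝ]).hasFDerivAt.comp p (dξ.hasFDerivAt.sub dN.hasFDerivAt)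
    rw [h2.fderiv, smul_apply, fderiv_eq_inner_unitNormal hρ.gradient_ne_zero] at h1
    simpa using h1
  have htr : ∑ i, c i * (‖gradient ρ p‖ * unitNormal ρ p i) = 0 := by
    have h1 : divg ξ p - divg (unitNormal ρ) p = 0 := by rw [hdiv, meanCurv]; ring
    rw [divg, divg, tr, tr, ← Finset.sum_sub_distrib] at h1
    rw [← h1]
    refine sum_congr rfl fun i _ => ?_
    rw [hD]; simp [EuclideanSpace.inner_single_right]
  have hsum : ⟪∇ ξ p a - ∇ (unitNormal ρ) p a, unitNormal ρ p⟫ = 0 := by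
    rw [PiLp.inner_apply]
    simp only [RCLike.inner_apply, conj_trivial, PiLp.sub_apply, hD]
    calc _ = (∑ i, c i * (‖gradient ρ p‖ * unitNormal ρ p i)) * ⟪unitNormal ρ p, a⟫ := by
          rw [Finset.sum_mul]
          exact sum_congr rfl fun i _ => by ring
      _ = 0 := by rw [htr, zero_mul]
  rw [inner_sub_left, hNN, sub_zero] at hsum
  rw [hN]; exact hsum

lemma tendsto_smooth_L1 [IsFiniteMeasure μ] (hν : Integrable ν μ) :
    ∃ V : ℕ → V[d], (∀ n, Smooth (V n)) ∧ (∀ n, Integrable (V n) μ) ∧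
      Null (fun n => ∫ x, ‖V n x - ν x‖ ∂μ) := by
  have h := fun n : ℕ => (memLp_one_iff_integrable.2 hν).exist_eLpNorm_sub_le (by norm_num) le_rfl
    (by positivity : (0 : ℝ) < 1 / (n + 1))
  choose V hc hs hV using h
  have hVi : ∀ n, Integrable (V n) μ := fun n => (hs n).continuous.integrable_of_hasCompactSupport (hc n)
  refine ⟨V, hs, hVi, squeeze_zero (fun n => integral_nonneg fun x => norm_nonneg _) (fun n => ?_)
    tendsto_inv_succ⟩
  have h2 := hV n
  rw [eLpNorm_one_eq_lintegral_enorm, ← ofReal_integral_norm_eq_lintegral_enorm (hν.sub (hVi n)),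
    ENNReal.ofReal_le_ofReal_iff (by positivity)] at h2
  refine (le_of_eq (integral_congr_ae (of_forall fun x => ?_))).trans h2
  exact norm_sub_rev _ _

/-- The measure theoretic normal is the classical normal. -/
lemma IsPolarGradient.ae_eq_normal (h : IsPolarGradient Ω χ μ ν) (dm : Dom Ω) (hχ : ∀ x ∈ Ω, χ x = U.indicator 1 x) (hUΩ : closure U ⊆ Ω) (hU : HasCkBoundary 2 U)
    {ξ : V[d]} (hcons : ∀ x ∈ frontier U, ∀ ρ, IsLocalDefiningFunction 2 U x ρ → ξ x = unitNormal ρ x) :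
    ∀ᵐ x ∂μ, ν x = ξ x := by
  have : IsFiniteMeasure μ := ⟨h.finite⟩
  have hνi : Integrable ν μ := Integrable.of_bound h.aesm 1 (h.norm_eq_one.mono fun x hx => hx.le)
  obtain ⟨V, hVs, hVi, hVt⟩ := tendsto_smooth_L1 hνi
  have hfr := h.ae_mem_frontier dm hχ
  have key : μ {x | x ∈ frontier U ∧ ν x ≠ ξ x} = 0 := by
    refine measure_null_of_locally_null _ fun p hp => ?_
    obtain ⟨ρ, hρ⟩ := hU p hp.1
    have hev := hρ.eventually
    obtain ⟨r, hr, hball⟩ := eventually_nhds_iff_ball.1 (hev.and (dm.o.mem_nhds (hUΩ hp.1.1)))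
    let κ : ContDiffBump p := ⟨r / 4, r / 2, by positivity, by linarith⟩
    let κ' : ContDiffBump p := ⟨r / 2, 3 * r / 4, by positivity, by linarith⟩
    have hκ : tsupport κ = closedBall p (r / 2) := κ.tsupport_eq
    have hκ' : tsupport κ' = closedBall p (3 * r / 4) := κ'.tsupport_eq
    have hin : ∀ x ∈ tsupport κ, x ∈ ball p r := fun x hx => by
      rw [hκ] at hx; exact Metric.closedBall_subset_ball (by linarith) hx
    have hin' : ∀ x ∈ tsupport κ', x ∈ ball p r := fun x hx => by
      rw [hκ'] at hx; exact Metric.closedBall_subset_ball (by linarith) hx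
    have hρ' : ContDiff ℝ 1 fun x => κ' x * ρ x := contDiff_of_tsupport fun x hx =>
      κ'.contDiff.contDiffAt.mul ((hball x (hin' x (closure_mono (support_mul_subset_left _ _) hx))).1.1.of_le (by norm_num))
    have hN : ContDiff ℝ 1 fun x => κ x • unitNormal ρ x := contDiff_of_tsupport fun x hx => by
      have hx' := hball x (hin x (closure_mono (support_smul_subset_left _ _) hx))
      exact κ.contDiff.contDiffAt.smul (contDiffAt_unitNormal hx'.1.1 hx'.1.2.1)
    have hNb : ∀ x, ‖κ x • unitNormal ρ x‖ ≤ 1 := fun x => by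
      by_cases hx : x ∈ tsupport κ
      · rw [norm_smul, norm_unitNormal (hball x (hin x hx)).1.2.1, mul_one, norm_of_nonneg κ.nonneg]
        exact κ.le_one
      · rw [eq_zero_off hx]; simp
    let X (n : ℕ) : V[d] := fun x => √((1 / ((n : ℝ) + 1)) ^ 2 + ‖V n x‖ ^ 2) • (κ x • unitNormal ρ x) - κ x • V n x
    let K : R[d] := fun x => ⟪ν x, κ x • unitNormal ρ x - κ x • ν x⟫
    have hKi : Integrable K μ := by
      refine Integrable.of_bound (h.aesm.inner (hN.continuous.aesm.sub
        (κ.continuous.aesm.smul h.aesm))) 2 (h.norm_eq_one.mono fun x hx => ?_)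
      refine (norm_inner_le_norm (𝕜 := ℝ) _ _).trans ?_
      rw [hx, one_mul]
      refine (norm_sub_le _ _).trans ?_
      rw [norm_smul (κ x) (ν x), hx, mul_one, norm_of_nonneg κ.nonneg]
      linarith [hNb x, κ.le_one (x := x)]
    have hpos : ∀ n : ℕ, 0 ≤ ∫ x, ⟪ν x, X n x⟫ ∂μ := fun n => by
      have hδ : (0 : ℝ) < 1 / ((n : ℝ) + 1) := by positivity
      have hsq : ContDiff ℝ 1 fun x => √((1 / ((n : ℝ) + 1)) ^ 2 + ‖V n x‖ ^ 2) := by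
        refine ContDiff.sqrt (contDiff_const.add (((hVs n).toC1).norm_sq ℝ)) fun x => ?_
        positivity
      have hF : ContDiff ℝ 1 (X n) :=
        (hsq.smul hN).sub (κ.contDiff.smul ((hVs n).toC1))
      have hsupp : tsupport (X n)
          ⊆ tsupport κ := closure_mono fun x hx hx' => hx (by simp [X, hx'])
      refine h.integral_inner_nonneg dm hχ hρ' hF (κ.hasCompactSupport.mono fun x hx hx' => hx (by simp [X, hx']))
        (fun x hx => (hball x (hin x (hsupp hx))).2) (fun x hx => ?_) fun x hx => ?_
      · have hx1 := hsupp hx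
        rw [hκ] at hx1
        have : κ' x = 1 := κ'.one_of_mem_closedBall hx1
        rw [this, one_mul]
        exact (hball x (hin x (hsupp hx))).1.2.2.1
      · have hx1 := hsupp hx
        have hx2 := (hball x (hin x hx1)).1
        have hsm : ∀ y ∈ ball p r, 0 ≤ ∇ ρ y (X n y) := by
          intro y hy
          have hy2 := (hball y hy).1
          rw [fderiv_eq_inner_unitNormal hy2.2.1, inner_sub_right, real_inner_smul_right, real_inner_smul_right,
            real_inner_smul_right, real_inner_self_eq_norm_sq, norm_unitNormal hy2.2.1]
          have h1 : ⟪unitNormal ρ y, V n y⟫ ≤ √((1 / ((n : ℝ) + 1)) ^ 2 + ‖V n y‖ ^ 2) := by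
            refine (real_inner_le_norm _ _).trans ?_
            rw [norm_unitNormal hy2.2.1, one_mul]
            refine Real.le_sqrt_of_sq_le ?_
            nlinarith [sq_nonneg (1 / ((n : ℝ) + 1))]
          have h2 := mul_nonneg (norm_nonneg (gradient ρ y)) (mul_nonneg (κ.nonneg (x := y)) (sub_nonneg.2 h1))
          nlinarith
        -- on the support of the field, the cut-off of the defining function is not seen
        by_cases hint : dist x p < r / 2
        · have e : (fun y => κ' y * ρ y) =ᶠ[𝓝 x] ρ := by
            filter_upwards [isOpen_ball.mem_nhds (mem_ball.2 hint)] with y hy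
            rw [κ'.one_of_mem_closedBall (ball_subset_closedBall hy), one_mul]
          rw [e.fderiv_eq]
          exact hsm x (hin x hx1)
        · have : κ x = 0 := κ.zero_of_le_dist (not_lt.1 hint)
          simp [X, this]
    have hlim : Tendsto (fun n : ℕ => ∫ x, ⟪ν x, X n x⟫ ∂μ) atTop (𝓝 (∫ x, K x ∂μ)) := by
      have hsqm : ∀ n : ℕ, AESM (fun x => √((1 / ((n : ℝ) + 1)) ^ 2 + ‖V n x‖ ^ 2)) μ := fun n =>
        (Real.continuous_sqrt.comp (continuous_const.add ((hVs n).continuous.norm.pow 2))).aesm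
      have hdiff : ∀ n : ℕ, ∀ᵐ x ∂μ, ‖⟪ν x, X n x⟫ - K x‖ ≤ 1 / ((n : ℝ) + 1) + 2 * ‖V n x - ν x‖ := fun n => by
        filter_upwards [h.norm_eq_one] with x hx
        have hδ : (0 : ℝ) < 1 / ((n : ℝ) + 1) := by positivity
        set δ := 1 / ((n : ℝ) + 1)
        have h1 : |√(δ ^ 2 + ‖V n x‖ ^ 2) - 1| ≤ δ + ‖V n x - ν x‖ := by
          have a1 : √(δ ^ 2 + ‖V n x‖ ^ 2) ≤ δ + ‖V n x‖ := Real.sqrt_le_iff.2 ⟨by positivity, by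
            nlinarith [norm_nonneg (V n x), mul_nonneg hδ.le (norm_nonneg (V n x))]⟩
          have a2 : ‖V n x‖ ≤ √(δ ^ 2 + ‖V n x‖ ^ 2) := Real.le_sqrt_of_sq_le (by nlinarith [sq_nonneg δ])
          have a3 := abs_le.1 (abs_norm_sub_norm_le (V n x) (ν x))
          rw [hx] at a3
          rw [abs_le]; constructor <;> linarith [a3.1, a3.2]
        have e : ⟪ν x, √(δ ^ 2 + ‖V n x‖ ^ 2) • (κ x • unitNormal ρ x) - κ x • V n x⟫
            - K x =
            ⟪ν x, (√(δ ^ 2 + ‖V n x‖ ^ 2) - 1) • (κ x • unitNormal ρ x) - κ x • (V n x - ν x)⟫ := by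
          rw [← inner_sub_right]; congr 1; module
        rw [e]
        refine (norm_inner_le_norm (𝕜 := ℝ) _ _).trans ?_
        rw [hx, one_mul]
        refine (norm_sub_le _ _).trans ?_
        rw [norm_smul, norm_smul (κ x) (V n x - ν x), norm_of_nonneg κ.nonneg, norm_eq_abs]
        have b1 := mul_le_mul h1 (hNb x) (norm_nonneg _) (by positivity)
        have b2 := mul_le_right (κ.le_one (x := x)) (norm_nonneg (V n x - ν x))
        linarith
      have hi : ∀ n : ℕ, Integrable (fun x => 1 / ((n : ℝ) + 1) + 2 * ‖V n x - ν x‖) μ := fun n =>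
        (integrable_const _).add (((hVi n).sub hνi).norm.const_mul _)
      have hmeas : ∀ n : ℕ, AESM (fun x => ⟪ν x, X n x⟫) μ := fun n => h.aesm.inner (((hsqm n).smul hN.continuous.aesm).sub
          (κ.continuous.aesm.smul (hVs n).continuous.aesm))
      have hi2 : ∀ n : ℕ, Integrable (fun x => ⟪ν x, X n x⟫ - K x) μ := fun n =>
        (hi n).mono' ((hmeas n).sub hKi.1) (hdiff n)
      have hi3 : ∀ n : ℕ, Integrable (fun x => ⟪ν x, X n x⟫) μ := fun n =>
        ((hi2 n).add hKi).congr (of_forall fun x => sub_add_cancel _ _)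
      rw [tendsto_iff_norm_sub_tendsto_zero]
      have hz : Null (fun n : ℕ => ∫ x, (1 / ((n : ℝ) + 1) + 2 * ‖V n x - ν x‖) ∂μ) := by
        have e : ∀ n : ℕ, ∫ x, (1 / ((n : ℝ) + 1) + 2 * ‖V n x - ν x‖) ∂μ =
            μ.real univ * (1 / ((n : ℝ) + 1)) + 2 * ∫ x, ‖V n x - ν x‖ ∂μ := fun n => by
          have hni : Integrable (fun x => 2 * ‖V n x - ν x‖) μ := ((hVi n).sub hνi).norm.const_mul _
          rw [integral_add (integrable_const _) hni, integral_const, integral_const_mul, smul_eq_mul]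
        simp only [e]
        simpa using tendsto_inv_succ.const_mul (μ.real univ) |>.add (hVt.const_mul 2)
      refine squeeze_zero (fun n => norm_nonneg _) (fun n => ?_) hz
      rw [← integral_sub (hi3 n) hKi]
      exact norm_integral_le_of_norm_le (hi n) (hdiff n)
    have h0 : 0 ≤ ∫ x, K x ∂μ := ge_of_tendsto' hlim hpos
    have hKe : ∀ x, ‖ν x‖ = 1 → K x = -(κ x * (1 - ⟪ν x, unitNormal ρ x⟫)) := fun x hx => by
      simp only [K]
      rw [← smul_sub, real_inner_smul_right, inner_sub_right, real_inner_self_eq_norm_sq, hx]; ring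
    have hle : ∀ᵐ x ∂μ, 0 ≤ -K x := by
      filter_upwards [h.norm_eq_one] with x hx
      rw [hKe x hx, neg_neg]
      by_cases hxs : x ∈ tsupport κ
      · refine mul_nonneg κ.nonneg (sub_nonneg.2 ((real_inner_le_norm _ _).trans ?_))
        rw [hx, norm_unitNormal (hball x (hin x hxs)).1.2.1, one_mul]
      · rw [eq_zero_off hxs, zero_mul]
    have hz : ∀ᵐ x ∂μ, K x = 0 := by
      have h1 : ∫ x, -K x ∂μ = 0 :=
        le_antisymm (by rw [integral_neg]; linarith) (integral_nonneg_of_ae hle)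
      filter_upwards [(integral_eq_zero_iff_of_nonneg_ae hle hKi.neg).1 h1] with x hx
      simpa using hx
    refine ⟨ball p (r / 4) ∩ {x | x ∈ frontier U ∧ ν x ≠ ξ x},
      inter_mem (mem_nhdsWithin_of_mem_nhds (ball_mem_nhds p (by positivity))) self_mem_nhdsWithin, ?_⟩
    rw [← compl_mem_ae_iff]
    filter_upwards [hz, h.norm_eq_one] with x hx hx1 hx2
    obtain ⟨hxb, hxf, hne⟩ := hx2
    have hxr : x ∈ ball p r := ball_subset_ball (by linarith) hxb
    rw [hKe x hx1, κ.one_of_mem_closedBall (ball_subset_closedBall hxb)] at hx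
    have h2 := (hball x hxr).1
    refine hne (((inner_eq_one_iff_of_norm_eq_one (𝕜 := ℝ) hx1 (norm_unitNormal h2.2.1)).1 (by linarith)).trans ?_)
    exact (hcons x hxf ρ (h2.2.2.2 (Or.inl hxf)).1).symm
  filter_upwards [hfr, compl_mem_ae_iff.2 key] with x hx1 hx2
  by_contra hne
  exact hx2 ⟨hx1, hne⟩

lemma tr_comp_comm (A B : M[d]) : tr (A.comp B) = tr (B.comp A) := by
  have e : ∀ A B : M[d], tr (A.comp B) = ∑ i, ∑ j, (A (single j 1)) i * (B (single i 1)) j :=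
    fun A B => by
      rw [tr]
      refine sum_congr rfl fun i _ => ?_
      rw [ContinuousLinearMap.comp_apply, clm_apply_eq_sum A]
      simp [mul_comm]
  rw [e, e, Finset.sum_comm]
  simp only [mul_comm]

lemma tr_fderiv_fderiv_apply {f g : V[d]} {x : Vec d} (hf : ContDiff ℝ 1 f)
    (hf2 : DifferentiableAt ℝ (∇ f) x) (hg : DifferentiableAt ℝ g x) :
    tr (∇ (fun y => ∇ f y (g y)) x) =
      ∇ (divg f) x (g x) + tr ((∇ f x).comp (∇ g x)) := by
  have h1 := ((trCLM d).hasFDerivAt.comp x hf2.hasFDerivAt).fderiv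
  have h2 : (trCLM d) ∘ ∇ f = divg f := funext fun y => trCLM_apply _
  rw [h2] at h1
  rw [(hf2.hasFDerivAt.clm_apply hg.hasFDerivAt).fderiv, ← trCLM_apply (_ + _), map_add, trCLM_apply, trCLM_apply, h1,
    add_comm, ContinuousLinearMap.comp_apply, trCLM_apply]
  congr 1
  simp only [tr, ContinuousLinearMap.flip_apply]
  refine sum_congr rfl fun i _ => ?_
  rw [second_derivative_symmetric (fun y => (hf.differentiable one_ne_zero y).hasFDerivAt) hf2.hasFDerivAt]

lemma IsPolarGradient.integral_normal_fderiv (h : IsPolarGradient Ω χ μ ν) (dm : Dom Ω) {ξ : V[d]} (hν : ∀ᵐ x ∂μ, ν x = ξ x)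
    (h0 : ∀ᵐ x ∂μ, ∀ a, ⟪∇ ξ x a, ξ x⟫ = 0) (hξ : ContDiff ℝ 1 ξ) {C : ℝ≥0}
    (hC : ∀ x, ‖∇ ξ x‖ ≤ C) (hL : LipschitzWith C (∇ ξ)) {η : V[d]} (hη : IsSolTest Ω η) :
    ∫ x, ⟪ν x, ∇ η x (ν x)⟫ ∂μ = ∫ x in Ω, χ x * ∇ (divg ξ) x (η x) := by
  have : IsFiniteMeasure μ := ⟨h.finite⟩
  have hs' : Smooth (∇ η) := hη.1.smooth.fderiv_right le_rfl
  have hs : ContDiff ℝ 1 (∇ η) := hs'.toC1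
  have hc1 : HasCompactSupport fun x => ∇ η x (ξ x) :=
    HasCompactSupport.intro hη.1.compact fun x hx => by rw [fderiv_off hx, zero_apply]
  obtain ⟨K₁, hK₁⟩ := (hs.clm_apply hξ).lipschitzWith_of_hasCompactSupport hc1 one_ne_zero
  obtain ⟨K, hK⟩ := hη.1.exists_lipschitz
  obtain ⟨M, hM⟩ := hη.1.compact.exists_bound_of_continuous hη.1.cont
  have hK₂ : LipschitzWith (C * K + C * M.toNNReal) fun x => ∇ ξ x (η x) :=
    LipschitzWith.of_dist_le_mul fun x y => by
      rw [dist_eq_norm]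
      have e : ∇ ξ x (η x) - ∇ ξ y (η y) =
        ∇ ξ x (η x - η y) + (∇ ξ x - ∇ ξ y) (η y) := by rw [map_sub, sub_apply]; abel
      rw [e]
      refine (norm_add_le _ _).trans ?_
      have a1 := (∇ ξ x).le_of_opNorm_le_of_le (hC x) ((dist_eq_norm _ _).symm.le.trans (hK.dist_le_mul x y))
      have a2 := (∇ ξ x - ∇ ξ y).le_of_opNorm_le_of_le ((dist_eq_norm _ _).symm.le.trans (hL.dist_le_mul x y))
        ((hM y).trans (le_coe_toNNReal M))
      rw [NNReal.coe_add, NNReal.coe_mul, NNReal.coe_mul, add_mul]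
      exact (add_le_add a1 a2).trans (le_of_eq (by ring))
  have p1 := h.byParts_lipschitz dm hK₁ fun x hx => by
    rw [fderiv_off fun hx' => hx (hη.1.support hx'), zero_apply]
  have p2 := h.byParts_lipschitz dm hK₂ fun x hx => by
    rw [eq_zero_off fun hx' => hx (hη.1.support hx'), map_zero]
  have hint : ∀ {F : V[d]} {L : ℝ≥0}, LipschitzWith L F →
      Integrable (fun x => χ x * tr (∇ F x)) (vol Ω) := fun {F L} hF => by
    borelize M[d]
    refine h.integrable.mul_bdd (c := ‖trCLM d‖ * L)
      (aesm_tr (measurable_fderiv ℝ F).aesm)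
      (of_forall fun x => ?_)
    exact (abs_tr_le _).trans (mul_le_left (norm_fderiv_le_of_lipschitz ℝ hF) (norm_nonneg (trCLM d)))
  have e1 : ∫ x, ⟪ν x, ∇ η x (ξ x)⟫ ∂μ = ∫ x, ⟪ν x, ∇ η x (ν x)⟫ ∂μ :=
    integral_congr_ae (by filter_upwards [hν] with x hx; rw [hx])
  have e2 : ∫ x, ⟪ν x, ∇ ξ x (η x)⟫ ∂μ = 0 := by
    rw [← integral_zero (Vec d) ℝ (μ := μ)]
    exact integral_congr_ae (by filter_upwards [hν, h0] with x hx hx0; rw [hx, real_inner_comm, hx0])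
  rw [e1] at p1
  rw [e2, neg_zero] at p2
  rw [← neg_neg (∫ x, ⟪ν x, ∇ η x (ν x)⟫ ∂μ), ← p1, ← zero_sub, ← p2, ← integral_sub (hint hK₂) (hint hK₁)]
  refine integral_congr_ae ?_
  filter_upwards [ae_restrict_of_ae hL.ae_differentiableAt] with x hx
  have hz : ∇ (divg η) x = 0 := by
    have : divg η = fun _ => 0 := funext hη.2
    rw [this]; simp
  rw [tr_fderiv_fderiv_apply hξ hx (hη.1.differentiable x), tr_fderiv_fderiv_apply (hη.1.smooth.toC1)
    (hs.differentiable one_ne_zero x) (hξ.differentiable one_ne_zero x), hz, tr_comp_comm (∇ η x)]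
  simp
  ring

lemma IsDiffeoFlow.hasCkBoundary {Tstar : ℝ} {Ψ Ψt : ℝ → V[d]} (h : IsDiffeoFlow Ω Tstar Ψ Ψt)
    (hΩ : IsOpen Ω) {t : ℝ} (ht : t ∈ Ico 0 Tstar) (hU : IsOpen U) (hUΩ : closure U ⊆ Ω) (hUb : HasCkBoundary 3 U)
    (hV : closure (Ψ t '' U) ⊆ Ω) : HasCkBoundary 2 (Ψ t '' U) := by
  intro p hp
  obtain ⟨Φ, hΦ, -, hL, hR⟩ := h.inverse t ht
  have hU' : U ⊆ closure Ω := (subset_closure.trans hUΩ).trans subset_closure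
  have hnh : ∀ {x}, x ∈ Ω → closure Ω ∈ 𝓝 x := fun hx => mem_of_superset (hΩ.mem_nhds hx) subset_closure
  have hpΩ := hV hp.1
  have cΦ : ContDiffAt ℝ 3 Φ p := hΦ.contDiffAt (hnh hpΩ)
  have hiff : ∀ᶠ y in 𝓝 p, (y ∈ Ψ t '' U ↔ Φ y ∈ U) := by
    filter_upwards [hnh hpΩ] with y hy
    refine ⟨?_, fun h => ⟨Φ y, h, hR hy⟩⟩
    rintro ⟨z, hz, rfl⟩
    rwa [hL (hU' hz)]
  have hq : Φ p ∈ frontier U := by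
    rw [hU.frontier_eq]
    refine ⟨closure_mono ?_ (cΦ.continuousAt.continuousWithinAt.mem_closure_image hp.1), fun hqU => hp.2 ?_⟩
    · rintro _ ⟨_, ⟨z, hz, rfl⟩, rfl⟩
      rwa [hL (hU' hz)]
    · rw [mem_interior_iff_mem_nhds]
      filter_upwards [hiff, cΦ.continuousAt.eventually (hU.mem_nhds hqU)] with y h1 h2 using h1.2 h2
  obtain ⟨ρ, hρ⟩ := hUb _ hq
  have hqΩ := hUΩ hq.1
  have hΨq : Ψ t (Φ p) = p := hR (subset_closure hpΩ)
  have dρ : DifferentiableAt ℝ ρ (Φ p) := hρ.contDiffAt.differentiableAt (by norm_num)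
  have dΦ : DifferentiableAt ℝ Φ p := cΦ.differentiableAt (by norm_num)
  have dΨ : DifferentiableAt ℝ (Ψ t) (Φ p) := ((h.contDiff t ht).contDiffAt (hnh hqΩ)).differentiableAt (by norm_num)
  refine ⟨ρ ∘ Φ, (hρ.contDiffAt.comp p cΦ).of_le (by norm_num), hρ.eq_zero, fun hg => hρ.gradient_ne_zero ?_, ?_⟩
  · have h1 : HasFDerivAt (Φ ∘ Ψ t) ((∇ Φ p).comp (∇ (Ψ t) (Φ p))) (Φ p) :=
      HasFDerivAt.comp _ (by rw [hΨq]; exact dΦ.hasFDerivAt) dΨ.hasFDerivAt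
    have h2 : (∇ Φ p).comp (∇ (Ψ t) (Φ p)) = idL (Vec d) :=
      h1.unique ((hasFDerivAt_id _).congr_of_eventuallyEq (by filter_upwards [hnh hqΩ] with z hz using hL hz))
    have h3 : (∇ ρ (Φ p)).comp (∇ Φ p) = 0 := by
      rw [← (dρ.hasFDerivAt.comp p dΦ.hasFDerivAt).fderiv]
      simpa [gradient] using hg
    have h4 : ∇ ρ (Φ p) = 0 := by
      rw [← ContinuousLinearMap.comp_id (∇ ρ (Φ p)), ← h2, ← ContinuousLinearMap.comp_assoc, h3, ContinuousLinearMap.zero_comp]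
    rw [gradient, h4, map_zero]
  · filter_upwards [hiff, cΦ.continuousAt.eventually hρ.mem_iff] with y h1 h2 using h1.trans h2

end

/-! ### Measurability of derivatives in space-time -/

section

variable [FiniteDimensional ℝ F]

lemma measurable_fderiv_param {α : Type*} [MeasurableSpace α] [MeasurableSpace F] [BorelSpace F] {g : α → Vec d → F}
    {C : ℝ≥0} (hg : ∀ t, LipschitzWith C (g t)) (hm : ∀ x, Measurable fun t => g t x) :
    Measurable fun p : α × Vec d => ∇ (g p.1) p.2 := by
  have := FiniteDimensional.complete ℝ F
  have := FiniteDimensional.proper ℝ F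
  let q := TopologicalSpace.denseSeq (Vec d)
  let _ : TopologicalSpace α := TopologicalSpace.induced (fun t (i : ℕ) => g t (q i)) inferInstance
  have hq : ∀ i, Continuous fun t => g t (q i) := fun i => 
    (continuous_apply (A := fun _ : ℕ => F) i).comp (continuous_induced_dom (f := fun t (i : ℕ) => g t (q i)))
  have : OpensMeasurableSpace α := ⟨by
    refine MeasurableSpace.generateFrom_le ?_
    rintro _ ⟨V, hV, rfl⟩
    exact (measurable_pi_lambda _ fun i => hm (q i)) hV.measurableSet⟩
  refine measurable_fderiv_with_param ℝ ?_
  rw [continuous_iff_continuousAt]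
  rintro ⟨t₀, x₀⟩
  rw [Metric.continuousAt_iff']
  intro ε hε
  obtain ⟨_, hi, ⟨i, rfl⟩⟩ := Metric.dense_iff.1 (TopologicalSpace.denseRange_denseSeq (Vec d)) x₀ (ε / (4 * (C + 1))) (by positivity)
  have h1 := (Metric.continuousAt_iff'.1 ((hq i).comp continuous_fst).continuousAt (ε / 4) (by positivity) : ∀ᶠ p : α × Vec d in 𝓝 (t₀, x₀), _)
  have h2 := (Metric.continuousAt_iff'.1 (continuous_snd : Continuous (Prod.snd : α × Vec d → Vec d)).continuousAt (ε / (4 * (C + 1)))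
    (by positivity) : ∀ᶠ p in 𝓝 (t₀, x₀), _)
  filter_upwards [h1, h2] with p a b
  have hC : ∀ r : ℝ, 0 ≤ r → r < ε / (4 * (C + 1)) → C * r ≤ ε / 4 := fun r hr hr' => by
    rw [lt_div_iff₀ (by positivity)] at hr'; nlinarith
  rw [mem_ball] at hi
  have c1 := ((hg p.1).dist_le_mul p.2 x₀).trans (hC _ dist_nonneg b)
  have c2 := ((hg p.1).dist_le_mul x₀ (q i)).trans (hC _ dist_nonneg (by rwa [dist_comm]))
  have c3 := ((hg t₀).dist_le_mul (q i) x₀).trans (hC _ dist_nonneg hi)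
  have t1 := dist_triangle4 (g p.1 p.2) (g p.1 x₀) (g p.1 (q i)) (g t₀ (q i))
  have t2 := dist_triangle (g p.1 p.2) (g t₀ (q i)) (g t₀ x₀)
  change dist (g p.1 (q i)) (g t₀ (q i)) < _ at a
  change dist (g p.1 p.2) (g t₀ x₀) < _
  linarith

lemma aesm_fderiv {T : ℝ} (hΩ : MeasurableSet Ω) {f : ℝ → Vec d → F}
    (hf : MemLp (uncurry f) ⊤ (ST Ω T)) {C : ℝ≥0}
    (h : ∀ᵐ t ∂vI T, LipschitzWith C (f t) ∧ ∀ x ∉ Ω, f t x = 0) :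
    AESM (uncurry fun t x => ∇ (f t) x) (ST Ω T) := by
  have := FiniteDimensional.complete ℝ F
  borelize F
  obtain ⟨A, Am, -, A0, Ae⟩ := exists_stronglyMeasurable_extension hΩ hf
  obtain ⟨S, hS, hSm, hS0⟩ := ((h.and Ae).exists_measurable_mem : ∃ S ∈ ae (vI T), _)
  have hmol : ∀ t ∈ S, ∀ n x, mollify n (fun y => A (t, y)) x = mollify n (f t) x := fun t ht n x => by
    refine congrFun (mollify_congr_ae ?_ n) x
    have h1 := (ae_restrict_iff' hΩ).1 (hS0 t ht).2
    filter_upwards [h1] with y hy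
    by_cases hyΩ : y ∈ Ω
    · exact (hy hyΩ).symm
    · rw [A0 _ hyΩ, (hS0 t ht).1.2 y hyΩ]
  have hm : ∀ x, Measurable fun t => S.indicator (fun t => f t x) t := fun x => by
    have h1 : ∀ n, StronglyMeasurable fun t => S.indicator (fun t => mollify n (fun y => A (t, y)) x) t := fun n => by
      refine StronglyMeasurable.indicator ?_ hSm
      simp only [mollify_apply']
      refine StronglyMeasurable.integral_prod_right' (f := fun p : ℝ × Vec d => κ[n] (x - p.2) • A p) ?_
      exact (((mollBump d n).continuous_normed.comp (continuous_const.sub continuous_snd)).stronglyMeasurable).smul Am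
    refine (stronglyMeasurable_of_tendsto atTop h1 (tendsto_pi_nhds.2 fun t => ?_)).measurable
    by_cases ht : t ∈ S
    · simp only [indicator_of_mem ht, hmol t ht]
      exact ContDiffBump.convolution_tendsto_right_of_continuous tendsto_mollBump_rOut (hS0 t ht).1.1.continuous x
    · simp only [indicator_of_notMem ht]; exact tendsto_const_nhds
  have hL : ∀ t, LipschitzWith C fun x => S.indicator (fun t => f t x) t := fun t => by
    by_cases ht : t ∈ S
    · simp only [indicator_of_mem ht]; exact (hS0 t ht).1.1
    · simp only [indicator_of_notMem ht]; exact LipschitzWith.const' 0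
  borelize (L[d, F])
  refine (measurable_fderiv_param hL hm).aesm.congr ?_
  have hp : ∀ᵐ p ∂ST Ω T, p.1 ∈ S := quasiMeasurePreserving_fst.ae hS
  filter_upwards [hp] with p hp
  simp only [indicator_of_mem hp, uncurry]

end

section

variable {α β : Type*} [MeasurableSpace α] [MeasurableSpace β] {μ : Measure (α × β)} {g : α × β → ℝ} {k l : ℕ}
  {E F G : Type*} [NormedAddCommGroup E] [NormedAddCommGroup F] [NormedAddCommGroup G]

/-- `f` is measurable and `f = O(g ^ k)`. -/
structure GrowthLE (μ : Measure (α × β)) (g : α × β → ℝ) (k : ℕ) (f : α → β → E) : Prop where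
  aesm : AESM (uncurry f) μ
  bound : ∃ C : ℝ, ∀ᵐ p ∂μ, ‖f p.1 p.2‖ ≤ C * g p ^ k

namespace GrowthLE

lemma add {f f' : α → β → E} (h : GrowthLE μ g k f) (h' : GrowthLE μ g k f') : GrowthLE μ g k fun t x => f t x + f' t x := by
  refine ⟨h.aesm.add h'.aesm, ?_⟩
  obtain ⟨C, hC⟩ := h.bound
  obtain ⟨C', hC'⟩ := h'.bound
  refine ⟨C + C', ?_⟩
  filter_upwards [hC, hC'] with p h1 h2
  rw [add_mul]
  exact norm_add_le_of_le h1 h2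

lemma neg {f : α → β → E} (h : GrowthLE μ g k f) : GrowthLE μ g k fun t x => -f t x := by
  refine ⟨h.aesm.neg, ?_⟩
  simpa only [norm_neg] using h.bound

lemma sub {f f' : α → β → E} (h : GrowthLE μ g k f) (h' : GrowthLE μ g k f') : GrowthLE μ g k fun t x => f t x - f' t x := by
  simpa only [sub_eq_add_neg] using h.add h'.neg

lemma norm {f : α → β → E} (h : GrowthLE μ g k f) : GrowthLE μ g k fun t x => ‖f t x‖ := by
  refine ⟨h.aesm.norm, ?_⟩
  simpa only [norm_norm] using h.bound

lemma const (c : E) : GrowthLE μ g 0 fun _ _ => c :=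
  ⟨aestronglyMeasurable_const, ‖c‖, of_forall fun p => by simp⟩

lemma of_norm_le {f : α → β → E} {f' : α → β → F} (hf : AESM (uncurry f) μ) (h : GrowthLE μ g k f')
    (hle : ∀ t x, ‖f t x‖ ≤ ‖f' t x‖) : GrowthLE μ g k f :=
  ⟨hf, h.bound.imp fun _ hC => hC.mono fun _ hp => (hle _ _).trans hp⟩

lemma mono (hg : ∀ p, 1 ≤ g p) (hkl : k ≤ l) {f : α → β → E} (h : GrowthLE μ g k f) : GrowthLE μ g l f := by
  refine ⟨h.aesm, ?_⟩
  obtain ⟨C, hC⟩ := h.bound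
  refine ⟨C, ?_⟩
  filter_upwards [hC] with p h1
  refine h1.trans (mul_le_left (pow_le_pow_right₀ (hg p) hkl) ?_)
  have := zero_lt_one.trans_le (hg p)
  exact nonneg_of_mul_nonneg_left ((norm_nonneg _).trans h1) (by positivity)

lemma integrable (hg : MemLp g 2 μ) {f : α → β → E} (h : GrowthLE μ g 2 f) : Integrable (uncurry f) μ := by
  obtain ⟨C, hC⟩ := h.bound
  exact (hg.integrable_sq.const_mul C).mono' h.aesm hC

lemma memLp (hg : MemLp g 2 μ) {f : α → β → E} (h : GrowthLE μ g 1 f) : MemLp (uncurry f) 2 μ := by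
  obtain ⟨C, hC⟩ := h.bound
  refine (hg.const_mul C).mono h.aesm (hC.mono fun p hp => hp.trans ?_)
  rw [pow_one]; exact le_abs_self _

lemma memLp_top {f : α → β → E} (h : GrowthLE μ g 0 f) : MemLp (uncurry f) ⊤ μ := by
  obtain ⟨C, hC⟩ := h.bound
  exact memLp_top_of_bound h.aesm C (hC.mono fun p hp => by rwa [pow_zero, mul_one] at hp)

variable [NormedSpace ℝ E] [NormedSpace ℝ F] [NormedSpace ℝ G]

lemma bilin (L : E →L[ℝ] F →L[ℝ] G) {f : α → β → E} {f' : α → β → F} (h : GrowthLE μ g k f) (h' : GrowthLE μ g l f') :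
    GrowthLE μ g (k + l) fun t x => L (f t x) (f' t x) := by
  refine ⟨L.aestronglyMeasurable_comp₂ h.aesm h'.aesm, ?_⟩
  obtain ⟨C, hC⟩ := h.bound
  obtain ⟨C', hC'⟩ := h'.bound
  refine ⟨‖L‖ * C * C', ?_⟩
  filter_upwards [hC, hC'] with p h1 h2
  have e : ‖L‖ * C * C' * g p ^ (k + l) = ‖L‖ * (C * g p ^ k) * (C' * g p ^ l) := by rw [pow_add]; ring
  rw [e]
  refine (L.le_opNorm₂ _ _).trans (mul_le_mul (mul_le_left h1 (by positivity)) h2 (norm_nonneg _) ?_)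
  exact mul_nonneg (by positivity) ((norm_nonneg _).trans h1)

lemma inner {f f' : α → β → Vec d} (h : GrowthLE μ g k f) (h' : GrowthLE μ g l f') :
    GrowthLE μ g (k + l) fun t x => ⟪f t x, f' t x⟫ := bilin (innerSL ℝ) h h'

lemma mul {f f' : α → β → ℝ} (h : GrowthLE μ g k f) (h' : GrowthLE μ g l f') :
    GrowthLE μ g (k + l) fun t x => f t x * f' t x := bilin (mulL) h h'

lemma smul {f : α → β → ℝ} {f' : α → β → E} (h : GrowthLE μ g k f) (h' : GrowthLE μ g l f') :
    GrowthLE μ g (k + l) fun t x => f t x • f' t x := bilin (lsmul ℝ ℝ) h h'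

lemma apply {f : α → β → E →L[ℝ] F} {f' : α → β → E} (h : GrowthLE μ g k f) (h' : GrowthLE μ g l f') :
    GrowthLE μ g (k + l) fun t x => f t x (f' t x) := bilin (idL _) h h'

lemma sq {f : α → β → ℝ} (h : GrowthLE μ g k f) : GrowthLE μ g (k + k) fun t x => f t x ^ 2 := by
  simpa only [_root_.sq] using h.mul h

lemma clm (L : E →L[ℝ] F) {f : α → β → E} (h : GrowthLE μ g k f) : GrowthLE μ g k fun t x => L (f t x) := by
  refine ⟨L.continuous.comp_aesm h.aesm, ?_⟩
  obtain ⟨C, hC⟩ := h.bound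
  refine ⟨‖L‖ * C, ?_⟩
  filter_upwards [hC] with p h1
  rw [mul_assoc]
  exact L.le_opNorm_of_le h1

end GrowthLE

end

section

variable {T : ℝ} {E F : Type*} [NormedAddCommGroup E] [NormedSpace ℝ E] [CompleteSpace E]
  [NormedAddCommGroup F] [NormedSpace ℝ F]

lemma integral_sub_eq_of_primitive [IsFiniteMeasure (vol Ω)] (L : E →L[ℝ] F →L[ℝ] ℝ) {V' : ℝ → Vec d → E}
    (hV' : MemLp (uncurry V') 2 (ST Ω T)) {b : Vec d → F} (hb : ML2 b Ω) {V₀ Vs Vt : Vec d → E}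
    {s t : ℝ} (ht : 0 ≤ t) (hts : t ≤ s) (hs : s < T) (hVs : ML2 Vs Ω) (hVt : ML2 Vt Ω)
    (hs' : ∀ᵐ x ∂vol Ω, Vs x = V₀ x + ∫ r in 0..s, V' r x)
    (ht' : ∀ᵐ x ∂vol Ω, Vt x = V₀ x + ∫ r in 0..t, V' r x) :
    (∫ x in Ω, L (Vs x) (b x)) - ∫ x in Ω, L (Vt x) (b x) = ∫ r in t..s, ∫ x in Ω, L (V' r x) (b x) := by
  have hsub : Ioc t s ⊆ Ioo 0 T := fun r hr => ⟨ht.trans_lt hr.1, hr.2.trans_lt hs⟩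
  have hle : (vol (Ioc t s)).prod (vol Ω) ≤ ST Ω T :=
    prod_mono (restrict_mono hsub le_rfl) le_rfl
  have hi : Integrable (uncurry fun r x => L (V' r x) (b x)) ((vol (Ioc t s)).prod (vol Ω)) :=
    integrable_bilin L (hV'.mono_measure hle) (hb.comp_snd _)
  rw [← integral_sub (integrable_bilin L hVs hb) (integrable_bilin L hVt hb), integral_of_le hts,
    integral_integral_swap hi]
  have hfin : IsFiniteMeasure (ST Ω T) := by unfold spaceTime; infer_instance
  refine integral_congr_ae ?_
  filter_upwards [hs', ht', Integrable.ae_time (hV'.integrable one_le_two)] with x h1 h2 h3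
  have hI : ∀ r ∈ Ico 0 T, IntervalIntegrable (fun r => V' r x) volume 0 r := fun r hr =>
    intervalIntegrable_of_Ioo_of_mem h3 (left_mem_Icc.2 (hr.1.trans hr.2.le)) ⟨hr.1, hr.2.le⟩
  have h4 := integral_interval_sub_left (hI s ⟨ht.trans hts, hs⟩) (hI t ⟨ht, hts.trans_lt hs⟩)
  rw [← sub_apply, ← map_sub, h1, h2, add_sub_add_left_eq_sub, h4, integral_of_le hts]
  exact (ContinuousLinearMap.integral_comp_comm (L.flip (b x)) (h3.mono_set hsub)).symm

lemma exists_seq_isSolTest_dense (Ω : Set (Vec d)) : ∃ w : ℕ → V[d], (∀ k, IsSolTest Ω (w k)) ∧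
    ∀ η, IsSolTest Ω η → ∃ k : ℕ → ℕ, Null (fun n => eL2 (w (k n) - η) Ω) ∧
      Null (fun n => eL2 (∇ (w (k n)) - ∇ η) Ω) := by
  have h1 : ∀ η : {η // IsSolTest Ω η}, ML2 η.1 Ω := fun η =>
    η.2.1.memLp
  have h2 : ∀ η : {η // IsSolTest Ω η}, ML2 (∇ η.1) Ω := fun η =>
    η.2.1.memLp_fderiv
  have hz : IsSolTest Ω (0 : V[d]) := ⟨⟨contDiff_const, HasCompactSupport.zero, by simp [tsupport]⟩, fun x => by simp [divg, tr]⟩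
  let j : {η // IsSolTest Ω η} → Lp (Vec d) 2 (vol Ω) × Lp M[d] 2 (vol Ω) :=
    fun η => ((h1 η).toLp _, (h2 η).toLp _)
  have : Fact ((2 : ℝ≥0∞) ≠ ⊤) := ⟨by norm_num⟩
  have : ProperSpace M[d] := FiniteDimensional.proper ℝ _
  have : SecondCountableTopology (Lp (Vec d) 2 (vol Ω)) := inferInstance
  have : SecondCountableTopology (Lp M[d] 2 (vol Ω)) := inferInstance
  have : TopologicalSpace.SeparableSpace (range j) := inferInstance
  have : Nonempty (range j) := ⟨⟨_, ⟨0, hz⟩, rfl⟩⟩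
  choose w hw using fun k => (TopologicalSpace.denseSeq (range j) k).2
  refine ⟨fun k => (w k).1, fun k => (w k).2, fun η hη => ?_⟩
  obtain ⟨f, hf⟩ := mem_closure_iff_seq_limit.1
    ((TopologicalSpace.denseRange_denseSeq (range j)) ⟨j ⟨η, hη⟩, ⟨η, hη⟩, rfl⟩)
  choose k hk using hf.1
  refine ⟨k, ?_⟩
  have h3 : Tendsto (fun n => j (w (k n))) atTop (𝓝 (j ⟨η, hη⟩)) := by
    have := (continuous_subtype_val.tendsto _).comp hf.2
    refine this.congr fun n => ?_
    rw [hw, hk]; rfl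
  have h4 := (Prod.tendsto_iff _ _).1 h3
  refine ⟨?_, ?_⟩
  · exact (Lp.tendsto_Lp_iff_tendsto_eLpNorm'' _ (fun n => h1 _) _ (h1 ⟨η, hη⟩)).1 h4.1
  · exact (Lp.tendsto_Lp_iff_tendsto_eLpNorm'' _ (fun n => h2 _) _ (h2 ⟨η, hη⟩)).1 h4.2

/-- A solenoidal test function of the form `θ(t) w(x)`, where `θ = 1` on `[0,τ]`. -/
lemma IsSolTest.exists_isSolenoidalTest {w : V[d]} (hw : IsSolTest Ω w) {τ : ℝ} (hτ : 0 < τ) (hT : τ < T) :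
    ∃ η, IsSolenoidalTest Ω T η ∧ (∀ t ∈ Icc 0 τ, η t = w) ∧ ∀ t ∈ Icc 0 τ, ∀ x, deriv (fun s => η s x) t = 0 := by
  let θ : ContDiffBump (0 : ℝ) := ⟨(2 * τ + T) / 3, (τ + 2 * T) / 3, by linarith, by linarith⟩
  have h1 : ∀ t ∈ Icc 0 τ, (θ : ℝ → ℝ) =ᶠ[𝓝 t] fun _ => 1 := fun t ht => by
    have : ball (0 : ℝ) ((2 * τ + T) / 3) ∈ 𝓝 t := isOpen_ball.mem_nhds (by
      rw [mem_ball, Real.dist_0_eq_abs, abs_of_nonneg ht.1]; linarith [ht.2])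
    filter_upwards [this] with s hs
    exact θ.one_of_mem_closedBall (ball_subset_closedBall hs)
  have hsub : tsupport (uncurry fun t x => θ t • w x) ⊆ tsupport θ ×ˢ tsupport w := by
    refine closure_minimal (fun p hp => ?_) ((isClosed_tsupport _).prod (isClosed_tsupport _))
    exact ⟨subset_tsupport _ (left_ne_zero_of_smul hp), subset_tsupport _ (right_ne_zero_of_smul hp)⟩
  refine ⟨fun t x => θ t • w x, ⟨?_, ?_, ?_, fun t x => ?_⟩, fun t ht => ?_, fun t ht x => ?_⟩
  · exact (θ.contDiff.comp contDiff_fst).smul (hw.1.smooth.comp contDiff_snd)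
  · exact of_support_subset_isCompact (θ.hasCompactSupport.isCompact.prod hw.1.compact.isCompact)
      ((subset_tsupport _).trans hsub)
  · refine hsub.trans (prod_mono (fun t ht => ?_) hw.1.support)
    rw [θ.tsupport_eq, mem_closedBall, Real.dist_0_eq_abs] at ht
    have : |t| ≤ (τ + 2 * T) / 3 := ht
    rw [mem_Iio]; linarith [le_abs_self t]
  · have h := hw.2 x
    rw [divg, ← trCLM_apply] at h ⊢
    rw [fderiv_fun_const_smul (hw.1.differentiable x), map_smul, h, smul_zero]
  · ext1 x; simp only [(h1 t ht).eq_of_nhds, one_smul]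
  · have : (fun s => θ s • w x) =ᶠ[𝓝 t] fun _ => w x := by
      filter_upwards [h1 t ht] with s hs
      rw [hs, one_smul]
    rw [this.deriv_eq, deriv_const]

end

/-! ### The two solutions on a fixed time interval -/

set_option maxSynthPendingDepth 10

section

noncomputable def outer (a b : Vec d) : M[d] →L[ℝ] ℝ :=
  ContinuousLinearMap.compL ℝ M[d] (Vec d) ℝ (innerSL ℝ a) (apply ℝ (Vec d) b)

lemma outer_apply (a b : Vec d) (A : M[d]) : outer a b A = ⟪a, A b⟫ := rfl

noncomputable def frobCLM (d : ℕ) : M[d] →L[ℝ] M[d] →L[ℝ] ℝ :=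
  ∑ i, (innerSL ℝ).bilinearComp (apply ℝ (Vec d) (single i 1))
    (apply ℝ (Vec d) (single i 1))

lemma frobCLM_apply (A A' : M[d]) : frobCLM d A A' = frob A A' := by
  simp [frobCLM, frob, sum_apply]

lemma fderiv_indicator_eq (hΩ : IsOpen Ω)
    {v : Vec d → F} {x : Vec d} (hx : x ∈ Ω) : ∇ (Ω.indicator v) x = ∇ v x :=
  Filter.EventuallyEq.fderiv_eq (by filter_upwards [hΩ.mem_nhds hx] with y hy using indicator_of_mem hy _)

end

/-- A weak solution of the phase-field model, a strong solution of the sharp interface limit and the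
auxiliary vector fields, with uniform bounds on the time interval `(0,τ)`. -/
structure SolutionPair (d : ℕ) where
  (Ω : Set (Vec d)) (W : ℝ → ℝ) (ε T₀ Tstar τ : ℝ) (C K : ℝ≥0) (φ₀ χ₀ : R[d]) (Dφ₀ u₀ v₀ Dψ₀ : V[d])
  (φ φt χ : ℝ → R[d]) (Dφ Dψ u v vt ξ ξt B : ℝ → V[d]) (D2φ Du : ℝ → Vec d → M[d])
  dim : d ≠ 0
  dom : IsC2Domain Ω
  well : IsDoubleWell W
  pos : 0 < ε
  le_T : Tstar ≤ T₀
  τ_mem : τ ∈ Ioo 0 Tstar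
  weak : IsWeakSolution Ω W ε T₀ φ₀ Dφ₀ u₀ φ φt Dφ D2φ u Du
  strong : IsStrongSolution Ω (surfaceTension W) Tstar χ₀ v₀ χ v
  reg : IsRegularPair Ω Tstar ξ ξt B
  cons : IsConsistent Ω Tstar χ ξ
  psi₀ : HasWeakGrad Ω (fun x => psi W (φ₀ x)) Dψ₀
  psi_meas : AESM (uncurry Dψ) (ST Ω T₀)
  psi_grad : ∀ᵐ t ∂vI T₀, HasWeakGrad Ω (fun x => psi W (φ t x)) (Dψ t)
  vt_memLp : MemLp (uncurry vt) 2 (ST Ω Tstar)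
  vt_weak : HasWeakTimeDeriv Ω Tstar v vt
  xi_lip : ∀ s ∈ Icc 0 τ, ∀ t ∈ Icc 0 τ, ∀ᵐ x ∂vol Ω, ‖ξ t x - ξ s x‖ ≤ C * |t - s|
  xi_time : ∀ᵐ p ∂ST Ω τ, ‖ξt p.1 p.2‖ ≤ C
  xi_bound : ∀ᵐ t ∂vI τ, ContDiff ℝ 1 (ξ t) ∧ HasCompactSupport (ξ t) ∧ tsupport (ξ t) ⊆ Ω ∧
    (∀ x, ‖ξ t x‖ ≤ C ∧ ‖∇ (ξ t) x‖ ≤ C) ∧ LipschitzWith C (∇ (ξ t))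
  B_bound : ∀ᵐ t ∂vI τ, LipschitzWith C (B t) ∧ (∀ x, ‖B t x‖ ≤ C) ∧ ∀ x ∉ Ω, B t x = 0
  v_bound : ∀ᵐ t ∂vI τ, ContDiffOn ℝ 1 (v t) Ω ∧ ∀ x ∈ Ω, ‖v t x‖ ≤ K ∧ ‖∇ (v t) x‖ ≤ K

namespace SolutionPair

variable (S : SolutionPair d)

lemma dm : Dom S.Ω := ⟨S.dim, S.dom.isOpen, S.dom.isBounded⟩

structure Slice (t : ℝ) : Prop where
  phase : PhaseSlice S.Ω (S.φ t) (S.Dφ t) (S.D2φ t)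
  allenCahn : ∀ᵐ x ∂vol S.Ω, S.φt t x + ⟪S.u t x, S.Dφ t x⟫
    = tr (S.D2φ t x) - 1 / S.ε ^ 2 * deriv S.W (S.φ t x)
  psi : ∀ᵐ x ∂vol S.Ω, S.Dψ t x = √(2 * S.W (S.φ t x)) • S.Dφ t x
  u_bdry : MemH10 S.Ω (S.u t) (S.Du t)
  u_div : WeaklyDivFree S.Ω (S.u t)
  v_bdry : MemH10 S.Ω (S.v t) (∇ (S.v t))
  v_div : WeaklyDivFree S.Ω (S.v t)
  v_C1 : ContDiffOn ℝ 1 (S.v t) S.Ω ∧ ∀ x ∈ S.Ω, ‖S.v t x‖ ≤ S.K ∧ ‖∇ (S.v t) x‖ ≤ S.K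
  xi : ContDiff ℝ 1 (S.ξ t) ∧ HasCompactSupport (S.ξ t) ∧ tsupport (S.ξ t) ⊆ S.Ω ∧
    (∀ x, ‖S.ξ t x‖ ≤ S.C ∧ ‖∇ (S.ξ t) x‖ ≤ S.C) ∧ LipschitzWith S.C (∇ (S.ξ t))
  B : LipschitzWith S.C (S.B t) ∧ (∀ x, ‖S.B t x‖ ≤ S.C) ∧ ∀ x ∉ S.Ω, S.B t x = 0

instance finite_Ω : IsFiniteMeasure (vol S.Ω) :=
  ⟨by rw [restrict_apply_univ]; exact S.dom.isBounded.measure_lt_top⟩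

lemma finite_spaceTime (T : ℝ) : IsFiniteMeasure (ST S.Ω T) := by
  unfold spaceTime; infer_instance

lemma τ_le : S.τ ≤ S.T₀ := S.τ_mem.2.le.trans S.le_T

lemma ae_slice : ∀ᵐ t ∂vI S.τ, S.Slice t := by
  have w := S.weak
  have h := S.strong
  have h1 : ∀ {p : ℝ → Prop}, (∀ᵐ t ∂vI S.T₀, p t) → ∀ᵐ t ∂vI S.τ, p t :=
    fun hp => ae_Ioo_mono S.τ_le hp
  have h2 : ∀ {p : ℝ → Prop}, (∀ᵐ t ∂vI S.Tstar, p t) → ∀ᵐ t ∂vI S.τ, p t :=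
    fun hp => ae_Ioo_mono S.τ_mem.2.le hp
  have m : ∀ {E : Type} [NormedAddCommGroup E] {f : ℝ → Vec d → E}, MemLp (uncurry f) 2 (ST S.Ω S.T₀) →
      ∀ᵐ t ∂vI S.τ, ML2 (f t) S.Ω := fun hf => by
    have a1 := (hf.integrable_norm_pow two_ne_zero).prod_right_ae
    filter_upwards [h1 a1, h1 hf.1.prodMk_left] with t b1 b2
    exact (memLp_two_iff_integrable_sq_norm b2).2 b1
  filter_upwards [h1 w.phase_bdry, m w.phase_grad_memLp, m w.phase_hess_memLp, h1 w.phase_hess,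
    h1 (spaceTime_ae_ae (p := fun t x => S.φ t x ∈ Icc (-1 : ℝ) 1) w.phase_range), h1 (spaceTime_ae_ae (p := fun t x =>
      S.φt t x + ⟪S.u t x, S.Dφ t x⟫ = tr (S.D2φ t x) - 1 / S.ε ^ 2 * deriv S.W (S.φ t x)) w.allenCahn),
    h1 S.psi_grad, h1 w.velocity_bdry, h1 w.divFree, h2 h.velocity_bdry, h2 h.divFree, S.v_bound, S.xi_bound, S.B_bound]
    with t a1 a2 a3 a4 a5 a6 a7 a8 a9 a10 a11 a12 a13 a14
  exact ⟨⟨a1, a2, a3, a4, a5⟩, a6, a1.grad_psi_eq S.dom.isOpen a5 S.well a7, a8, a9, a10, a11, a12, a13, a14⟩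

variable {S}

lemma Slice.v_lipschitz {t : ℝ} (h : S.Slice t) : LipschitzWith S.K (S.Ω.indicator (S.v t)) :=
  h.v_bdry.lipschitzWith_indicator S.dom h.v_C1.1 fun x hx => (h.v_C1.2 x hx).2

lemma Slice.v_le {t : ℝ} (h : S.Slice t) (x : Vec d) : ‖S.Ω.indicator (S.v t) x‖ ≤ S.K := by
  by_cases hx : x ∈ S.Ω
  · rw [indicator_of_mem hx]; exact (h.v_C1.2 x hx).1
  · rw [indicator_of_notMem hx, norm_zero]; exact S.K.2

lemma Slice.v_induction {t : ℝ} (h : S.Slice t) {p : V[d] → Prop} (test : ∀ η, IsSolTest S.Ω η → p η)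
    (lim : ∀ C w w₀, (∀ n, p (w n)) → BddConv S.Ω C w w₀ → p w₀) : p (S.Ω.indicator (S.v t)) :=
  solenoidal_induction S.dom test lim h.v_lipschitz h.v_le (fun _ hx => indicator_of_notMem hx _)
    (h.v_C1.1.congr fun _ hx => indicator_of_mem hx _)
    fun _ hη => h.v_bdry.integral_fderiv_indicator_eq_zero S.dom.isOpen h.v_div hη

lemma Slice.xi_eq_zero {t : ℝ} (h : S.Slice t) {x : Vec d} (hx : x ∉ S.Ω) : S.ξ t x = 0 ∧ ∇ (S.ξ t) x = 0 :=
  ⟨eq_zero_off fun hx' => hx (h.xi.2.2.1 hx'), by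
    by_contra hne; exact hx (h.xi.2.2.1 (support_fderiv_subset ℝ hne))⟩

lemma Slice.divg_xi_lipschitz {t : ℝ} (h : S.Slice t) : LipschitzWith (‖trCLM d‖₊ * S.C) (divg (S.ξ t)) := by
  have e : divg (S.ξ t) = trCLM d ∘ ∇ (S.ξ t) := funext fun x => (trCLM_apply _).symm
  rw [e]; exact (trCLM d).lipschitz.comp h.xi.2.2.2.2

variable (S)

/-- A square integrable majorant of all unbounded quantities. -/
noncomputable def maj (p : ℝ × Vec d) : ℝ := 1 + (‖S.u p.1 p.2‖ + ‖S.Du p.1 p.2‖ + ‖S.Dφ p.1 p.2‖ + ‖S.D2φ p.1 p.2‖ + ‖S.φt p.1 p.2‖ + ‖S.vt p.1 p.2‖ +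
  (‖S.u₀ p.2‖ + ‖S.v₀ p.2‖ + ‖S.Dψ₀ p.2‖))

abbrev Gr {E : Type*} [NormedAddCommGroup E] (k : ℕ) (f : ℝ → Vec d → E) : Prop :=
  GrowthLE (ST S.Ω S.τ) S.maj k f

lemma one_le_maj (p : ℝ × Vec d) : 1 ≤ S.maj p := by
  unfold maj; exact le_add_of_nonneg_right (by positivity)

lemma _root_.GrowthLE.up {G : Type*} [NormedAddCommGroup G] {k l : ℕ} {f : ℝ → Vec d → G} (h : S.Gr k f)
    (hkl : k ≤ l := by decide) : S.Gr l f := h.mono S.one_le_maj hkl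

lemma memLp_weak {E : Type*} [NormedAddCommGroup E] {f : ℝ → Vec d → E} (h : MemLp (uncurry f) 2 (ST S.Ω S.T₀)) :
    MemLp (uncurry f) 2 (ST S.Ω S.τ) := h.mono_measure (spaceTime_mono S.τ_le)

lemma vt_memLp' : MemLp (uncurry S.vt) 2 (ST S.Ω S.τ) := S.vt_memLp.mono_measure (spaceTime_mono S.τ_mem.2.le)

lemma memLp_u₀ : ML2 S.u₀ S.Ω := S.weak.init_velocity.choose_spec.memLp
lemma memLp_v₀ : ML2 S.v₀ S.Ω := S.strong.init_velocity.2.memLp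

lemma Dpsi₀_eq : ∀ᵐ x ∂vol S.Ω, S.Dψ₀ x = √(2 * S.W (S.φ₀ x)) • S.Dφ₀ x :=
  S.weak.init_phase_bdry.grad_psi_eq S.dom.isOpen S.weak.init_range S.well S.psi₀

lemma memLp_Dphi₀ : ML2 S.Dφ₀ S.Ω := by
  have h := ((InnerProductSpace.toDual ℝ (Vec d)).symm.toContinuousLinearEquiv.toContinuousLinearMap).comp_memLp' S.weak.init_phase.memLp_deriv
  refine h.ae_eq (of_forall fun x => ?_)
  exact (InnerProductSpace.toDual ℝ (Vec d)).symm_apply_apply (S.Dφ₀ x)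

lemma memLp_Dpsi₀ : ML2 S.Dψ₀ S.Ω := by
  obtain ⟨c, hc⟩ := S.well.continuous_sqrt.bdd_Icc
  refine (S.memLp_Dphi₀.bdd_smul (S.well.continuous_sqrt.comp_aesm S.weak.init_phase.memLp.1)
    (S.weak.init_range.mono fun x hx => hc _ hx)).ae_eq ?_
  exact S.Dpsi₀_eq.mono fun x hx => hx.symm

lemma memLp_maj : MemLp S.maj 2 (ST S.Ω S.τ) := by
  have := S.finite_spaceTime S.τ
  have w := S.weak
  have a : ∀ {E : Type} [NormedAddCommGroup E] {f : ℝ → Vec d → E}, MemLp (uncurry f) 2 (ST S.Ω S.τ) →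
      MemLp (fun p => ‖f p.1 p.2‖) 2 (ST S.Ω S.τ) := fun hf => hf.norm
  have b : ∀ {f : V[d]}, ML2 f S.Ω → MemLp (fun p : ℝ × Vec d => ‖f p.2‖) 2 (ST S.Ω S.τ) :=
    fun hf => hf.norm.comp_snd _
  exact (memLp_const (1 : ℝ)).add (((((a (S.memLp_weak w.velocity_memLp)).add (a (S.memLp_weak w.velocity_grad_memLp))).add
    (a (S.memLp_weak w.phase_grad_memLp))).add (a (S.memLp_weak w.phase_hess_memLp))).add
    (a (S.memLp_weak w.phase_time_memLp)) |>.add (a S.vt_memLp') |>.add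
    (((b S.memLp_u₀).add (b S.memLp_v₀)).add (b S.memLp_Dpsi₀)))

lemma le_maj (p : ℝ × Vec d) : ‖S.u p.1 p.2‖ ≤ S.maj p ∧ ‖S.Du p.1 p.2‖ ≤ S.maj p ∧ ‖S.Dφ p.1 p.2‖ ≤ S.maj p ∧
    ‖S.D2φ p.1 p.2‖ ≤ S.maj p ∧ ‖S.φt p.1 p.2‖ ≤ S.maj p ∧ ‖S.vt p.1 p.2‖ ≤ S.maj p ∧
    ‖S.u₀ p.2‖ ≤ S.maj p ∧ ‖S.v₀ p.2‖ ≤ S.maj p ∧ ‖S.Dψ₀ p.2‖ ≤ S.maj p := by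
  have h1 := norm_nonneg (S.u p.1 p.2)
  have h2 := norm_nonneg (S.Du p.1 p.2)
  have h3 := norm_nonneg (S.Dφ p.1 p.2)
  have h4 := norm_nonneg (S.D2φ p.1 p.2)
  have h5 := norm_nonneg (S.φt p.1 p.2)
  have h6 := norm_nonneg (S.vt p.1 p.2)
  have h7 := norm_nonneg (S.u₀ p.2)
  have h8 := norm_nonneg (S.v₀ p.2)
  have h9 := norm_nonneg (S.Dψ₀ p.2)
  unfold maj
  refine ⟨?_, ?_, ?_, ?_, ?_, ?_, ?_, ?_, ?_⟩ <;> linarith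

variable {S} {E : Type*} [NormedAddCommGroup E]

lemma gr_of_le {f : ℝ → Vec d → E} (hf : MemLp (uncurry f) 2 (ST S.Ω S.τ)) (h : ∀ p : ℝ × Vec d, ‖f p.1 p.2‖ ≤ S.maj p) : S.Gr 1 f :=
  ⟨hf.1, 1, of_forall fun p => by rw [one_mul, pow_one]; exact h p⟩

lemma gr_u : S.Gr 1 S.u := gr_of_le (S.memLp_weak S.weak.velocity_memLp) fun p => (S.le_maj p).1
lemma gr_Du : S.Gr 1 S.Du := gr_of_le (S.memLp_weak S.weak.velocity_grad_memLp) fun p => (S.le_maj p).2.1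
lemma gr_Dphi : S.Gr 1 S.Dφ := gr_of_le (S.memLp_weak S.weak.phase_grad_memLp) fun p => (S.le_maj p).2.2.1
lemma gr_D2phi : S.Gr 1 S.D2φ := gr_of_le (S.memLp_weak S.weak.phase_hess_memLp) fun p => (S.le_maj p).2.2.2.1
lemma gr_phit : S.Gr 1 S.φt := gr_of_le (S.memLp_weak S.weak.phase_time_memLp) fun p => (S.le_maj p).2.2.2.2.1
lemma gr_vt : S.Gr 1 S.vt := gr_of_le S.vt_memLp' fun p => (S.le_maj p).2.2.2.2.2.1
lemma gr_u₀ : S.Gr 1 fun _ => S.u₀ := gr_of_le (S.memLp_u₀.comp_snd _) fun p => (S.le_maj p).2.2.2.2.2.2.1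
lemma gr_v₀ : S.Gr 1 fun _ => S.v₀ := gr_of_le (S.memLp_v₀.comp_snd _) fun p => (S.le_maj p).2.2.2.2.2.2.2.1
lemma gr_Dpsi₀ : S.Gr 1 fun _ => S.Dψ₀ := gr_of_le (S.memLp_Dpsi₀.comp_snd _) fun p => (S.le_maj p).2.2.2.2.2.2.2.2

lemma gr_of_bound {f : ℝ → Vec d → E} (hf : AESM (uncurry f) (ST S.Ω S.τ)) {c : ℝ}
    (h : ∀ᵐ t ∂vI S.τ, ∀ x ∈ S.Ω, ‖f t x‖ ≤ c) : S.Gr 0 f := by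
  refine ⟨hf, c, ?_⟩
  obtain ⟨A, hA, hAm, h0⟩ := (h.exists_measurable_mem : ∃ A ∈ ae (vI S.τ), _)
  have h1 : ∀ᵐ p ∂ST S.Ω S.τ, p.1 ∈ A := quasiMeasurePreserving_fst.ae hA
  have h2 : ∀ᵐ p ∂ST S.Ω S.τ, p.2 ∈ S.Ω :=
    quasiMeasurePreserving_snd.ae (ae_restrict_mem S.dm.m)
  filter_upwards [h1, h2] with p a b
  rw [pow_zero, mul_one]; exact h0 _ a _ b

lemma gr_comp {f : ℝ → ℝ} (hf : Continuous f) : S.Gr 0 fun t x => f (S.φ t x) := by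
  refine ⟨hf.comp_aesm (S.memLp_weak S.weak.phase_memLp).1, ?_⟩
  obtain ⟨c, hc⟩ := hf.bdd_Icc
  refine ⟨c, ?_⟩
  filter_upwards [ae_spaceTime_mono S.τ_le S.weak.phase_range] with p hp
  rw [pow_zero, mul_one]; exact hc _ hp

lemma gr_v : S.Gr 0 S.v := gr_of_bound (S.strong.velocity_memLp.1.mono_measure (spaceTime_mono S.τ_mem.2.le))
  (S.v_bound.mono fun _ h x hx => (h.2 x hx).1)
lemma gr_Dv : S.Gr 0 fun t x => ∇ (S.v t) x :=
  gr_of_bound (S.strong.velocity_grad_memLp.1.mono_measure (spaceTime_mono S.τ_mem.2.le)) (S.v_bound.mono fun _ h x hx => (h.2 x hx).2)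
lemma gr_xi : S.Gr 0 S.ξ := gr_of_bound (S.reg.xi_measurable.mono_measure (spaceTime_mono S.τ_mem.2.le))
  (S.xi_bound.mono fun _ h x _ => (h.2.2.2.1 x).1)
lemma gr_xit : S.Gr 0 S.ξt := ⟨S.reg.xi_time_measurable.mono_measure (spaceTime_mono S.τ_mem.2.le), S.C,
  S.xi_time.mono fun p hp => by rwa [pow_zero, mul_one]⟩
lemma gr_B : S.Gr 0 S.B := gr_of_bound (S.reg.B_measurable.mono_measure (spaceTime_mono S.τ_mem.2.le))
  (S.B_bound.mono fun _ h x _ => h.2.1 x)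
lemma gr_chi : S.Gr 0 S.χ := by
  refine gr_of_bound (c := 1) (S.strong.phase_measurable.mono_measure (spaceTime_mono S.τ_mem.2.le)) ?_
  filter_upwards [ae_mem_Ioo] with t ht x hx
  rcases S.strong.phase_range t ⟨ht.1, ht.2.trans S.τ_mem.2⟩ x hx with h | h <;> simp [h]

lemma gr_fderiv [NormedSpace ℝ E] [FiniteDimensional ℝ E] {f : ℝ → Vec d → E} (hf : S.Gr 0 f) {c : ℝ≥0}
    (h : ∀ t, S.Slice t → LipschitzWith c (f t) ∧ ∀ x ∉ S.Ω, f t x = 0) : S.Gr 0 fun t x => ∇ (f t) x :=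
  gr_of_bound (aesm_fderiv S.dm.m hf.memLp_top (S.ae_slice.mono h))
    (S.ae_slice.mono fun t ht _ _ => norm_fderiv_le_of_lipschitz ℝ (h t ht).1)

lemma gr_DB : S.Gr 0 fun t x => ∇ (S.B t) x := gr_fderiv gr_B fun _ h => ⟨h.B.1, h.B.2.2⟩
lemma gr_Dxi : S.Gr 0 fun t x => ∇ (S.ξ t) x := gr_fderiv (c := S.C) gr_xi fun _ h =>
  ⟨lipschitzWith_of_nnnorm_fderiv_le (h.xi.1.differentiable one_ne_zero) fun x => (h.xi.2.2.2.1 x).2, fun _ hx => (h.xi_eq_zero hx).1⟩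
lemma gr_tr {f : ℝ → Vec d → M[d]} {k : ℕ} (hf : S.Gr k f) : S.Gr k fun t x => tr (f t x) := by
  simpa only [trCLM_apply] using hf.clm (trCLM d)
lemma gr_divg : S.Gr 0 fun t x => divg (S.ξ t) x := gr_tr gr_Dxi
lemma gr_Ddivg : S.Gr 0 fun t x => ∇ (divg (S.ξ t)) x := gr_fderiv gr_divg fun t h =>
  ⟨h.divg_xi_lipschitz, fun x hx => by rw [divg, (h.xi_eq_zero hx).2, ← trCLM_apply, map_zero]⟩

lemma ae_psi : ∀ᵐ p ∂ST S.Ω S.τ, S.Dψ p.1 p.2 = √(2 * S.W (S.φ p.1 p.2)) • S.Dφ p.1 p.2 := by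
  have h := ae_prod_eq_zero (f := fun p : ℝ × Vec d => S.Dψ p.1 p.2 - √(2 * S.W (S.φ p.1 p.2)) • S.Dφ p.1 p.2)
    ((S.psi_meas.mono_measure (spaceTime_mono S.τ_le)).sub
      ((gr_comp S.well.continuous_sqrt).smul gr_Dphi).aesm) (S.ae_slice.mono fun t h => h.psi.mono fun x hx => by
        simp only [hx, sub_self])
  exact h.mono fun p hp => sub_eq_zero.1 hp

lemma gr_Dpsi : S.Gr 1 S.Dψ := by
  have h := (gr_comp S.well.continuous_sqrt).smul (gr_Dphi (S := S))
  refine ⟨S.psi_meas.mono_measure (spaceTime_mono S.τ_le), h.bound.imp fun c hc => ?_⟩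
  filter_upwards [hc, ae_psi] with p h1 h2
  rw [h2]; exact h1

lemma gr_frob {f g : ℝ → Vec d → M[d]} {k l : ℕ} (hf : S.Gr k f) (hg : S.Gr l g) :
    S.Gr (k + l) fun t x => frob (f t x) (g t x) := by
  simpa only [frobCLM_apply] using hf.bilin (frobCLM d) hg

lemma gr_outer {f g : ℝ → V[d]} {k l : ℕ} (hf : S.Gr k f) (hg : S.Gr l g) :
    S.Gr (k + l) fun t x => outer (f t x) (g t x) :=
  (hf.clm (innerSL ℝ)).bilin (ContinuousLinearMap.compL ℝ M[d] (Vec d) ℝ)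
    (hg.clm (apply ℝ (Vec d)))

/-- The momentum flux of the weak solution, as a functional on velocity gradients. -/
noncomputable def stress (S : SolutionPair d) (t : ℝ) (x : Vec d) : M[d] →L[ℝ] ℝ :=
  outer (S.u t x) (S.u t x) - frobCLM d (S.Du t x) + S.ε • outer (S.Dφ t x) (S.Dφ t x)

lemma gr_stress : S.Gr 2 S.stress :=
  ((gr_outer gr_u gr_u).sub ((gr_Du.clm (frobCLM d)).up)).add
    ((GrowthLE.const S.ε).smul (gr_outer gr_Dphi gr_Dphi))

end SolutionPair

/-! ### Evolution of products of the solutions -/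

namespace SolutionPair

variable {S : SolutionPair d}

lemma integrableOn_slice {f : ℝ → R[d]} (h : S.Gr 2 f) : IntegrableOn (fun t => ∫ x in S.Ω, f t x) (Ioo 0 S.τ) :=
  (h.integrable S.memLp_maj).integral_prod_left

lemma slice_intervalIntegrable {f : ℝ → R[d]} (h : S.Gr 2 f) {a b : ℝ} (ha : a ∈ Icc 0 S.τ) (hb : b ∈ Icc 0 S.τ) :
    IntervalIntegrable (fun t => ∫ x in S.Ω, f t x) volume a b := intervalIntegrable_of_Ioo_of_mem (integrableOn_slice h) ha hb

lemma zero_mem : (0 : ℝ) ∈ Icc 0 S.τ := left_mem_Icc.2 S.τ_mem.1.le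

lemma iterated_eq {f : ℝ → R[d]} (h : S.Gr 2 f) {T : ℝ} (hT : T ∈ Ioo 0 S.τ) :
    ∫ t in 0..T, ∫ x in S.Ω, f t x = ∫ p, f p.1 p.2 ∂ST S.Ω T := by
  rw [integral_of_le hT.1.le, integral_Ioc_eq_integral_Ioo, spaceTime]
  exact (integral_prod _ ((h.integrable S.memLp_maj).mono_measure (spaceTime_mono hT.2.le))).symm

lemma integrable_of_gr {f : ℝ → Vec d → E} (h : S.Gr 2 f) {T : ℝ} (hT : T ∈ Ioo 0 S.τ) :
    Integrable (uncurry f) (ST S.Ω T) := (h.integrable S.memLp_maj).mono_measure (spaceTime_mono hT.2.le)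

lemma iterated_add {f g : ℝ → R[d]} (h : S.Gr 2 f) (h' : S.Gr 2 g) {T : ℝ} (hT : T ∈ Ioo 0 S.τ) :
    (∫ t in 0..T, ∫ x in S.Ω, f t x) + ∫ t in 0..T, ∫ x in S.Ω, g t x = ∫ t in 0..T, ∫ x in S.Ω, (f t x + g t x) := by
  rw [iterated_eq h hT, iterated_eq h' hT, iterated_eq (h.add h') hT]
  exact (integral_add (integrable_of_gr h hT) (integrable_of_gr h' hT)).symm

lemma iterated_sub {f g : ℝ → R[d]} (h : S.Gr 2 f) (h' : S.Gr 2 g) {T : ℝ} (hT : T ∈ Ioo 0 S.τ) :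
    (∫ t in 0..T, ∫ x in S.Ω, f t x) - ∫ t in 0..T, ∫ x in S.Ω, g t x = ∫ t in 0..T, ∫ x in S.Ω, (f t x - g t x) := by
  rw [iterated_eq h hT, iterated_eq h' hT, iterated_eq (h.sub h') hT]
  exact (integral_sub (integrable_of_gr h hT) (integrable_of_gr h' hT)).symm

lemma gr_lip {w : V[d]} {c : ℝ≥0} (hw : LipschitzWith c w) : S.Gr 0 fun _ x => ∇ w x := by
  borelize M[d]
  exact gr_of_bound ((measurable_fderiv ℝ w).comp measurable_snd).aesm
    (of_forall fun _ _ _ => norm_fderiv_le_of_lipschitz ℝ hw)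

lemma gr_bdd {w : V[d]} (hw : Continuous w) {c : ℝ} (hc : ∀ x, ‖w x‖ ≤ c) : S.Gr 0 fun _ => w :=
  gr_of_bound (hw.comp continuous_snd).aesm (of_forall fun _ _ _ => hc _)

lemma intervalIntegrable_pair
    {g : Vec d → F} (hg : ML2 g S.Ω) {a b : ℝ} (ha : a ∈ Icc 0 S.τ) (hb : b ∈ Icc 0 S.τ) {f : ℝ → Vec d → E}
    (hf : MemLp (uncurry f) 2 (ST S.Ω S.τ)) (L : E →L[ℝ] F →L[ℝ] ℝ) :
    IntervalIntegrable (fun t => ∫ x in S.Ω, L (f t x) (g x)) volume a b := by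
  exact intervalIntegrable_of_Ioo_of_mem (Integrable.integral_prod_left (f := fun p : ℝ × Vec d => L (f p.1 p.2) (g p.2))
    (integrable_bilin L hf (hg.comp_snd _))) ha hb

/-- The momentum equation of the weak solution at time `T`. -/
def Momentum (S : SolutionPair d) (w : V[d]) (T : ℝ) : Prop :=
  (∫ x in S.Ω, ⟪S.u T x, w x⟫) - ∫ x in S.Ω, ⟪S.u₀ x, w x⟫ = ∫ t in 0..T, ∫ x in S.Ω, S.stress t x (∇ w x)

lemma ae_momentum : ∀ᵐ T ∂vI S.τ, ∀ w, IsSolTest S.Ω w → S.Momentum w T := by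
  filter_upwards [ae_Ioo_mono S.τ_le S.weak.momentum, ae_mem_Ioo] with T h hT w hw
  obtain ⟨η, hη, h1, h2⟩ := hw.exists_isSolenoidalTest S.τ_mem.1 (S.τ_mem.2.trans_le S.le_T)
  obtain ⟨K, hK⟩ := hw.1.exists_lipschitz
  have hsub : uIcc 0 T ⊆ Icc 0 S.τ := by rw [uIcc_of_le hT.1.le]; exact Icc_subset_Icc_right hT.2.le
  have c : ∀ {f g : ℝ → ℝ}, (∀ t ∈ Icc 0 S.τ, f t = g t) → ∫ t in 0..T, f t = ∫ t in 0..T, g t :=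
    fun hfg => integral_congr fun t ht => hfg t (hsub ht)
  have h := h η hη
  rw [h1 T ⟨hT.1.le, hT.2.le⟩, h1 0 zero_mem, c (f := fun t => ∫ x in S.Ω, ⟪S.u t x, deriv (fun s => η s x) t⟫) (g := fun _ => 0) fun t ht => by simp [h2 t ht],
    c (f := fun t => ∫ x in S.Ω, ⟪S.u t x, ∇ (η t) x (S.u t x)⟫)
      (g := fun t => ∫ x in S.Ω, ⟪S.u t x, ∇ w x (S.u t x)⟫) fun t ht => by rw [h1 t ht],
    c (f := fun t => ∫ x in S.Ω, frob (S.Du t x) (∇ (η t) x)) (g := fun t => ∫ x in S.Ω, frob (S.Du t x) (∇ w x)) fun t ht => by rw [h1 t ht],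
    c (f := fun t => ∫ x in S.Ω, S.ε * ⟪S.Dφ t x, ∇ (η t) x (S.Dφ t x)⟫)
      (g := fun t => ∫ x in S.Ω, S.ε * ⟪S.Dφ t x, ∇ w x (S.Dφ t x)⟫) fun t ht => by rw [h1 t ht],
    intervalIntegral.integral_zero, zero_add] at h
  have g1 := gr_u.inner ((gr_lip (S := S) hK).apply gr_u)
  have g2 := (gr_frob gr_Du (gr_lip (S := S) hK)).up S (l := 2)
  have g3 := (GrowthLE.const S.ε).mul (gr_Dphi.inner ((gr_lip (S := S) hK).apply gr_Dphi))
  rw [Momentum, h, iterated_sub g1 g2 hT, iterated_add (g1.sub g2) g3 hT]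
  refine c fun t _ => integral_congr_ae (of_forall fun x => ?_)
  simp [stress, outer_apply, frobCLM_apply]

lemma Slice.u_memLp {t : ℝ} (h : S.Slice t) : ML2 (S.u t) S.Ω := h.u_bdry.memLp
lemma Slice.v_memLp {t : ℝ} (h : S.Slice t) : ML2 (S.v t) S.Ω := h.v_bdry.memLp

lemma setIntegral_congr_Ω {f g : R[d]} (h : ∀ x ∈ S.Ω, f x = g x) : ∫ x in S.Ω, f x = ∫ x in S.Ω, g x :=
  setIntegral_congr_fun S.dm.m h

/-- The momentum equation may be tested with the strong velocity at another time. -/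
lemma Slice.momentum_v {t : ℝ} (h : S.Slice t) {T : ℝ} (hTI : T ∈ Ioo 0 S.τ) (hT : S.Slice T)
    (hm : ∀ w, IsSolTest S.Ω w → S.Momentum w T) : (∫ x in S.Ω, ⟪S.u T x, S.v t x⟫) - ∫ x in S.Ω, ⟪S.u₀ x, S.v t x⟫ =
      ∫ r in 0..T, ∫ x in S.Ω, S.stress r x (∇ (S.v t) x) := by
  have key : (∃ K, LipschitzWith K (S.Ω.indicator (S.v t))) ∧ S.Momentum (S.Ω.indicator (S.v t)) T := by
    refine h.v_induction (p := fun w => (∃ K, LipschitzWith K w) ∧ S.Momentum w T) (fun η hη => ⟨hη.1.exists_lipschitz, hm η hη⟩)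
      fun C w w₀ hw hc => ?_
    have hL : LipschitzWith C w₀ := LipschitzWith.of_dist_le_mul fun x y =>
      le_of_tendsto' ((hc.tendsto x).dist (hc.tendsto y)) fun n => (hc.lip n).dist_le_mul x y
    refine ⟨⟨C, hL⟩, ?_⟩
    have l : ∀ {f : V[d]}, ML2 f S.Ω →
        Tendsto (fun n => ∫ x in S.Ω, ⟪f x, w n x⟫) atTop (𝓝 (∫ x in S.Ω, ⟪f x, w₀ x⟫)) := fun {f} hf => by
      refine tendsto_integral_of_dominated_convergence (fun x => ‖f x‖ * C)
        (fun n => hf.1.inner (hc.lip n).continuous.aesm) ((hf.integrable one_le_two).norm.mul_const _)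
        (fun n => of_forall fun x => ?_) (of_forall fun x => tendsto_const_nhds.inner (hc.tendsto x))
      exact (norm_inner_le_norm _ _).trans (mul_le_left (hc.bdd n x) (norm_nonneg _))
    have hi : Integrable (fun p => ‖S.stress p.1 p.2‖ * C) (ST S.Ω T) := ((integrable_of_gr gr_stress hTI).norm).mul_const _
    have hg : ∀ {w' : V[d]}, LipschitzWith C w' → S.Gr 2 fun t x => S.stress t x (∇ w' x) :=
      fun hw' => gr_stress.apply (gr_lip hw')
    have l2 : Tendsto (fun n => ∫ r in 0..T, ∫ x in S.Ω, S.stress r x (∇ (w n) x)) atTop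
        (𝓝 (∫ r in 0..T, ∫ x in S.Ω, S.stress r x (∇ w₀ x))) := by
      simp only [iterated_eq (hg (hc.lip _)) hTI, iterated_eq (hg hL) hTI]
      refine tendsto_integral_of_dominated_convergence _ (fun n => (integrable_of_gr (hg (hc.lip n)) hTI).1) hi
        (fun n => of_forall fun p => (le_opNorm _ _).trans
          (mul_le_left (hc.norm_fderiv_le n p.2) (norm_nonneg (S.stress p.1 p.2)))) ?_
      have := (quasiMeasurePreserving_snd (μ := vI T) (ν := vol S.Ω)).ae hc.tendsto_fderiv
      exact this.mono fun p hp => ((S.stress p.1 p.2).continuous.tendsto _).comp hp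
    exact tendsto_nhds_unique ((l hT.u_memLp).sub (l S.memLp_u₀)) (l2.congr fun n => (hw n).2.symm)
  have h3 := key.2
  have e : ∀ f : V[d], ∫ x in S.Ω, ⟪f x, S.Ω.indicator (S.v t) x⟫ = ∫ x in S.Ω, ⟪f x, S.v t x⟫ := fun f =>
    setIntegral_congr_Ω fun x hx => by rw [indicator_of_mem hx]
  rw [Momentum, e, e] at h3
  rw [h3]
  refine integral_congr fun r _ => setIntegral_congr_Ω fun x hx => ?_
  simp only [fderiv_indicator_eq S.dom.isOpen hx]

lemma ae_primitive {f f' : ℝ → V[d]} {f₀ : V[d]} (h : HasWeakTimeDeriv S.Ω S.Tstar f f')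
    (hf : S.Gr 1 f) (hf' : S.Gr 1 f') (h₀ : AESM f₀ (vol S.Ω)) (hini : TendstoL2AtZero S.Ω f f₀) :
    ∀ᵐ t ∂vI S.τ, ∀ᵐ x ∂vol S.Ω, f t x = f₀ x + ∫ r in 0..t, f' r x := by
  have := S.finite_spaceTime S.τ
  have i1 := (hf.memLp S.memLp_maj).integrable one_le_two
  have i2 := (hf'.memLp S.memLp_maj).integrable one_le_two
  obtain ⟨c, hc, hp⟩ := (h.mono S.τ_mem.2.le).exists_primitive_vec S.dom.isOpen S.τ_mem.1 i1 i2
  have he := ae_eq_of_tendstoL2AtZero S.τ_mem.1 i1.1 i2 hc.1 h₀ hp hini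
  filter_upwards [spaceTime_ae_ae (p := fun t x => f t x = c x + ∫ s in 0..t, f' s x) hp] with t ht
  filter_upwards [ht, he] with x h1 h2
  rw [h1, h2]

lemma ae_v : ∀ᵐ t ∂vI S.τ, ∀ᵐ x ∂vol S.Ω, S.v t x = S.v₀ x + ∫ r in 0..t, S.vt r x :=
  ae_primitive S.vt_weak (gr_v.up S) gr_vt S.memLp_v₀.1 S.strong.velocity_init

lemma tendsto_of_eq_iterated {f : ℝ → ℝ} {f₀ : ℝ} {H : ℝ → R[d]} (hH : S.Gr 2 H)
    (h : ∀ᵐ t ∂vI S.τ, ∃ A : ℝ → R[d], S.Gr 2 A ∧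
      (∀ r, ∀ x ∈ S.Ω, ‖A r x‖ ≤ H r x) ∧ f t - f₀ = ∫ r in 0..t, ∫ x in S.Ω, A r x) :
    Tendsto f (𝓝[>] 0 ⊓ ae volume) (𝓝 f₀) := by
  have hc := continuousOn_primitive_interval' (slice_intervalIntegrable hH zero_mem (right_mem_Icc.2 S.τ_mem.1.le))
    left_mem_uIcc 0 left_mem_uIcc
  rw [uIcc_of_le S.τ_mem.1.le, ContinuousWithinAt, integral_same] at hc
  have hc' : Tendsto (fun t => ∫ r in 0..t, ∫ x in S.Ω, H r x) (𝓝[>] 0 ⊓ ae volume) (𝓝 0) :=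
    hc.mono_left (inf_le_left.trans (nhdsWithin_le_of_mem (mem_of_superset (Ioo_mem_nhdsGT S.τ_mem.1) Ioo_subset_Icc_self)))
  rw [tendsto_iff_norm_sub_tendsto_zero]
  refine squeeze_zero' (of_forall fun t => norm_nonneg _) ?_ hc'
  filter_upwards [eventually_of_ae_Ioo S.τ_mem.1 h, eventually_of_ae_Ioo S.τ_mem.1 (ae_mem_Ioo)] with t ht htI
  obtain ⟨A, hA, hle, he⟩ := ht
  rw [he, iterated_eq hA htI, iterated_eq hH htI]
  refine norm_integral_le_of_norm_le (integrable_of_gr hH htI) ?_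
  have := (quasiMeasurePreserving_snd (μ := vI t) (ν := vol S.Ω)).ae (ae_restrict_mem S.dm.m)
  exact this.mono fun p hp => hle _ _ hp

lemma norm_stress_apply_le {t r : ℝ} (h : S.Slice t) {x : Vec d} (hx : x ∈ S.Ω) :
    ‖S.stress r x (∇ (S.v t) x)‖ ≤ ‖S.stress r x‖ * S.K :=
  (le_opNorm (S.stress r x) _).trans (mul_le_left (a := ‖S.stress r x‖) (h.v_C1.2 x hx).2 (norm_nonneg _))

lemma Slice.gr_fderiv_v {t : ℝ} (h : S.Slice t) : S.Gr 0 fun _ x => ∇ (S.v t) x := by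
  have := gr_lip (S := S) h.v_lipschitz
  have hm := (measurableSet_Ioo (a := (0 : ℝ)) (b := S.τ)).prod S.dm.m
  refine gr_of_bound (this.aesm.congr ?_) (of_forall fun _ x hx => (h.v_C1.2 x hx).2)
  rw [spaceTime_eq_restrict]
  exact (ae_restrict_mem hm).mono fun p hp => fderiv_indicator_eq S.dom.isOpen hp.2

lemma Slice.gr_v {t : ℝ} (h : S.Slice t) : S.Gr 1 fun _ => S.v t := by
  have hb := gr_bdd (S := S) h.v_lipschitz.continuous h.v_le
  refine (gr_of_bound (c := S.K) (hb.aesm.congr ?_) (of_forall fun _ x hx => (h.v_C1.2 x hx).1)).up S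
  rw [spaceTime_eq_restrict]
  exact (ae_restrict_mem (measurableSet_Ioo.prod S.dm.m)).mono fun p hp => indicator_of_mem hp.2 _

/-- The evolution of `∫ u · v`. -/
lemma ae_inner_u_v : ∀ᵐ s ∂vI S.τ, ∫ x in S.Ω, ⟪S.u s x, S.v s x⟫ = (∫ x in S.Ω, ⟪S.u₀ x, S.v₀ x⟫) +
    ∫ t in 0..s, ((∫ x in S.Ω, S.stress t x (∇ (S.v t) x)) + ∫ x in S.Ω, ⟪S.vt t x, S.u t x⟫) := by
  have hP : ∀ᵐ t ∂vI S.τ, S.Slice t ∧ (∀ w, IsSolTest S.Ω w → S.Momentum w t) ∧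
      ∀ᵐ x ∂vol S.Ω, S.v t x = S.v₀ x + ∫ r in 0..t, S.vt r x := S.ae_slice.and (ae_momentum.and ae_v)
  refine sub_eq_integral_pairing S.dm.m S.τ_mem.1 (idL _) (innerSL ℝ)
    (p := 1) (q := ⊤) ENNReal.one_ne_top (a := S.stress) (b := fun t x => ∇ (S.v t) x)
    (memLp_one_iff_integrable.2 (gr_stress.integrable S.memLp_maj)) gr_Dv.memLp_top S.vt_memLp'
    (S.memLp_weak S.weak.velocity_memLp) (integrableOn_slice (gr_u.inner (gr_v.up S (l := 1)))) hP
    (fun t s ht hs h0 hts hsτ => ?_) (tendsto_of_eq_iterated (H := fun r x => ‖S.stress r x‖ * S.K + ‖S.vt r x‖ * ‖S.u₀ x‖)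
      ((gr_stress.norm.mul (GrowthLE.const (S.K : ℝ))).add (gr_vt.norm.mul gr_u₀.norm)) ?_)
  · have hsI : s ∈ Ioo 0 S.τ := ⟨h0.trans hts, hsτ⟩
    have htI : t ∈ Ioo 0 S.τ := ⟨h0, hts.trans hsτ⟩
    have m1 := ht.1.momentum_v hsI hs.1 hs.2.1
    have m2 := ht.1.momentum_v htI ht.1 ht.2.1
    have m3 := integral_sub_eq_of_primitive (innerSL ℝ) S.vt_memLp' hs.1.u_memLp h0.le hts.le hsτ hs.1.v_memLp ht.1.v_memLp hs.2.2 ht.2.2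
    have m3' : (∫ x in S.Ω, ⟪S.u s x, S.v s x⟫) - ∫ x in S.Ω, ⟪S.u s x, S.v t x⟫ = ∫ r in t..s, ∫ x in S.Ω, ⟪S.vt r x, S.u s x⟫ := by
      refine Eq.trans ?_ m3; congr 1 <;> exact setIntegral_congr_Ω fun x _ => real_inner_comm _ _
    have hg := (gr_stress.apply ht.1.gr_fderiv_v)
    have ii := fun {c} (hc : c ∈ Icc 0 S.τ) {e} (he : e ∈ Icc 0 S.τ) => slice_intervalIntegrable hg hc he
    have m4 := integral_interval_sub_left (ii zero_mem (Ioo_subset_Icc_self hsI)) (ii zero_mem (Ioo_subset_Icc_self htI))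
    have m5 := intervalIntegrable_pair hs.1.u_memLp (Ioo_subset_Icc_self htI) (Ioo_subset_Icc_self hsI) S.vt_memLp' (innerSL ℝ)
    change IntervalIntegrable (fun r => ∫ x in S.Ω, ⟪S.vt r x, S.u s x⟫) volume t s at m5
    change _ = ∫ r in t..s, ((∫ x in S.Ω, S.stress r x (∇ (S.v t) x)) + ∫ x in S.Ω, ⟪S.vt r x, S.u s x⟫)
    rw [intervalIntegral.integral_add (ii (Ioo_subset_Icc_self htI) (Ioo_subset_Icc_self hsI)) m5, ← m4, ← m1, ← m2, ← m3']
    ring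
  · filter_upwards [hP, ae_mem_Ioo] with t ht htI
    have g1 := gr_stress.apply ht.1.gr_fderiv_v
    have g2 := gr_vt.inner (gr_u₀ (S := S))
    refine ⟨fun r x => S.stress r x (∇ (S.v t) x) + ⟪S.vt r x, S.u₀ x⟫, g1.add g2, fun r x hx =>
      norm_add_le_of_le (norm_stress_apply_le ht.1 hx) (norm_inner_le_norm _ _), ?_⟩
    have m1 := ht.1.momentum_v htI ht.1 ht.2.1
    have m2 := integral_sub_eq_of_primitive (innerSL ℝ) S.vt_memLp' S.memLp_u₀ le_rfl htI.1.le htI.2 ht.1.v_memLp S.memLp_v₀ ht.2.2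
      (of_forall fun x => by simp)
    have m2' : (∫ x in S.Ω, ⟪S.u₀ x, S.v t x⟫) - ∫ x in S.Ω, ⟪S.u₀ x, S.v₀ x⟫ = ∫ r in 0..t, ∫ x in S.Ω, ⟪S.vt r x, S.u₀ x⟫ := by
      refine Eq.trans ?_ m2; congr 1 <;> exact setIntegral_congr_Ω fun x _ => real_inner_comm _ _
    rw [← iterated_add g1 g2 htI, ← m1, ← m2']
    ring

end SolutionPair

lemma HasWeakGrad.integral_inner_lipschitz (dm : Dom Ω)
    {f : R[d]} {D : V[d]} (h : HasWeakGrad Ω f D) (hf : IntegrableOn f Ω) (hD : IntegrableOn D Ω) {w : V[d]} {K : ℝ≥0}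
    (hK : LipschitzWith K w) (h0 : ∀ x ∉ Ω, w x = 0) : ∫ x in Ω, (⟪D x, w x⟫ + f x * divg w x) = 0 := by
  refine lipschitz_integral_eq_zero (Λ := fun x m M => ⟪D x, m⟫ + f x * tr M) (g := fun x => ‖D x‖ + |f x| * ‖trCLM d‖) dm
    (fun x => by simp only [← trCLM_apply]; fun_prop) (fun w hw hDw => ?_) (hD.norm.add (hf.abs.mul_const _))
    (of_forall fun x => ⟨by positivity, fun m M => ?_⟩) (fun η hη => ?_) hK h0
  · simp only [← trCLM_apply]
    exact (hD.1.inner hw.aesm).add (hf.1.mul ((trCLM d).continuous.comp_aesm hDw))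
  · have c1 := norm_inner_le_norm (𝕜 := ℝ) (D x) m
    have c2 : ‖f x * tr M‖ ≤ |f x| * (‖trCLM d‖ * ‖M‖) := by
      rw [← trCLM_apply, norm_mul]; exact mul_le_left ((trCLM d).le_opNorm M) (norm_nonneg _)
    refine (norm_add_le_of_le c1 c2).trans ?_
    have p1 : 0 ≤ ‖D x‖ * ‖M‖ := by positivity
    have p2 : 0 ≤ |f x| * ‖trCLM d‖ * ‖m‖ := by positivity
    nlinarith
  · have e := HasWeakFDeriv.integral_apply_test h hη
    obtain ⟨C, hC⟩ := hη.bdd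
    obtain ⟨C', hC'⟩ := hη.bdd_fderiv
    have i1 : IntegrableOn (fun x => ⟪D x, η x⟫) Ω := (hD.norm.mul_const C).mono'
      (hD.1.inner hη.cont.aesm)
      (of_forall fun x => (norm_inner_le_norm _ _).trans (mul_le_left (hC x) (norm_nonneg _)))
    have i2 : IntegrableOn (fun x => f x * tr (∇ η x)) Ω := by
      simp only [← trCLM_apply]
      refine hf.mul_bdd (c := ‖trCLM d‖ * C') ((trCLM d).continuous.comp hη.continuous_fderiv).aesm
        (of_forall fun x => ((trCLM d).le_opNorm _).trans (mul_le_left (hC' x) (norm_nonneg _)))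
    rw [integral_add i1 i2]
    have e' : ∫ x in Ω, ⟪D x, η x⟫ = -∫ x in Ω, f x * tr (∇ η x) := e
    rw [e', neg_add_cancel]

lemma IsDoubleWell.continuous_psi {W : ℝ → ℝ} (hW : IsDoubleWell W) : Continuous (psi W) :=
  intervalIntegral.continuous_primitive (fun a b => hW.continuous_sqrt.intervalIntegrable a b) (-1)

namespace SolutionPair

variable {S : SolutionPair d}

lemma ae_inner_v_v : ∀ᵐ s ∂vI S.τ, ∫ x in S.Ω, ⟪S.v s x, S.v s x⟫ = (∫ x in S.Ω, ⟪S.v₀ x, S.v₀ x⟫) +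
    ∫ t in 0..s, ((∫ x in S.Ω, ⟪S.vt t x, S.v t x⟫) + ∫ x in S.Ω, ⟪S.vt t x, S.v t x⟫) := by
  have gv := gr_v.up S (l := 1)
  have key : ∀ {s t : ℝ} {f f₀ : V[d]} (_ : 0 ≤ t) (_ : t < s) (_ : s < S.τ)
      (_ : ML2 f S.Ω) (_ : ML2 f₀ S.Ω),
      (∀ᵐ x ∂vol S.Ω, f x = S.v₀ x + ∫ r in 0..s, S.vt r x) →
      (∀ᵐ x ∂vol S.Ω, f₀ x = S.v₀ x + ∫ r in 0..t, S.vt r x) →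
      (∫ x in S.Ω, ⟪f x, f x⟫) - ∫ x in S.Ω, ⟪f₀ x, f₀ x⟫ =
        ∫ r in t..s, ((∫ x in S.Ω, ⟪S.vt r x, f₀ x⟫) + ∫ x in S.Ω, ⟪S.vt r x, f x⟫) :=
    fun {s t f f₀} h0 hts hs hf hf₀ e e₀ => by
      have ha : t ∈ Icc 0 S.τ := ⟨h0, (hts.trans hs).le⟩
      have hb : s ∈ Icc 0 S.τ := ⟨h0.trans hts.le, hs.le⟩
      have m1 := integral_sub_eq_of_primitive (innerSL ℝ) S.vt_memLp' hf h0 hts.le hs hf hf₀ e e₀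
      have m2 := integral_sub_eq_of_primitive (innerSL ℝ) S.vt_memLp' hf₀ h0 hts.le hs hf hf₀ e e₀
      have j1 := intervalIntegrable_pair hf ha hb S.vt_memLp' (innerSL ℝ)
      have j2 := intervalIntegrable_pair hf₀ ha hb S.vt_memLp' (innerSL ℝ)
      have m3 := intervalIntegral.integral_add j2 j1
      have m4 : ∫ x in S.Ω, innerSL ℝ (f₀ x) (f x) = ∫ x in S.Ω, innerSL ℝ (f x) (f₀ x) :=
        setIntegral_congr_Ω fun x _ => real_inner_comm (f x) (f₀ x)
      refine Eq.trans ?_ m3.symm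
      rw [← m1, ← m2, m4]
      change (∫ x in S.Ω, innerSL ℝ (f x) (f x)) - ∫ x in S.Ω, innerSL ℝ (f₀ x) (f₀ x) = _
      ring
  refine sub_eq_integral_pairing S.dm.m S.τ_mem.1 (innerSL ℝ) (innerSL ℝ)
    (p := 2) (q := 2) (by norm_num) (a := S.vt) (b := S.v) S.vt_memLp' (gv.memLp S.memLp_maj) S.vt_memLp' (gv.memLp S.memLp_maj)
    (integrableOn_slice (gv.inner gv)) (S.ae_slice.and ae_v) (fun t s ht hs h0 hts hsτ => ?_)
    (tendsto_of_eq_iterated (H := fun r x => ‖S.vt r x‖ * ‖S.v₀ x‖ + ‖S.vt r x‖ * S.K)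
      ((gr_vt.norm.mul gr_v₀.norm).add ((gr_vt.norm.mul (GrowthLE.const (S.K : ℝ))).up S)) ?_)
  · exact key h0.le hts hsτ hs.1.v_memLp ht.1.v_memLp hs.2 ht.2
  · filter_upwards [S.ae_slice, ae_v, ae_mem_Ioo] with t ht hv htI
    refine ⟨fun r x => ⟪S.vt r x, S.v₀ x⟫ + ⟪S.vt r x, S.v t x⟫, (gr_vt.inner gr_v₀).add (gr_vt.inner ht.gr_v),
      fun r x hx => norm_add_le_of_le (norm_inner_le_norm _ _) ((norm_inner_le_norm _ _).trans
        (mul_le_left (ht.v_C1.2 x hx).1 (norm_nonneg _))), ?_⟩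
    rw [key le_rfl htI.1 htI.2 ht.v_memLp S.memLp_v₀ hv (of_forall fun x => by simp),
      ← iterated_add (gr_vt.inner gr_v₀) (gr_vt.inner ht.gr_v) htI]
    exact intervalIntegral.integral_add (slice_intervalIntegrable (gr_vt.inner gr_v₀) zero_mem (Ioo_subset_Icc_self htI))
      (slice_intervalIntegrable (gr_vt.inner ht.gr_v) zero_mem (Ioo_subset_Icc_self htI))

lemma gr_psi : S.Gr 0 fun t x => psi S.W (S.φ t x) := gr_comp S.well.continuous_psi

lemma gr_psit : S.Gr 1 fun t x => √(2 * S.W (S.φ t x)) * S.φt t x := (gr_comp S.well.continuous_sqrt).mul gr_phit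

lemma ae_psi_time : ∀ᵐ t ∂vI S.τ, ∀ᵐ x ∂vol S.Ω,
    psi S.W (S.φ t x) = psi S.W (S.φ₀ x) + ∫ r in 0..t, √(2 * S.W (S.φ r x)) * S.φt r x := by
  have := S.finite_spaceTime S.τ
  have w := S.weak
  have hφ := S.memLp_weak w.phase_memLp
  have i1 := hφ.integrable one_le_two
  have i2 := (S.memLp_weak w.phase_time_memLp).integrable one_le_two
  obtain ⟨c, hc, hp⟩ := (w.phase_time.mono S.τ_le).exists_primitive_real S.dom.isOpen S.τ_mem.1 i1 i2
  have he := ae_eq_of_tendstoL2AtZero S.τ_mem.1 i1.1 i2 hc.1 w.init_phase.memLp.1 hp w.phase_init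
  have h11 : (-1 : ℝ) ≤ 1 := by norm_num
  set h : ℝ → ℝ := IccExtend h11 fun r => √(2 * S.W r) with hh
  have hcont : Continuous h := S.well.continuous_sqrt.comp continuous_subtype_val |>.Icc_extend'
  obtain ⟨M, hM⟩ := S.well.continuous_sqrt.bdd_Icc
  set Ψ : ℝ → ℝ := fun r => ∫ s in (-1 : ℝ)..r, h s with hΨdef
  have hΨ : ∀ r, HasDerivAt Ψ (h r) r := fun r => integral_hasDerivAt_right
    (hcont.intervalIntegrable _ _) (hcont.stronglyMeasurableAtFilter _ _) hcont.continuousAt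
  have hK : LipschitzWith M.toNNReal Ψ := lipschitzWith_of_nnnorm_deriv_le (fun r => (hΨ r).differentiableAt) fun r => by
    rw [(hΨ r).deriv, ← NNReal.coe_le_coe, coe_nnnorm]
    exact (hM _ (projIcc (-1) 1 h11 r).2).trans (le_coe_toNNReal M)
  have heq : ∀ r ∈ Icc (-1 : ℝ) 1, h r = √(2 * S.W r) := fun r hr => IccExtend_of_mem h11 _ hr
  have hpsi : ∀ r ∈ Icc (-1 : ℝ) 1, Ψ r = psi S.W r := fun r hr => by
    refine integral_congr fun s hs => heq s ?_
    rw [uIcc_of_le hr.1] at hs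
    exact ⟨hs.1, hs.2.trans hr.2⟩
  have hr := ae_spaceTime_mono S.τ_le w.phase_range
  have q1 := spaceTime_ae_swap (p := fun t x => S.φ t x = c x + ∫ s in 0..t, S.φt s x ∧ S.φ t x ∈ Icc (-1 : ℝ) 1) (hp.and hr)
  have q2 := spaceTime_ae_ae (p := fun t x => S.φ t x = c x + ∫ s in 0..t, S.φt s x ∧ S.φ t x ∈ Icc (-1 : ℝ) 1) (hp.and hr)
  filter_upwards [q2, ae_mem_Ioo] with t ht htI
  filter_upwards [ht, he, q1, w.init_range, Integrable.ae_time i2] with x h1 h2 h3 h4 h5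
  have key := integral_comp_primitive hΨ hK S.τ_mem.1.le h5 (c x) (Ioo_subset_Icc_self htI)
  rw [← h1.1, hpsi _ h1.2, h2, hpsi _ h4] at key
  rw [key]
  congr 1
  refine intervalIntegral.integral_congr_ae ?_
  rw [ae_restrict_iff' measurableSet_Ioo] at h3
  filter_upwards [h3] with s hs hsI
  rw [uIoc_of_le htI.1.le] at hsI
  obtain ⟨a1, a2⟩ := hs ⟨hsI.1, hsI.2.trans_lt htI.2⟩
  rw [← h2, ← a1, heq _ a2]

lemma tendsto_xi : TendstoL2AtZero S.Ω S.ξ (S.ξ 0) := by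
  have h1 : Tendsto (fun t : ℝ => vol S.Ω univ ^ (2 : ℝ≥0∞).toReal⁻¹ * ofReal (S.C * |t - 0|)) (𝓝[>] 0 ⊓ ae volume) (𝓝 0) := by
    have h2 : Tendsto (fun t : ℝ => ofReal (S.C * |t - 0|)) (𝓝 0) (𝓝 (ofReal (S.C * |(0 : ℝ) - 0|))) :=
      (continuous_ofReal.comp (by fun_prop : Continuous fun t : ℝ => S.C * |t - 0|)).tendsto 0
    rw [sub_self, abs_zero, mul_zero, ofReal_zero] at h2
    have h3 := ENNReal.Tendsto.const_mul (a := vol S.Ω univ ^ (2 : ℝ≥0∞).toReal⁻¹) h2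
      (Or.inr (rpow_ne_top_of_nonneg (by positivity) (measure_ne_top _ _)))
    rw [mul_zero] at h3
    exact h3.mono_left (inf_le_left.trans nhdsWithin_le_nhds)
  refine tendsto_of_tendsto_of_tendsto_of_le_of_le' tendsto_const_nhds h1 (of_forall fun _ => zero_le) ?_
  filter_upwards [eventually_of_ae_Ioo S.τ_mem.1 (ae_mem_Ioo)] with t ht
  exact eLpNorm_le_of_ae_bound (S.xi_lip 0 zero_mem t (Ioo_subset_Icc_self ht))

lemma aesm_xi₀ : AESM (S.ξ 0) (vol S.Ω) := by
  obtain ⟨t, h1, h2, h3, -⟩ := exists_seq_tendsto_zero S.τ_mem.1 (eventually_of_ae_Ioo S.τ_mem.1 S.ae_slice) (tendsto_const_nhds (x := (0 : ℝ)))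
  refine aestronglyMeasurable_of_tendsto_ae atTop (fun n => (h1 n).xi.1.continuous.aesm) ?_
  filter_upwards [ae_all_iff.2 fun n => S.xi_lip 0 zero_mem (t n) (Ioo_subset_Icc_self (h2 n))] with x hx
  rw [tendsto_iff_norm_sub_tendsto_zero]
  refine squeeze_zero (fun _ => norm_nonneg _) hx ?_
  simpa using (h3.abs.const_mul (S.C : ℝ))

lemma xi₀_le : ∀ᵐ x ∂vol S.Ω, ‖S.ξ 0 x‖ ≤ S.C + S.C * S.τ := by
  obtain ⟨t, h1, h2, -, -⟩ := exists_seq_tendsto_zero S.τ_mem.1 (eventually_of_ae_Ioo S.τ_mem.1 S.ae_slice) (tendsto_const_nhds (x := (0 : ℝ)))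
  filter_upwards [S.xi_lip (t 0) (Ioo_subset_Icc_self (h2 0)) 0 zero_mem] with x hx
  rw [zero_sub, abs_neg, abs_of_pos (h2 0).1] at hx
  have h3 := norm_add_le (S.ξ (t 0) x) (S.ξ 0 x - S.ξ (t 0) x)
  rw [add_sub_cancel] at h3
  exact h3.trans (add_le_add ((h1 0).xi.2.2.2.1 x).1 (hx.trans (mul_le_left (h2 0).2.le S.C.2)))

lemma memLp_xi₀ : ML2 (S.ξ 0) S.Ω := by
  exact MemLp.of_bound aesm_xi₀ _ xi₀_le

lemma ae_xi : ∀ᵐ t ∂vI S.τ, ∀ᵐ x ∂vol S.Ω, S.ξ t x = S.ξ 0 x + ∫ r in 0..t, S.ξt r x :=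
  ae_primitive S.reg.xi_time (gr_xi.up S) (gr_xit.up S) aesm_xi₀ tendsto_xi

lemma Slice.xi_memLp {t : ℝ} (h : S.Slice t) : ML2 (S.ξ t) S.Ω := by
  exact MemLp.of_bound h.xi.1.continuous.aesm _ (of_forall fun x => (h.xi.2.2.2.1 x).1)

lemma Slice.xi_lipschitz {t : ℝ} (h : S.Slice t) : LipschitzWith S.C (S.ξ t) :=
  lipschitzWith_of_nnnorm_fderiv_le (h.xi.1.differentiable one_ne_zero) fun x => (h.xi.2.2.2.1 x).2

lemma Slice.divg_xi_le {t : ℝ} (h : S.Slice t) (x : Vec d) : ‖divg (S.ξ t) x‖ ≤ ‖trCLM d‖ * S.C := by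
  rw [divg, ← trCLM_apply]
  exact ((trCLM d).le_opNorm _).trans (mul_le_left (h.xi.2.2.2.1 x).2 (norm_nonneg _))

lemma Slice.divg_xi_memLp {t : ℝ} (h : S.Slice t) : ML2 (divg (S.ξ t)) S.Ω := by
  exact MemLp.of_bound h.divg_xi_lipschitz.continuous.aesm _ (of_forall h.divg_xi_le)

lemma memLp_of_range {f : ℝ → ℝ} (hf : Continuous f) {φ : R[d]} (hφ : AESM φ (vol S.Ω))
    (h : ∀ᵐ x ∂vol S.Ω, φ x ∈ Icc (-1 : ℝ) 1) : ML2 (fun x => f (φ x)) S.Ω := by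
  obtain ⟨c, hc⟩ := hf.bdd_Icc
  exact MemLp.of_bound (hf.comp_aesm hφ) c (h.mono fun x hx => hc _ hx)

lemma Slice.Dpsi_memLp {t : ℝ} (h : S.Slice t) : ML2 (S.Dψ t) S.Ω := by
  obtain ⟨c, hc⟩ := S.well.continuous_sqrt.bdd_Icc
  have hm := h.phase.bdry.memLp.1.add_const (-1 : ℝ)
  simp only [sub_add_cancel] at hm
  exact (h.phase.grad.bdd_smul (S.well.continuous_sqrt.comp_aesm hm)
    (h.phase.range.mono fun x hx => hc _ hx)).ae_eq (h.psi.mono fun x hx => hx.symm)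

lemma Slice.integral_xi_sub {t : ℝ} (h : S.Slice t) {f g : R[d]} {D D' : V[d]} (hf : HasWeakGrad S.Ω f D)
    (hg : HasWeakGrad S.Ω g D') (mf : ML2 f S.Ω) (mg : ML2 g S.Ω)
    (mD : ML2 D S.Ω) (mD' : ML2 D' S.Ω) {a b : ℝ} (ha : 0 ≤ a) (hab : a < b) (hb : b < S.τ)
    (ef : ∀ᵐ x ∂vol S.Ω, f x = _root_.psi S.W (S.φ₀ x) + ∫ r in 0..b, √(2 * S.W (S.φ r x)) * S.φt r x)
    (eg : ∀ᵐ x ∂vol S.Ω, g x = _root_.psi S.W (S.φ₀ x) + ∫ r in 0..a, √(2 * S.W (S.φ r x)) * S.φt r x) :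
    (∫ x in S.Ω, ⟪S.ξ t x, D x⟫) - ∫ x in S.Ω, ⟪S.ξ t x, D' x⟫ =
      ∫ r in a..b, ∫ x in S.Ω, (-mulL) (√(2 * S.W (S.φ r x)) * S.φt r x) (divg (S.ξ t) x) := by
  have ibp : ∀ {f : R[d]} {D : V[d]}, HasWeakGrad S.Ω f D → ML2 f S.Ω →
      ML2 D S.Ω → ∫ x in S.Ω, ⟪S.ξ t x, D x⟫ = ∫ x in S.Ω, (-mulL) (f x) (divg (S.ξ t) x) :=
    fun {f D} hf mf mD => by
      have e := hf.integral_inner_lipschitz S.dm (mf.integrable one_le_two) (mD.integrable one_le_two)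
        h.xi_lipschitz fun x hx => (h.xi_eq_zero hx).1
      have i1 : IntegrableOn (fun x => ⟪D x, S.ξ t x⟫) S.Ω := integrable_bilin (innerSL ℝ) mD h.xi_memLp
      have i2 : IntegrableOn (fun x => f x * divg (S.ξ t) x) S.Ω := integrable_bilin (mulL) mf h.divg_xi_memLp
      rw [integral_add i1 i2] at e
      simp only [neg_apply, mul_apply', integral_neg, real_inner_comm (D _)]
      linarith
  rw [ibp hf mf mD, ibp hg mg mD']
  exact integral_sub_eq_of_primitive _ (gr_psit.memLp S.memLp_maj) h.divg_xi_memLp ha hab.le hb mf mg ef eg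

lemma ae_inner_xi_Dpsi : ∀ᵐ s ∂vI S.τ, ∫ x in S.Ω, ⟪S.ξ s x, S.Dψ s x⟫ = (∫ x in S.Ω, ⟪S.ξ 0 x, S.Dψ₀ x⟫) +
    ∫ t in 0..s, ((∫ x in S.Ω, (-mulL) (√(2 * S.W (S.φ t x)) * S.φt t x) (divg (S.ξ t) x))
      + ∫ x in S.Ω, ⟪S.ξt t x, S.Dψ t x⟫) := by
  have := S.finite_spaceTime S.τ
  have mψ : ∀ {t}, S.Slice t → ML2 (fun x => psi S.W (S.φ t x)) S.Ω := fun h => by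
    have hm := h.phase.bdry.memLp.1.add_const (-1 : ℝ)
    simp only [sub_add_cancel] at hm
    exact memLp_of_range S.well.continuous_psi hm h.phase.range
  have mψ₀ := memLp_of_range S.well.continuous_psi S.weak.init_phase.memLp.1 S.weak.init_range
  have gξ := gr_xi.up S (l := 1)
  have gξt := gr_xit.up S (l := 1)
  have mξt := gξt.memLp S.memLp_maj
  have hP := S.ae_slice.and (ae_xi.and (ae_psi_time.and (ae_Ioo_mono S.τ_le S.psi_grad)))
  refine sub_eq_integral_pairing S.dm.m S.τ_mem.1 (-mulL) (innerSL ℝ)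
    (p := 2) (q := 2) (by norm_num) (a := fun t x => √(2 * S.W (S.φ t x)) * S.φt t x) (b := fun t x => divg (S.ξ t) x)
    (gr_psit.memLp S.memLp_maj) ((gr_divg.up S).memLp S.memLp_maj) mξt (gr_Dpsi.memLp S.memLp_maj)
    (integrableOn_slice (gξ.inner gr_Dpsi)) hP (fun t s ht hs h0 hts hsτ => ?_)
    (tendsto_of_eq_iterated (H := fun r x => ‖√(2 * S.W (S.φ r x)) * S.φt r x‖ * (‖trCLM d‖ * S.C) + ‖S.ξt r x‖ * ‖S.Dψ₀ x‖)
      (((gr_psit.norm.mul (GrowthLE.const (‖trCLM d‖ * S.C))).up S).add (gξt.norm.mul gr_Dpsi₀.norm)) ?_)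
  · have ha : t ∈ Icc 0 S.τ := ⟨h0.le, (hts.trans hsτ).le⟩
    have hb : s ∈ Icc 0 S.τ := ⟨(h0.trans hts).le, hsτ.le⟩
    have m1 := ht.1.integral_xi_sub hs.2.2.2 ht.2.2.2 (mψ hs.1) (mψ ht.1) hs.1.Dpsi_memLp ht.1.Dpsi_memLp h0.le hts hsτ hs.2.2.1 ht.2.2.1
    have m2 := integral_sub_eq_of_primitive (innerSL ℝ) mξt hs.1.Dpsi_memLp h0.le hts.le hsτ hs.1.xi_memLp ht.1.xi_memLp hs.2.1 ht.2.1
    have j1 := intervalIntegrable_pair ht.1.divg_xi_memLp ha hb (gr_psit.memLp S.memLp_maj) (-mulL)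
    have j2 := intervalIntegrable_pair hs.1.Dpsi_memLp ha hb mξt (innerSL ℝ)
    refine Eq.trans ?_ (intervalIntegral.integral_add j1 j2).symm
    rw [← m1, ← m2]
    change _ = _ + ((∫ x in S.Ω, ⟪S.ξ s x, S.Dψ s x⟫) - ∫ x in S.Ω, ⟪S.ξ t x, S.Dψ s x⟫)
    ring
  · filter_upwards [hP, ae_mem_Ioo] with t ht htI
    have gd : S.Gr 0 fun _ x => divg (S.ξ t) x := gr_of_bound
      (ht.1.divg_xi_lipschitz.continuous.comp continuous_snd).aesm (of_forall fun _ x _ => ht.1.divg_xi_le x)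
    have g1 := (gr_psit.bilin (-mulL) gd).up S (l := 2)
    have g2 := gξt.inner (gr_Dpsi₀ (S := S))
    refine ⟨_, g1.add g2, fun r x _ => norm_add_le_of_le ?_ (norm_inner_le_norm _ _), ?_⟩
    · rw [neg_apply, neg_apply, norm_neg, mul_apply', norm_mul]
      exact mul_le_left (ht.1.divg_xi_le x) (norm_nonneg _)
    · have m1 := ht.1.integral_xi_sub ht.2.2.2 S.psi₀ (mψ ht.1) mψ₀ ht.1.Dpsi_memLp S.memLp_Dpsi₀ le_rfl htI.1 htI.2 ht.2.2.1
        (of_forall fun x => by simp)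
      have m2 := integral_sub_eq_of_primitive (innerSL ℝ) mξt S.memLp_Dpsi₀ le_rfl htI.1.le htI.2 ht.1.xi_memLp memLp_xi₀ ht.2.1
        (of_forall fun x => by simp)
      change (∫ x in S.Ω, ⟪S.ξ t x, S.Dψ₀ x⟫) - ∫ x in S.Ω, ⟪S.ξ 0 x, S.Dψ₀ x⟫ = ∫ r in 0..t, ∫ x in S.Ω, ⟪S.ξt r x, S.Dψ₀ x⟫ at m2
      rw [← iterated_add g1 g2 htI, ← m1, ← m2]
      ring

end SolutionPair

namespace SolutionPair

variable {S : SolutionPair d}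

lemma ae_memLp_slice {E : Type*} [NormedAddCommGroup E] {f : ℝ → Vec d → E} (h : S.Gr 1 f) :
    ∀ᵐ t ∂vI S.τ, ML2 (f t) S.Ω := by
  have hf := h.memLp S.memLp_maj
  filter_upwards [(hf.integrable_norm_pow two_ne_zero).prod_right_ae, hf.1.prodMk_left] with t b1 b2
  exact (memLp_two_iff_integrable_sq_norm b2).2 b1

noncomputable def residual (S : SolutionPair d) (t : ℝ) (x : Vec d) : L[d, ℝ] :=
  innerSL ℝ (S.vt t x + ∇ (S.v t) x (S.v t x)) - (surfaceTension S.W * S.χ t x) • ∇ (divg (S.ξ t)) x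

lemma gr_residual : S.Gr 1 S.residual :=
  ((gr_vt.add ((gr_Dv.apply gr_v).up S)).clm (innerSL ℝ)).sub
    ((((GrowthLE.const (surfaceTension S.W)).mul gr_chi).smul gr_Ddivg).up S)

lemma ae_surface {μ : ℝ → Measure (Vec d)} {ν : ℝ → V[d]} (h : ∀ t ∈ Ioo 0 S.Tstar, IsPolarGradient S.Ω (S.χ t) (μ t) (ν t)) :
    ∀ᵐ t ∂vI S.τ, ∀ η, IsSolTest S.Ω η →
      ∫ x, ⟪ν t x, ∇ η x (ν t x)⟫ ∂(μ t) = ∫ x in S.Ω, S.χ t x * ∇ (divg (S.ξ t)) x (η x) := by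
  obtain ⟨Ψ, Ψt, hΨ, hΨχ, -⟩ := S.strong.evolution
  filter_upwards [S.ae_slice, ae_Ioo_mono S.τ_mem.2.le S.cons, ae_mem_Ioo] with t ht hcons htI η hη
  have htI' : t ∈ Ioo 0 S.Tstar := ⟨htI.1, htI.2.trans S.τ_mem.2⟩
  have hcl := S.strong.phase_closure t htI'
  have hU : HasCkBoundary 2 (plusPhase S.Ω (S.χ t)) := by
    rw [hΨχ t htI'] at hcl ⊢
    exact hΨ.hasCkBoundary S.dom.isOpen ⟨htI'.1.le, htI'.2⟩ S.strong.init_open S.strong.init_closure S.strong.init_boundary hcl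
  have hχ : ∀ x ∈ S.Ω, S.χ t x = (plusPhase S.Ω (S.χ t)).indicator 1 x := fun x hx => by
    rcases S.strong.phase_range t htI' x hx with h | h
    · rw [h, indicator_of_notMem]; rintro ⟨-, h'⟩; rw [h] at h'; exact zero_ne_one h'
    · rw [h, indicator_of_mem (show x ∈ plusPhase S.Ω (S.χ t) from ⟨hx, h⟩), Pi.one_apply]
  have hp := h t htI'
  refine hp.integral_normal_fderiv S.dm
    (hp.ae_eq_normal S.dm hχ hcl hU fun x hx ρ hρ => (hcons x hx ρ hρ).1) ?_ ht.xi.1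
    (fun x => (ht.xi.2.2.2.1 x).2) ht.xi.2.2.2.2 hη
  filter_upwards [hp.ae_mem_frontier S.dm hχ] with x hx a
  obtain ⟨ρ, hρ⟩ := hU x hx
  exact inner_fderiv_eq_zero_of_consistent ht.xi.1 hcons hx hρ a

lemma gr_strong_test {w : V[d]} (hw : IsSolTest S.Ω w) :
    S.Gr 2 fun t x => S.residual t x (w x) + frobCLM d (∇ (S.v t) x) (∇ w x) := by
  obtain ⟨K, hK⟩ := hw.1.exists_lipschitz
  obtain ⟨M, hM⟩ := hw.1.compact.exists_bound_of_continuous hw.1.cont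
  exact ((gr_residual.apply (gr_bdd hK.continuous hM)).up S).add
    ((gr_Dv.bilin (frobCLM d) (gr_lip hK)).up S)

/-- The momentum equation of the strong solution at almost every time. -/
lemma ae_strong_test {w : V[d]} (hw : IsSolTest S.Ω w) : ∀ᵐ t ∂vI S.τ,
    ∫ x in S.Ω, (S.residual t x (w x) + frobCLM d (∇ (S.v t) x) (∇ w x)) = 0 := by
  obtain ⟨μ, ν, hp, hm⟩ := S.strong.momentum
  obtain ⟨η, hη, h1, h2⟩ := hw.exists_isSolenoidalTest S.τ_mem.1 S.τ_mem.2
  obtain ⟨K, hK⟩ := hw.1.exists_lipschitz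
  obtain ⟨M, hM⟩ := hw.1.compact.exists_bound_of_continuous hw.1.cont
  have gw := gr_bdd (S := S) hK.continuous hM
  have mw : ML2 w S.Ω := hw.1.memLp
  have hg := integrableOn_slice (gr_strong_test hw)
  have key : ∀ᵐ T ∂vI S.τ, ∫ t in 0..T, ∫ x in S.Ω,
      (S.residual t x (w x) + frobCLM d (∇ (S.v t) x) (∇ w x)) = 0 := by
    filter_upwards [ae_Ioo_mono S.τ_mem.2.le hm, S.ae_slice, ae_v, ae_mem_Ioo] with T h hs hv hT
    have hsub : uIcc 0 T ⊆ Icc 0 S.τ := by rw [uIcc_of_le hT.1.le]; exact Icc_subset_Icc_right hT.2.le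
    have c : ∀ {f g : ℝ → ℝ}, (∀ t ∈ Icc 0 S.τ, f t = g t) → ∫ t in 0..T, f t = ∫ t in 0..T, g t :=
      fun hfg => integral_congr fun t ht => hfg t (hsub ht)
    have h := h η hη
    have e4 : ∫ t in 0..T, ∫ x, ⟪ν t x, ∇ (η t) x (ν t x)⟫ ∂(μ t) =
        ∫ t in 0..T, ∫ x in S.Ω, S.χ t x * ∇ (divg (S.ξ t)) x (w x) := by
      refine intervalIntegral.integral_congr_ae ?_
      have := ae_surface hp
      rw [ae_restrict_iff' measurableSet_Ioo] at this
      filter_upwards [this] with t ht htI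
      rw [uIoc_of_le hT.1.le] at htI
      have htI' : t ∈ Ioo 0 S.τ := ⟨htI.1, htI.2.trans_lt hT.2⟩
      rw [h1 t (Ioo_subset_Icc_self htI'), ht htI' w hw]
    rw [h1 T ⟨hT.1.le, hT.2.le⟩, h1 0 zero_mem, e4,
      c (f := fun t => ∫ x in S.Ω, ⟪S.v t x, deriv (fun s => η s x) t⟫) (g := fun _ => 0) fun t ht => by simp [h2 t ht],
      c (f := fun t => ∫ x in S.Ω, ⟪η t x, ∇ (S.v t) x (S.v t x)⟫)
        (g := fun t => ∫ x in S.Ω, ⟪w x, ∇ (S.v t) x (S.v t x)⟫) fun t ht => by rw [h1 t ht],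
      c (f := fun t => ∫ x in S.Ω, frob (∇ (S.v t) x) (∇ (η t) x))
        (g := fun t => ∫ x in S.Ω, frob (∇ (S.v t) x) (∇ w x)) fun t ht => by rw [h1 t ht],
      intervalIntegral.integral_zero] at h
    have m := integral_sub_eq_of_primitive (innerSL ℝ) S.vt_memLp' mw le_rfl hT.1.le hT.2 hs.v_memLp S.memLp_v₀ hv
      (of_forall fun x => by simp)
    change (∫ x in S.Ω, ⟪S.v T x, w x⟫) - ∫ x in S.Ω, ⟪S.v₀ x, w x⟫ = ∫ t in 0..T, ∫ x in S.Ω, ⟪S.vt t x, w x⟫ at m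
    have g1 : S.Gr 2 fun t x => ⟪S.vt t x, w x⟫ := (gr_vt.inner gw).up S
    have g2 : S.Gr 2 fun t x => ⟪w x, ∇ (S.v t) x (S.v t x)⟫ := (gw.inner (gr_Dv.apply gr_v)).up S
    have g3 : S.Gr 2 fun t x => frob (∇ (S.v t) x) (∇ w x) := (gr_frob gr_Dv (gr_lip hK)).up S
    have g4 : S.Gr 2 fun t x => surfaceTension S.W * (S.χ t x * ∇ (divg (S.ξ t)) x (w x)) :=
      ((GrowthLE.const _).mul (gr_chi.mul (gr_Ddivg.apply gw))).up S
    have h5 := iterated_sub ((g1.add g2).add g3) g4 hT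
    rw [← iterated_add (g1.add g2) g3 hT, ← iterated_add g1 g2 hT, ← m, h] at h5
    simp only [integral_const_mul, intervalIntegral.integral_const_mul] at h5
    refine Eq.trans (c fun t _ => integral_congr_ae (of_forall fun x => ?_)) (h5.symm.trans (by ring))
    simp only [residual, sub_apply, smul_apply, innerSL_apply_apply, inner_add_right, frobCLM_apply, smul_eq_mul, real_inner_comm (w x)]
    ring
  have hcont := continuousOn_primitive_interval' (intervalIntegrable_of_Ioo S.τ_mem.1.le hg) left_mem_uIcc
  rw [uIcc_of_le S.τ_mem.1.le] at hcont
  have hz : EqOn (fun T => ∫ t in 0..T, ∫ x in S.Ω, (S.residual t x (w x) + frobCLM d (∇ (S.v t) x) (∇ w x)))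
      (fun _ => 0) (Ioo 0 S.τ) :=
    Measure.eqOn_open_of_ae_eq key isOpen_Ioo (hcont.mono Ioo_subset_Icc_self) continuousOn_const
  filter_upwards [ae_deriv_primitive S.τ_mem.1.le hg, ae_mem_Ioo] with t ht htI
  refine ht.unique ((hasDerivAt_const t (0 : ℝ)).congr_of_eventuallyEq ?_)
  filter_upwards [isOpen_Ioo.mem_nhds htI] with s hs using hz hs

lemma ae_strong : ∀ᵐ t ∂vI S.τ, ∀ w Dw, MemH10 S.Ω w Dw → WeaklyDivFree S.Ω w →
    ∫ x in S.Ω, (S.residual t x (w x) + frobCLM d (∇ (S.v t) x) (Dw x)) = 0 := by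
  obtain ⟨W, hW, hd⟩ := exists_seq_isSolTest_dense S.Ω
  have gDv := gr_Dv.up S (l := 1)
  filter_upwards [ae_all_iff.2 fun k => ae_strong_test (hW k), ae_memLp_slice gr_residual, ae_memLp_slice gDv] with t ht m1 m2
  have z : ∀ {E : Type} [NormedAddCommGroup E] (a : Vec d → E), Null (fun _ : ℕ => eL2 (a - a) S.Ω) := fun a => by simp
  have lim : ∀ {f : ℕ → V[d]} {F : ℕ → Vec d → M[d]} {w Dw}, (∀ n, ML2 (f n) S.Ω) →
      (∀ n, ML2 (F n) S.Ω) → ML2 w S.Ω → ML2 Dw S.Ω →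
      Null (fun n => eL2 (f n - w) S.Ω) →
      Null (fun n => eL2 (F n - Dw) S.Ω) →
      (∀ n, ∫ x in S.Ω, (S.residual t x (f n x) + frobCLM d (∇ (S.v t) x) (F n x)) = 0) →
      ∫ x in S.Ω, (S.residual t x (w x) + frobCLM d (∇ (S.v t) x) (Dw x)) = 0 := fun {f F w Dw} a1 a2 a3 a4 t1 t2 h => by
    have l1 := tendsto_integral_bilin (idL (L[d, ℝ])) (fun _ : ℕ => m1) m1 a1 a3 (z _) t1
    have l2 := tendsto_integral_bilin (frobCLM d) (fun _ : ℕ => m2) m2 a2 a4 (z _) t2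
    have i1 := fun {g : V[d]} (hg : ML2 g S.Ω) => integrable_bilin (idL (L[d, ℝ])) m1 hg
    have i2 := fun {g : Vec d → M[d]} (hg : ML2 g S.Ω) => integrable_bilin (frobCLM d) m2 hg
    refine (integral_add (i1 a3) (i2 a4)).trans (tendsto_nhds_unique (l1.add l2) (tendsto_const_nhds.congr fun n => ?_))
    exact (h n).symm.trans (integral_add (i1 (a1 n)) (i2 (a2 n)))
  have mt : ∀ {η}, IsSolTest S.Ω η → ML2 η S.Ω ∧ ML2 (∇ η) S.Ω := fun h =>
    ⟨h.1.memLp, h.1.memLp_fderiv⟩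
  intro w Dw hw hdiv
  obtain ⟨η, hη, t1, t2⟩ := hw.exists_isSolTest_tendsto S.dom hdiv
  refine lim (fun n => (mt (hη n)).1) (fun n => (mt (hη n)).2) hw.memLp hw.memLp_deriv t1 t2 fun n => ?_
  obtain ⟨k, s1, s2⟩ := hd _ (hη n)
  exact lim (fun n => (mt (hW (k n))).1) (fun n => (mt (hW (k n))).2) (mt (hη n)).1 (mt (hη n)).2 s1 s2 fun n => ht (k n)

end SolutionPair

namespace SolutionPair

variable {S : SolutionPair d}

noncomputable abbrev H (S : SolutionPair d) : ℝ → R[d] := diffuseCurvature S.W S.ε S.φ S.D2φ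

lemma gr_H : S.Gr 1 S.H :=
  ((GrowthLE.const (-S.ε)).mul (gr_tr gr_D2phi)).add (((GrowthLE.const (1 / S.ε)).mul
    (gr_comp (S.well.contDiff.continuous_deriv one_le_two))).up S)

lemma gr_P : S.Gr 0 fun t x => √(2 * S.W (S.φ t x)) := gr_comp S.well.continuous_sqrt

noncomputable def rate (S : SolutionPair d) (t : ℝ) (x : Vec d) : ℝ :=
  -(frob (S.Du t x) (S.Du t x) + 1 / S.ε * S.H t x ^ 2) + ⟪S.vt t x, S.v t x⟫ - (S.stress t x (∇ (S.v t) x) + ⟪S.vt t x, S.u t x⟫)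
    - (-(√(2 * S.W (S.φ t x)) * S.φt t x * divg (S.ξ t) x) + ⟪S.ξt t x, S.Dψ t x⟫)

lemma gr_dissipation : S.Gr 2 fun t x => frob (S.Du t x) (S.Du t x) + 1 / S.ε * S.H t x ^ 2 :=
  (gr_frob gr_Du gr_Du).add ((GrowthLE.const (1 / S.ε)).mul gr_H.sq)

lemma gr_vt_v : S.Gr 2 fun t x => ⟪S.vt t x, S.v t x⟫ := (gr_vt.inner gr_v).up S

lemma gr_coupling : S.Gr 2 fun t x => S.stress t x (∇ (S.v t) x) + ⟪S.vt t x, S.u t x⟫ := (gr_stress.apply gr_Dv).add (gr_vt.inner gr_u)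

lemma gr_calibration : S.Gr 2 fun t x => -(√(2 * S.W (S.φ t x)) * S.φt t x * divg (S.ξ t) x) + ⟪S.ξt t x, S.Dψ t x⟫ :=
  ((gr_psit.mul gr_divg).neg.up S).add ((gr_xit.inner gr_Dpsi).up S)

lemma gr_rate : S.Gr 2 S.rate := ((gr_dissipation.neg.add gr_vt_v).sub gr_coupling).sub gr_calibration

lemma iterated_add' {f g : ℝ → R[d]} (h : S.Gr 2 f) (h' : S.Gr 2 g) {T : ℝ} (hT : T ∈ Ioo 0 S.τ) :
    ∫ t in 0..T, ((∫ x in S.Ω, f t x) + ∫ x in S.Ω, g t x) = ∫ t in 0..T, ∫ x in S.Ω, (f t x + g t x) := by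
  rw [intervalIntegral.integral_add (slice_intervalIntegrable h zero_mem (Ioo_subset_Icc_self hT))
    (slice_intervalIntegrable h' zero_mem (Ioo_subset_Icc_self hT)), iterated_add h h' hT]

lemma relEnergy_eq {φ : R[d]} {Dφ Dψ u v ξ : V[d]} (mφ : AESM φ (vol S.Ω))
    (hr : ∀ᵐ x ∂vol S.Ω, φ x ∈ Icc (-1 : ℝ) 1) (mD : ML2 Dφ S.Ω)
    (mψ : ML2 Dψ S.Ω) (mu : ML2 u S.Ω) (mv : ML2 v S.Ω)
    (mξ : ML2 ξ S.Ω) : IntegrableOn (relEnergyDensity S.W S.ε φ Dφ Dψ u v ξ) S.Ω ∧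
      relEnergy S.Ω S.W S.ε φ Dφ Dψ u v ξ = totalEnergy S.Ω S.W S.ε φ Dφ u + 1 / 2 * (∫ x in S.Ω, ⟪v x, v x⟫)
        - (∫ x in S.Ω, ⟪u x, v x⟫) - ∫ x in S.Ω, ⟪ξ x, Dψ x⟫ := by
  have sq : ∀ {f : V[d]}, ML2 f S.Ω → IntegrableOn (fun x => ‖f x‖ ^ 2) S.Ω := fun h => h.integrable_norm_pow two_ne_zero
  have i1 : IntegrableOn (fun x => 1 / 2 * ‖u x‖ ^ 2) S.Ω := (sq mu).const_mul _
  have i2 : IntegrableOn (fun x => S.ε / 2 * ‖Dφ x‖ ^ 2 + 1 / S.ε * S.W (φ x)) S.Ω := ((sq mD).const_mul _).add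
    (((memLp_of_range S.well.contDiff.continuous mφ hr).integrable one_le_two).const_mul _)
  have i3 : IntegrableOn (fun x => 1 / 2 * ⟪v x, v x⟫) S.Ω := (integrable_bilin (innerSL ℝ) mv mv).const_mul (1 / 2)
  have i4 : IntegrableOn (fun x => ⟪u x, v x⟫) S.Ω := integrable_bilin (innerSL ℝ) mu mv
  have i5 : IntegrableOn (fun x => ⟪ξ x, Dψ x⟫) S.Ω := integrable_bilin (innerSL ℝ) mξ mψ
  have e : ∀ x, relEnergyDensity S.W S.ε φ Dφ Dψ u v ξ x = 1 / 2 * ‖u x‖ ^ 2 + (S.ε / 2 * ‖Dφ x‖ ^ 2 + 1 / S.ε * S.W (φ x))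
      + 1 / 2 * ⟪v x, v x⟫ - ⟪u x, v x⟫ - ⟪ξ x, Dψ x⟫ := fun x => by
    rw [relEnergyDensity, norm_sub_sq_real, real_inner_self_eq_norm_sq]; ring
  refine ⟨((((i1.add i2).add i3).sub i4).sub i5).congr (of_forall fun x => (e x).symm), ?_⟩
  rw [relEnergy, integral_congr_ae (of_forall e), totalEnergy, ← integral_add i1 i2, ← integral_const_mul]
  refine (integral_sub (((i1.add i2).add i3).sub i4) i5).trans (congrArg (· - _) ?_)
  refine (integral_sub ((i1.add i2).add i3) i4).trans (congrArg (· - _) ?_)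
  exact integral_add (i1.add i2) i3

lemma integrableOn_init : IntegrableOn (relEnergyDensity S.W S.ε S.φ₀ S.Dφ₀ S.Dψ₀ S.u₀ S.v₀ (S.ξ 0)) S.Ω :=
  (relEnergy_eq S.weak.init_phase.memLp.1 S.weak.init_range S.memLp_Dphi₀ S.memLp_Dpsi₀ S.memLp_u₀ S.memLp_v₀ memLp_xi₀).1

lemma Slice.allenCahn' {t : ℝ} (h : S.Slice t) :
    ∀ᵐ x ∂vol S.Ω, S.H t x = -S.ε * (S.φt t x + ⟪S.u t x, S.Dφ t x⟫) := by
  filter_upwards [h.allenCahn] with x hx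
  have := S.pos.ne'
  rw [hx, H, diffuseCurvature]
  field_simp
  ring

lemma ae_relEnergy_le : ∀ᵐ T ∂vI S.τ,
    IntegrableOn (relEnergyDensity S.W S.ε (S.φ T) (S.Dφ T) (S.Dψ T) (S.u T) (S.v T) (S.ξ T)) S.Ω ∧
    relEnergy S.Ω S.W S.ε (S.φ T) (S.Dφ T) (S.Dψ T) (S.u T) (S.v T) (S.ξ T)
      ≤ relEnergy S.Ω S.W S.ε S.φ₀ S.Dφ₀ S.Dψ₀ S.u₀ S.v₀ (S.ξ 0) + ∫ t in 0..T, ∫ x in S.Ω, S.rate t x := by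
  filter_upwards [S.ae_slice, ae_Ioo_mono S.τ_le S.weak.energy, ae_inner_u_v, ae_inner_v_v, ae_inner_xi_Dpsi, ae_mem_Ioo]
    with T h he h1 h2 h3 hT
  have hm := h.phase.bdry.memLp.1.add_const (-1 : ℝ)
  simp only [sub_add_cancel] at hm
  obtain ⟨a1, a2⟩ := relEnergy_eq hm h.phase.range h.phase.grad h.Dpsi_memLp h.u_memLp h.v_memLp h.xi_memLp
  refine ⟨a1, ?_⟩
  rw [a2, (relEnergy_eq S.weak.init_phase.memLp.1 S.weak.init_range S.memLp_Dphi₀ S.memLp_Dpsi₀ S.memLp_u₀ S.memLp_v₀ memLp_xi₀).2]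
  have e : ∫ t in 0..T, ∫ x in S.Ω, (frob (S.Du t x) (S.Du t x) + S.ε * (S.φt t x + ⟪S.u t x, S.Dφ t x⟫) ^ 2) =
      ∫ t in 0..T, ∫ x in S.Ω, (frob (S.Du t x) (S.Du t x) + 1 / S.ε * S.H t x ^ 2) := by
    refine intervalIntegral.integral_congr_ae ?_
    filter_upwards [(ae_restrict_iff' measurableSet_Ioo).1 S.ae_slice] with t ht htI
    rw [uIoc_of_le hT.1.le] at htI
    refine integral_congr_ae ((ht ⟨htI.1, htI.2.trans_lt hT.2⟩).allenCahn'.mono fun x hx => ?_)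
    simp only [hx]
    have := S.pos.ne'
    field_simp
  rw [e] at he
  have g1 := gr_stress.apply (gr_Dv (S := S))
  have g2 := gr_vt.inner (gr_u (S := S))
  have g3 := ((gr_psit.mul (gr_divg (S := S))).neg.up S (l := 2))
  have g4 := (gr_xit.inner (gr_Dpsi (S := S))).up S (l := 2)
  rw [iterated_add' g1 g2 hT] at h1
  rw [iterated_add' gr_vt_v gr_vt_v hT, ← iterated_add gr_vt_v gr_vt_v hT] at h2
  simp only [neg_apply, mul_apply'] at h3
  rw [iterated_add' g3 g4 hT] at h3
  have r1 := iterated_sub ((gr_dissipation.neg.add gr_vt_v).sub gr_coupling) (gr_calibration (S := S)) hT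
  rw [← iterated_sub (gr_dissipation.neg.add gr_vt_v) gr_coupling hT, ← iterated_add gr_dissipation.neg gr_vt_v hT] at r1
  simp only [integral_neg, intervalIntegral.integral_neg] at r1
  change _ = ∫ t in 0..T, ∫ x in S.Ω, S.rate t x at r1
  rw [← r1, h1, h2, h3]
  linarith

end SolutionPair

/-! ### The relative energy at a fixed time -/

lemma frob_comm (A A' : M[d]) : frob A A' = frob A' A :=
  sum_congr rfl fun _ _ => real_inner_comm _ _

lemma relEnergy_algebra {ε : ℝ} (hε : 0 < ε) {g P w H φt D K₁ K₂ c χ ψ b : ℝ} {n p q u v vt ξ ξt B : Vec d}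
    {U A X Y : M[d]} (hw : P ^ 2 = 2 * w) (hg : 0 ≤ g) (hP : 0 ≤ P) (hn : ‖n‖ = 1) (hp : p = g • n) (hq : q = P • p)
    (hH : H = -ε * (φt + ⟪u, p⟫)) (hA : tr A = 0) (hb : b = ⟪B - v, ξ⟫) :
    -(frob U U + 1 / ε * H ^ 2) + ⟪vt, v⟫ - (⟪u, A u⟫ - frob U A + ε * ⟪p, A p⟫ + ⟪vt, u⟫) - (-(P * φt * D) + ⟪ξt, q⟫)
      + ((D * ⟪q, u⟫ + ψ * K₁) - (D * ⟪q, v⟫ + ψ * K₂)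
      - (H * ⟪p, v⟫ - ε * ⟪p, A p⟫ + tr A * (ε / 2 * ‖p‖ ^ 2 + 1 / ε * w))
      + (H * ⟪p, B⟫ - ε * ⟪p, Y p⟫ + tr Y * (ε / 2 * ‖p‖ ^ 2 + 1 / ε * w))
      + ⟪q, D • B + Y ξ - tr Y • ξ - X B⟫ + ⟪v, A u⟫
      + ((⟪vt + A v, u⟫ - c * χ * K₁ + frob A U) - (⟪vt + A v, v⟫ - c * χ * K₂ + frob A A))) ≤
    (-frob (U - A) (U - A)) + (-(1 / (2 * ε) * (H + P * D) ^ 2) + (-(1 / (2 * ε) * (H - b * (ε * ‖p‖)) ^ 2)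
      + (-⟪u - v, A (u - v)⟫ + (-((c * χ - ψ) * (K₁ - K₂)) + ((b + D) ^ 2 * (ε * ‖p‖ ^ 2)
      + (D ^ 2 * (P / √ε - √ε * ‖p‖) ^ 2 + (-(1 / √ε * (H + P * D) * ⟪v - B, n - ξ⟫ * (√ε * ‖p‖))
      + (-(⟪ξt + X B + ContinuousLinearMap.adjoint Y ξ, n - ξ⟫ * ‖q‖) + (-(⟪ξ, ξt + X B⟫ * ‖q‖)
      + (-(⟪ξ - n, Y (ξ - n)⟫ * ‖q‖) + (tr Y * (1 - ⟪ξ, n⟫) * ‖q‖ + (tr Y * (1 / 2 * (√ε * ‖p‖ - 1 / √ε * P) ^ 2)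
      + (-((⟪n, Y n⟫ - ⟪ξ, Y ξ⟫) * (ε * ‖p‖ ^ 2 - ‖q‖)) + (-(⟪ξ, Y ξ⟫ * (ε * ‖p‖ ^ 2 - ‖q‖)) + 0)))))))))))))) := by
  have np : ‖p‖ = g := by rw [hp, norm_smul, hn, mul_one, norm_of_nonneg hg]
  have nq : ‖q‖ = P * g := by rw [hq, norm_smul, np, norm_of_nonneg hP]
  obtain ⟨r, hr, rfl⟩ : ∃ r, 0 < r ∧ ε = r ^ 2 := ⟨√ε, Real.sqrt_pos.2 hε, (Real.sq_sqrt hε.le).symm⟩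
  have hw' : w = P ^ 2 / 2 := by linarith
  have hφt : φt = -H / r ^ 2 - g * ⟪n, u⟫ := by
    rw [hH, hp, real_inner_smul_right, real_inner_comm n u]; field_simp; ring
  have s1 : ∀ a b : M[d], frob (a - b) (a - b) = frob a a - 2 * frob a b + frob b b := fun a b => by
    simp only [← frobCLM_apply, map_sub, sub_apply]
    rw [frobCLM_apply b a, frob_comm, ← frobCLM_apply]; ring
  rw [np, nq, Real.sqrt_sq hr.le, hA, s1, frob_comm A U, hφt, hw']
  rw [← sub_nonneg]
  have key : 0 ≤ 1 / 2 * ((b + D) * (r * g) - D * (P / r - r * g)) ^ 2 := by positivity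
  refine key.trans_eq ?_
  have hb' : ⟪ξ, B⟫ = b + ⟪ξ, v⟫ := by rw [hb, inner_sub_left, real_inner_comm ξ, real_inner_comm ξ]; ring
  simp only [hp, hq, map_sub, map_smul, inner_sub_left, inner_sub_right, inner_add_left, inner_add_right,
    real_inner_smul_left, real_inner_smul_right, ContinuousLinearMap.adjoint_inner_left, smul_smul]
  simp only [real_inner_comm ξ B, real_inner_comm ξ v, hb', real_inner_comm n B, real_inner_comm n v, real_inner_comm n ξ, real_inner_comm n (X B),
    real_inner_comm n ξt, real_inner_comm ξ ξt, real_inner_comm ξ (X B)]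
  rw [real_inner_comm u (A v), real_inner_comm v (A v)]
  field_simp
  ring

namespace SolutionPair

variable {S : SolutionPair d}

/-- `f` is integrable in space-time, with vanishing integrals over almost all time slices. -/
def IsNull (S : SolutionPair d) (f : ℝ → R[d]) : Prop :=
  S.Gr 2 f ∧ ∀ᵐ t ∂vI S.τ, ∫ x in S.Ω, f t x = 0

lemma ae_integrableOn {f : ℝ → R[d]} (h : S.Gr 2 f) : ∀ᵐ t ∂vI S.τ, IntegrableOn (f t) S.Ω :=
  (h.integrable S.memLp_maj).prod_right_ae

lemma IsNull.add {f g : ℝ → R[d]} (hf : S.IsNull f) (hg : S.IsNull g) : S.IsNull fun t x => f t x + g t x := by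
  refine ⟨hf.1.add hg.1, ?_⟩
  filter_upwards [hf.2, hg.2, ae_integrableOn hf.1, ae_integrableOn hg.1] with t h1 h2 h3 h4
  rw [integral_add h3 h4, h1, h2, add_zero]

lemma IsNull.sub {f g : ℝ → R[d]} (hf : S.IsNull f) (hg : S.IsNull g) : S.IsNull fun t x => f t x - g t x := by
  refine ⟨hf.1.sub hg.1, ?_⟩
  filter_upwards [hf.2, hg.2, ae_integrableOn hf.1, ae_integrableOn hg.1] with t h1 h2 h3 h4
  rw [integral_sub h3 h4, h1, h2, sub_zero]

lemma Slice.psi_memH1 {t : ℝ} (h : S.Slice t) : MemH1 univ (S.Ω.indicator fun x => _root_.psi S.W (S.φ t x))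
    (S.Ω.indicator fun x => √(2 * S.W (S.φ t x)) • innerSL ℝ (S.Dφ t x)) :=
  h.phase.bdry.comp_primitive S.dom.isOpen h.phase.range S.well.continuous_sqrt

lemma isNull_transport {w : ℝ → V[d]} (hw : S.Gr 1 w) (hs : ∀ t, S.Slice t → WeaklyDivFree S.Ω (w t) ∧ ML2 (w t) S.Ω) :
    S.IsNull fun t x => divg (S.ξ t) x * ⟪S.Dψ t x, w t x⟫ + psi S.W (S.φ t x) * ∇ (divg (S.ξ t)) x (w t x) := by
  refine ⟨(gr_divg.mul (gr_Dpsi.inner hw)).add ((gr_psi.mul (gr_Ddivg.apply hw)).up S), ?_⟩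
  filter_upwards [S.ae_slice] with t h
  rw [← h.psi_memH1.integral_mul_apply S.dm (hs t h).1 (hs t h).2 h.divg_xi_lipschitz fun x hx => by
    rw [divg, (h.xi_eq_zero hx).2, ← trCLM_apply, map_zero]]
  refine integral_congr_ae ?_
  filter_upwards [h.psi, ae_restrict_mem S.dm.m] with x hx hxΩ
  simp only [indicator_of_mem hxΩ, hx, real_inner_smul_left, smul_apply, innerSL_apply_apply, smul_eq_mul]

lemma isNull_curvature {w : ℝ → V[d]} (hw : S.Gr 0 w) (hDw : S.Gr 0 fun t x => ∇ (w t) x) {K : ℝ≥0}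
    (hs : ∀ t, S.Slice t → LipschitzWith K (S.Ω.indicator (w t))) : S.IsNull fun t x =>
      S.H t x * ⟪S.Dφ t x, w t x⟫ - S.ε * ⟪S.Dφ t x, ∇ (w t) x (S.Dφ t x)⟫
      + tr (∇ (w t) x) * (S.ε / 2 * ‖S.Dφ t x‖ ^ 2 + 1 / S.ε * S.W (S.φ t x)) := by
  refine ⟨((gr_H.mul (gr_Dphi.inner hw)).sub ((GrowthLE.const S.ε).mul (gr_Dphi.inner (hDw.apply gr_Dphi)))).add
    ((gr_tr hDw).mul (((GrowthLE.const (S.ε / 2)).mul gr_Dphi.norm.sq).add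
      (((GrowthLE.const (1 / S.ε)).mul (gr_comp S.well.contDiff.continuous)).up S))), ?_⟩
  filter_upwards [S.ae_slice] with t h
  rw [← h.phase.integral_curvature S.dm S.well (ε := S.ε) (hs t h) fun x hx => indicator_of_notMem hx _]
  refine setIntegral_congr_Ω fun x hx => ?_
  simp only [indicator_of_mem hx, fderiv_indicator_eq S.dom.isOpen hx, diffuseCurvature]

lemma isNull_curl : S.IsNull fun t x =>
    ⟪S.Dψ t x, divg (S.ξ t) x • S.B t x + ∇ (S.B t) x (S.ξ t x) - tr (∇ (S.B t) x) • S.ξ t x - ∇ (S.ξ t) x (S.B t x)⟫ := by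
  refine ⟨(gr_Dpsi.inner ((((gr_divg.smul gr_B).add (gr_DB.apply gr_xi)).sub ((gr_tr gr_DB).smul gr_xi)).sub (gr_Dxi.apply gr_B))).up S, ?_⟩
  filter_upwards [S.ae_slice] with t h
  rw [← h.psi_memH1.integral_curl S.dm h.xi.1 h.xi.2.2.2.1 h.B.1 h.B.2.2]
  refine integral_congr_ae ?_
  filter_upwards [h.psi, ae_restrict_mem S.dm.m] with x hx hxΩ
  simp only [indicator_of_mem hxΩ, hx, real_inner_smul_left, smul_apply, innerSL_apply_apply, smul_eq_mul]
  rfl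

lemma isNull_convection : S.IsNull fun t x => ⟪S.v t x, ∇ (S.v t) x (S.u t x)⟫ := by
  refine ⟨(gr_v.inner (gr_Dv.apply gr_u)).up S, ?_⟩
  filter_upwards [S.ae_slice] with t h
  rw [← h.u_div.integral_inner_fderiv S.dm (h.u_memLp.integrable one_le_two) h.v_lipschitz h.v_le
    fun x hx => indicator_of_notMem hx _]
  refine setIntegral_congr_Ω fun x hx => ?_
  simp only [indicator_of_mem hx, fderiv_indicator_eq S.dom.isOpen hx]

lemma isNull_strong {w : ℝ → V[d]} {Dw : ℝ → Vec d → M[d]} (hw : S.Gr 1 w) (hDw : S.Gr 1 Dw)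
    (hs : ∀ t, S.Slice t → MemH10 S.Ω (w t) (Dw t) ∧ WeaklyDivFree S.Ω (w t)) :
    S.IsNull fun t x => S.residual t x (w t x) + frobCLM d (∇ (S.v t) x) (Dw t x) := by
  refine ⟨(gr_residual.apply hw).add ((gr_Dv.bilin (frobCLM d) hDw).up S), ?_⟩
  filter_upwards [S.ae_slice, ae_strong] with t h h'
  exact h' _ _ (hs t h).1 (hs t h).2

/-- The terms of the relative energy inequality. -/
noncomputable abbrev terms (S : SolutionPair d) (s : Vec d) : List (ℝ → R[d]) :=
  relEnergyTerms S.W S.ε s S.φ S.Dφ S.Dψ S.D2φ S.u S.Du S.χ S.v S.ξ S.ξt S.B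

lemma norm_diffuseNormal {s : Vec d} (hs : ‖s‖ = 1) (t : ℝ) (x : Vec d) : ‖diffuseNormal s S.Dφ t x‖ = 1 := by
  rw [diffuseNormal]
  split_ifs with h
  · exact hs
  · rw [norm_smul, norm_inv, norm_norm, inv_mul_cancel₀ (norm_ne_zero_iff.2 h)]

lemma smul_diffuseNormal (s : Vec d) (t : ℝ) (x : Vec d) : S.Dφ t x = ‖S.Dφ t x‖ • diffuseNormal s S.Dφ t x := by
  rw [diffuseNormal]
  split_ifs with h
  · rw [h, norm_zero, zero_smul]
  · rw [smul_smul, mul_inv_cancel₀ (norm_ne_zero_iff.2 h), one_smul]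

lemma gr_diffuseNormal {s : Vec d} (hs : ‖s‖ = 1) : S.Gr 0 (diffuseNormal s S.Dφ) := by
  classical
  refine ⟨?_, 1, of_forall fun p => by rw [pow_zero, mul_one]; exact (norm_diffuseNormal hs _ _).le⟩
  have hN : Measurable fun y : Vec d => if y = 0 then s else ‖y‖⁻¹ • y :=
    Measurable.ite (measurableSet_singleton 0) measurable_const (measurable_norm.inv.smul measurable_id)
  have h := (hN.comp_aemeasurable (gr_Dphi (S := S)).aesm.aemeasurable).aestronglyMeasurable
  refine h.congr (of_forall fun p => ?_)
  simp only [comp_apply, uncurry, diffuseNormal]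
  congr

lemma gr_terms {s : Vec d} (hs : ‖s‖ = 1) {f : ℝ → R[d]} (hf : f ∈ S.terms s) : S.Gr 2 f := by
  have n := gr_diffuseNormal (S := S) hs
  have P := gr_P (S := S)
  have g := (gr_Dphi (S := S)).norm
  have q := (gr_Dpsi (S := S)).norm
  have c := fun a : ℝ => GrowthLE.const (μ := ST S.Ω S.τ) (g := S.maj) a
  have b := (gr_B.sub gr_v).inner (gr_xi (S := S))
  have D := gr_divg (S := S)
  have e : ∀ {f : ℝ → V[d]}, S.Gr 0 f → S.Gr 0 fun t x => ⟪f t x, ∇ (S.B t) x (f t x)⟫ := fun h => h.inner (gr_DB.apply h)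
  have m : ∀ {k : ℕ} {f : ℝ → R[d]}, S.Gr k f → k ≤ 2 → S.Gr 2 f := fun h hk => h.up S hk
  have w := gr_u.sub (gr_v.up S (l := 1))
  have hD := gr_H.add ((P.mul D).up S (l := 1))
  have tB := gr_xit.add (gr_Dxi.apply (gr_B (S := S)))
  have A := gr_Du.sub (gr_Dv.up S (l := 1))
  have ad : S.Gr 0 fun t x => ContinuousLinearMap.adjoint (∇ (S.B t) x) := gr_DB.of_norm_le
    (ContinuousLinearMap.adjoint.continuous.comp_aesm gr_DB.aesm) fun t x => (LinearIsometryEquiv.norm_map _ _).le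
  have ge := ((c S.ε).mul g.sq).sub (q.up S (l := 2))
  simp only [relEnergyTerms, List.mem_cons, List.not_mem_nil, or_false] at hf
  rcases hf with rfl | rfl | rfl | rfl | rfl | rfl | rfl | rfl | rfl | rfl | rfl | rfl | rfl | rfl | rfl
  · exact (gr_frob A A).neg
  · exact ((c _).mul hD.sq).neg
  · exact ((c _).mul (gr_H.sub (b.mul ((c _).mul g))).sq).neg
  · exact (w.inner (gr_Dv.apply w)).neg
  · exact m (((((c _).mul gr_chi).sub gr_psi).mul (gr_Ddivg.apply w)).neg) (by decide)
  · exact (b.add D).sq.mul ((c _).mul g.sq)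
  · exact D.sq.mul (((P.mul (c (√S.ε)⁻¹)).up S).sub ((c _).mul g)).sq
  · exact ((((c _).mul hD).mul ((gr_v.sub gr_B).inner (n.sub gr_xi))).mul ((c _).mul g)).neg
  · exact m (((tB.add (ad.apply gr_xi)).inner (n.sub gr_xi)).mul q).neg (by decide)
  · exact m ((gr_xi.inner tB).mul q).neg (by decide)
  · exact m ((e (gr_xi.sub n)).mul q).neg (by decide)
  · exact m (((gr_tr gr_DB).mul ((c 1).sub (gr_xi.inner n))).mul q) (by decide)
  · exact (gr_tr gr_DB).mul ((c _).mul (((c _).mul g).sub (((c _).mul P).up S)).sq)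
  · exact (((e n).sub (e gr_xi)).mul ge).neg
  · exact ((e gr_xi).mul ge).neg

lemma iterated_list_sum {T : ℝ} (hT : T ∈ Ioo 0 S.τ) (l : List (ℝ → R[d])) (h : ∀ f ∈ l, S.Gr 2 f) :
    S.Gr 2 (fun t x => (l.map fun f => f t x).sum) ∧
      (l.map fun f => ∫ t in 0..T, ∫ x in S.Ω, f t x).sum = ∫ t in 0..T, ∫ x in S.Ω, (l.map fun f => f t x).sum := by
  induction l with
  | nil => exact ⟨(GrowthLE.const (0 : ℝ)).up S, by simp⟩
  | cons f l ih =>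
    obtain ⟨h1, h2⟩ := ih fun f hf => h f (List.mem_cons_of_mem _ hf)
    have hf := h f List.mem_cons_self
    simp only [List.map_cons, List.sum_cons]
    exact ⟨hf.add h1, by rw [h2, iterated_add hf h1 hT]⟩

lemma ae_rate_le {s : Vec d} (hs : ‖s‖ = 1) : ∀ᵐ t ∂vI S.τ,
    ∫ x in S.Ω, S.rate t x ≤ ∫ x in S.Ω, ((S.terms s).map fun f => f t x).sum := by
  have gv := gr_v.up S (l := 1)
  have gDv := gr_Dv.up S (l := 1)
  have hZ := (((((((isNull_transport gr_u fun t h => ⟨h.u_div, h.u_memLp⟩).sub (isNull_transport gv fun t h => ⟨h.v_div, h.v_memLp⟩)).sub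
    (isNull_curvature gr_v gr_Dv fun t h => h.v_lipschitz)).add
    (isNull_curvature (K := S.C) gr_B gr_DB fun t h => by rw [indicator_eq_self.2 fun x hx => by_contra fun h' => hx (h.B.2.2 x h')]; exact h.B.1)).add
    isNull_curl).add isNull_convection).add
    ((isNull_strong gr_u gr_Du fun t h => ⟨h.u_bdry, h.u_div⟩).sub (isNull_strong gv gDv fun t h => ⟨h.v_bdry, h.v_div⟩)))
  have hl := (iterated_list_sum (S := S) (T := S.τ / 2) ⟨half_pos S.τ_mem.1, half_lt_self S.τ_mem.1⟩ (S.terms s) fun f => gr_terms hs).1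
  filter_upwards [S.ae_slice, hZ.2, ae_integrableOn hZ.1, ae_integrableOn gr_rate, ae_integrableOn hl] with t h z1 z2 z3 z4
  rw [← add_zero (∫ x in S.Ω, S.rate t x), ← z1, ← integral_add z3 z2]
  refine integral_mono_ae (z3.add z2) z4 ?_
  have htr := h.v_bdry.weak.tr_eq_zero S.dom.isOpen fun η hη => h.v_div.integral_eq η hη
  filter_upwards [h.psi, h.phase.range, h.allenCahn', ae_restrict_of_ae htr, ae_restrict_mem S.dm.m] with x a1 a2 a3 a4 a5
  have key := relEnergy_algebra (c := surfaceTension S.W) (χ := S.χ t x) (ψ := psi S.W (S.φ t x)) (D := divg (S.ξ t) x)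
    (K₁ := ∇ (divg (S.ξ t)) x (S.u t x)) (K₂ := ∇ (divg (S.ξ t)) x (S.v t x)) (B := S.B t x) (v := S.v t x) (ξ := S.ξ t x) (vt := S.vt t x) (ξt := S.ξt t x)
    (U := S.Du t x) (X := ∇ (S.ξ t) x) (Y := ∇ (S.B t) x) S.pos
    (Real.sq_sqrt (mul_nonneg zero_le_two (S.well.nonneg a2))) (norm_nonneg _) (Real.sqrt_nonneg _) (norm_diffuseNormal hs t x)
    (smul_diffuseNormal s t x) a1 a3 (a4 a5) rfl
  refine le_of_eq_of_le ?_ (key.trans_eq ?_)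
  · simp only [rate, stress, residual, sub_apply, add_apply, smul_apply, smul_eq_mul, outer_apply, frobCLM_apply, innerSL_apply_apply]
  · rw [← map_sub]; rfl

/-- The relative energy inequality up to time `τ`. -/
lemma ae_relEnergy_le_terms {s : Vec d} (hs : ‖s‖ = 1) : ∀ᵐ T ∂vI S.τ,
    IntegrableOn (relEnergyDensity S.W S.ε (S.φ T) (S.Dφ T) (S.Dψ T) (S.u T) (S.v T) (S.ξ T)) S.Ω ∧
    relEnergy S.Ω S.W S.ε (S.φ T) (S.Dφ T) (S.Dψ T) (S.u T) (S.v T) (S.ξ T)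
      ≤ relEnergy S.Ω S.W S.ε S.φ₀ S.Dφ₀ S.Dψ₀ S.u₀ S.v₀ (S.ξ 0) + ((S.terms s).map fun f => ∫ t in 0..T, ∫ x in S.Ω, f t x).sum := by
  filter_upwards [ae_relEnergy_le (S := S), ae_mem_Ioo] with T h hT
  refine ⟨h.1, h.2.trans (add_le_add_right ?_ _)⟩
  obtain ⟨g, e⟩ := iterated_list_sum hT (S.terms s) fun f => gr_terms hs
  rw [e]
  simp only [integral_of_le hT.1.le, integral_Ioc_eq_integral_Ioo]
  have hsub : Ioo 0 T ⊆ Ioo 0 S.τ := Ioo_subset_Ioo_right hT.2.le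
  exact integral_mono_ae ((integrableOn_slice gr_rate).mono_set hsub) ((integrableOn_slice g).mono_set hsub)
    (ae_Ioo_mono hT.2.le (ae_rate_le hs))

end SolutionPair

theorem proposition4p1
    {d : ℕ} (hd : d = 2 ∨ d = 3)
    {Ω : Set (Vec d)} (hΩ : IsC2Domain Ω)
    {W : ℝ → ℝ} (hW : IsDoubleWell W)
    {Tstar T₀ : ℝ} (hTstar : 0 < Tstar) (hT₀ : Tstar ≤ T₀)
    {ε : ℝ} (hε : ε ∈ Ioo (0 : ℝ) 1)
    -- the weak solution `(φ, u)` of the phase-field model, with its weak derivatives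
    {φ₀ : Vec d → ℝ} {Dφ₀ u₀ : Vec d → Vec d}
    {φ φt : ℝ → Vec d → ℝ} {Dφ : ℝ → Vec d → Vec d} {D2φ : ℝ → Vec d → Vec d →L[ℝ] Vec d}
    {u : ℝ → Vec d → Vec d} {Du : ℝ → Vec d → Vec d →L[ℝ] Vec d}
    (hweak : IsWeakSolution Ω W ε T₀ φ₀ Dφ₀ u₀ φ φt Dφ D2φ u Du)
    -- the strong solution `(χ, v)` of the sharp interface limit
    {χ₀ : Vec d → ℝ} {v₀ : Vec d → Vec d} {χ : ℝ → Vec d → ℝ} {v : ℝ → Vec d → Vec d}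
    (hstrong : IsStrongSolution Ω (surfaceTension W) Tstar χ₀ v₀ χ v)
    -- the pair `(ξ, B)`
    {ξ ξt B : ℝ → Vec d → Vec d}
    (hreg : IsRegularPair Ω Tstar ξ ξt B) (hcons : IsConsistent Ω Tstar χ ξ)
    -- `Dψ₀` and `Dψ` are the weak gradients of `psi W ∘ φ₀` and `psi W ∘ φ`
    {Dψ₀ : Vec d → Vec d} (hDψ₀ : HasWeakGrad Ω (fun x => psi W (φ₀ x)) Dψ₀)
    {Dψ : ℝ → Vec d → Vec d} (hDψ_meas : AEStronglyMeasurable (uncurry Dψ) (spaceTime Ω T₀))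
    (hDψ : ∀ᵐ t ∂(volume.restrict (Ioo 0 T₀)), HasWeakGrad Ω (fun x => psi W (φ t x)) (Dψ t))
    -- the value of the diffuse normal where `∇φ = 0`
    {s : Vec d} (hs : ‖s‖ = 1) :
    -- all integrals are finite
    (∀ f ∈ relEnergyTerms W ε s φ Dφ Dψ D2φ u Du χ v ξ ξt B,
      ∀ T ∈ Ioo 0 Tstar, Integrable (uncurry f) (spaceTime Ω T)) ∧
    IntegrableOn (relEnergyDensity W ε φ₀ Dφ₀ Dψ₀ u₀ v₀ (ξ 0)) Ω ∧
    ∀ᵐ T ∂(volume.restrict (Ioo 0 Tstar)),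
      IntegrableOn (relEnergyDensity W ε (φ T) (Dφ T) (Dψ T) (u T) (v T) (ξ T)) Ω ∧
      -- the relative energy inequality
      relEnergy Ω W ε (φ T) (Dφ T) (Dψ T) (u T) (v T) (ξ T)
        ≤ relEnergy Ω W ε φ₀ Dφ₀ Dψ₀ u₀ v₀ (ξ 0)
          + ((relEnergyTerms W ε s φ Dφ Dψ D2φ u Du χ v ξ ξt B).map fun f =>
              ∫ t in 0..T, ∫ x in Ω, f t x).sum := by
  obtain ⟨vt, hvt, hvt'⟩ := hstrong.velocity_time
  have key : ∀ τ ∈ Ioo 0 Tstar, ∃ S : SolutionPair d, S.τ = τ ∧ S.terms s = relEnergyTerms W ε s φ Dφ Dψ D2φ u Du χ v ξ ξt B ∧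
      S.Ω = Ω ∧ IntegrableOn (relEnergyDensity W ε φ₀ Dφ₀ Dψ₀ u₀ v₀ (ξ 0)) Ω ∧ ∀ᵐ T ∂vol (Ioo 0 τ),
        IntegrableOn (relEnergyDensity W ε (φ T) (Dφ T) (Dψ T) (u T) (v T) (ξ T)) Ω ∧
        relEnergy Ω W ε (φ T) (Dφ T) (Dψ T) (u T) (v T) (ξ T) ≤ relEnergy Ω W ε φ₀ Dφ₀ Dψ₀ u₀ v₀ (ξ 0)
          + ((relEnergyTerms W ε s φ Dφ Dψ D2φ u Du χ v ξ ξt B).map fun f => ∫ t in 0..T, ∫ x in Ω, f t x).sum := fun τ hτ => by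
    obtain ⟨C, hC, hCt, hCξ, hCB⟩ := hreg.bounds τ ⟨hτ.1.le, hτ.2⟩
    obtain ⟨K, hK⟩ := hstrong.velocity_C1 τ ⟨hτ.1.le, hτ.2⟩
    let S : SolutionPair d :=
      { Ω, W, ε, T₀, Tstar, τ, C, K := K.toNNReal, φ₀, χ₀, Dφ₀, u₀, v₀, Dψ₀, φ, φt, χ, Dφ, Dψ, u, v, vt, ξ, ξt, B, D2φ, Du
        dim := by rcases hd with rfl | rfl <;> decide
        dom := hΩ
        well := hW
        pos := hε.1
        le_T := hT₀
        τ_mem := hτ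
        weak := hweak
        strong := hstrong
        reg := hreg
        cons := hcons
        psi₀ := hDψ₀
        psi_meas := hDψ_meas
        psi_grad := hDψ
        vt_memLp := hvt
        vt_weak := hvt'
        xi_lip := hC
        xi_time := hCt
        xi_bound := hCξ
        B_bound := hCB
        v_bound := hK.mono fun t h => ⟨h.1, fun x hx =>
          ⟨(h.2 x hx).1.trans (le_coe_toNNReal K), (h.2 x hx).2.trans (le_coe_toNNReal K)⟩⟩ }
    exact ⟨S, rfl, rfl, rfl, S.integrableOn_init, S.ae_relEnergy_le_terms hs⟩
  refine ⟨fun f hf T hT => ?_, ?_, ?_⟩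
  · obtain ⟨τ, hτ, hτ'⟩ := exists_between hT.2
    obtain ⟨S, rfl, h2, rfl, -⟩ := key τ ⟨hT.1.trans hτ, hτ'⟩
    exact SolutionPair.integrable_of_gr (SolutionPair.gr_terms hs (h2 ▸ hf)) ⟨hT.1, hτ⟩
  · obtain ⟨S, -, -, -, h, -⟩ := key (Tstar / 2) ⟨half_pos hTstar, half_lt_self hTstar⟩
    exact h
  · obtain ⟨τ, -, hτ, hlim⟩ := exists_seq_strictMono_tendsto' hTstar
    have h : ∀ n, ∀ᵐ T ∂(vol (Ioo 0 (τ n))), _ := fun n => (key (τ n) (hτ n)).choose_spec.2.2.2.2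
    simp only [ae_restrict_iff' measurableSet_Ioo] at h ⊢
    filter_upwards [ae_all_iff.2 h] with T hT hTI
    obtain ⟨n, hn⟩ := (hlim.eventually (lt_mem_nhds hTI.2)).exists
    exact hT n ⟨hTI.1, hn⟩
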